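/- Let $0<Y<2$, $\alpha_M\in(-1,-\tfrac12)$, $\alpha_G>\alpha_M$ and $\beta=1-(Y-2)\alpha_M$. For $\theta\in(0,1]$ let $C_\theta,G_\theta,M_\theta>0$ be such that, as $\theta\downarrow0$, $M_\theta\asymp\theta^{\alpha_M}$, $C_\theta\asymp\theta^{\beta}$ (exact orders) and $G_\theta-M_\theta=O(\theta^{\alpha_G})$. Let $Z_\theta\sim\mathrm{CGMY}(C_\theta,G_\theta,M_\theta,Y)$ (with an arbitrary location), i.e. $Z_\theta$ is infinitely divisible without Gaussian part and with Lévy density $C_\theta e^{-M_\theta x}x^{-1-Y}$ for $x>0$ and $C_\theta e^{-G_\theta|x|}|x|^{-1-Y}$ for $x<0$. Assume $E[e^{Z_\theta}]<\infty$, put $w_\theta=-\ln E[e^{Z_\theta}]$, and assume that the laws of $e^{Z_\theta+w_\theta}$ increase in the convex order: $E[f(e^{Z_s+w_s})]\le E[f(e^{Z_t+w_t})]$ for all $0<s\le t\le1$ and all convex $f$ for which both expectations exist. Let $\sigma_0(\theta)$ be the standard deviation of $Z_\theta+w_\theta$, $X_\theta=(Z_\theta+w_\theta)/\sigma_0(\theta)$,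 $\kappa_2(\theta)=\sigma_0(\theta)/\sqrt\theta$, and, for a spot price $S_0>0$ and an interest rate $r\in\mathbb R$, let $\sigma_{\rm BS}(k,\theta)$ be the Black–Scholes implied volatility, at log-moneyness $k$ and maturity $\theta$, of the put on $S_0e^{r\theta+Z_\theta+w_\theta}$ with strike $S_0e^{r\theta+k}$ and price $e^{-r\theta}E[(S_0e^{r\theta+k}-S_0e^{r\theta+Z_\theta+w_\theta})^+]$. Put $$\beta_1=\alpha_G-2\alpha_M-\tfrac12,\qquad \beta_2=-2\alpha_M-1,\qquad \bar\beta_\epsilon=\min\{\beta_2+\tfrac12,\,2\beta_1,\,2\beta_2-\epsilon,\,\beta_1+\beta_2-\epsilon\}.$$ Then the following hold. (1) $\sigma_0(\theta)\asymp\sqrt\theta$ as $\theta\downarrow0$. For every $\theta\in(0,1]$, $\sigma_0(\theta)^2=C_\theta\Gamma(2-Y)(M_\theta^{Y-2}+G_\theta^{Y-2})$, and the skewness and excess kurtosis of $X_\theta$ are $$\tilde\kappa_3(\theta)=\frac{C_\theta\Gamma(3-Y)(M_\theta^{Y-3}-G_\theta^{Y-3})}{\big(C_\theta\Gamma(2-Y)(M_\theta^{Y-2}+G_\theta^{Y-2})\big)^{3/2}},\qquad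 \tilde\kappa_4(\theta)=\frac{C_\theta\Gamma(4-Y)(M_\theta^{Y-4}+G_\theta^{Y-4})}{\big(C_\theta\Gamma(2-Y)(M_\theta^{Y-2}+G_\theta^{Y-2})\big)^{2}}.$$ (2) $\beta_1,\beta_2>0$, the functions $\kappa_3(\theta)=\tfrac16\tilde\kappa_3(\theta)\theta^{-\beta_1}$ and $\kappa_4(\theta)=\tfrac1{24}\tilde\kappa_4(\theta)\theta^{-\beta_2}$ are bounded on $(0,1)$, and there is $v>0$ such that $\sup_{\theta\in(0,1)}E[e^{-vX_\theta}]<\infty$, such that $u\mapsto\phi_X(u+iv;\theta)$ is in $L^1(\mathbb R)$ for every $\theta\in(0,1)$, where $\phi_X(z;\theta)=E[e^{izX_\theta}]$, and such that for every $\epsilon>0$ $$\int_{\mathbb R}\big|\phi_X(u+iv;\theta)-\phi_{(0,0)}(u+iv;\theta)\big|\,du=o(\theta^{\bar\beta_\epsilon})\quad(\theta\downarrow0),$$ where $\phi_{(0,0)}(z;\theta)=e^{-iz\sigma_0(\theta)/2-z^2/2}\big\{1-i\kappa_3(\theta)z^3\theta^{\beta_1}-\tfrac12\kappa_3(\theta)^2z^6\theta^{2\beta_1}+\kappa_4(\theta)z^4\theta^{\beta_2}\big\}$.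 (3) For every $\theta\in(0,1)$, $\sigma_{\rm BS}(k,\theta)$ exists for $k$ near $0$ and is twice continuously differentiable in $k$ at $0$; as $\theta\downarrow0$, $$\partial_k\sigma_{\rm BS}(0,\theta)=\frac{\tilde\kappa_3(\theta)}6\theta^{-1/2}+\frac1{12}\kappa_2(\theta)\tilde\kappa_4(\theta)+o(\theta^{\bar\beta_\epsilon-\frac12})\quad\text{for every }\epsilon>0,$$ $$\partial_k^2\sigma_{\rm BS}(0,\theta)=\frac{\tilde\kappa_4(\theta)}{12\,\kappa_2(\theta)}\theta^{-1}+o(\theta^{-2\alpha_M-2}).$$ -/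

import Mathlib

open Real Set Filter Topology MeasureTheory ProbabilityTheory Asymptotics

noncomputable section

/-- The CGMY Lévy density: `C e^{-G|x|} / |x|^{1+Y}` for `x < 0` and
`C e^{-Mx} / x^{1+Y}` for `x > 0`. -/
def cgmyLevyDensity (C G M Y x : ℝ) : ℝ :=
  if x < 0 then C * Real.exp (-G * |x|) / |x| ^ (1 + Y)
  else if 0 < x then C * Real.exp (-M * x) / x ^ (1 + Y)
  else 0

/-- `μ` is the CGMY law with parameters `C, G, M, Y` and mean `b`: the infinitely divisible law
without Gaussian part whose Lévy measure has the density `cgmyLevyDensity C G M Y`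
(Lévy–Khintchine formula, all jumps compensated). For `Y ∉ {0, 1}` the choice
`b = C Γ(1 - Y) (M^{Y-1} - G^{Y-1})` gives the familiar closed form
`exp (C Γ(-Y) ((M - iu)^Y - M^Y + (G + iu)^Y - G^Y))` of the characteristic function. -/
def IsCGMY (b C G M Y : ℝ) (μ : Measure ℝ) : Prop :=
  IsProbabilityMeasure μ ∧
    ∀ u : ℝ, charFun μ u =
      Complex.exp (Complex.I * u * b +
        ∫ x : ℝ, (Complex.exp (Complex.I * u * x) - 1 - Complex.I * u * x) *
          (cgmyLevyDensity C G M Y x : ℂ))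

/-- The drift `w = -ln E[e^Z]` for `Z ∼ ν`. -/
def martingaleDrift (ν : Measure ℝ) : ℝ := -Real.log (∫ x, Real.exp x ∂ν)

/-- The law of the log return `Z + w`, where `Z ∼ ν` and `w = -ln E[e^Z]`. -/
def logReturnLaw (ν : Measure ℝ) : Measure ℝ := ν.map (fun x => x + martingaleDrift ν)

/-- The standard deviation of a law on the real line. -/
def stdDev (μ : Measure ℝ) : ℝ := √(variance id μ)

/-- `σ₀`, the standard deviation of the log return `Z + w`. -/
def sigmaZero (ν : Measure ℝ) : ℝ := stdDev (logReturnLaw ν)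

/-- The law of the normalized return `X = (Z + w) / σ₀`. -/
def normalizedLaw (ν : Measure ℝ) : Measure ℝ :=
  (logReturnLaw ν).map (fun x => x / sigmaZero ν)

/-- Skewness of a law. -/
def skewnessOf (μ : Measure ℝ) : ℝ :=
  (∫ x, (x - ∫ y, y ∂μ) ^ 3 ∂μ) / stdDev μ ^ 3

/-- Excess kurtosis of a law. -/
def excessKurtosisOf (μ : Measure ℝ) : ℝ :=
  (∫ x, (x - ∫ y, y ∂μ) ^ 4 ∂μ) / stdDev μ ^ 4 - 3

/-- `C Γ(2-Y) (M^{Y-2} + G^{Y-2})`. -/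
def cgmyVariance (C G M Y : ℝ) : ℝ :=
  C * Real.Gamma (2 - Y) * (M ^ (Y - 2) + G ^ (Y - 2))

/-- `C Γ(3-Y) (M^{Y-3} - G^{Y-3}) / (C Γ(2-Y) (M^{Y-2} + G^{Y-2}))^{3/2}`. -/
def cgmySkewness (C G M Y : ℝ) : ℝ :=
  C * Real.Gamma (3 - Y) * (M ^ (Y - 3) - G ^ (Y - 3)) / cgmyVariance C G M Y ^ (3 / 2 : ℝ)

/-- `C Γ(4-Y) (M^{Y-4} + G^{Y-4}) / (C Γ(2-Y) (M^{Y-2} + G^{Y-2}))^2`. -/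
def cgmyKurtosis (C G M Y : ℝ) : ℝ :=
  C * Real.Gamma (4 - Y) * (M ^ (Y - 4) + G ^ (Y - 4)) / cgmyVariance C G M Y ^ 2

/-- Convex order of laws on the real line: `∫ f dμ ≤ ∫ f dν` for every convex `f` for which both
expectations exist. -/
def ConvexOrderLE (μ ν : Measure ℝ) : Prop :=
  ∀ f : ℝ → ℝ, ConvexOn ℝ univ f → Integrable f μ → Integrable f ν →
    ∫ x, f x ∂μ ≤ ∫ x, f x ∂ν

/-- The exponent `β̄_ε = min {β₂ + 1/2, 2β₁, 2β₂ - ε, β₁ + β₂ - ε}`. -/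
def betaBar (β₁ β₂ ε : ℝ) : ℝ :=
  min (β₂ + 1 / 2) (min (2 * β₁) (min (2 * β₂ - ε) (β₁ + β₂ - ε)))

/-- The approximating characteristic function `φ_{(m,n)}(z; θ)` at a complex argument `z`; here
`s = σ₀(θ)`, `k₃ = κ₃(θ)` and `k₄ = κ₄(θ)`. -/
def edgeworthCharFun (m n β₁ β₂ s k₃ k₄ θ : ℝ) (z : ℂ) : ℂ :=
  Complex.exp (-(Complex.I * z * s) / 2 - z ^ 2 / 2) *
    (1 - k₃ * (Complex.I * z ^ 3 - m * z ^ 2 * s) * ((θ ^ β₁ : ℝ) : ℂ)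
      - (k₃ : ℂ) ^ 2 / 2 * z ^ 6 * ((θ ^ (2 * β₁) : ℝ) : ℂ)
      + k₄ * (z ^ 4 + Complex.I * z ^ 3 * n * s) * ((θ ^ β₂ : ℝ) : ℂ))

/-- The extended characteristic function `φ(z) = E[e^{izX}]`, `X ∼ μ`, at a complex `z`. -/
def complexCharFun (μ : Measure ℝ) (z : ℂ) : ℂ := ∫ x : ℝ, Complex.exp (Complex.I * z * x) ∂μ

/-- The characteristic function conditions on a family of laws `(X θ)`, `θ ∈ (0,1)`, for the
pair `(m, n)`, the exponents `β₁, β₂` and the coefficient functions `σ₀, κ₃, κ₄`, together with the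
requirements `β₁, β₂ > 0` and boundedness of `κ₃, κ₄`. -/
def CharFunConditions (X : ℝ → Measure ℝ) (σ₀ κ₃ κ₄ : ℝ → ℝ) (m n β₁ β₂ : ℝ) : Prop :=
  0 < β₁ ∧ 0 < β₂ ∧
  (∃ B : ℝ, ∀ θ ∈ Ioo (0 : ℝ) 1, |κ₃ θ| ≤ B ∧ |κ₄ θ| ≤ B) ∧
  ∃ v : ℝ, 0 < v ∧
    (∃ B : ℝ, ∀ θ ∈ Ioo (0 : ℝ) 1,
      Integrable (fun x : ℝ => Real.exp (-v * x)) (X θ) ∧ ∫ x, Real.exp (-v * x) ∂(X θ) ≤ B) ∧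
    (∀ θ ∈ Ioo (0 : ℝ) 1,
      Integrable (fun u : ℝ => complexCharFun (X θ) (u + Complex.I * v))) ∧
    ∀ ε : ℝ, 0 < ε →
      (fun θ : ℝ => ∫ u : ℝ,
          ‖complexCharFun (X θ) (u + Complex.I * v) -
            edgeworthCharFun m n β₁ β₂ (σ₀ θ) (κ₃ θ) (κ₄ θ) θ (u + Complex.I * v)‖)
        =o[𝓝[>] 0] fun θ => θ ^ betaBar β₁ β₂ ε

/-- The price `e^{-rθ} E[(K - S₀ e^{rθ + L})⁺]` of a put with strike `K` and maturity `θ`, where the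
log return `L` has law `ρ`. -/
def putPrice (S₀ r : ℝ) (ρ : Measure ℝ) (K θ : ℝ) : ℝ :=
  Real.exp (-r * θ) * ∫ x, max (K - S₀ * Real.exp (r * θ + x)) 0 ∂ρ

/-- The standard normal distribution function. -/
def stdNormalCDF (x : ℝ) : ℝ := cdf (gaussianReal 0 1) x

/-- The Black–Scholes price of a put with strike `K`, maturity `θ` and volatility `σ`. -/
def blackScholesPut (S₀ r K θ σ : ℝ) : ℝ :=
  K * Real.exp (-r * θ) *
      stdNormalCDF (-((Real.log (S₀ / K) + (r - σ ^ 2 / 2) * θ) / (σ * √θ))) -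
    S₀ * stdNormalCDF (-((Real.log (S₀ / K) + (r + σ ^ 2 / 2) * θ) / (σ * √θ)))

/-- `σ` is a Black–Scholes implied volatility at log-moneyness `k` and maturity `θ`, i.e. for the
strike `K = F e^k` with the forward price `F = S₀ e^{rθ}`. -/
def IsImpliedVol (S₀ r : ℝ) (ρ : Measure ℝ) (θ k σ : ℝ) : Prop :=
  0 < σ ∧
    blackScholesPut S₀ r (S₀ * Real.exp (r * θ) * Real.exp k) θ σ =
      putPrice S₀ r ρ (S₀ * Real.exp (r * θ) * Real.exp k) θ

/-- The implied volatility `σ_BS(k, θ)`; the set is a singleton whenever it is nonempty. -/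
def impliedVol (S₀ r : ℝ) (ρ : Measure ℝ) (θ k : ℝ) : ℝ :=
  sInf {σ : ℝ | IsImpliedVol S₀ r ρ θ k σ}

end

/-! ### Taylor remainders of the exponential -/

/-! Everything rests on the Lévy exponent Ψ(z) = ∫ (e^{zx} − 1 − zx) ℓ(x) dx (`cgmyExponent`),
analytic on the strip −G < Re z < M. The definition of the law fixes its transform only on the
imaginary axis. A Gaussian regularization shows that the exponential moments exist
(`integrable_exp_of_isCGMY`), and the identity theorem then gives the transform on the whole strip
(`complexMGF_of_isCGMY`). The cumulants of order n ≥ 2 are CΓ(n−Y)(M^{Y−n} + (−1)^n G^{Y−n}). Under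
the scaling of C, G, M they are O(θ^{1−(n−2)α_M}), and the odd ones gain a factor θ^{α_G−α_M}
because the two half lines almost cancel. Hence σ₀ ≍ √θ, and after normalization the third, fourth,
fifth and sixth order terms are O(θ^{β₁}), O(θ^{β₂}), O(θ^{β₁+β₂}), O(θ^{2β₂}).

Let k₃ be a sixth of the skewness and k₄ a twenty-fourth of the excess kurtosis. On the line Im z =
v the logarithm of φ_X is −izσ₀/2 − z²/2 − ik₃z³ + k₄z⁴ plus a small remainder; the term −izσ₀/2
comes from the martingale drift −Ψ(1) (`complexCharFun_normalized_expansion`). Where (|k₃| + |k₄| +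
δ)(1+|z|)^6 ≤ 1 the exponential is expanded. Elsewhere any power of this quantity is at least 1, and
both functions have integrable majorants independent of θ, thanks to the decay e^{−c|u|^Y} produced
by the small jumps (`exists_uniform_decay`). This gives the L¹ estimate
(`exists_integral_sub_edgeCF_le`, `cgmy_short_maturity`).

The convex order supplies constants that are uniform on all of (0,1), where asymptotics as θ ↓ 0 say
nothing. Negative powers S^{−p} are mixtures of the convex functions e^{−λS}, so one negative moment
at maturity 1 bounds all earlier ones; this keeps G away from zero and bounds the cumulants.
Monotone call prices keep σ₀ away from zero on [δ,1] (`exists_uniform_bounds_of_convexOrder`).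

The put price, its derivative in k at the money, and the difference of its second and first
derivatives are integrals of φ_X against bounded kernels (`unitPut_derivatives_scaled`), so the L¹
estimate passes to prices. For the Edgeworth approximation these integrals reduce to Gaussian
moments along the line, the leading term being read off from the Black–Scholes formula
(`exists_edgeCF_functionals`). The implicit function theorem makes the total implied volatility a C²
function of k, with explicit derivatives (`exists_total_vol`). The expansion then gives total
volatility σ₀(1 − k₄), slope k₃ + 2σ₀k₄ and curvature 2k₄/σ₀ to leading order
(`exists_total_vol_expansion`), and division by √θ gives the claim. -/

lemma norm_cexp_sub_sum_le (n : ℕ) (w : ℂ) :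
    ‖Complex.exp w - ∑ k ∈ Finset.range n, w ^ k / (k.factorial : ℂ)‖
      ≤ ‖w‖ ^ n * max 1 (Real.exp w.re) := by
  induction n generalizing w with
  | zero => simp [Complex.norm_exp]
  | succ n ih =>
    have hsum : ∀ t : ℝ, HasDerivAt (fun t : ℝ => ∑ k ∈ Finset.range (n + 1),
        ((t : ℂ) * w) ^ k / (k.factorial : ℂ))
        (w * ∑ k ∈ Finset.range n, ((t : ℂ) * w) ^ k / (k.factorial : ℂ)) t := by
      intro t
      have h1 : HasDerivAt (fun t : ℝ => ((t : ℂ) * w)) w t := by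
        simpa using (Complex.ofRealCLM.hasDerivAt (x := t)).mul_const w
      have h2 : HasDerivAt (fun t : ℝ => ∑ k ∈ Finset.range (n + 1),
          ((t : ℂ) * w) ^ k / (k.factorial : ℂ))
          (∑ k ∈ Finset.range (n + 1), (k * ((t : ℂ) * w) ^ (k - 1) * w) / (k.factorial : ℂ)) t :=
        HasDerivAt.fun_sum fun k _ => (h1.pow k).div_const _
      convert h2 using 1
      rw [Finset.sum_range_succ', Finset.mul_sum]
      simp only [Nat.cast_zero, zero_mul, zero_div, add_zero]
      refine Finset.sum_congr rfl fun k _ => ?_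
      have : ((k + 1).factorial : ℂ) = (k + 1) * k.factorial := by
        rw [Nat.factorial_succ]; push_cast; ring
      have h3 : ((k : ℂ) + 1) ≠ 0 := by exact_mod_cast Nat.succ_ne_zero k
      have h4 : (k.factorial : ℂ) ≠ 0 := by exact_mod_cast Nat.factorial_ne_zero k
      rw [this]
      push_cast
      field_simp
    -- Along the segment t ↦ tw the remainder of order n+1 has derivative w times the remainder of
    -- order n, so the mean value inequality carries the induction.
    have hder : ∀ t : ℝ, HasDerivAt (fun t : ℝ => Complex.exp ((t : ℂ) * w) -
        ∑ k ∈ Finset.range (n + 1), ((t : ℂ) * w) ^ k / (k.factorial : ℂ))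
        (w * (Complex.exp ((t : ℂ) * w) -
          ∑ k ∈ Finset.range n, ((t : ℂ) * w) ^ k / (k.factorial : ℂ))) t := by
      intro t
      have h1 : HasDerivAt (fun t : ℝ => ((t : ℂ) * w)) w t := by
        simpa using (Complex.ofRealCLM.hasDerivAt (x := t)).mul_const w
      exact (h1.cexp.sub (hsum t)).congr_deriv (by ring)
    have hb := norm_image_sub_le_of_norm_deriv_le_segment_01' (C := ‖w‖ ^ (n + 1) *
      max 1 (Real.exp w.re)) (fun t _ => (hder t).hasDerivWithinAt) (by
        intro t ht
        rw [norm_mul, pow_succ' ‖w‖, mul_assoc]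
        refine mul_le_mul_of_nonneg_left ((ih _).trans ?_) (norm_nonneg _)
        have h0 : ‖(t : ℂ) * w‖ ≤ ‖w‖ := by
          rw [norm_mul, Complex.norm_real, Real.norm_of_nonneg ht.1]
          exact mul_le_of_le_one_left (norm_nonneg _) ht.2.le
        have h1 : Real.exp ((t : ℂ) * w).re ≤ max 1 (Real.exp w.re) := by
          rw [Complex.re_ofReal_mul]
          rcases le_total 0 w.re with h | h
          · exact le_max_of_le_right (Real.exp_le_exp.2 (mul_le_of_le_one_left h ht.2.le))
          · exact le_max_of_le_left (Real.exp_le_one_iff.2 (mul_nonpos_of_nonneg_of_nonpos ht.1 h))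
        exact mul_le_mul (pow_le_pow_left₀ (norm_nonneg _) h0 n) (max_le (le_max_left _ _) h1)
          (by positivity) (by positivity))
    have h0 : ∑ k ∈ Finset.range (n + 1), (((0 : ℝ) : ℂ) * w) ^ k / (k.factorial : ℂ) = 1 := by
      rw [Finset.sum_range_succ']
      simp
    rw [h0] at hb
    simpa using hb

/-- A sum in place of the maximum can be integrated against the Lévy density term by term. -/
lemma norm_cexp_sub_sum_le_add (n : ℕ) (w : ℂ) :
    ‖Complex.exp w - ∑ k ∈ Finset.range n, w ^ k / (k.factorial : ℂ)‖
      ≤ ‖w‖ ^ n * (1 + Real.exp w.re) := by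
  refine (norm_cexp_sub_sum_le n w).trans ?_
  gcongr
  exact max_le (by linarith [Real.exp_pos w.re]) (by linarith)

lemma norm_cexp_sub_one_le (w : ℂ) :
    ‖Complex.exp w - 1‖ ≤ ‖w‖ * (1 + Real.exp w.re) := by
  simpa using norm_cexp_sub_sum_le_add 1 w

lemma norm_cexp_sub_one_sub_le (w : ℂ) :
    ‖Complex.exp w - 1 - w‖ ≤ ‖w‖ ^ 2 * (1 + Real.exp w.re) := by
  simpa [Finset.sum_range_succ, sub_sub] using norm_cexp_sub_sum_le_add 2 w

/-! ### Moments of the Lévy density -/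

lemma cgmyLevyDensity_of_pos {C G M Y x : ℝ} (hx : 0 < x) :
    cgmyLevyDensity C G M Y x = C * Real.exp (-M * x) / x ^ (1 + Y) := by
  simp [cgmyLevyDensity, hx, hx.not_gt]

lemma cgmyLevyDensity_of_neg {C G M Y x : ℝ} (hx : 0 < x) :
    cgmyLevyDensity C G M Y (-x) = C * Real.exp (-G * x) / x ^ (1 + Y) := by
  simp [cgmyLevyDensity, hx, abs_of_pos hx]

lemma cgmyLevyDensity_nonneg {C : ℝ} (hC : 0 ≤ C) (G M Y x : ℝ) :
    0 ≤ cgmyLevyDensity C G M Y x := by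
  unfold cgmyLevyDensity
  split_ifs with h1 h2
  · positivity
  · positivity
  · exact le_rfl

lemma measurable_cgmyLevyDensity (C G M Y : ℝ) : Measurable (cgmyLevyDensity C G M Y) := by
  unfold cgmyLevyDensity
  refine Measurable.ite measurableSet_Iio (by fun_prop) ?_
  exact Measurable.ite measurableSet_Ioi (by fun_prop) measurable_const

/-- An integral over the line against a function split into its two half lines. -/
lemma integrable_of_half_lines {f : ℝ → ℝ} (h1 : IntegrableOn f (Ioi 0))
    (h2 : IntegrableOn (fun x => f (-x)) (Ioi 0)) :
    Integrable f ∧ ∫ x, f x = (∫ x in Ioi 0, f x) + ∫ x in Ioi 0, f (-x) := by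
  have h3 : IntegrableOn f (Iic 0) := by
    rw [integrableOn_Iic_iff_integrableOn_Iio]
    rw [← neg_zero] at h2
    simpa using h2.comp_neg_Iio
  have h4 : Integrable f := by
    rw [← integrableOn_univ, ← Iic_union_Ioi (a := (0 : ℝ))]
    exact h3.union h1
  refine ⟨h4, ?_⟩
  rw [← intervalIntegral.integral_Iic_add_Ioi h3 h1, integral_comp_neg_Ioi]
  simp [add_comm]

/-- A Gamma integral; n ≥ 2 > Y is what makes it converge at the origin. -/
lemma integral_pow_mul_exp_div_rpow {Y r : ℝ} (hY : Y < 2) (hr : 0 < r) {n : ℕ} (hn : 2 ≤ n) :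
    IntegrableOn (fun x : ℝ => x ^ n * (Real.exp (-r * x) / x ^ (1 + Y))) (Ioi 0) ∧
    ∫ x in Ioi (0 : ℝ), x ^ n * (Real.exp (-r * x) / x ^ (1 + Y)) =
      Real.Gamma (n - Y) * r ^ (Y - n) := by
  have hnY : 0 < (n : ℝ) - Y := by
    have : (2 : ℝ) ≤ n := by exact_mod_cast hn
    linarith
  have he : EqOn (fun x : ℝ => x ^ ((n : ℝ) - Y - 1) * Real.exp (-(r * x)))
      (fun x : ℝ => x ^ n * (Real.exp (-r * x) / x ^ (1 + Y))) (Ioi 0) := by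
    intro x hx
    have hx : 0 < x := hx
    simp only
    rw [show (n : ℝ) - Y - 1 = n - (1 + Y) by ring, rpow_sub hx, rpow_natCast, neg_mul]
    ring
  constructor
  · refine IntegrableOn.congr_fun ?_ he measurableSet_Ioi
    have := integrableOn_rpow_mul_exp_neg_mul_rpow (p := 1) (s := (n : ℝ) - Y - 1) (b := r)
      (by linarith) one_pos hr
    simpa using this
  · rw [← setIntegral_congr_fun measurableSet_Ioi he,
      integral_rpow_mul_exp_neg_mul_Ioi hnY hr, one_div, inv_rpow hr.le, ← rpow_neg hr.le]
    rw [neg_sub, mul_comm]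

section moments

variable {C G M Y : ℝ}

/-- The tilt e^{sx} replaces M by M − s and G by G + s. The parameter a covers signed moments, a =
(−1)^n, and absolute moments, a = 1, in one computation. -/
lemma cgmy_moment_aux (hY : Y < 2) {s : ℝ} (hs : s ∈ Ioo (-G) M)
    {n : ℕ} (hn : 2 ≤ n) (a : ℝ) {f : ℝ → ℝ} (hf1 : ∀ x > 0, f x = x ^ n)
    (hf2 : ∀ x > 0, f (-x) = a * x ^ n) :
    Integrable (fun x => f x * Real.exp (s * x) * cgmyLevyDensity C G M Y x) ∧
    ∫ x, f x * Real.exp (s * x) * cgmyLevyDensity C G M Y x =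
      C * Real.Gamma (n - Y) * ((M - s) ^ (Y - n) + a * (G + s) ^ (Y - n)) := by
  have hp := integral_pow_mul_exp_div_rpow hY (r := M - s) (by linarith [hs.2]) hn
  have hq := integral_pow_mul_exp_div_rpow hY (r := G + s) (by linarith [hs.1]) hn
  have e1 : EqOn (fun x : ℝ => C * (x ^ n * (Real.exp (-(M - s) * x) / x ^ (1 + Y))))
      (fun x => f x * Real.exp (s * x) * cgmyLevyDensity C G M Y x) (Ioi 0) := by
    intro x hx
    simp only
    rw [cgmyLevyDensity_of_pos hx, hf1 x hx,
      show -(M - s) * x = s * x + (-M * x) by ring, Real.exp_add]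
    ring
  have e2 : EqOn (fun x : ℝ => C * a * (x ^ n * (Real.exp (-(G + s) * x) / x ^ (1 + Y))))
      (fun x => f (-x) * Real.exp (s * -x) * cgmyLevyDensity C G M Y (-x)) (Ioi 0) := by
    intro x hx
    simp only
    rw [cgmyLevyDensity_of_neg hx, hf2 x hx,
      show -(G + s) * x = s * (-x) + (-G * x) by ring, Real.exp_add]
    ring
  have i1 := IntegrableOn.congr_fun (hp.1.const_mul C) e1 measurableSet_Ioi
  have i2 := IntegrableOn.congr_fun (hq.1.const_mul (C * a)) e2 measurableSet_Ioi
  obtain ⟨h, h'⟩ := integrable_of_half_lines i1 i2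
  refine ⟨h, ?_⟩
  rw [h', ← setIntegral_congr_fun measurableSet_Ioi e1,
    ← setIntegral_congr_fun measurableSet_Ioi e2, integral_const_mul, integral_const_mul,
    hp.2, hq.2]
  ring

lemma integrable_pow_mul_cgmy (hY : Y < 2) {s : ℝ} (hs : s ∈ Ioo (-G) M) {n : ℕ} (hn : 2 ≤ n) :
    Integrable (fun x => x ^ n * Real.exp (s * x) * cgmyLevyDensity C G M Y x) :=
  (cgmy_moment_aux hY hs hn ((-1) ^ n) (f := fun x => x ^ n) (fun _ _ => rfl)
    (fun x _ => by simp only [neg_pow x n])).1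

lemma integral_pow_mul_cgmy (hY : Y < 2) {s : ℝ} (hs : s ∈ Ioo (-G) M) {n : ℕ} (hn : 2 ≤ n) :
    ∫ x, x ^ n * Real.exp (s * x) * cgmyLevyDensity C G M Y x =
      C * Real.Gamma (n - Y) * ((M - s) ^ (Y - n) + (-1) ^ n * (G + s) ^ (Y - n)) :=
  (cgmy_moment_aux hY hs hn ((-1) ^ n) (f := fun x => x ^ n) (fun _ _ => rfl)
    (fun x _ => by simp only [neg_pow x n])).2

lemma integrable_abs_pow_mul_cgmy (hY : Y < 2) {s : ℝ} (hs : s ∈ Ioo (-G) M) {n : ℕ}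
    (hn : 2 ≤ n) :
    Integrable (fun x => |x| ^ n * Real.exp (s * x) * cgmyLevyDensity C G M Y x) :=
  (cgmy_moment_aux hY hs hn 1 (f := fun x => |x| ^ n) (fun x hx => by rw [abs_of_pos hx])
    (fun x hx => by rw [abs_neg, abs_of_pos hx, one_mul])).1

lemma integral_abs_pow_mul_cgmy (hY : Y < 2) {s : ℝ} (hs : s ∈ Ioo (-G) M) {n : ℕ}
    (hn : 2 ≤ n) :
    ∫ x, |x| ^ n * Real.exp (s * x) * cgmyLevyDensity C G M Y x =
      C * Real.Gamma (n - Y) * ((M - s) ^ (Y - n) + (G + s) ^ (Y - n)) := by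
  simpa using (cgmy_moment_aux hY hs hn 1 (f := fun x => |x| ^ n)
    (fun x hx => by rw [abs_of_pos hx])
    (fun x hx => by rw [abs_neg, abs_of_pos hx, one_mul])).2

end moments

/-! ### The Lévy exponent on its strip of analyticity -/

/-- The compensated Lévy exponent `∫ (e^{zx} - 1 - zx) ℓ(x) dx` of the CGMY law. -/
noncomputable def cgmyExponent (C G M Y : ℝ) (z : ℂ) : ℂ :=
  ∫ x : ℝ, (Complex.exp (z * x) - 1 - z * x) * (cgmyLevyDensity C G M Y x : ℂ)

/-- The real Lévy exponent. -/
noncomputable def cgmyCumulant (C G M Y : ℝ) (t : ℝ) : ℝ :=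
  ∫ x : ℝ, (Real.exp (t * x) - 1 - t * x) * cgmyLevyDensity C G M Y x

lemma cgmyExponent_ofReal (C G M Y t : ℝ) :
    cgmyExponent C G M Y (t : ℂ) = (cgmyCumulant C G M Y t : ℂ) := by
  unfold cgmyExponent cgmyCumulant
  rw [← integral_complex_ofReal]
  refine integral_congr_ae (Eventually.of_forall fun x => ?_)
  simp only
  push_cast
  rfl

section exponent

variable {C G M Y : ℝ}

/-- The basic majorant: remainders of order `n ≥ 2` are integrable on the strip. -/
lemma cgmy_norm_bound (hY : Y < 2) (hG : 0 < G) (hM : 0 < M)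
    {s₁ s₂ : ℝ} (h1 : s₁ ∈ Ioo (-G) M) (h2 : s₂ ∈ Ioo (-G) M) {n : ℕ} (hn : 2 ≤ n) :
    Integrable (fun x => |x| ^ n * (1 + (Real.exp (s₁ * x) + Real.exp (s₂ * x))) *
      cgmyLevyDensity C G M Y x) := by
  have h0 : (0 : ℝ) ∈ Ioo (-G) M := ⟨by linarith, hM⟩
  have := ((integrable_abs_pow_mul_cgmy (C := C) hY h0 hn).add
    ((integrable_abs_pow_mul_cgmy (C := C) hY h1 hn).add
      (integrable_abs_pow_mul_cgmy (C := C) hY h2 hn)))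
  refine this.congr (Eventually.of_forall fun x => ?_)
  simp only [Pi.add_apply, zero_mul, Real.exp_zero]
  ring

/-- Provides one majorant for all exponents in [s₁, s₂], as needed for differentiation under the
integral. -/
lemma exp_mul_le_add {s₁ s₂ s x : ℝ} (h1 : s₁ ≤ s) (h2 : s ≤ s₂) :
    Real.exp (s * x) ≤ Real.exp (s₁ * x) + Real.exp (s₂ * x) := by
  rcases le_total 0 x with h | h
  · have : Real.exp (s * x) ≤ Real.exp (s₂ * x) :=
      Real.exp_le_exp.2 (mul_le_mul_of_nonneg_right h2 h)
    linarith [Real.exp_pos (s₁ * x)]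
  · have : Real.exp (s * x) ≤ Real.exp (s₁ * x) :=
      Real.exp_le_exp.2 (mul_le_mul_of_nonpos_right h1 h)
    linarith [Real.exp_pos (s₂ * x)]

lemma aestronglyMeasurable_mul_cgmy {f : ℝ → ℂ} (hf : Continuous f) :
    AEStronglyMeasurable (fun x => f x * (cgmyLevyDensity C G M Y x : ℂ)) :=
  hf.aestronglyMeasurable.mul
    (Complex.measurable_ofReal.comp (measurable_cgmyLevyDensity C G M Y)).aestronglyMeasurable

lemma norm_ofReal_cgmy (hC : 0 ≤ C) (x : ℝ) :
    ‖(cgmyLevyDensity C G M Y x : ℂ)‖ = cgmyLevyDensity C G M Y x := by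
  rw [Complex.norm_real, Real.norm_of_nonneg (cgmyLevyDensity_nonneg hC G M Y x)]

lemma integrable_cgmyExponent (hC : 0 ≤ C) (hY : Y < 2) (hG : 0 < G) (hM : 0 < M) {z : ℂ}
    (hz : z.re ∈ Ioo (-G) M) :
    Integrable (fun x : ℝ => (Complex.exp (z * x) - 1 - z * x) *
      (cgmyLevyDensity C G M Y x : ℂ)) := by
  refine Integrable.mono' ((cgmy_norm_bound (C := C) hY hG hM hz hz (n := 2) le_rfl).const_mul
    (‖z‖ ^ 2)) (aestronglyMeasurable_mul_cgmy (by fun_prop))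
    (Eventually.of_forall fun x => ?_)
  rw [norm_mul, norm_ofReal_cgmy hC, ← mul_assoc]
  refine mul_le_mul_of_nonneg_right ?_ (cgmyLevyDensity_nonneg hC G M Y x)
  refine (norm_cexp_sub_one_sub_le _).trans ?_
  rw [norm_mul, Complex.norm_real, Real.norm_eq_abs, mul_pow, Complex.re_mul_ofReal, ← mul_assoc]
  gcongr
  linarith [Real.exp_pos (z.re * x)]

lemma integrable_cgmyExponent_deriv (hC : 0 ≤ C) (hY : Y < 2) (hG : 0 < G) (hM : 0 < M) {z : ℂ}
    (hz : z.re ∈ Ioo (-G) M) :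
    Integrable (fun x : ℝ => x * (Complex.exp (z * x) - 1) *
      (cgmyLevyDensity C G M Y x : ℂ)) := by
  refine Integrable.mono' ((cgmy_norm_bound (C := C) hY hG hM hz hz (n := 2) le_rfl).const_mul
    ‖z‖) (aestronglyMeasurable_mul_cgmy (by fun_prop))
    (Eventually.of_forall fun x => ?_)
  rw [norm_mul, norm_ofReal_cgmy hC, ← mul_assoc]
  refine mul_le_mul_of_nonneg_right ?_ (cgmyLevyDensity_nonneg hC G M Y x)
  rw [norm_mul, Complex.norm_real, Real.norm_eq_abs]
  refine (mul_le_mul_of_nonneg_left (norm_cexp_sub_one_le _) (abs_nonneg x)).trans ?_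
  rw [norm_mul, Complex.norm_real, Real.norm_eq_abs, Complex.re_mul_ofReal]
  calc |x| * (‖z‖ * |x| * (1 + Real.exp (z.re * x)))
      = ‖z‖ * |x| ^ 2 * (1 + Real.exp (z.re * x)) := by ring
    _ ≤ _ := by
        rw [← mul_assoc]; gcongr; linarith [Real.exp_pos (z.re * x)]

/-- Local uniformity: real parts near z stay in a compact subinterval, so the two endpoint tilts
dominate. -/
lemma strip_nhds {z : ℂ} (hz : z.re ∈ Ioo (-G) M) :
    ∃ ε > 0, ∃ s₁ ∈ Ioo (-G) M, ∃ s₂ ∈ Ioo (-G) M, ∀ w ∈ Metric.ball z ε,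
      s₁ ≤ w.re ∧ w.re ≤ s₂ := by
  obtain ⟨h1, h2⟩ := hz
  refine ⟨min ((z.re + G) / 2) ((M - z.re) / 2), lt_min (by linarith) (by linarith),
    (z.re - G) / 2, ⟨by linarith, by linarith⟩, (z.re + M) / 2, ⟨by linarith, by linarith⟩,
    fun w hw => ?_⟩
  have h3 : |w.re - z.re| < min ((z.re + G) / 2) ((M - z.re) / 2) :=
    (Complex.abs_re_le_norm (w - z)).trans_lt (by rwa [mem_ball_iff_norm] at hw)
  have h4 := abs_lt.1 (h3.trans_le (min_le_left _ _))
  have h5 := abs_lt.1 (h3.trans_le (min_le_right _ _))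
  constructor <;> linarith [h4.1, h5.2]

/-- Differentiation under the integral sign. The derivative keeps enough compensation to remain
O(x²) at the origin, where ℓ itself may fail to be integrable. -/
lemma hasDerivAt_cgmyExponent (hC : 0 ≤ C) (hY : Y < 2) (hG : 0 < G) (hM : 0 < M) {z : ℂ}
    (hz : z.re ∈ Ioo (-G) M) :
    HasDerivAt (cgmyExponent C G M Y)
      (∫ x : ℝ, x * (Complex.exp (z * x) - 1) * (cgmyLevyDensity C G M Y x : ℂ)) z := by
  obtain ⟨ε, hε, s₁, h1, s₂, h2, hs⟩ := strip_nhds hz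
  refine (hasDerivAt_integral_of_dominated_loc_of_deriv_le (μ := volume)
    (F := fun (w : ℂ) (x : ℝ) => (Complex.exp (w * x) - 1 - w * x) *
      (cgmyLevyDensity C G M Y x : ℂ))
    (F' := fun (w : ℂ) (x : ℝ) => x * (Complex.exp (w * x) - 1) *
      (cgmyLevyDensity C G M Y x : ℂ))
    (bound := fun x => (‖z‖ + ε) * (|x| ^ 2 * (1 + (Real.exp (s₁ * x) + Real.exp (s₂ * x))) *
      cgmyLevyDensity C G M Y x))
    (Metric.ball_mem_nhds z hε)
    (Eventually.of_forall fun w => aestronglyMeasurable_mul_cgmy (by fun_prop))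
    (integrable_cgmyExponent hC hY hG hM hz)
    (aestronglyMeasurable_mul_cgmy (by fun_prop))
    (Eventually.of_forall fun x w hw => ?_)
    ((cgmy_norm_bound (C := C) hY hG hM h1 h2 le_rfl).const_mul _)
    (Eventually.of_forall fun x w hw => ?_)).2
  · rw [norm_mul, norm_ofReal_cgmy hC, ← mul_assoc]
    refine mul_le_mul_of_nonneg_right ?_ (cgmyLevyDensity_nonneg hC G M Y x)
    rw [norm_mul, Complex.norm_real, Real.norm_eq_abs]
    refine (mul_le_mul_of_nonneg_left (norm_cexp_sub_one_le _) (abs_nonneg x)).trans ?_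
    rw [norm_mul, Complex.norm_real, Real.norm_eq_abs, Complex.re_mul_ofReal]
    have hw' : ‖w‖ ≤ ‖z‖ + ε := by
      have : ‖w - z‖ < ε := by simpa [dist_eq_norm] using hw
      linarith [norm_le_norm_add_norm_sub' w z]
    have := exp_mul_le_add (x := x) (hs w hw).1 (hs w hw).2
    calc |x| * (‖w‖ * |x| * (1 + Real.exp (w.re * x)))
        = ‖w‖ * (|x| ^ 2 * (1 + Real.exp (w.re * x))) := by ring
      _ ≤ _ := by gcongr
  · have h3 : HasDerivAt (fun w : ℂ => w * (x : ℂ)) x w := by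
      simpa using (hasDerivAt_id w).mul_const (x : ℂ)
    exact (((h3.cexp.sub_const 1).sub h3).mul_const _).congr_deriv (by ring)

lemma hasDerivAt_cgmyExponent_deriv (hC : 0 ≤ C) (hY : Y < 2) (hG : 0 < G) (hM : 0 < M) {z : ℂ}
    (hz : z.re ∈ Ioo (-G) M) :
    HasDerivAt (fun z : ℂ => ∫ x : ℝ, x * (Complex.exp (z * x) - 1) *
        (cgmyLevyDensity C G M Y x : ℂ))
      (∫ x : ℝ, x ^ 2 * Complex.exp (z * x) * (cgmyLevyDensity C G M Y x : ℂ)) z := by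
  obtain ⟨ε, hε, s₁, h1, s₂, h2, hs⟩ := strip_nhds hz
  refine (hasDerivAt_integral_of_dominated_loc_of_deriv_le (μ := volume)
    (F := fun (w : ℂ) (x : ℝ) => x * (Complex.exp (w * x) - 1) *
      (cgmyLevyDensity C G M Y x : ℂ))
    (F' := fun (w : ℂ) (x : ℝ) => x ^ 2 * Complex.exp (w * x) *
      (cgmyLevyDensity C G M Y x : ℂ))
    (bound := fun x => (|x| ^ 2 * (1 + (Real.exp (s₁ * x) + Real.exp (s₂ * x))) *
      cgmyLevyDensity C G M Y x))
    (Metric.ball_mem_nhds z hε)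
    (Eventually.of_forall fun w => aestronglyMeasurable_mul_cgmy (by fun_prop))
    (integrable_cgmyExponent_deriv hC hY hG hM hz)
    (aestronglyMeasurable_mul_cgmy (by fun_prop))
    (Eventually.of_forall fun x w hw => ?_)
    (cgmy_norm_bound (C := C) hY hG hM h1 h2 le_rfl)
    (Eventually.of_forall fun x w hw => ?_)).2
  · rw [norm_mul, norm_ofReal_cgmy hC]
    refine mul_le_mul_of_nonneg_right ?_ (cgmyLevyDensity_nonneg hC G M Y x)
    rw [norm_mul, norm_pow, Complex.norm_real, Real.norm_eq_abs, Complex.norm_exp,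
      Complex.re_mul_ofReal]
    have := exp_mul_le_add (x := x) (hs w hw).1 (hs w hw).2
    gcongr
    linarith
  · have h3 : HasDerivAt (fun w : ℂ => w * (x : ℂ)) x w := by
      simpa using (hasDerivAt_id w).mul_const (x : ℂ)
    exact (((h3.cexp.sub_const 1).const_mul (x : ℂ)).mul_const _).congr_deriv (by ring)

lemma isOpen_strip (G M : ℝ) : IsOpen {z : ℂ | z.re ∈ Ioo (-G) M} :=
  isOpen_Ioo.preimage Complex.continuous_re

lemma convex_strip (G M : ℝ) : Convex ℝ {z : ℂ | z.re ∈ Ioo (-G) M} :=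
  (convex_Ioo (-G) M).linear_preimage Complex.reLm

lemma differentiableOn_cgmyExponent (hC : 0 ≤ C) (hY : Y < 2) (hG : 0 < G) (hM : 0 < M) :
    DifferentiableOn ℂ (cgmyExponent C G M Y) {z : ℂ | z.re ∈ Ioo (-G) M} :=
  fun _ hz => (hasDerivAt_cgmyExponent hC hY hG hM hz).differentiableAt.differentiableWithinAt

/-- First derivative of the real exponent. -/
noncomputable def cgmyCumulantDeriv (C G M Y : ℝ) (t : ℝ) : ℝ :=
  ∫ x : ℝ, x * (Real.exp (t * x) - 1) * cgmyLevyDensity C G M Y x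

lemma hasDerivAt_cgmyCumulant (hC : 0 ≤ C) (hY : Y < 2) (hG : 0 < G) (hM : 0 < M) {t : ℝ}
    (ht : t ∈ Ioo (-G) M) :
    HasDerivAt (cgmyCumulant C G M Y) (cgmyCumulantDeriv C G M Y t) t := by
  have h := (hasDerivAt_cgmyExponent (C := C) hC hY hG hM (z := (t : ℂ)) (by simpa using ht)).real_of_complex
  have e1 : (fun x : ℝ => (cgmyExponent C G M Y (x : ℂ)).re) = cgmyCumulant C G M Y := by
    ext x; rw [cgmyExponent_ofReal, Complex.ofReal_re]
  rw [e1] at h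
  convert h using 1
  rw [cgmyCumulantDeriv, ← Complex.ofReal_re (∫ x : ℝ, _), ← integral_complex_ofReal]
  congr 2
  ext x
  push_cast
  rfl

lemma hasDerivAt_cgmyCumulantDeriv (hC : 0 ≤ C) (hY : Y < 2) (hG : 0 < G) (hM : 0 < M) {t : ℝ}
    (ht : t ∈ Ioo (-G) M) :
    HasDerivAt (cgmyCumulantDeriv C G M Y)
      (C * Real.Gamma (2 - Y) * ((M - t) ^ (Y - 2) + (G + t) ^ (Y - 2))) t := by
  have h := (hasDerivAt_cgmyExponent_deriv (C := C) hC hY hG hM (z := (t : ℂ))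
    (by simpa using ht)).real_of_complex
  have e1 : (fun t : ℝ => (∫ x : ℝ, (x : ℂ) * (Complex.exp (t * x) - 1) *
        (cgmyLevyDensity C G M Y x : ℂ)).re) = cgmyCumulantDeriv C G M Y := by
    ext t
    rw [cgmyCumulantDeriv, ← Complex.ofReal_re (∫ x : ℝ, x * (Real.exp (t * x) - 1) * _),
      ← integral_complex_ofReal]
    congr 2
    ext x
    push_cast
    rfl
  rw [e1] at h
  convert h using 1
  have h2 := integral_pow_mul_cgmy (C := C) hY ht (n := 2) le_rfl
  norm_num at h2
  rw [← h2, ← Complex.ofReal_re (∫ x : ℝ, _), ← integral_complex_ofReal]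
  congr 2
  ext x
  push_cast
  rfl

lemma cgmyCumulant_zero : cgmyCumulant C G M Y 0 = 0 := by simp [cgmyCumulant]

lemma cgmyCumulantDeriv_zero : cgmyCumulantDeriv C G M Y 0 = 0 := by simp [cgmyCumulantDeriv]

/-- The real part of the exponent on a vertical line. -/
lemma integrable_cos_mul_cgmy (hC : 0 ≤ C) (hY : Y < 2) (hG : 0 < G) (hM : 0 < M) {z : ℂ}
    (hz : z.re ∈ Ioo (-G) M) :
    Integrable (fun x => Real.exp (z.re * x) * (1 - Real.cos (z.im * x)) *
      cgmyLevyDensity C G M Y x) ∧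
    (cgmyExponent C G M Y z).re = cgmyCumulant C G M Y z.re -
      ∫ x, Real.exp (z.re * x) * (1 - Real.cos (z.im * x)) * cgmyLevyDensity C G M Y x := by
  have h1 := integrable_cgmyExponent hC hY hG hM hz
  have h2 := integrable_cgmyExponent hC hY hG hM (z := (z.re : ℂ)) (by simpa using hz)
  have e : ∀ x : ℝ, Real.exp (z.re * x) * (1 - Real.cos (z.im * x)) * cgmyLevyDensity C G M Y x =
      ((Complex.exp ((z.re : ℂ) * x) - 1 - (z.re : ℂ) * x) * (cgmyLevyDensity C G M Y x : ℂ)).re -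
      ((Complex.exp (z * x) - 1 - z * x) * (cgmyLevyDensity C G M Y x : ℂ)).re := by
    intro x
    rw [Complex.re_mul_ofReal, Complex.re_mul_ofReal]
    simp only [Complex.sub_re, Complex.one_re, Complex.re_mul_ofReal, Complex.exp_re,
      Complex.im_mul_ofReal, Complex.ofReal_re, Complex.ofReal_im]
    simp
    ring
  refine ⟨(h2.re.sub h1.re).congr (Eventually.of_forall fun x => (e x).symm), ?_⟩
  simp_rw [e]
  rw [show ∫ x : ℝ, (((Complex.exp ((z.re : ℂ) * x) - 1 - (z.re : ℂ) * x) *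
      (cgmyLevyDensity C G M Y x : ℂ)).re -
      ((Complex.exp (z * x) - 1 - z * x) * (cgmyLevyDensity C G M Y x : ℂ)).re) = _ from
      integral_sub h2.re h1.re]
  have h3 := integral_re h1
  have h4 := integral_re h2
  simp only [RCLike.re_to_complex] at h3 h4
  rw [h3, h4]
  have : cgmyExponent C G M Y (z.re : ℂ) = cgmyCumulant C G M Y z.re := cgmyExponent_ofReal ..
  unfold cgmyExponent at this ⊢
  rw [this, Complex.ofReal_re]
  ring

/-- The oscillatory correction is nonnegative. This is the analogue of |E e^{zX}| ≤ E e^{X Re z} for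
the exponent, available before exponential moments are known to exist. -/
lemma re_cgmyExponent_le (hC : 0 ≤ C) (hY : Y < 2) (hG : 0 < G) (hM : 0 < M) {z : ℂ}
    (hz : z.re ∈ Ioo (-G) M) : (cgmyExponent C G M Y z).re ≤ cgmyCumulant C G M Y z.re := by
  rw [(integrable_cos_mul_cgmy hC hY hG hM hz).2]
  have : 0 ≤ ∫ x, Real.exp (z.re * x) * (1 - Real.cos (z.im * x)) * cgmyLevyDensity C G M Y x := by
    refine integral_nonneg fun x => ?_
    have := Real.cos_le_one (z.im * x)
    have := cgmyLevyDensity_nonneg hC G M Y x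
    exact mul_nonneg (mul_nonneg (Real.exp_pos _).le (by linarith)) this
  linarith

end exponent

/-! ### Exponential moments of the CGMY law -/

section strip

variable {b C G M Y : ℝ}

/-- Identity theorem: the imaginary axis lies in the connected open strip and accumulates at 0. -/
lemma eqOn_strip_of_eq_on_imaginary {f g : ℂ → ℂ} (hG : 0 < G) (hM : 0 < M)
    (hf : DifferentiableOn ℂ f {z : ℂ | z.re ∈ Ioo (-G) M})
    (hg : DifferentiableOn ℂ g {z : ℂ | z.re ∈ Ioo (-G) M})
    (h : ∀ t : ℝ, f (t * Complex.I) = g (t * Complex.I)) :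
    EqOn f g {z : ℂ | z.re ∈ Ioo (-G) M} := by
  refine (hf.analyticOnNhd (isOpen_strip G M)).eqOn_of_preconnected_of_frequently_eq
    (hg.analyticOnNhd (isOpen_strip G M)) (convex_strip G M).isPreconnected
    (z₀ := 0) (by simp [hG, hM]) ?_
  have ht : Tendsto (fun t : ℝ => (t : ℂ) * Complex.I) (𝓝[≠] 0) (𝓝[≠] 0) := by
    refine tendsto_nhdsWithin_iff.2 ⟨?_, ?_⟩
    · have : Continuous (fun t : ℝ => (t : ℂ) * Complex.I) := by fun_prop
      simpa using (this.tendsto 0).mono_left nhdsWithin_le_nhds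
    · filter_upwards [self_mem_nhdsWithin] with t ht
      simpa using ht
  exact ht.frequently (Eventually.of_forall h).frequently

/-- The function `exp (zb + Ψ(z))`. -/
noncomputable def cgmyTransform (b C G M Y : ℝ) (z : ℂ) : ℂ :=
  Complex.exp (z * b + cgmyExponent C G M Y z)

lemma norm_cgmyTransform_le (b : ℝ) (hC : 0 ≤ C) (hY : Y < 2) (hG : 0 < G) (hM : 0 < M) {z : ℂ}
    (hz : z.re ∈ Ioo (-G) M) :
    ‖cgmyTransform b C G M Y z‖ ≤ Real.exp (z.re * b + cgmyCumulant C G M Y z.re) := by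
  rw [cgmyTransform, Complex.norm_exp, Complex.add_re, Complex.re_mul_ofReal]
  exact Real.exp_le_exp.2 (by linarith [re_cgmyExponent_le hC hY hG hM hz])

lemma differentiableOn_cgmyTransform (b : ℝ) (hC : 0 ≤ C) (hY : Y < 2) (hG : 0 < G)
    (hM : 0 < M) :
    DifferentiableOn ℂ (cgmyTransform b C G M Y) {z : ℂ | z.re ∈ Ioo (-G) M} :=
  ((differentiableOn_id.mul_const _).add (differentiableOn_cgmyExponent hC hY hG hM)).cexp

/-- The transform is bounded on vertical strips with compact base, uniformly in the imaginary
direction. Cauchy's estimate on circles of radius ε/3 then bounds its derivative, and the integral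
can be differentiated. -/
lemma differentiableOn_gaussian_average (b : ℝ) (hC : 0 ≤ C) (hY : Y < 2) (hG : 0 < G)
    (hM : 0 < M) (v : NNReal) :
    DifferentiableOn ℂ (fun z => ∫ u : ℝ, cgmyTransform b C G M Y (z + u * Complex.I)
      ∂(gaussianReal 0 v)) {z : ℂ | z.re ∈ Ioo (-G) M} := by
  intro z hz
  obtain ⟨ε, hε, s₁, h1, s₂, h2, hs⟩ := strip_nhds hz
  set F := cgmyTransform b C G M Y with hF
  have hd := differentiableOn_cgmyTransform b hC hY hG hM
  have hsub : Icc s₁ s₂ ⊆ Ioo (-G) M := fun x hx => ⟨h1.1.trans_le hx.1, hx.2.trans_lt h2.2⟩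
  obtain ⟨B, hB⟩ : ∃ B, ∀ t ∈ Icc s₁ s₂, Real.exp (t * b + cgmyCumulant C G M Y t) ≤ B := by
    have hc : ContinuousOn (fun t => Real.exp (t * b + cgmyCumulant C G M Y t)) (Icc s₁ s₂) :=
      ((continuousOn_id.mul continuousOn_const).add fun t ht =>
        (hasDerivAt_cgmyCumulant hC hY hG hM (hsub ht)).continuousAt.continuousWithinAt).rexp
    obtain ⟨B, hB⟩ := (isCompact_Icc.image_of_continuousOn hc).bddAbove
    exact ⟨B, fun t ht => hB ⟨t, ht, rfl⟩⟩
  have hre : ∀ (w : ℂ) (u : ℝ), (w + u * Complex.I).re = w.re := by intro w u; simp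
  have hFB : ∀ w ∈ Metric.ball z ε, ∀ u : ℝ, ‖F (w + u * Complex.I)‖ ≤ B := fun w hw u =>
    (norm_cgmyTransform_le b hC hY hG hM (by rw [hre]; exact hsub (hs w hw))).trans
      (by rw [hre]; exact hB _ (hs w hw))
  have hmem : ∀ w ∈ Metric.ball z ε, ∀ u : ℝ,
      w + u * Complex.I ∈ {z : ℂ | z.re ∈ Ioo (-G) M} := fun w hw u => by
    change (w + u * Complex.I).re ∈ Ioo (-G) M
    rw [hre]; exact hsub (hs w hw)
  have hcont : ∀ w ∈ Metric.ball z ε, Continuous fun u : ℝ => F (w + u * Complex.I) :=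
    fun w hw => hd.continuousOn.comp_continuous (by fun_prop) (hmem w hw)
  have hcont' : ∀ w ∈ Metric.ball z ε, Continuous fun u : ℝ => deriv F (w + u * Complex.I) :=
    fun w hw => ((hd.analyticOnNhd (isOpen_strip G M)).deriv.continuousOn).comp_continuous
      (by fun_prop) (hmem w hw)
  have hz0 : z ∈ Metric.ball z ε := Metric.mem_ball_self hε
  have hsub3 : Metric.ball z (ε / 3) ⊆ Metric.ball z ε := Metric.ball_subset_ball (by linarith)
  refine (hasDerivAt_integral_of_dominated_loc_of_deriv_le (μ := gaussianReal 0 v)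
    (F := fun (w : ℂ) (u : ℝ) => F (w + u * Complex.I))
    (F' := fun (w : ℂ) (u : ℝ) => deriv F (w + u * Complex.I))
    (bound := fun _ => B / (ε / 3))
    (Metric.ball_mem_nhds z (by linarith : 0 < ε / 3))
    ?_ ?_ (hcont' z hz0).aestronglyMeasurable
    (Eventually.of_forall fun u w hw => ?_) (integrable_const _)
    (Eventually.of_forall fun u w hw => ?_)).2.differentiableAt.differentiableWithinAt
  · filter_upwards [Metric.ball_mem_nhds z hε] with w hw
    exact (hcont w hw).aestronglyMeasurable
  · exact Integrable.mono' (integrable_const B) (hcont z hz0).aestronglyMeasurable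
      (Eventually.of_forall fun u => hFB z hz0 u)
  · have hball : ∀ w' ∈ Metric.closedBall (w + u * Complex.I) (ε / 3),
        w' - u * Complex.I ∈ Metric.ball z ε := by
      intro w' hw'
      rw [mem_ball_iff_norm] at hw ⊢
      rw [mem_closedBall_iff_norm] at hw'
      calc ‖w' - u * Complex.I - z‖ = ‖(w' - (w + u * Complex.I)) + (w - z)‖ := by ring_nf
        _ ≤ _ := norm_add_le _ _
        _ < ε := by linarith
    refine Complex.norm_deriv_le_of_forall_mem_sphere_norm_le (by linarith)
      (DifferentiableOn.diffContOnCl_ball (U := {z : ℂ | z.re ∈ Ioo (-G) M}) hd ?_) ?_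
    · intro w' hw'
      simpa using hmem _ (hball w' hw') u
    · intro w' hw'
      simpa using hFB _ (hball w' (Metric.sphere_subset_closedBall hw')) u
  · have h3 := hmem w (hsub3 hw) u
    have h4 : HasDerivAt F (deriv F (w + u * Complex.I)) (w + u * Complex.I) :=
      (hd.differentiableAt ((isOpen_strip G M).mem_nhds h3)).hasDerivAt
    exact h4.comp_add_const w (u * Complex.I)

lemma isCGMY_charFun {μ : Measure ℝ} (h : IsCGMY b C G M Y μ) (u : ℝ) :
    charFun μ u = cgmyTransform b C G M Y (u * Complex.I) := by
  rw [h.2 u, cgmyTransform, cgmyExponent, mul_comm (u : ℂ) Complex.I]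

lemma exp_mul_sub_sq_le (s x : ℝ) {v : ℝ} (hv : 0 < v) :
    Real.exp (s * x) * Real.exp (-(v * x ^ 2 / 2)) ≤ Real.exp (s ^ 2 / (2 * v)) := by
  rw [← Real.exp_add, Real.exp_le_exp, le_div_iff₀ (by positivity)]
  nlinarith [sq_nonneg (s - v * x)]

/-- The weight e^{−vx²/2} makes the left side entire, and it is itself the characteristic function
of N(0, v). On the imaginary axis Fubini therefore turns the left side into a Gaussian average of
the known characteristic function; the identity theorem extends this to the strip. -/
lemma gaussian_regularized_transform {μ : Measure ℝ} (h : IsCGMY b C G M Y μ) (hC : 0 ≤ C)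
    (hY : Y < 2) (hG : 0 < G) (hM : 0 < M) {v : NNReal} (hv : 0 < v) {z : ℂ}
    (hz : z.re ∈ Ioo (-G) M) :
    ∫ x : ℝ, Complex.exp (z * x) * Real.exp (-(v * x ^ 2 / 2)) ∂μ =
      ∫ u : ℝ, cgmyTransform b C G M Y (z + u * Complex.I) ∂(gaussianReal 0 v) := by
  have hP : IsProbabilityMeasure μ := h.1
  have hv' : (0 : ℝ) < v := by exact_mod_cast hv
  refine eqOn_strip_of_eq_on_imaginary (f := fun z => ∫ x : ℝ, Complex.exp (z * x) *
    Real.exp (-(v * x ^ 2 / 2)) ∂μ) hG hM ?_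
    (differentiableOn_gaussian_average b hC hY hG hM v) ?_ hz
  -- The weight is absorbed into the measure, which then has every exponential moment, so that
  -- analyticity of `complexMGF` applies everywhere.
  · set w : ℝ → NNReal := fun x => Real.toNNReal (Real.exp (-(v * x ^ 2 / 2))) with hw
    have hwm : Measurable w := by fun_prop
    have hwc : ∀ x, (w x : ℝ) = Real.exp (-(v * x ^ 2 / 2)) := fun x =>
      Real.coe_toNNReal _ (Real.exp_pos _).le
    have huniv : integrableExpSet (id : ℝ → ℝ) (μ.withDensity fun x => (w x : ENNReal)) = univ := by
      refine eq_univ_of_forall fun t => ?_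
      change Integrable _ _
      rw [integrable_withDensity_iff_integrable_smul hwm]
      refine Integrable.mono' (integrable_const (Real.exp (t ^ 2 / (2 * v))))
        (by fun_prop) (Eventually.of_forall fun x => ?_)
      rw [NNReal.smul_def, hwc, smul_eq_mul, Real.norm_of_nonneg (by positivity), mul_comm]
      exact exp_mul_sub_sq_le t x hv'
    have := differentiableOn_complexMGF (X := (id : ℝ → ℝ))
      (μ := μ.withDensity fun x => (w x : ENNReal))
    rw [huniv, interior_univ] at this
    refine (this.mono (fun _ _ => mem_univ _)).congr fun z _ => ?_
    rw [complexMGF, integral_withDensity_eq_integral_smul hwm]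
    refine integral_congr_ae (Eventually.of_forall fun x => ?_)
    simp only [id_eq, NNReal.smul_def, hwc, Complex.real_smul]
    ring
  · intro t
    have h1 : ∀ u : ℝ, cgmyTransform b C G M Y (t * Complex.I + u * Complex.I) =
        ∫ x : ℝ, Complex.exp (((t + u : ℝ) : ℂ) * x * Complex.I) ∂μ := by
      intro u
      rw [← charFun_apply_real, isCGMY_charFun h]
      push_cast
      ring_nf
    simp_rw [h1]
    rw [integral_integral_swap]
    · refine integral_congr_ae (Eventually.of_forall fun x => ?_)
      have h2 := charFun_gaussianReal (μ := 0) (v := v) x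
      rw [charFun_apply_real] at h2
      have h3 : (Real.exp (-(v * x ^ 2 / 2)) : ℂ) =
          ∫ u : ℝ, Complex.exp (x * u * Complex.I) ∂(gaussianReal 0 v) := by
        rw [h2]; push_cast; congr 1; simp
      simp only
      rw [h3, ← integral_const_mul]
      refine integral_congr_ae (Eventually.of_forall fun u => ?_)
      simp only
      rw [← Complex.exp_add]
      push_cast
      ring_nf
    · refine Integrable.mono' (integrable_const (1 : ℝ)) ?_ (Eventually.of_forall fun p => ?_)
      · have : Continuous (fun p : ℝ × ℝ => Complex.exp (((t + p.1 : ℝ) : ℂ) * p.2 * Complex.I)) := by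
          fun_prop
        exact this.aestronglyMeasurable
      · change ‖Complex.exp (((t + p.1 : ℝ) : ℂ) * p.2 * Complex.I)‖ ≤ 1
        rw [← Complex.ofReal_mul, Complex.norm_exp_ofReal_mul_I]

/-- The modulus of the transform on a vertical line is at most its value K on the real axis, so the
regularized moments are bounded by K for every v > 0. Letting v → 0, Fatou's lemma gives a finite
moment. -/
lemma integrable_exp_of_isCGMY {μ : Measure ℝ} (h : IsCGMY b C G M Y μ) (hC : 0 ≤ C)
    (hY : Y < 2) (hG : 0 < G) (hM : 0 < M) {s : ℝ} (hs : s ∈ Ioo (-G) M) :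
    Integrable (fun x => Real.exp (s * x)) μ := by
  have hP : IsProbabilityMeasure μ := h.1
  set K := Real.exp (s * b + cgmyCumulant C G M Y s)
  have h1 : ∀ v : NNReal, 0 < v →
      Integrable (fun x : ℝ => Real.exp (s * x) * Real.exp (-(v * x ^ 2 / 2))) μ ∧
      ∫ x : ℝ, Real.exp (s * x) * Real.exp (-(v * x ^ 2 / 2)) ∂μ ≤ K := by
    intro v hv
    have hv' : (0 : ℝ) < v := by exact_mod_cast hv
    refine ⟨Integrable.mono' (integrable_const (Real.exp (s ^ 2 / (2 * v)))) (by fun_prop)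
      (Eventually.of_forall fun x => ?_), ?_⟩
    · rw [Real.norm_of_nonneg (by positivity)]
      exact exp_mul_sub_sq_le s x hv'
    · have h2 := gaussian_regularized_transform h hC hY hG hM hv (z := (s : ℂ)) (by simpa using hs)
      have h3 : ∫ x : ℝ, Complex.exp ((s : ℂ) * x) * Real.exp (-(v * x ^ 2 / 2)) ∂μ =
          ((∫ x : ℝ, Real.exp (s * x) * Real.exp (-(v * x ^ 2 / 2)) ∂μ : ℝ) : ℂ) := by
        rw [← integral_complex_ofReal]
        refine integral_congr_ae (Eventually.of_forall fun x => ?_)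
        simp only
        push_cast
        rfl
      rw [h3] at h2
      calc ∫ x : ℝ, Real.exp (s * x) * Real.exp (-(v * x ^ 2 / 2)) ∂μ
          ≤ ‖((∫ x : ℝ, Real.exp (s * x) * Real.exp (-(v * x ^ 2 / 2)) ∂μ : ℝ) : ℂ)‖ := by
            rw [Complex.norm_real]; exact le_abs_self _
        _ ≤ ∫ u : ℝ, K ∂(gaussianReal 0 v) := by
            rw [h2]
            refine norm_integral_le_of_norm_le (integrable_const _)
              (Eventually.of_forall fun u => ?_)
            have h4 := norm_cgmyTransform_le b hC hY hG hM (z := (s : ℂ) + u * Complex.I)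
              (by simpa using hs)
            simpa using h4
        _ = K := by simp
  refine ⟨by fun_prop, ?_⟩
  rw [hasFiniteIntegral_iff_ofReal (Eventually.of_forall fun x => (Real.exp_pos _).le)]
  set vn : ℕ → NNReal := fun n => 1 / ((n : NNReal) + 1)
  have hvn : ∀ n, 0 < vn n := fun n => by positivity
  have hlim : Tendsto (fun n => (vn n : ℝ)) atTop (𝓝 0) := by
    simpa [vn] using tendsto_one_div_add_atTop_nhds_zero_nat (𝕜 := ℝ)
  have hpt : ∀ x : ℝ, Tendsto (fun n => ENNReal.ofReal
      (Real.exp (s * x) * Real.exp (-(vn n * x ^ 2 / 2)))) atTop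
      (𝓝 (ENNReal.ofReal (Real.exp (s * x)))) := by
    intro x
    refine ENNReal.tendsto_ofReal ?_
    have hc : Continuous (fun v : ℝ => Real.exp (s * x) * Real.exp (-(v * x ^ 2 / 2))) := by
      fun_prop
    have h2 := (hc.tendsto 0).comp hlim
    simp only [zero_mul, zero_div, neg_zero, Real.exp_zero, mul_one] at h2
    exact h2
  calc ∫⁻ x, ENNReal.ofReal (Real.exp (s * x)) ∂μ
      = ∫⁻ x, liminf (fun n => ENNReal.ofReal
          (Real.exp (s * x) * Real.exp (-(vn n * x ^ 2 / 2)))) atTop ∂μ :=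
        lintegral_congr fun x => (hpt x).liminf_eq.symm
    _ ≤ liminf (fun n => ∫⁻ x, ENNReal.ofReal
          (Real.exp (s * x) * Real.exp (-(vn n * x ^ 2 / 2))) ∂μ) atTop :=
        lintegral_liminf_le fun n => by fun_prop
    _ ≤ ENNReal.ofReal K := by
        refine liminf_le_of_frequently_le' (Eventually.frequently (Eventually.of_forall fun n => ?_))
        rw [← ofReal_integral_eq_lintegral_ofReal (h1 _ (hvn n)).1
          (Eventually.of_forall fun x => by positivity)]
        exact ENNReal.ofReal_le_ofReal (h1 _ (hvn n)).2
    _ < ⊤ := ENNReal.ofReal_lt_top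

lemma Ioo_subset_interior_integrableExpSet {μ : Measure ℝ} (h : IsCGMY b C G M Y μ) (hC : 0 ≤ C)
    (hY : Y < 2) (hG : 0 < G) (hM : 0 < M) :
    Ioo (-G) M ⊆ interior (integrableExpSet (id : ℝ → ℝ) μ) :=
  interior_maximal (fun _ hs => integrable_exp_of_isCGMY h hC hY hG hM hs) isOpen_Ioo

/-- Once the exponential moments are finite the transform of the law is analytic in the strip, and
agreement on the imaginary axis propagates. -/
theorem complexMGF_of_isCGMY {μ : Measure ℝ} (h : IsCGMY b C G M Y μ) (hC : 0 ≤ C)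
    (hY : Y < 2) (hG : 0 < G) (hM : 0 < M) {z : ℂ} (hz : z.re ∈ Ioo (-G) M) :
    complexMGF id μ z = Complex.exp (z * b + cgmyExponent C G M Y z) := by
  refine eqOn_strip_of_eq_on_imaginary hG hM (g := cgmyTransform b C G M Y)
    (differentiableOn_complexMGF.mono fun z hz =>
      Ioo_subset_interior_integrableExpSet h hC hY hG hM hz)
    (differentiableOn_cgmyTransform b hC hY hG hM) (fun t => ?_) hz
  rw [complexMGF_id_mul_I, isCGMY_charFun h]

lemma mgf_of_isCGMY {μ : Measure ℝ} (h : IsCGMY b C G M Y μ) (hC : 0 ≤ C)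
    (hY : Y < 2) (hG : 0 < G) (hM : 0 < M) {s : ℝ} (hs : s ∈ Ioo (-G) M) :
    mgf id μ s = Real.exp (s * b + cgmyCumulant C G M Y s) := by
  have := complexMGF_of_isCGMY h hC hY hG hM (z := (s : ℂ)) (by simpa using hs)
  rw [complexMGF_ofReal, cgmyExponent_ofReal] at this
  exact_mod_cast this

lemma cgf_of_isCGMY {μ : Measure ℝ} (h : IsCGMY b C G M Y μ) (hC : 0 ≤ C)
    (hY : Y < 2) (hG : 0 < G) (hM : 0 < M) {s : ℝ} (hs : s ∈ Ioo (-G) M) :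
    cgf id μ s = s * b + cgmyCumulant C G M Y s := by
  rw [cgf, mgf_of_isCGMY h hC hY hG hM hs, Real.log_exp]

end strip

/-! ### Cumulants, moments and decay of the characteristic function -/

section cumulants

variable {b C G M Y : ℝ}

/-- The derivative of order `n ≥ 2` of the real Lévy exponent. -/
noncomputable def cgmyCumulantIter (C G M Y : ℝ) (n : ℕ) (t : ℝ) : ℝ :=
  C * Real.Gamma (n - Y) * ((M - t) ^ (Y - n) + (-1) ^ n * (G + t) ^ (Y - n))

lemma hasDerivAt_cgmyCumulantIter (hY : Y < 2) {t : ℝ} (ht : t ∈ Ioo (-G) M) {n : ℕ}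
    (hn : 2 ≤ n) :
    HasDerivAt (cgmyCumulantIter C G M Y n) (cgmyCumulantIter C G M Y (n + 1) t) t := by
  have hn' : (2 : ℝ) ≤ n := by exact_mod_cast hn
  have h1 : HasDerivAt (fun t : ℝ => (M - t) ^ (Y - n)) _ t :=
    ((hasDerivAt_id t).const_sub M).rpow_const (Or.inl (by simp; linarith [ht.2]))
  have h2 : HasDerivAt (fun t : ℝ => (G + t) ^ (Y - n)) _ t :=
    ((hasDerivAt_id t).const_add G).rpow_const (Or.inl (by simp; linarith [ht.1]))
  refine ((h1.add (h2.const_mul ((-1) ^ n))).const_mul (C * Real.Gamma (n - Y))).congr_deriv ?_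
  have h3 : Real.Gamma ((n + 1 : ℕ) - Y) = (n - Y) * Real.Gamma (n - Y) := by
    rw [← Real.Gamma_add_one (by linarith : 0 < (n : ℝ) - Y).ne']
    push_cast
    ring_nf
  simp only [cgmyCumulantIter, h3, id_eq]
  rw [show Y - ((n + 1 : ℕ) : ℝ) = Y - n - 1 by push_cast; ring, pow_succ]
  ring

lemma hasDerivAt_cgmyCumulantDeriv' (hC : 0 ≤ C) (hY : Y < 2) (hG : 0 < G) (hM : 0 < M) {t : ℝ}
    (ht : t ∈ Ioo (-G) M) :
    HasDerivAt (cgmyCumulantDeriv C G M Y) (cgmyCumulantIter C G M Y 2 t) t :=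
  (hasDerivAt_cgmyCumulantDeriv hC hY hG hM ht).congr_deriv (by simp [cgmyCumulantIter])

lemma mgf_sub_const_of_isCGMY {μ : Measure ℝ} (h : IsCGMY b C G M Y μ) (hC : 0 ≤ C)
    (hY : Y < 2) (hG : 0 < G) (hM : 0 < M) {s : ℝ} (hs : s ∈ Ioo (-G) M) :
    mgf (fun x => x - b) μ s = Real.exp (cgmyCumulant C G M Y s) := by
  have h1 : mgf (fun x => x - b) μ s = Real.exp (-(s * b)) * mgf id μ s := by
    rw [mgf, mgf, ← integral_const_mul]
    refine integral_congr_ae (Eventually.of_forall fun x => ?_)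
    simp only [id_eq]
    rw [← Real.exp_add]
    ring_nf
  rw [h1, mgf_of_isCGMY h hC hY hG hM hs, ← Real.exp_add]
  ring_nf

lemma zero_mem_interior_sub_const {μ : Measure ℝ} (h : IsCGMY b C G M Y μ) (hC : 0 ≤ C)
    (hY : Y < 2) (hG : 0 < G) (hM : 0 < M) :
    (0 : ℝ) ∈ interior (integrableExpSet (fun x : ℝ => x - b) μ) := by
  have hsub : Ioo (-G) M ⊆ integrableExpSet (fun x : ℝ => x - b) μ := by
    intro s hs
    have := (integrable_exp_of_isCGMY h hC hY hG hM hs).const_mul (Real.exp (-(s * b)))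
    refine this.congr (Eventually.of_forall fun x => ?_)
    simp only
    rw [← Real.exp_add]
    ring_nf
  exact interior_maximal hsub isOpen_Ioo ⟨by linarith, hM⟩

/-- The central moments of the CGMY law. -/
lemma central_moments_of_isCGMY {μ : Measure ℝ} (h : IsCGMY b C G M Y μ) (hC : 0 ≤ C)
    (hY : Y < 2) (hG : 0 < G) (hM : 0 < M) :
    ∫ x, (x - b) ∂μ = 0 ∧
    ∫ x, (x - b) ^ 2 ∂μ = cgmyCumulantIter C G M Y 2 0 ∧
    ∫ x, (x - b) ^ 3 ∂μ = cgmyCumulantIter C G M Y 3 0 ∧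
    ∫ x, (x - b) ^ 4 ∂μ = cgmyCumulantIter C G M Y 4 0 + 3 * cgmyCumulantIter C G M Y 2 0 ^ 2 := by
  have hint := zero_mem_interior_sub_const h hC hY hG hM
  have h0 : (0 : ℝ) ∈ Ioo (-G) M := ⟨by linarith, hM⟩
  have hnh : ∀ᶠ t in 𝓝 (0 : ℝ), t ∈ Ioo (-G) M := isOpen_Ioo.mem_nhds h0
  set P := cgmyCumulant C G M Y
  set P1 := cgmyCumulantDeriv C G M Y
  set K := cgmyCumulantIter C G M Y
  have d0 : ∀ t ∈ Ioo (-G) M, HasDerivAt P (P1 t) t := fun t ht =>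
    hasDerivAt_cgmyCumulant hC hY hG hM ht
  have d1 : ∀ t ∈ Ioo (-G) M, HasDerivAt P1 (K 2 t) t := fun t ht =>
    hasDerivAt_cgmyCumulantDeriv' hC hY hG hM ht
  have dn : ∀ n, 2 ≤ n → ∀ t ∈ Ioo (-G) M, HasDerivAt (K n) (K (n + 1) t) t :=
    fun n hn t ht => hasDerivAt_cgmyCumulantIter hY ht hn
  set f1 : ℝ → ℝ := fun t => P1 t * Real.exp (P t)
  set f2 : ℝ → ℝ := fun t => (K 2 t + P1 t ^ 2) * Real.exp (P t)
  set f3 : ℝ → ℝ := fun t => (K 3 t + 3 * (P1 t * K 2 t) + P1 t ^ 3) * Real.exp (P t)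
  have e0 : mgf (fun x => x - b) μ =ᶠ[𝓝 0] fun t => Real.exp (P t) :=
    hnh.mono fun t ht => mgf_sub_const_of_isCGMY h hC hY hG hM ht
  have e1 : deriv (fun t => Real.exp (P t)) =ᶠ[𝓝 0] f1 := hnh.mono fun t ht => by
    rw [(d0 t ht).exp.deriv]; ring
  have e2 : deriv f1 =ᶠ[𝓝 0] f2 := hnh.mono fun t ht => by
    rw [((d1 t ht).fun_mul (d0 t ht).exp).deriv]; simp only [f2]; ring
  have e3 : deriv f2 =ᶠ[𝓝 0] f3 := hnh.mono fun t ht => by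
    rw [(((dn 2 le_rfl t ht).fun_add ((d1 t ht).fun_pow 2)).fun_mul (d0 t ht).exp).deriv]
    simp only [f3]; push_cast; ring
  have e4 : deriv f3 0 = K 4 0 + 3 * K 2 0 ^ 2 := by
    rw [((((dn 3 (by norm_num) 0 h0).fun_add (((d1 0 h0).fun_mul (dn 2 le_rfl 0 h0)).const_mul 3)).fun_add
      ((d1 0 h0).fun_pow 3)).fun_mul (d0 0 h0).exp).deriv]
    have : P 0 = 0 := cgmyCumulant_zero
    have : P1 0 = 0 := cgmyCumulantDeriv_zero
    simp [*]; ring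
  have hP : P 0 = 0 := cgmyCumulant_zero
  have hP1 : P1 0 = 0 := cgmyCumulantDeriv_zero
  have m1 : ∫ x, (x - b) ^ 1 ∂μ = 0 := by
    have := iteratedDeriv_mgf_zero hint 1
    rw [e0.iteratedDeriv_eq 1, iteratedDeriv_one, e1.eq_of_nhds] at this
    simp only [f1, hP1, zero_mul] at this
    exact this.symm
  have m2 := iteratedDeriv_mgf_zero hint 2
  rw [e0.iteratedDeriv_eq 2, iteratedDeriv_succ', e1.iteratedDeriv_eq 1, iteratedDeriv_one,
    e2.eq_of_nhds] at m2
  have m3 := iteratedDeriv_mgf_zero hint 3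
  rw [e0.iteratedDeriv_eq 3, iteratedDeriv_succ', e1.iteratedDeriv_eq 2, iteratedDeriv_succ',
    e2.iteratedDeriv_eq 1, iteratedDeriv_one, e3.eq_of_nhds] at m3
  have m4 := iteratedDeriv_mgf_zero hint 4
  rw [e0.iteratedDeriv_eq 4, iteratedDeriv_succ', e1.iteratedDeriv_eq 3, iteratedDeriv_succ',
    e2.iteratedDeriv_eq 2, iteratedDeriv_succ', e3.iteratedDeriv_eq 1, iteratedDeriv_one, e4] at m4
  refine ⟨by simpa using m1, ?_, ?_, ?_⟩
  · simp only [f2, hP, hP1] at m2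
    simpa using m2.symm
  · simp only [f3, hP, hP1] at m3
    simpa using m3.symm
  · exact m4.symm

/-- A finite exponential moment of order `-p` forces the left tempering parameter to be at
least `p`. -/
lemma le_of_integrable_exp_neg {μ : Measure ℝ} (h : IsCGMY b C G M Y μ) (hC : 0 < C)
    (hY : Y < 2) (hG : 0 < G) (hM : 0 < M) {p : ℝ}
    (hp : Integrable (fun x => Real.exp (-p * x)) μ) : p ≤ G := by
  by_contra hlt
  push Not at hlt
  have hPr : IsProbabilityMeasure μ := h.1
  -- If p > G, then −G is an interior point of the set of finite exponential moments. The cumulant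
  -- generating function is then analytic there, with a finite second derivative.
  have hmem : -G ∈ interior (integrableExpSet (id : ℝ → ℝ) μ) := by
    have h0 : (0 : ℝ) ∈ integrableExpSet (id : ℝ → ℝ) μ := by simp [integrableExpSet]
    have hp' : -p ∈ integrableExpSet (id : ℝ → ℝ) μ := hp
    have hsub : Icc (-p) 0 ⊆ integrableExpSet (id : ℝ → ℝ) μ :=
      convex_integrableExpSet.ordConnected.out hp' h0
    refine interior_mono hsub ?_
    rw [interior_Icc]
    exact ⟨by linarith, by linarith⟩
  have hcont := (analyticAt_cgf hmem).deriv.deriv.continuousAt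
  have heq : ∀ t ∈ Ioo (-G) M, deriv (deriv (cgf id μ)) t = cgmyCumulantIter C G M Y 2 t := by
    have h1 : ∀ t ∈ Ioo (-G) M, deriv (cgf id μ) t = b + cgmyCumulantDeriv C G M Y t := by
      intro t ht
      have : cgf id μ =ᶠ[𝓝 t] fun t => t * b + cgmyCumulant C G M Y t := by
        filter_upwards [isOpen_Ioo.mem_nhds ht] with s hs
        exact cgf_of_isCGMY h hC.le hY hG hM hs
      rw [this.deriv_eq]
      have := ((hasDerivAt_id t).mul_const b).add (hasDerivAt_cgmyCumulant hC.le hY hG hM ht)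
      rw [one_mul] at this
      exact this.deriv
    intro t ht
    have : deriv (cgf id μ) =ᶠ[𝓝 t] fun t => b + cgmyCumulantDeriv C G M Y t := by
      filter_upwards [isOpen_Ioo.mem_nhds ht] with s hs
      exact h1 s hs
    rw [this.deriv_eq]
    exact ((hasDerivAt_cgmyCumulantDeriv' hC.le hY hG hM ht).const_add b).deriv
  have hfin : Tendsto (deriv (deriv (cgf id μ))) (𝓝[>] (-G))
      (𝓝 (deriv (deriv (cgf id μ)) (-G))) := hcont.tendsto.mono_left nhdsWithin_le_nhds
  have hΓ : 0 < C * Real.Gamma (2 - Y) := mul_pos hC (Real.Gamma_pos_of_pos (by linarith))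
  -- Yet just to the right of −G the second derivative is explicit, and its term (G+t)^{Y−2}
  -- explodes because Y < 2.
  have hinf : Tendsto (fun t : ℝ => C * Real.Gamma (2 - Y) * (G + t) ^ (Y - 2)) (𝓝[>] (-G))
      atTop := by
    refine Tendsto.const_mul_atTop hΓ ?_
    refine (tendsto_rpow_neg_nhdsGT_zero (by linarith : Y - 2 < 0)).comp ?_
    refine tendsto_nhdsWithin_iff.2 ⟨?_, ?_⟩
    · have : Continuous fun t : ℝ => G + t := by fun_prop
      simpa using (this.tendsto (-G)).mono_left nhdsWithin_le_nhds
    · filter_upwards [self_mem_nhdsWithin] with t ht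
      have : -G < t := ht
      change 0 < G + t
      linarith
  have hinf' : Tendsto (deriv (deriv (cgf id μ))) (𝓝[>] (-G)) atTop := by
    refine tendsto_atTop_mono' _ ?_ hinf
    filter_upwards [Ioo_mem_nhdsGT (by linarith : -G < M)] with t ht
    rw [heq t ht, cgmyCumulantIter]
    push_cast
    refine mul_le_mul_of_nonneg_left ?_ hΓ.le
    have : 0 ≤ (M - t) ^ (Y - 2) := rpow_nonneg (by linarith [ht.2]) _
    linarith
  exact not_tendsto_nhds_of_tendsto_atTop hinf' _ hfin

/-- Lower bound for the oscillatory part of the exponent. -/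
lemma le_integral_cos_mul_cgmy (hC : 0 ≤ C) (hY : Y < 2) (hG : 0 < G) (hM : 0 < M) {z : ℂ}
    (hz : z.re ∈ Ioo (-G) M) :
    2 / π ^ 2 * Real.exp (-1) / (2 - Y) * C * z.im ^ 2 * (|z.im| + (M - z.re)) ^ (Y - 2) ≤
    ∫ x, Real.exp (z.re * x) * (1 - Real.cos (z.im * x)) * cgmyLevyDensity C G M Y x := by
  -- For 0 < x ≤ 1/q both |Im z|x ≤ 1 and (M − Re z)x ≤ 1. There the cosine lies below a parabola
  -- and the tempering costs at most a factor e^{−1}; the integral of x^{1−Y} up to 1/q produces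
  -- q^{Y−2}/(2−Y).
  set q := |z.im| + (M - z.re) with hq
  have hqpos : 0 < q := by have := abs_nonneg z.im; linarith [hz.2]
  have hint := (integrable_cos_mul_cgmy hC hY hG hM hz).1
  have hnn : ∀ x, 0 ≤ Real.exp (z.re * x) * (1 - Real.cos (z.im * x)) *
      cgmyLevyDensity C G M Y x := fun x =>
    mul_nonneg (mul_nonneg (Real.exp_pos _).le (by linarith [Real.cos_le_one (z.im * x)]))
      (cgmyLevyDensity_nonneg hC G M Y x)
  have hr : (0 : ℝ) ≤ q⁻¹ := by positivity
  have hI : IntervalIntegrable (fun x : ℝ => x ^ (1 - Y)) volume 0 q⁻¹ :=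
    intervalIntegral.intervalIntegrable_rpow' (by linarith)
  have hval : ∫ x in Ioc 0 q⁻¹, 2 / π ^ 2 * Real.exp (-1) * C * z.im ^ 2 * x ^ (1 - Y) =
      2 / π ^ 2 * Real.exp (-1) / (2 - Y) * C * z.im ^ 2 * q ^ (Y - 2) := by
    rw [integral_const_mul, ← intervalIntegral.integral_of_le hr,
      integral_rpow (Or.inl (by linarith)), zero_rpow (by linarith), inv_rpow hqpos.le,
      ← rpow_neg hqpos.le, show -(1 - Y + 1) = Y - 2 by ring, show 1 - Y + 1 = 2 - Y by ring]
    ring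
  rw [← hval]
  refine (setIntegral_mono_on ?_ hint.integrableOn measurableSet_Ioc fun x hx => ?_).trans
    (setIntegral_le_integral hint (Eventually.of_forall hnn))
  · have := (intervalIntegrable_iff_integrableOn_Ioc_of_le hr).1 hI
    exact this.const_mul _
  · have hx0 : 0 < x := hx.1
    have hxq : q * x ≤ 1 := by
      have := mul_le_mul_of_nonneg_left hx.2 hqpos.le
      rwa [mul_inv_cancel₀ hqpos.ne'] at this
    have h1 : |z.im * x| ≤ 1 := by
      rw [abs_mul, abs_of_pos hx0]
      refine le_trans (mul_le_mul_of_nonneg_right ?_ hx0.le) hxq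
      linarith [hz.2]
    have h2 : (M - z.re) * x ≤ 1 := by
      refine le_trans (mul_le_mul_of_nonneg_right ?_ hx0.le) hxq
      linarith [abs_nonneg z.im]
    have h3 := Real.cos_le_one_sub_mul_cos_sq (h1.trans (by linarith [Real.pi_gt_three]))
    rw [cgmyLevyDensity_of_pos hx0]
    have h4 : Real.exp (-1) ≤ Real.exp (z.re * x) * Real.exp (-M * x) := by
      rw [← Real.exp_add]; exact Real.exp_le_exp.2 (by linarith)
    have h5 : x ^ (1 - Y) = x ^ 2 / x ^ (1 + Y) := by
      rw [show 1 - Y = 2 - (1 + Y) by ring, rpow_sub hx0]; norm_cast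
    rw [h5]
    calc 2 / π ^ 2 * Real.exp (-1) * C * z.im ^ 2 * (x ^ 2 / x ^ (1 + Y))
        = (Real.exp (-1) * (2 / π ^ 2 * (z.im * x) ^ 2)) * (C / x ^ (1 + Y)) := by ring
      _ ≤ (Real.exp (z.re * x) * Real.exp (-M * x) * (1 - Real.cos (z.im * x))) *
          (C / x ^ (1 + Y)) := by
          refine mul_le_mul_of_nonneg_right (mul_le_mul h4 (by linarith) (by positivity)
            (by positivity)) (by positivity)
      _ = _ := by ring

end cumulants

/-! ### Moments of the normalized return -/

section laws

lemma integral_logReturnLaw {E : Type*} [NormedAddCommGroup E] [NormedSpace ℝ E] (ν : Measure ℝ)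
    {f : ℝ → E} (hf : StronglyMeasurable f) :
    ∫ x, f x ∂(logReturnLaw ν) = ∫ x, f (x + martingaleDrift ν) ∂ν :=
  integral_map (by fun_prop) hf.aestronglyMeasurable

lemma integrable_logReturnLaw {E : Type*} [NormedAddCommGroup E] (ν : Measure ℝ)
    {f : ℝ → E} (hf : StronglyMeasurable f) :
    Integrable f (logReturnLaw ν) ↔ Integrable (fun x => f (x + martingaleDrift ν)) ν :=
  integrable_map_measure hf.aestronglyMeasurable (by fun_prop)

lemma integral_normalizedLaw {E : Type*} [NormedAddCommGroup E] [NormedSpace ℝ E] (ν : Measure ℝ)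
    {f : ℝ → E} (hf : StronglyMeasurable f) :
    ∫ x, f x ∂(normalizedLaw ν) = ∫ x, f (x / sigmaZero ν) ∂(logReturnLaw ν) :=
  integral_map (by fun_prop) hf.aestronglyMeasurable

lemma integrable_normalizedLaw {E : Type*} [NormedAddCommGroup E] (ν : Measure ℝ)
    {f : ℝ → E} (hf : StronglyMeasurable f) :
    Integrable f (normalizedLaw ν) ↔ Integrable (fun x => f (x / sigmaZero ν)) (logReturnLaw ν) :=
  integrable_map_measure hf.aestronglyMeasurable (by fun_prop)

instance isProbabilityMeasure_logReturnLaw (ν : Measure ℝ) [IsProbabilityMeasure ν] :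
    IsProbabilityMeasure (logReturnLaw ν) :=
  Measure.isProbabilityMeasure_map (by fun_prop)

/-- The discounted price `e^{Z+w}` has mean one. -/
lemma integral_exp_logReturnLaw (ν : Measure ℝ) [IsProbabilityMeasure ν]
    (h : Integrable Real.exp ν) :
    Integrable Real.exp (logReturnLaw ν) ∧ ∫ x, Real.exp x ∂(logReturnLaw ν) = 1 := by
  rw [integrable_logReturnLaw ν (by fun_prop), integral_logReturnLaw ν (by fun_prop)]
  simp_rw [Real.exp_add]
  refine ⟨h.mul_const _, ?_⟩
  have hpos : 0 < ∫ x, Real.exp x ∂ν := integral_exp_pos h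
  rw [integral_mul_const, martingaleDrift, Real.exp_neg, Real.exp_log hpos,
    mul_inv_cancel₀ hpos.ne']

variable {b C G M Y : ℝ}

lemma cgmyVariance_eq : cgmyVariance C G M Y = cgmyCumulantIter C G M Y 2 0 := by
  simp [cgmyVariance, cgmyCumulantIter]

lemma cgmyVariance_pos (hC : 0 < C) (hY : Y < 2) (hG : 0 < G) (hM : 0 < M) :
    0 < cgmyVariance C G M Y := by
  have : 0 < Real.Gamma (2 - Y) := Real.Gamma_pos_of_pos (by linarith)
  unfold cgmyVariance
  positivity

lemma integrable_pow_of_isCGMY {μ : Measure ℝ} (h : IsCGMY b C G M Y μ) (hC : 0 ≤ C)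
    (hY : Y < 2) (hG : 0 < G) (hM : 0 < M) (n : ℕ) : Integrable (fun x => (x - b) ^ n) μ :=
  integrable_pow_of_mem_interior_integrableExpSet (zero_mem_interior_sub_const h hC hY hG hM) n

lemma mean_of_isCGMY {μ : Measure ℝ} (h : IsCGMY b C G M Y μ) (hC : 0 ≤ C)
    (hY : Y < 2) (hG : 0 < G) (hM : 0 < M) : ∫ x, (x + martingaleDrift μ) ∂μ =
      b + martingaleDrift μ := by
  have hP := h.1
  have h1 := (central_moments_of_isCGMY h hC hY hG hM).1
  have h2 := integrable_pow_of_isCGMY h hC hY hG hM 1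
  simp only [pow_one] at h2
  have h3 : ∫ x, (x + martingaleDrift μ) ∂μ = ∫ x, ((x - b) + (b + martingaleDrift μ)) ∂μ :=
    integral_congr_ae (Eventually.of_forall fun x => by simp only; ring)
  rw [h3, integral_add h2 (integrable_const _), h1]
  simp

lemma mean_logReturnLaw {μ : Measure ℝ} (h : IsCGMY b C G M Y μ) (hC : 0 ≤ C)
    (hY : Y < 2) (hG : 0 < G) (hM : 0 < M) : ∫ x, x ∂(logReturnLaw μ) =
      b + martingaleDrift μ := by
  rw [integral_logReturnLaw μ (f := fun x => x) (by fun_prop), mean_of_isCGMY h hC hY hG hM]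

lemma variance_logReturnLaw {μ : Measure ℝ} (h : IsCGMY b C G M Y μ) (hC : 0 ≤ C)
    (hY : Y < 2) (hG : 0 < G) (hM : 0 < M) :
    variance id (logReturnLaw μ) = cgmyVariance C G M Y := by
  have hP := h.1
  rw [variance_eq_integral (by fun_prop)]
  simp only [id_eq]
  rw [mean_logReturnLaw h hC hY hG hM, integral_logReturnLaw μ (by fun_prop), cgmyVariance_eq,
    ← (central_moments_of_isCGMY h hC hY hG hM).2.1]
  exact integral_congr_ae (Eventually.of_forall fun x => by simp only; ring)

lemma sigmaZero_eq {μ : Measure ℝ} (h : IsCGMY b C G M Y μ) (hC : 0 ≤ C)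
    (hY : Y < 2) (hG : 0 < G) (hM : 0 < M) : sigmaZero μ = √(cgmyVariance C G M Y) := by
  rw [sigmaZero, stdDev, variance_logReturnLaw h hC hY hG hM]

lemma sigmaZero_pos {μ : Measure ℝ} (h : IsCGMY b C G M Y μ) (hC : 0 < C)
    (hY : Y < 2) (hG : 0 < G) (hM : 0 < M) : 0 < sigmaZero μ := by
  rw [sigmaZero_eq h hC.le hY hG hM]
  exact Real.sqrt_pos.2 (cgmyVariance_pos hC hY hG hM)

lemma sigmaZero_sq {μ : Measure ℝ} (h : IsCGMY b C G M Y μ) (hC : 0 < C)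
    (hY : Y < 2) (hG : 0 < G) (hM : 0 < M) : sigmaZero μ ^ 2 = cgmyVariance C G M Y := by
  rw [sigmaZero_eq h hC.le hY hG hM, Real.sq_sqrt (cgmyVariance_pos hC hY hG hM).le]

lemma mean_normalizedLaw {μ : Measure ℝ} (h : IsCGMY b C G M Y μ) (hC : 0 ≤ C)
    (hY : Y < 2) (hG : 0 < G) (hM : 0 < M) : ∫ x, x ∂(normalizedLaw μ) =
      (b + martingaleDrift μ) / sigmaZero μ := by
  rw [integral_normalizedLaw μ (f := fun x => x) (by fun_prop), integral_div,
    mean_logReturnLaw h hC hY hG hM]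

lemma central_moment_normalizedLaw {μ : Measure ℝ} (h : IsCGMY b C G M Y μ) (hC : 0 ≤ C)
    (hY : Y < 2) (hG : 0 < G) (hM : 0 < M) (n : ℕ) :
    ∫ x, (x - ∫ y, y ∂(normalizedLaw μ)) ^ n ∂(normalizedLaw μ) =
      (∫ x, (x - b) ^ n ∂μ) / sigmaZero μ ^ n := by
  rw [mean_normalizedLaw h hC hY hG hM, integral_normalizedLaw μ (by fun_prop),
    integral_logReturnLaw μ (by fun_prop), ← integral_div]
  refine integral_congr_ae (Eventually.of_forall fun x => ?_)
  simp only
  rw [← sub_div, div_pow]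
  ring_nf

lemma stdDev_normalizedLaw {μ : Measure ℝ} (h : IsCGMY b C G M Y μ) (hC : 0 < C)
    (hY : Y < 2) (hG : 0 < G) (hM : 0 < M) : stdDev (normalizedLaw μ) = 1 := by
  have hP := h.1
  rw [stdDev, variance_eq_integral (by fun_prop)]
  simp only [id_eq]
  rw [central_moment_normalizedLaw h hC.le hY hG hM, (central_moments_of_isCGMY h hC.le hY hG hM).2.1,
    ← cgmyVariance_eq, sigmaZero_sq h hC hY hG hM, div_self (cgmyVariance_pos hC hY hG hM).ne',
    Real.sqrt_one]

lemma cgmySkewness_eq {μ : Measure ℝ} (h : IsCGMY b C G M Y μ) (hC : 0 < C)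
    (hY : Y < 2) (hG : 0 < G) (hM : 0 < M) :
    cgmySkewness C G M Y = cgmyCumulantIter C G M Y 3 0 / sigmaZero μ ^ 3 := by
  have hV := cgmyVariance_pos hC hY hG hM
  have : cgmyVariance C G M Y ^ (3 / 2 : ℝ) = sigmaZero μ ^ 3 := by
    rw [sigmaZero_eq h hC.le hY hG hM, Real.sqrt_eq_rpow, ← rpow_natCast, ← rpow_mul hV.le]
    norm_num
  rw [cgmySkewness, this, cgmyCumulantIter]
  norm_num
  ring

lemma cgmyKurtosis_eq {μ : Measure ℝ} (h : IsCGMY b C G M Y μ) (hC : 0 < C)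
    (hY : Y < 2) (hG : 0 < G) (hM : 0 < M) :
    cgmyKurtosis C G M Y = cgmyCumulantIter C G M Y 4 0 / sigmaZero μ ^ 4 := by
  have : cgmyVariance C G M Y ^ 2 = sigmaZero μ ^ 4 := by
    rw [← sigmaZero_sq h hC hY hG hM]; ring
  rw [cgmyKurtosis, this, cgmyCumulantIter]
  norm_num

lemma skewnessOf_normalizedLaw {μ : Measure ℝ} (h : IsCGMY b C G M Y μ) (hC : 0 < C)
    (hY : Y < 2) (hG : 0 < G) (hM : 0 < M) :
    skewnessOf (normalizedLaw μ) = cgmySkewness C G M Y := by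
  rw [skewnessOf, stdDev_normalizedLaw h hC hY hG hM, central_moment_normalizedLaw h hC.le hY hG hM,
    (central_moments_of_isCGMY h hC.le hY hG hM).2.2.1, cgmySkewness_eq h hC hY hG hM]
  simp

lemma excessKurtosisOf_normalizedLaw {μ : Measure ℝ} (h : IsCGMY b C G M Y μ) (hC : 0 < C)
    (hY : Y < 2) (hG : 0 < G) (hM : 0 < M) :
    excessKurtosisOf (normalizedLaw μ) = cgmyKurtosis C G M Y := by
  have hσ := sigmaZero_pos h hC hY hG hM
  rw [excessKurtosisOf, stdDev_normalizedLaw h hC hY hG hM,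
    central_moment_normalizedLaw h hC.le hY hG hM,
    (central_moments_of_isCGMY h hC.le hY hG hM).2.2.2, cgmyKurtosis_eq h hC hY hG hM,
    ← cgmyVariance_eq, ← sigmaZero_sq h hC hY hG hM]
  field_simp
  ring

/-- The extended characteristic function of the log return. -/
lemma complexCharFun_logReturnLaw {μ : Measure ℝ} (h : IsCGMY b C G M Y μ) (hC : 0 ≤ C)
    (hY : Y < 2) (hG : 0 < G) (hM : 0 < M) {z : ℂ} (hz : (Complex.I * z).re ∈ Ioo (-G) M) :
    complexCharFun (logReturnLaw μ) z = Complex.exp (Complex.I * z * (b + martingaleDrift μ) +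
      cgmyExponent C G M Y (Complex.I * z)) := by
  rw [complexCharFun, integral_logReturnLaw μ (by fun_prop)]
  have h1 := complexMGF_of_isCGMY h hC hY hG hM hz
  rw [complexMGF] at h1
  have h2 : ∀ x : ℝ, Complex.exp (Complex.I * z * ((x + martingaleDrift μ : ℝ) : ℂ)) =
      Complex.exp (Complex.I * z * martingaleDrift μ) *
        Complex.exp (Complex.I * z * ((id x : ℝ) : ℂ)) := by
    intro x
    rw [← Complex.exp_add]; push_cast; simp only [id_eq]; ring_nf
  simp_rw [h2]
  rw [integral_const_mul, h1, ← Complex.exp_add]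
  ring_nf

lemma complexCharFun_normalizedLaw (μ : Measure ℝ) (z : ℂ) :
    complexCharFun (normalizedLaw μ) z = complexCharFun (logReturnLaw μ) (z / sigmaZero μ) := by
  rw [complexCharFun, integral_normalizedLaw μ (by fun_prop), complexCharFun]
  refine integral_congr_ae (Eventually.of_forall fun x => ?_)
  simp only
  push_cast
  ring_nf

/-- The drift in terms of the Lévy exponent. -/
lemma add_martingaleDrift_eq {μ : Measure ℝ} (h : IsCGMY b C G M Y μ) (hC : 0 ≤ C)
    (hY : Y < 2) (hG : 0 < G) (hM : 1 < M) :
    b + martingaleDrift μ = - cgmyCumulant C G M Y 1 := by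
  have := cgf_of_isCGMY h hC hY hG (by linarith) (s := 1) ⟨by linarith, hM⟩
  rw [cgf, mgf] at this
  simp only [id_eq, one_mul] at this
  rw [martingaleDrift, this]
  ring

end laws

/-! ### Uniform bounds from the convex order -/

section convexOrder

lemma ConvexOrderLE.integral_comp_exp {ρ₁ ρ₂ : Measure ℝ}
    (h : ConvexOrderLE (ρ₁.map Real.exp) (ρ₂.map Real.exp)) {f : ℝ → ℝ}
    (hf : ConvexOn ℝ univ f) (hfc : Continuous f) (h1 : Integrable (fun x => f (Real.exp x)) ρ₁)
    (h2 : Integrable (fun x => f (Real.exp x)) ρ₂) :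
    ∫ x, f (Real.exp x) ∂ρ₁ ≤ ∫ x, f (Real.exp x) ∂ρ₂ := by
  have e : ∀ ρ : Measure ℝ, ∫ x, f x ∂(ρ.map Real.exp) = ∫ x, f (Real.exp x) ∂ρ := fun ρ =>
    integral_map (by fun_prop) hfc.aestronglyMeasurable
  have i : ∀ ρ : Measure ℝ, Integrable (fun x => f (Real.exp x)) ρ →
      Integrable f (ρ.map Real.exp) := fun ρ hρ =>
    (integrable_map_measure hfc.aestronglyMeasurable (by fun_prop)).2 hρ
  rw [← e, ← e]
  exact h f hf (i _ h1) (i _ h2)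

lemma convexOn_exp_neg_mul (l : ℝ) : ConvexOn ℝ univ fun x : ℝ => Real.exp (-(l * x)) := by
  have := convexOn_exp.comp_linearMap (LinearMap.mulLeft ℝ (-l))
  simpa [Function.comp_def] using this

lemma convexOn_max_sub (a : ℝ) : ConvexOn ℝ univ fun x : ℝ => max (x - a) 0 :=
  ((convexOn_id convex_univ).sub (concaveOn_const a convex_univ)).sup
    (convexOn_const 0 convex_univ)

lemma integrable_exp_neg_mul_exp (ρ : Measure ℝ) [IsProbabilityMeasure ρ] {l : ℝ} (hl : 0 ≤ l) :
    Integrable (fun x => Real.exp (-(l * Real.exp x))) ρ := by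
  refine Integrable.mono' (integrable_const (1 : ℝ)) (by fun_prop)
    (Eventually.of_forall fun x => ?_)
  rw [Real.norm_of_nonneg (Real.exp_pos _).le]
  exact Real.exp_le_one_iff.2 (by have := Real.exp_pos x; nlinarith)

/-- Negative exponential moments as mixtures of the convex functions `S ↦ e^{-λ S}`. -/
lemma lintegral_exp_neg_mul (ρ : Measure ℝ) [IsProbabilityMeasure ρ] {p : ℝ} (hp : 0 < p) :
    ENNReal.ofReal (Real.Gamma p) * ∫⁻ x, ENNReal.ofReal (Real.exp (-p * x)) ∂ρ =
      ∫⁻ l in Ioi (0 : ℝ), ENNReal.ofReal (l ^ (p - 1)) *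
        ENNReal.ofReal (∫ x, Real.exp (-(l * Real.exp x)) ∂ρ) := by
  -- The Gamma integral Γ(p)S^{−p} = ∫ λ^{p−1}e^{−λS} dλ at S = e^x. Working with nonnegative
  -- extended integrals, Tonelli needs no prior integrability.
  have h1 : ∀ x : ℝ, ENNReal.ofReal (Real.Gamma p) * ENNReal.ofReal (Real.exp (-p * x)) =
      ∫⁻ l in Ioi (0 : ℝ), ENNReal.ofReal (l ^ (p - 1) * Real.exp (-(l * Real.exp x))) := by
    intro x
    have h2 := integral_rpow_mul_exp_neg_mul_Ioi hp (Real.exp_pos x)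
    have h3 : IntegrableOn (fun l : ℝ => l ^ (p - 1) * Real.exp (-(l * Real.exp x))) (Ioi 0) := by
      have := integrableOn_rpow_mul_exp_neg_mul_rpow (p := 1) (s := p - 1) (b := Real.exp x)
        (by linarith) one_pos (Real.exp_pos x)
      refine this.congr_fun (fun l _ => ?_) measurableSet_Ioi
      simp only [rpow_one]
      ring_nf
    rw [← ofReal_integral_eq_lintegral_ofReal h3, ← ENNReal.ofReal_mul
      (Real.Gamma_pos_of_pos hp).le]
    · congr 1
      have h4 : ∀ l : ℝ, l ^ (p - 1) * Real.exp (-(l * Real.exp x)) =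
          l ^ (p - 1) * Real.exp (-(Real.exp x * l)) := fun l => by ring_nf
      simp_rw [h4]
      rw [h2, one_div, ← Real.exp_neg, ← Real.exp_mul]
      ring_nf
    · filter_upwards [self_mem_ae_restrict measurableSet_Ioi] with l hl
      have : (0 : ℝ) < l := hl
      simp only [Pi.zero_apply]
      positivity
  rw [← lintegral_const_mul _ (by fun_prop)]
  simp_rw [h1]
  rw [lintegral_lintegral_swap (by fun_prop)]
  refine setLIntegral_congr_fun measurableSet_Ioi fun l hl => ?_
  have hl' : (0 : ℝ) < l := hl
  rw [ofReal_integral_eq_lintegral_ofReal (integrable_exp_neg_mul_exp ρ hl'.le)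
    (Eventually.of_forall fun x => (Real.exp_pos _).le), ← lintegral_const_mul _ (by fun_prop)]
  refine lintegral_congr fun x => ?_
  rw [ENNReal.ofReal_mul (by positivity)]

/-- S ↦ S^{−p} is not a convex function on the whole line, so the order cannot be tested on it
directly. The functions e^{−λS} are convex on ℝ and bounded on the support; integrating their
comparisons over λ transfers both finiteness and size of the moment. -/
lemma ConvexOrderLE.integrable_exp_neg_mul {ρ₁ ρ₂ : Measure ℝ} [IsProbabilityMeasure ρ₁]
    [IsProbabilityMeasure ρ₂] (h : ConvexOrderLE (ρ₁.map Real.exp) (ρ₂.map Real.exp)) {p : ℝ}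
    (hp : 0 < p) (hint : Integrable (fun x => Real.exp (-p * x)) ρ₂) :
    Integrable (fun x => Real.exp (-p * x)) ρ₁ ∧
    ∫ x, Real.exp (-p * x) ∂ρ₁ ≤ ∫ x, Real.exp (-p * x) ∂ρ₂ := by
  have hle : ENNReal.ofReal (Real.Gamma p) * ∫⁻ x, ENNReal.ofReal (Real.exp (-p * x)) ∂ρ₁ ≤
      ENNReal.ofReal (Real.Gamma p) * ∫⁻ x, ENNReal.ofReal (Real.exp (-p * x)) ∂ρ₂ := by
    rw [lintegral_exp_neg_mul ρ₁ hp, lintegral_exp_neg_mul ρ₂ hp]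
    refine setLIntegral_mono' measurableSet_Ioi fun l hl => ?_
    have hl' : (0 : ℝ) < l := hl
    refine mul_le_mul_right (ENNReal.ofReal_le_ofReal ?_) _
    exact h.integral_comp_exp (convexOn_exp_neg_mul l) (by fun_prop)
      (integrable_exp_neg_mul_exp ρ₁ hl'.le) (integrable_exp_neg_mul_exp ρ₂ hl'.le)
  have hΓ : ENNReal.ofReal (Real.Gamma p) ≠ 0 := by
    simpa using Real.Gamma_pos_of_pos hp
  have hle' := (ENNReal.mul_le_mul_iff_right hΓ ENNReal.ofReal_ne_top).1 hle
  have hnn : ∀ ρ : Measure ℝ, 0 ≤ᵐ[ρ] fun x => Real.exp (-p * x) := fun ρ =>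
    Eventually.of_forall fun x => (Real.exp_pos _).le
  have hint1 : Integrable (fun x => Real.exp (-p * x)) ρ₁ := by
    refine ⟨by fun_prop, ?_⟩
    rw [hasFiniteIntegral_iff_ofReal (hnn ρ₁)]
    refine hle'.trans_lt ?_
    rw [← ofReal_integral_eq_lintegral_ofReal hint (hnn ρ₂)]
    exact ENNReal.ofReal_lt_top
  refine ⟨hint1, ?_⟩
  rw [← ofReal_integral_eq_lintegral_ofReal hint (hnn ρ₂),
    ← ofReal_integral_eq_lintegral_ofReal hint1 (hnn ρ₁)] at hle'
  exact (ENNReal.ofReal_le_ofReal_iff (integral_nonneg fun x => (Real.exp_pos _).le)).1 hle'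

/-- Uses y⁴/4! ≤ e^y with y = x on the right half line and y = −px on the left. -/
lemma pow_four_le_exp {p : ℝ} (hp : 0 < p) (x : ℝ) :
    x ^ 4 ≤ 24 * (1 + p⁻¹ ^ 4) * (Real.exp (-p * x) + Real.exp x) := by
  have key : ∀ y : ℝ, 0 ≤ y → y ^ 4 ≤ 24 * Real.exp y := by
    intro y hy
    have := Real.pow_div_factorial_le_exp y hy 4
    rw [div_le_iff₀ (by positivity)] at this
    norm_num [Nat.factorial] at this
    linarith
  have hp4 : 0 ≤ p⁻¹ ^ 4 := by positivity
  rcases le_total 0 x with hx | hx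
  · have h1 := key x hx
    have h2 := Real.exp_pos (-p * x)
    have h3 := Real.exp_pos x
    nlinarith [mul_nonneg hp4 h2.le, mul_nonneg hp4 h3.le]
  · have h1 := key (-p * x) (by nlinarith)
    have h2 := Real.exp_pos (-p * x)
    have h3 := Real.exp_pos x
    have h4 : x ^ 4 = p⁻¹ ^ 4 * (-p * x) ^ 4 := by field_simp
    rw [h4]
    nlinarith [mul_nonneg hp4 h2.le, mul_nonneg hp4 h3.le, mul_le_mul_of_nonneg_left h1 hp4]

lemma integral_pow_four_le {ρ : Measure ℝ} [IsProbabilityMeasure ρ] {p : ℝ} (hp : 0 < p)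
    (h1 : Integrable (fun x => Real.exp (-p * x)) ρ) (h2 : Integrable Real.exp ρ) :
    Integrable (fun x => x ^ 4) ρ ∧ ∫ x, x ^ 4 ∂ρ ≤
      24 * (1 + p⁻¹ ^ 4) * (∫ x, Real.exp (-p * x) ∂ρ + ∫ x, Real.exp x ∂ρ) := by
  have h3 := (h1.add h2).const_mul (24 * (1 + p⁻¹ ^ 4))
  have h4 : Integrable (fun x : ℝ => x ^ 4) ρ := by
    refine Integrable.mono' h3 (by fun_prop) (Eventually.of_forall fun x => ?_)
    rw [Real.norm_of_nonneg (by positivity)]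
    exact pow_four_le_exp hp x
  refine ⟨h4, ?_⟩
  rw [← integral_add h1 h2, ← integral_const_mul]
  exact integral_mono h4 h3 fun x => pow_four_le_exp hp x

lemma integrable_max_exp_sub {ρ : Measure ℝ} [IsProbabilityMeasure ρ] (h : Integrable Real.exp ρ)
    (a : ℝ) : Integrable (fun x => max (Real.exp x - a) 0) ρ :=
  (h.sub (integrable_const a)).pos_part

lemma tendsto_integral_max_exp_sub {ρ : Measure ℝ} [IsProbabilityMeasure ρ]
    (h : Integrable Real.exp ρ) :
    Tendsto (fun a : ℝ => ∫ x, max (Real.exp x - a) 0 ∂ρ) atTop (𝓝 0) := by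
  have key : Tendsto (fun a : ℝ => ∫ x, max (Real.exp x - a) 0 ∂ρ) atTop
      (𝓝 (∫ _, (0 : ℝ) ∂ρ)) := by
   refine tendsto_integral_filter_of_dominated_convergence Real.exp
     (Eventually.of_forall fun a => by fun_prop) ?_ h (Eventually.of_forall fun x => ?_)
   · filter_upwards [eventually_ge_atTop 0] with a ha
     refine Eventually.of_forall fun x => ?_
     rw [Real.norm_of_nonneg (le_max_right _ _)]
     exact max_le (by linarith) (Real.exp_pos x).le
   · refine tendsto_const_nhds.congr' ?_
     filter_upwards [eventually_ge_atTop (Real.exp x)] with a ha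
     rw [max_eq_right (by linarith)]
  simpa using key

/-- Non-degenerate laws that increase in the convex order have a standard deviation bounded away
from zero. -/
lemma ConvexOrderLE.exists_le_stdDev {ρ₀ ρ₂ : Measure ℝ} [IsProbabilityMeasure ρ₀]
    [IsProbabilityMeasure ρ₂] (h0 : Integrable Real.exp ρ₀) (h2 : Integrable Real.exp ρ₂)
    (hpos : 0 < ∫ x, max (Real.exp x - 1) 0 ∂ρ₀) :
    ∃ c > 0, ∀ ρ : Measure ℝ, IsProbabilityMeasure ρ → Integrable Real.exp ρ →
      ∫ x, Real.exp x ∂ρ = 1 → MemLp id 2 ρ →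
      ConvexOrderLE (ρ₀.map Real.exp) (ρ.map Real.exp) →
      ConvexOrderLE (ρ.map Real.exp) (ρ₂.map Real.exp) → c ≤ stdDev ρ := by
  -- c₀ is the at-the-money call price of the smallest law; a is a strike at which the largest law
  -- has call price below c₀/2. For a law in between, the call spread between strikes 1 and a is
  -- worth at least c₀/2, and this spread is dominated by a|x − m|.
  set c₀ := ∫ x, max (Real.exp x - 1) 0 ∂ρ₀ with hc₀
  obtain ⟨a, ha, ha1⟩ : ∃ a, ∫ x, max (Real.exp x - a) 0 ∂ρ₂ < c₀ / 2 ∧ 1 ≤ a :=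
    (((tendsto_integral_max_exp_sub h2).eventually_lt_const (by linarith : (0 : ℝ) < c₀ / 2)).and
      (eventually_ge_atTop 1)).exists
  refine ⟨c₀ / 2 / a, by positivity, fun ρ hρ hexp hone hL2 hl hu => ?_⟩
  have hint1 : Integrable (fun x : ℝ => x) ρ := hL2.integrable (by norm_num)
  set m := ∫ x, x ∂ρ with hm
  -- Jensen in elementary form: x ≤ e^x − 1, and e^x has mean one. The sign of m gives x ≤ |x − m|
  -- for x ≥ 0.
  have hm0 : m ≤ 0 := by
    have h3 : m ≤ ∫ x, (Real.exp x - 1) ∂ρ :=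
      integral_mono hint1 (hexp.sub (integrable_const _)) fun x => by
        have := Real.add_one_le_exp x; simp only; linarith
    rw [integral_sub hexp (integrable_const _), hone] at h3
    simpa using h3
  have hA : c₀ ≤ ∫ x, max (Real.exp x - 1) 0 ∂ρ :=
    hl.integral_comp_exp (convexOn_max_sub 1) (by fun_prop) (integrable_max_exp_sub h0 1)
      (integrable_max_exp_sub hexp 1)
  have hB : ∫ x, max (Real.exp x - a) 0 ∂ρ ≤ ∫ x, max (Real.exp x - a) 0 ∂ρ₂ :=
    hu.integral_comp_exp (convexOn_max_sub a) (by fun_prop) (integrable_max_exp_sub hexp a)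
      (integrable_max_exp_sub h2 a)
  have habs : Integrable (fun x => |x - m|) ρ := (hint1.sub (integrable_const m)).abs
  have hC : ∫ x, max (Real.exp x - 1) 0 ∂ρ ≤
      ∫ x, max (Real.exp x - a) 0 ∂ρ + a * ∫ x, |x - m| ∂ρ := by
    rw [← integral_const_mul, ← integral_add (integrable_max_exp_sub hexp a) (habs.const_mul a)]
    refine integral_mono (integrable_max_exp_sub hexp 1)
      ((integrable_max_exp_sub hexp a).add (habs.const_mul a)) fun x => ?_
    simp only
    rcases le_total x 0 with hx | hx
    · have : Real.exp x ≤ 1 := Real.exp_le_one_iff.2 hx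
      rw [max_eq_right (by linarith : Real.exp x - 1 ≤ 0)]
      have := le_max_right (Real.exp x - a) 0
      positivity
    · have h4 : x ≤ |x - m| := by
        have := le_abs_self (x - m); linarith
      -- If e^x ≤ a, then e^x − 1 ≤ xe^x ≤ ax; otherwise a − 1 ≤ a log a ≤ ax.
      have h5 : min (Real.exp x) a - 1 ≤ a * x := by
        rcases le_total (Real.exp x) a with h6 | h6
        · rw [min_eq_left h6]
          have h7 := Real.add_one_le_exp (-x)
          rw [Real.exp_neg] at h7
          have h8 := Real.exp_pos x
          have h9 : Real.exp x * (-x + 1) ≤ 1 := by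
            have := mul_le_mul_of_nonneg_left h7 h8.le
            rwa [mul_inv_cancel₀ h8.ne'] at this
          nlinarith
        · rw [min_eq_right h6]
          have h7 : Real.log a ≤ x := (Real.log_le_iff_le_exp (by linarith)).2 h6
          have h8 := Real.one_sub_inv_le_log_of_pos (by linarith : 0 < a)
          have h9 : a * (1 - a⁻¹) ≤ a * x := mul_le_mul_of_nonneg_left (by linarith) (by linarith)
          rwa [mul_sub, mul_one, mul_inv_cancel₀ (by linarith)] at h9
      have h10 : a * x ≤ a * |x - m| := mul_le_mul_of_nonneg_left h4 (by linarith)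
      have h11 : Real.exp x - 1 ≤ max (Real.exp x - a) 0 + (min (Real.exp x) a - 1) := by
        rcases le_total (Real.exp x) a with h6 | h6
        · rw [min_eq_left h6]; linarith [le_max_right (Real.exp x - a) 0]
        · rw [min_eq_right h6]; linarith [le_max_left (Real.exp x - a) 0]
      refine max_le (by linarith) ?_
      have := le_max_right (Real.exp x - a) 0
      positivity
  have hD : ∫ x, |x - m| ∂ρ ≤ stdDev ρ := by
    rw [stdDev]
    refine Real.le_sqrt_of_sq_le ?_
    have hL : MemLp (fun x => |x - m|) 2 ρ := (hL2.sub (memLp_const m)).abs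
    have h6 := variance_nonneg (fun x => |x - m|) ρ
    rw [variance_eq_sub hL] at h6
    rw [variance_eq_integral (by fun_prop)]
    simp only [Pi.pow_apply, sq_abs] at h6
    simpa using h6
  rw [div_le_iff₀ (by linarith), mul_comm]
  have := mul_le_mul_of_nonneg_left hD (by linarith : 0 ≤ a)
  linarith

/-- With mean one, the at-the-money call and put have the same price. If it vanished, both payoffs
would be zero almost surely, so e^x = 1 and the variance would be zero. -/
lemma integral_max_exp_sub_one_pos {ρ : Measure ℝ} [IsProbabilityMeasure ρ]
    (h : Integrable Real.exp ρ) (h1 : ∫ x, Real.exp x ∂ρ = 1) (hs : 0 < stdDev ρ) :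
    0 < ∫ x, max (Real.exp x - 1) 0 ∂ρ ∧ 0 < ∫ x, max (1 - Real.exp x) 0 ∂ρ := by
  have key : ∀ x : ℝ, max (Real.exp x - 1) 0 - max (1 - Real.exp x) 0 = Real.exp x - 1 := by
    intro x
    rcases le_total (Real.exp x) 1 with hx | hx
    · rw [max_eq_right (by linarith), max_eq_left (by linarith)]; ring
    · rw [max_eq_left (by linarith), max_eq_right (by linarith)]; ring
  have i1 := integrable_max_exp_sub h 1
  have i2 : Integrable (fun x => max (1 - Real.exp x) 0) ρ :=
    ((integrable_const 1).sub h).pos_part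
  have e : ∫ x, max (Real.exp x - 1) 0 ∂ρ = ∫ x, max (1 - Real.exp x) 0 ∂ρ := by
    rw [← sub_eq_zero, ← integral_sub i1 i2]
    simp_rw [key]
    rw [integral_sub h (integrable_const _), h1]
    simp
  have n1 : 0 ≤ ∫ x, max (Real.exp x - 1) 0 ∂ρ := integral_nonneg fun x => le_max_right _ _
  rcases n1.lt_or_eq with hp | hp
  · exact ⟨hp, e ▸ hp⟩
  exfalso
  have z1 := (integral_eq_zero_iff_of_nonneg (fun x => le_max_right _ _) i1).1 hp.symm
  have z2 := (integral_eq_zero_iff_of_nonneg (fun x => le_max_right _ _) i2).1 (e ▸ hp.symm)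
  have z : (id : ℝ → ℝ) =ᵐ[ρ] fun _ => 0 := by
    filter_upwards [z1, z2] with x hx1 hx2
    have := key x
    simp only [Pi.zero_apply] at hx1 hx2
    rw [hx1, hx2] at this
    have h3 : Real.exp x = 1 := by linarith
    simpa using h3
  have : variance id ρ = 0 := by
    rw [variance_congr z]
    exact variance_zero ρ
  rw [stdDev, this, Real.sqrt_zero] at hs
  exact hs.false

end convexOrder

/-! ### Fourier representation of put prices -/

section pricing

lemma le_norm_sub_I_mul (v u : ℝ) : v ≤ ‖(v : ℂ) - Complex.I * u‖ := by
  have := Complex.re_le_norm ((v : ℂ) - Complex.I * u)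
  simpa using this

lemma sub_I_mul_ne_zero {v : ℝ} (hv : 0 < v) (u : ℝ) : (v : ℂ) - Complex.I * u ≠ 0 :=
  norm_pos_iff.1 (hv.trans_le (le_norm_sub_I_mul v u))

lemma norm_sub_I_mul_sq (v u : ℝ) : ‖(v : ℂ) - Complex.I * u‖ ^ 2 = v ^ 2 + u ^ 2 := by
  rw [← Complex.normSq_eq_norm_sq, Complex.normSq_apply]
  simp
  ring

lemma norm_sub_I_mul_le {v : ℝ} (hv : 0 < v) (u : ℝ) :
    ‖(v : ℂ) - Complex.I * u‖ ≤ ‖((v + 1 : ℝ) : ℂ) - Complex.I * u‖ := by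
  rw [← sq_le_sq₀ (norm_nonneg _) (norm_nonneg _), norm_sub_I_mul_sq, norm_sub_I_mul_sq]
  nlinarith

lemma continuous_inv_sub_I_mul {v : ℝ} (hv : 0 < v) :
    Continuous fun u : ℝ => ((v : ℂ) - Complex.I * u)⁻¹ :=
  Continuous.inv₀ (by fun_prop) fun u => sub_I_mul_ne_zero hv u

lemma norm_inv_sub_I_mul_le {v : ℝ} (hv : 0 < v) (u : ℝ) :
    ‖((v : ℂ) - Complex.I * u)⁻¹‖ ≤ v⁻¹ := by
  rw [norm_inv]
  exact inv_anti₀ hv (le_norm_sub_I_mul v u)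

lemma integrable_inv_mul_inv {v : ℝ} (hv : 0 < v) :
    Integrable fun u : ℝ => ((v : ℂ) - Complex.I * u)⁻¹ *
      (((v + 1 : ℝ) : ℂ) - Complex.I * u)⁻¹ := by
  refine Integrable.mono' (integrable_inv_one_add_sq.const_mul (1 + (v ^ 2)⁻¹))
    ((continuous_inv_sub_I_mul hv).mul
      (continuous_inv_sub_I_mul (by linarith))).aestronglyMeasurable
    (Eventually.of_forall fun u => ?_)
  have h0 : 0 < ‖(v : ℂ) - Complex.I * u‖ := norm_pos_iff.2 (sub_I_mul_ne_zero hv u)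
  rw [norm_mul, norm_inv, norm_inv, ← mul_inv]
  have h1 : v ^ 2 + u ^ 2 ≤ ‖(v : ℂ) - Complex.I * u‖ * ‖((v + 1 : ℝ) : ℂ) - Complex.I * u‖ := by
    rw [← norm_sub_I_mul_sq, sq]
    exact mul_le_mul_of_nonneg_left (norm_sub_I_mul_le hv u) h0.le
  refine (inv_anti₀ (by positivity) h1).trans ?_
  rw [← div_eq_mul_inv, inv_le_comm₀ (by positivity) (by positivity), inv_div,
    div_le_iff₀ (by positivity)]
  have h2 : (v ^ 2 + u ^ 2) * (1 + (v ^ 2)⁻¹) = v ^ 2 + u ^ 2 + 1 + u ^ 2 * (v ^ 2)⁻¹ := by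
    field_simp
    ring
  rw [h2]
  have : 0 ≤ u ^ 2 * (v ^ 2)⁻¹ := by positivity
  nlinarith [sq_nonneg v]

open scoped FourierTransform in
/-- Fourier representation of the put payoff. -/
lemma put_payoff_eq_integral {v : ℝ} (hv : 0 < v) (x : ℝ) :
    ((max (1 - Real.exp x) 0 : ℝ) : ℂ) = (2 * π : ℂ)⁻¹ * ∫ u : ℝ,
      Complex.exp (-(((v : ℂ) - Complex.I * u) * x)) * (((v : ℂ) - Complex.I * u)⁻¹ *
      (((v + 1 : ℝ) : ℂ) - Complex.I * u)⁻¹) := by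
  -- The payoff tends to 1 at −∞; the damping e^{vx} makes it integrable. The transform of the
  -- damped payoff is a product of two simple kernels, hence integrable, and Fourier inversion
  -- applies.
  set g : ℝ → ℂ := fun x => ((max (1 - Real.exp x) 0 * Real.exp (v * x) : ℝ) : ℂ) with hg
  set H : ℝ → ℂ := fun u => ((v : ℂ) - Complex.I * u)⁻¹ *
      (((v + 1 : ℝ) : ℂ) - Complex.I * u)⁻¹ with hH
  have hgc : Continuous g := by fun_prop
  have hind : ∀ a : ℂ, (fun x : ℝ => Complex.exp (a * x) * g x) = indicator (Iic 0)
      fun x : ℝ => Complex.exp ((v + a) * x) - Complex.exp ((v + a + 1) * x) := by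
    intro a
    ext x
    by_cases hx : x ≤ 0
    · rw [indicator_of_mem (by exact hx)]
      simp only [hg]
      rw [max_eq_left (by linarith [Real.exp_le_one_iff.2 hx])]
      push_cast
      rw [show ((v : ℂ) + a + 1) * x = a * x + v * x + x by ring,
        show ((v : ℂ) + a) * x = a * x + v * x by ring, Complex.exp_add (a * x + v * x),
        Complex.exp_add (a * x)]
      ring
    · rw [indicator_of_notMem (by simpa using hx)]
      have : 1 < Real.exp x := Real.one_lt_exp_iff.2 (not_le.1 hx)
      simp only [hg]
      rw [max_eq_right (by linarith)]
      simp
  have hint : ∀ a : ℂ, 0 ≤ a.re → Integrable (fun x : ℝ => Complex.exp (a * x) * g x) ∧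
      ∫ x : ℝ, Complex.exp (a * x) * g x = (v + a)⁻¹ - (v + a + 1)⁻¹ := by
    intro a ha
    have h1 : 0 < ((v : ℂ) + a).re := by simp; linarith
    have h2 : 0 < ((v : ℂ) + a + 1).re := by simp; linarith
    have i1 := integrableOn_exp_mul_complex_Iic h1 0
    have i2 := integrableOn_exp_mul_complex_Iic h2 0
    rw [hind a]
    refine ⟨(i1.sub i2).integrable_indicator measurableSet_Iic, ?_⟩
    rw [integral_indicator measurableSet_Iic, integral_sub i1 i2,
      integral_exp_mul_complex_Iic h1, integral_exp_mul_complex_Iic h2]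
    simp
  have hgi : Integrable g := by simpa using (hint 0 (by simp)).1
  have hF : 𝓕 g = fun w : ℝ => H (2 * π * w) := by
    ext w
    rw [Real.fourier_real_eq_integral_exp_smul]
    have e1 : ∀ x : ℝ, Complex.exp (((-2 * π * x * w : ℝ) : ℂ) * Complex.I) • g x =
        Complex.exp ((-(Complex.I * ((2 * π * w : ℝ) : ℂ))) * x) * g x := by
      intro x
      rw [smul_eq_mul]
      congr 2
      push_cast
      ring
    simp_rw [e1]
    rw [(hint _ (by simp)).2]
    have n1 := sub_I_mul_ne_zero hv (2 * π * w)
    have n2 := sub_I_mul_ne_zero (by linarith : 0 < v + 1) (2 * π * w)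
    simp only [hH]
    rw [← sub_eq_add_neg, show (v : ℂ) - Complex.I * ((2 * π * w : ℝ) : ℂ) + 1 =
      ((v + 1 : ℝ) : ℂ) - Complex.I * ((2 * π * w : ℝ) : ℂ) by push_cast; ring,
      inv_sub_inv n1 n2, ← mul_inv, div_eq_mul_inv]
    push_cast
    ring
  have hHi : Integrable H := integrable_inv_mul_inv hv
  have hFi : Integrable (𝓕 g) := by
    rw [hF]
    exact hHi.comp_mul_left' (by positivity)
  have hinv := congrFun (hgc.fourierInv_fourier_eq hgi hFi) x
  rw [hF, Real.fourierInv_eq'] at hinv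
  have e2 : ∀ w : ℝ, Complex.exp (((2 * π * inner ℝ w x : ℝ) : ℂ) * Complex.I) • H (2 * π * w) =
      (fun u : ℝ => Complex.exp (Complex.I * u * x) * H u) (2 * π * w) := by
    intro w
    simp only [smul_eq_mul, RCLike.inner_apply, conj_trivial]
    congr 2
    push_cast
    ring
  simp_rw [e2] at hinv
  rw [Measure.integral_comp_mul_left (fun u : ℝ => Complex.exp (Complex.I * u * x) * H u) (2 * π),
    abs_of_pos (by positivity)] at hinv
  have e3 : ∀ u : ℝ, Complex.exp (-(((v : ℂ) - Complex.I * u) * x)) * H u =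
      Complex.exp (-(v * x)) * (Complex.exp (Complex.I * u * x) * H u) := by
    intro u
    rw [← mul_assoc (Complex.exp (-(v * x : ℂ))), ← Complex.exp_add]
    congr 2
    ring
  change _ = (2 * π : ℂ)⁻¹ * ∫ u : ℝ, Complex.exp (-(((v : ℂ) - Complex.I * u) * x)) * H u
  simp_rw [e3]
  rw [integral_const_mul]
  have e4 : ((max (1 - Real.exp x) 0 : ℝ) : ℂ) = Complex.exp (-(v * x)) * g x := by
    simp only [hg]
    push_cast
    rw [mul_left_comm, ← Complex.exp_add]
    simp
  rw [e4, ← hinv, Complex.real_smul]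
  push_cast
  ring

/-- The general transform `k ↦ (2π)⁻¹ ∫ e^{k(1+v-iu)} h(u) du`. -/
noncomputable def expTransform (v : ℝ) (h : ℝ → ℂ) (k : ℝ) : ℂ :=
  (2 * π : ℂ)⁻¹ * ∫ u : ℝ, Complex.exp (k * (((v + 1 : ℝ) : ℂ) - Complex.I * u)) * h u

lemma norm_exp_mul_sub_I_mul (k v u : ℝ) :
    ‖Complex.exp (k * (((v + 1 : ℝ) : ℂ) - Complex.I * u))‖ = Real.exp (k * (v + 1)) := by
  rw [Complex.norm_exp]
  simp

lemma integrable_expTransform (v : ℝ) {h : ℝ → ℂ} (hh : Integrable h) (k : ℝ) :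
    Integrable fun u : ℝ => Complex.exp (k * (((v + 1 : ℝ) : ℂ) - Complex.I * u)) * h u := by
  refine Integrable.mono' (hh.norm.const_mul (Real.exp (k * (v + 1)))) ?_
    (Eventually.of_forall fun u => ?_)
  · exact (Continuous.aestronglyMeasurable (by fun_prop)).mul hh.aestronglyMeasurable
  · rw [norm_mul, norm_exp_mul_sub_I_mul]

lemma continuous_expTransform (v : ℝ) {h : ℝ → ℂ} (hh : Integrable h) :
    Continuous (expTransform v h) := by
  refine continuous_const.mul (continuous_iff_continuousAt.2 fun k₀ => ?_)
  refine continuousAt_of_dominated (bound := fun u => Real.exp ((|k₀| + 1) * |v + 1|) * ‖h u‖)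
    (Eventually.of_forall fun k => (integrable_expTransform v hh k).aestronglyMeasurable) ?_
    (hh.norm.const_mul _) (Eventually.of_forall fun u => ?_)
  · filter_upwards [Metric.ball_mem_nhds k₀ one_pos] with k hk
    refine Eventually.of_forall fun u => ?_
    rw [norm_mul, norm_exp_mul_sub_I_mul]
    refine mul_le_mul_of_nonneg_right (Real.exp_le_exp.2 ?_) (norm_nonneg _)
    have h1 : |k| ≤ |k₀| + 1 := by
      rw [Metric.mem_ball, Real.dist_eq] at hk
      linarith [abs_sub_abs_le_abs_sub k k₀]
    calc k * (v + 1) ≤ |k * (v + 1)| := le_abs_self _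
      _ = |k| * |v + 1| := abs_mul _ _
      _ ≤ _ := by gcongr
  · fun_prop

/-- Each derivative in k multiplies the integrand by v+1−iu, cancelling the kernel (v+1−iu)⁻¹ of the
put at the first step. -/
lemma hasDerivAt_expTransform (v : ℝ) {h : ℝ → ℂ} (hh : Integrable h)
    (hh' : Integrable fun u : ℝ => (((v + 1 : ℝ) : ℂ) - Complex.I * u) * h u) (k₀ : ℝ) :
    HasDerivAt (expTransform v h)
      (expTransform v (fun u : ℝ => (((v + 1 : ℝ) : ℂ) - Complex.I * u) * h u) k₀) k₀ := by
  refine HasDerivAt.const_mul _ ?_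
  refine (hasDerivAt_integral_of_dominated_loc_of_deriv_le (μ := volume)
    (F := fun (k : ℝ) (u : ℝ) => Complex.exp (k * (((v + 1 : ℝ) : ℂ) - Complex.I * u)) * h u)
    (F' := fun (k : ℝ) (u : ℝ) => Complex.exp (k * (((v + 1 : ℝ) : ℂ) - Complex.I * u)) *
      ((((v + 1 : ℝ) : ℂ) - Complex.I * u) * h u))
    (bound := fun u => Real.exp ((|k₀| + 1) * |v + 1|) *
      ‖(((v + 1 : ℝ) : ℂ) - Complex.I * u) * h u‖)
    (Metric.ball_mem_nhds k₀ one_pos)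
    (Eventually.of_forall fun k => (integrable_expTransform v hh k).aestronglyMeasurable)
    (integrable_expTransform v hh k₀)
    (integrable_expTransform v hh' k₀).aestronglyMeasurable
    (Eventually.of_forall fun u k hk => ?_) (hh'.norm.const_mul _)
    (Eventually.of_forall fun u k hk => ?_)).2
  · rw [norm_mul, norm_exp_mul_sub_I_mul]
    refine mul_le_mul_of_nonneg_right (Real.exp_le_exp.2 ?_) (norm_nonneg _)
    have h1 : |k| ≤ |k₀| + 1 := by
      rw [Metric.mem_ball, Real.dist_eq] at hk
      linarith [abs_sub_abs_le_abs_sub k k₀]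
    calc k * (v + 1) ≤ |k * (v + 1)| := le_abs_self _
      _ = |k| * |v + 1| := abs_mul _ _
      _ ≤ _ := by gcongr
  · have h3 : HasDerivAt (fun k : ℝ => (k : ℂ) * (((v + 1 : ℝ) : ℂ) - Complex.I * u))
        (((v + 1 : ℝ) : ℂ) - Complex.I * u) k := by
      simpa using (Complex.ofRealCLM.hasDerivAt (x := k)).mul_const
        (((v + 1 : ℝ) : ℂ) - Complex.I * u)
    exact (h3.cexp.mul_const (h u)).congr_deriv (by ring)

/-- The put price as a function of log-moneyness, normalized by the discounted spot. -/
noncomputable def unitPut (ρ : Measure ℝ) (k : ℝ) : ℝ :=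
  ∫ x, max (Real.exp k - Real.exp x) 0 ∂ρ

lemma complexCharFun_vertical (ρ : Measure ℝ) (u v : ℝ) :
    complexCharFun ρ (u + Complex.I * v) =
      ∫ x : ℝ, Complex.exp (-(((v : ℂ) - Complex.I * u) * x)) ∂ρ := by
  rw [complexCharFun]
  refine integral_congr_ae (Eventually.of_forall fun x => ?_)
  simp only
  congr 1
  linear_combination ((v : ℂ) * x) * Complex.I_mul_I

/-- The payoff is e^k(1 − e^{x−k})⁺. Inserting its Fourier form, Fubini is licensed by the quadratic
decay of the kernel and the finite moment of order −v. -/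
lemma unitPut_eq_expTransform {ρ : Measure ℝ} [IsProbabilityMeasure ρ] {v : ℝ} (hv : 0 < v)
    (hint : Integrable (fun x => Real.exp (-v * x)) ρ) (k : ℝ) :
    (unitPut ρ k : ℂ) = expTransform v (fun u : ℝ => ((v : ℂ) - Complex.I * u)⁻¹ *
      (((v + 1 : ℝ) : ℂ) - Complex.I * u)⁻¹ * complexCharFun ρ (u + Complex.I * v)) k := by
  have hH := integrable_inv_mul_inv hv
  have e1 : ∀ x : ℝ, ((max (Real.exp k - Real.exp x) 0 : ℝ) : ℂ) = (2 * π : ℂ)⁻¹ * ∫ u : ℝ,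
      (Complex.exp (k * (((v + 1 : ℝ) : ℂ) - Complex.I * u)) * (((v : ℂ) - Complex.I * u)⁻¹ *
      (((v + 1 : ℝ) : ℂ) - Complex.I * u)⁻¹)) *
        Complex.exp (-(((v : ℂ) - Complex.I * u) * x)) := by
    intro x
    have h1 : max (Real.exp k - Real.exp x) 0 = Real.exp k * max (1 - Real.exp (x - k)) 0 := by
      rw [mul_max_of_nonneg _ _ (Real.exp_pos k).le, mul_sub, ← Real.exp_add]
      simp
    rw [h1, Complex.ofReal_mul, put_payoff_eq_integral hv, mul_left_comm, ← integral_const_mul]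
    congr 2
    ext u
    push_cast
    rw [← mul_assoc, ← Complex.exp_add, mul_right_comm, ← Complex.exp_add]
    congr 2
    ring
  have e2 : (unitPut ρ k : ℂ) = ∫ x, ((max (Real.exp k - Real.exp x) 0 : ℝ) : ℂ) ∂ρ :=
    integral_complex_ofReal.symm
  rw [e2]
  simp_rw [e1]
  rw [integral_const_mul, expTransform]
  congr 1
  rw [integral_integral_swap]
  · congr 1
    ext u
    rw [integral_const_mul, complexCharFun_vertical]
    ring
  · refine Integrable.mono (g := fun p : ℝ × ℝ => (Real.exp (-v * p.1) : ℝ) •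
      (Complex.exp (k * (((v + 1 : ℝ) : ℂ) - Complex.I * p.2)) * (((v : ℂ) - Complex.I * p.2)⁻¹ *
      (((v + 1 : ℝ) : ℂ) - Complex.I * p.2)⁻¹))) ?_ ?_ (Eventually.of_forall fun p => ?_)
    · exact hint.smul_prod (integrable_expTransform v hH k)
    · have c1 := (continuous_inv_sub_I_mul hv).comp (continuous_snd (X := ℝ) (Y := ℝ))
      have c2 := (continuous_inv_sub_I_mul (by linarith : 0 < v + 1)).comp
        (continuous_snd (X := ℝ) (Y := ℝ))
      refine Continuous.aestronglyMeasurable ?_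
      refine Continuous.mul (Continuous.mul (by fun_prop) (c1.mul c2)) (by fun_prop)
    · change ‖_ * Complex.exp (-(((v : ℂ) - Complex.I * p.2) * p.1))‖ ≤ _
      rw [norm_mul, norm_smul, mul_comm]
      refine le_of_eq ?_
      congr 1
      rw [Complex.norm_exp, Real.norm_of_nonneg (Real.exp_pos _).le]
      simp

/-- Put prices are twice continuously differentiable when the extended characteristic function is
integrable; the derivatives at the money are Fourier integrals. -/
theorem unitPut_derivatives {ρ : Measure ℝ} [IsProbabilityMeasure ρ] {v : ℝ} (hv : 0 < v)
    (hint : Integrable (fun x => Real.exp (-v * x)) ρ)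
    (hφ : Integrable fun u : ℝ => complexCharFun ρ (u + Complex.I * v)) :
    ∃ p₁ p₂ : ℝ → ℝ, (∀ k, HasDerivAt (unitPut ρ) (p₁ k) k) ∧ (∀ k, HasDerivAt p₁ (p₂ k) k) ∧
      Continuous p₂ ∧
      (unitPut ρ 0 : ℂ) = (2 * π : ℂ)⁻¹ * ∫ u : ℝ, ((v : ℂ) - Complex.I * u)⁻¹ *
        (((v + 1 : ℝ) : ℂ) - Complex.I * u)⁻¹ * complexCharFun ρ (u + Complex.I * v) ∧
      p₁ 0 = ((2 * π : ℂ)⁻¹ * ∫ u : ℝ, ((v : ℂ) - Complex.I * u)⁻¹ *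
        complexCharFun ρ (u + Complex.I * v)).re ∧
      p₂ 0 - p₁ 0 = ((2 * π : ℂ)⁻¹ * ∫ u : ℝ, complexCharFun ρ (u + Complex.I * v)).re := by
  set φ : ℝ → ℂ := fun u => complexCharFun ρ (u + Complex.I * v) with hφdef
  set d : ℝ → ℂ := fun u => (v : ℂ) - Complex.I * u
  set e : ℝ → ℂ := fun u => ((v + 1 : ℝ) : ℂ) - Complex.I * u
  have hd : ∀ u, d u ≠ 0 := fun u => sub_I_mul_ne_zero hv u
  have he : ∀ u, e u ≠ 0 := fun u => sub_I_mul_ne_zero (by linarith : 0 < v + 1) u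
  have hde : ∀ u, e u = d u + 1 := fun u => by simp only [d, e]; push_cast; ring
  have i1 : Integrable fun u => (d u)⁻¹ * φ u :=
    hφ.bdd_mul (continuous_inv_sub_I_mul hv).aestronglyMeasurable
      (Eventually.of_forall fun u => norm_inv_sub_I_mul_le hv u)
  have i0 : Integrable fun u => (d u)⁻¹ * (e u)⁻¹ * φ u := by
    have := i1.bdd_mul (continuous_inv_sub_I_mul (by linarith : 0 < v + 1)).aestronglyMeasurable
      (Eventually.of_forall fun u => norm_inv_sub_I_mul_le (by linarith : 0 < v + 1) u)
    refine this.congr (Eventually.of_forall fun u => ?_)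
    simp only [d, e]
    ring
  have e01 : (fun u => e u * ((d u)⁻¹ * (e u)⁻¹ * φ u)) = fun u => (d u)⁻¹ * φ u := by
    ext u
    have := he u
    field_simp
  -- Since (v+1−iu)/(v−iu) = 1 + 1/(v−iu), the second derivative minus the first is the integral of
  -- φ with no kernel.
  have e12 : (fun u => e u * ((d u)⁻¹ * φ u)) = fun u => φ u + (d u)⁻¹ * φ u := by
    ext u
    have := hd u
    rw [hde]
    field_simp
  have i2 : Integrable fun u => e u * ((d u)⁻¹ * φ u) := by rw [e12]; exact hφ.add i1
  have h0 : ∀ k, HasDerivAt (fun k => (unitPut ρ k : ℂ))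
      (expTransform v (fun u => (d u)⁻¹ * φ u) k) k := by
    intro k
    have := hasDerivAt_expTransform v i0 (by rw [e01]; exact i1) k
    rw [e01] at this
    refine this.congr_of_eventuallyEq (Eventually.of_forall fun k => ?_)
    exact unitPut_eq_expTransform hv hint k
  have h1 : ∀ k, HasDerivAt (expTransform v (fun u => (d u)⁻¹ * φ u))
      (expTransform v (fun u => e u * ((d u)⁻¹ * φ u)) k) k := fun k =>
    hasDerivAt_expTransform v i1 i2 k
  refine ⟨fun k => (expTransform v (fun u => (d u)⁻¹ * φ u) k).re,
    fun k => (expTransform v (fun u => e u * ((d u)⁻¹ * φ u)) k).re, fun k => ?_, fun k => ?_,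
    Complex.continuous_re.comp (continuous_expTransform v i2), ?_, ?_, ?_⟩
  · have := Complex.reCLM.hasFDerivAt.comp_hasDerivAt k (h0 k)
    simpa [Function.comp_def] using this
  · have := Complex.reCLM.hasFDerivAt.comp_hasDerivAt k (h1 k)
    simpa [Function.comp_def] using this
  · rw [unitPut_eq_expTransform hv hint 0, expTransform]
    simp only [Complex.ofReal_zero, zero_mul, Complex.exp_zero, one_mul]
  · simp only [expTransform, Complex.ofReal_zero, zero_mul, Complex.exp_zero, one_mul]
    rfl
  · rw [e12]
    simp only [expTransform, Complex.ofReal_zero, zero_mul, Complex.exp_zero, one_mul]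
    rw [integral_add hφ i1, mul_add, Complex.add_re]
    ring

end pricing

/-! ### The Black–Scholes price and implied volatility -/

section blackScholes

/-- The standard normal density. -/
noncomputable def stdNormalPDF (x : ℝ) : ℝ := (√(2 * π))⁻¹ * Real.exp (-x ^ 2 / 2)

lemma stdNormalPDF_eq (x : ℝ) : gaussianPDFReal 0 1 x = stdNormalPDF x := by
  simp [gaussianPDFReal, stdNormalPDF]

lemma stdNormalPDF_pos (x : ℝ) : 0 < stdNormalPDF x := by unfold stdNormalPDF; positivity

lemma contDiff_stdNormalPDF {n : WithTop ℕ∞} : ContDiff ℝ n stdNormalPDF := by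
  unfold stdNormalPDF; fun_prop

lemma hasDerivAt_stdNormalPDF (x : ℝ) : HasDerivAt stdNormalPDF (-(x * stdNormalPDF x)) x := by
  have h : HasDerivAt (fun x : ℝ => -x ^ 2 / 2) (-x) x :=
    ((hasDerivAt_pow 2 x).neg.div_const 2).congr_deriv (by norm_num; ring)
  exact (h.exp.const_mul _).congr_deriv (by unfold stdNormalPDF; ring)

lemma stdNormalPDF_le (x : ℝ) : stdNormalPDF x ≤ stdNormalPDF 0 := by
  unfold stdNormalPDF
  exact mul_le_mul_of_nonneg_left (Real.exp_le_exp.2 (by nlinarith [sq_nonneg x]))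
    (by positivity)

lemma stdNormalPDF_anti {x y : ℝ} (h0 : 0 ≤ x) (h : x ≤ y) : stdNormalPDF y ≤ stdNormalPDF x := by
  unfold stdNormalPDF
  gcongr

lemma stdNormalPDF_zero_sub_le (x : ℝ) : |stdNormalPDF x - stdNormalPDF 0| ≤
    stdNormalPDF 0 * x ^ 2 := by
  rw [abs_sub_comm, abs_of_nonneg (by linarith [stdNormalPDF_le x])]
  have h1 : stdNormalPDF x = stdNormalPDF 0 * Real.exp (-x ^ 2 / 2) := by simp [stdNormalPDF]
  have h2 := Real.add_one_le_exp (-x ^ 2 / 2)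
  have h3 := stdNormalPDF_pos 0
  rw [h1]
  nlinarith [sq_nonneg x, mul_le_mul_of_nonneg_left h2 h3.le, mul_nonneg h3.le (sq_nonneg x)]

lemma stdNormalCDF_eq_real (x : ℝ) : stdNormalCDF x = (gaussianReal 0 1).real (Iic x) :=
  cdf_eq_real _ x

lemma integrable_stdNormalPDF : Integrable stdNormalPDF := by
  have := integrable_gaussianPDFReal 0 1
  rwa [show gaussianPDFReal 0 1 = stdNormalPDF from funext stdNormalPDF_eq] at this

lemma stdNormalCDF_eq_integral (x : ℝ) : stdNormalCDF x = ∫ t in Iic x, stdNormalPDF t := by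
  rw [stdNormalCDF_eq_real, measureReal_def, gaussianReal_apply_eq_integral 0 one_ne_zero,
    ENNReal.toReal_ofReal]
  · simp_rw [stdNormalPDF_eq]
  · exact integral_nonneg fun x => gaussianPDFReal_nonneg _ _ _

lemma hasDerivAt_stdNormalCDF (x : ℝ) : HasDerivAt stdNormalCDF (stdNormalPDF x) x := by
  have h1 : stdNormalCDF = fun x => stdNormalCDF 0 + ∫ t in (0 : ℝ)..x, stdNormalPDF t := by
    ext x
    rw [stdNormalCDF_eq_integral, stdNormalCDF_eq_integral,
      ← intervalIntegral.integral_Iic_sub_Iic integrable_stdNormalPDF.integrableOn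
        integrable_stdNormalPDF.integrableOn]
    ring
  have h2 : Continuous stdNormalPDF := (contDiff_stdNormalPDF (n := 0)).continuous
  rw [h1]
  exact (h2.integral_hasStrictDerivAt 0 x).hasDerivAt.const_add _

lemma contDiff_stdNormalCDF : ContDiff ℝ 2 stdNormalCDF := by
  rw [show (2 : WithTop ℕ∞) = 1 + 1 from rfl, contDiff_succ_iff_deriv]
  refine ⟨fun x => (hasDerivAt_stdNormalCDF x).differentiableAt, by simp, ?_⟩
  rw [show deriv stdNormalCDF = stdNormalPDF from funext fun x => (hasDerivAt_stdNormalCDF x).deriv]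
  exact contDiff_stdNormalPDF

lemma stdNormalCDF_neg (x : ℝ) : stdNormalCDF (-x) = 1 - stdNormalCDF x := by
  have h1 : gaussianReal 0 1 (Iic (-x)) = gaussianReal 0 1 (Ici x) := by
    have := gaussianReal_map_neg (μ := 0) (v := 1)
    rw [neg_zero] at this
    conv_lhs => rw [← this]
    rw [Measure.map_apply (by fun_prop) measurableSet_Iic]
    congr 1
    ext y
    simp
  rw [stdNormalCDF_eq_real, stdNormalCDF_eq_real, measureReal_def, h1, ← measureReal_def,
    ← compl_Iio, probReal_compl_eq_one_sub measurableSet_Iio]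
  have : NullSingletonClass (gaussianReal 0 1) := nullSingletonClass_gaussianReal one_ne_zero
  rw [measureReal_congr (Iio_ae_eq_Iic (μ := gaussianReal 0 1) (a := x))]

/-- The Black–Scholes put price with unit discounted spot, as a function of log-moneyness and
total volatility. -/
noncomputable def unitBlackScholes (k s : ℝ) : ℝ :=
  Real.exp k * stdNormalCDF (k / s + s / 2) - stdNormalCDF (k / s - s / 2)

/-- The identity behind vega: it merges the two density terms when the Black–Scholes formula is
differentiated, so only the derivative of the volatility survives next to them. -/
lemma exp_mul_stdNormalPDF (k : ℝ) {s : ℝ} (hs : s ≠ 0) :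
    Real.exp k * stdNormalPDF (k / s + s / 2) = stdNormalPDF (k / s - s / 2) := by
  unfold stdNormalPDF
  rw [mul_left_comm, ← Real.exp_add]
  congr 2
  field_simp
  ring

lemma unitBlackScholes_zero (s : ℝ) : unitBlackScholes 0 s = 2 * stdNormalCDF (s / 2) - 1 := by
  simp only [unitBlackScholes, Real.exp_zero, zero_div, zero_add, zero_sub, one_mul,
    stdNormalCDF_neg]
  ring

lemma contDiffAt_unitBlackScholes (k : ℝ) {s : ℝ} (hs : s ≠ 0) :
    ContDiffAt ℝ 2 (fun p : ℝ × ℝ => unitBlackScholes p.1 p.2) (k, s) := by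
  unfold unitBlackScholes
  have h1 : ContDiffAt ℝ 2 (fun p : ℝ × ℝ => p.1 / p.2) (k, s) :=
    contDiffAt_fst.div contDiffAt_snd hs
  have h2 : ContDiffAt ℝ 2 (fun p : ℝ × ℝ => p.2 / 2) (k, s) := contDiffAt_snd.div_const 2
  exact ((contDiff_exp.contDiffAt.comp _ contDiffAt_fst).mul
    (contDiff_stdNormalCDF.contDiffAt.comp _ (h1.add h2))).sub
    (contDiff_stdNormalCDF.contDiffAt.comp _ (h1.sub h2))

/-- The chain rule for the Black–Scholes price along a curve of total volatilities. -/
lemma hasDerivAt_unitBlackScholes_comp {f g : ℝ → ℝ} {f' g' x : ℝ} (hf : HasDerivAt f f' x)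
    (hg : HasDerivAt g g' x) (hx : g x ≠ 0) :
    HasDerivAt (fun x => unitBlackScholes (f x) (g x))
      (Real.exp (f x) * stdNormalCDF (f x / g x + g x / 2) * f' +
        Real.exp (f x) * stdNormalPDF (f x / g x + g x / 2) * g') x := by
  have h1 := hf.div hg hx
  have h2 := hg.div_const 2
  have h3 := (hasDerivAt_stdNormalCDF (f x / g x + g x / 2)).comp x (h1.add h2)
  have h4 := (hasDerivAt_stdNormalCDF (f x / g x - g x / 2)).comp x (h1.sub h2)
  refine ((hf.exp.mul h3).sub h4).congr_deriv ?_
  have e := exp_mul_stdNormalPDF (f x) hx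
  simp only [Function.comp_apply, Pi.add_apply, Pi.div_apply]
  rw [← e]
  ring

lemma hasDerivAt_unitBlackScholes_vol (k : ℝ) {s : ℝ} (hs : s ≠ 0) :
    HasDerivAt (unitBlackScholes k) (Real.exp k * stdNormalPDF (k / s + s / 2)) s :=
  (hasDerivAt_unitBlackScholes_comp (hasDerivAt_const s k) (hasDerivAt_id s) hs).congr_deriv
    (by simp)

lemma strictMonoOn_unitBlackScholes (k : ℝ) : StrictMonoOn (unitBlackScholes k) (Ioi 0) := by
  refine strictMonoOn_of_deriv_pos (convex_Ioi 0) (fun s hs =>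
    (hasDerivAt_unitBlackScholes_vol k (ne_of_gt hs)).continuousAt.continuousWithinAt)
    fun s hs => ?_
  rw [interior_Ioi] at hs
  rw [(hasDerivAt_unitBlackScholes_vol k (ne_of_gt hs)).deriv]
  have := stdNormalPDF_pos (k / s + s / 2)
  positivity

lemma exists_unitBlackScholes_zero_eq {p : ℝ} (h0 : 0 < p) (h1 : p < 1) :
    ∃ s > 0, unitBlackScholes 0 s = p := by
  have hc : Continuous (unitBlackScholes 0) := by
    have : unitBlackScholes 0 = fun s => 2 * stdNormalCDF (s / 2) - 1 :=
      funext unitBlackScholes_zero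
    rw [this]
    have := contDiff_stdNormalCDF.continuous
    fun_prop
  have ht : Tendsto (unitBlackScholes 0) atTop (𝓝 1) := by
    have h2 : Tendsto (fun s : ℝ => 2 * stdNormalCDF (s / 2) - 1) atTop (𝓝 (2 * 1 - 1)) :=
      (((tendsto_cdf_atTop (gaussianReal 0 1)).comp
        (tendsto_id.atTop_div_const two_pos)).const_mul 2).sub_const 1
    rw [show unitBlackScholes 0 = fun s => 2 * stdNormalCDF (s / 2) - 1 from
      funext unitBlackScholes_zero]
    convert h2 using 2
    norm_num
  -- With the convention 0/0 = 0 the formula takes its correct limit 0 at zero volatility, so the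
  -- intermediate value theorem can start at 0.
  have hz : unitBlackScholes 0 0 = 0 := by simp [unitBlackScholes]
  obtain ⟨S, hS, hS0⟩ := ((ht.eventually_const_lt h1).and (eventually_gt_atTop 0)).exists
  obtain ⟨s, hs, hsp⟩ := intermediate_value_Icc hS0.le hc.continuousOn
    (show p ∈ Icc (unitBlackScholes 0 0) (unitBlackScholes 0 S) from ⟨by rw [hz]; exact h0.le, hS.le⟩)
  refine ⟨s, lt_of_le_of_ne hs.1 fun h => ?_, hsp⟩
  rw [← h, hz] at hsp
  exact h0.ne hsp

/-- Put prices of a normal log return are given by the Black–Scholes formula. -/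
lemma unitPut_gaussianReal (k : ℝ) {s : ℝ} (hs : 0 < s) :
    unitPut (gaussianReal (-s ^ 2 / 2) ⟨s ^ 2, sq_nonneg s⟩) k = unitBlackScholes k s := by
  have hv : (⟨s ^ 2, sq_nonneg s⟩ : NNReal) ≠ 0 := by
    intro h
    have h1 : s ^ 2 = 0 := congrArg NNReal.toReal h
    exact hs.ne' (pow_eq_zero_iff two_ne_zero |>.1 h1)
  set v : NNReal := ⟨s ^ 2, sq_nonneg s⟩ with hvdef
  have hvs : (v : ℝ) = s ^ 2 := rfl
  have hcdf : ∀ m : ℝ, ∫ x in Iic k, gaussianPDFReal m v x = stdNormalCDF ((k - m) / s) := by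
    intro m
    have h1 : gaussianReal m v = (gaussianReal 0 1).map fun x => s * x + m := by
      have h2 : (gaussianReal 0 1).map (fun x => s * x + m) =
          ((gaussianReal 0 1).map fun x => s * x).map fun x => x + m :=
        (Measure.map_map (g := fun x : ℝ => x + m) (f := fun x : ℝ => s * x) (by fun_prop)
          (by fun_prop)).symm
      rw [h2, gaussianReal_map_const_mul, gaussianReal_map_add_const]
      simp only [mul_one, mul_zero, zero_add, hvdef]
      rfl
    have h3 : (gaussianReal m v).real (Iic k) = ∫ x in Iic k, gaussianPDFReal m v x := by
      rw [measureReal_def, gaussianReal_apply_eq_integral m hv, ENNReal.toReal_ofReal]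
      exact integral_nonneg fun x => gaussianPDFReal_nonneg _ _ _
    rw [← h3, h1, stdNormalCDF_eq_real, map_measureReal_apply (by fun_prop) measurableSet_Iic]
    congr 1
    ext x
    simp only [mem_preimage, mem_Iic]
    rw [le_div_iff₀ hs]
    constructor <;> intro h <;> linarith
  -- Exponential tilting: weighting the normal density by e^x moves its mean from −s²/2 to s²/2.
  have hshift : ∀ x, Real.exp x * gaussianPDFReal (-s ^ 2 / 2) v x =
      gaussianPDFReal (s ^ 2 / 2) v x := by
    intro x
    simp only [gaussianPDFReal, hvs]
    rw [mul_left_comm, ← Real.exp_add]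
    congr 2
    field_simp
    ring
  rw [unitPut, integral_gaussianReal_eq_integral_smul hv]
  have hind : (fun x => gaussianPDFReal (-s ^ 2 / 2) v x • max (Real.exp k - Real.exp x) 0) =
      indicator (Iic k) fun x => Real.exp k * gaussianPDFReal (-s ^ 2 / 2) v x -
        gaussianPDFReal (s ^ 2 / 2) v x := by
    ext x
    by_cases hx : x ≤ k
    · rw [indicator_of_mem (by exact hx), max_eq_left (by linarith [Real.exp_le_exp.2 hx]),
        ← hshift, smul_eq_mul]
      ring
    · rw [indicator_of_notMem (by exact hx),
        max_eq_right (by linarith [Real.exp_le_exp.2 (not_le.1 hx).le]), smul_zero]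
  rw [hind, integral_indicator measurableSet_Iic,
    integral_sub ((integrable_gaussianPDFReal _ _).integrableOn.const_mul _)
      (integrable_gaussianPDFReal _ _).integrableOn, integral_const_mul, hcdf, hcdf,
    unitBlackScholes]
  congr 3
  · field_simp
    ring
  · field_simp

end blackScholes

/-! ### Implied volatility as an implicit function of log-moneyness -/

section impliedVol

lemma putPrice_eq {S₀ : ℝ} (hS₀ : 0 < S₀) (r : ℝ) (ρ : Measure ℝ) (θ k : ℝ) :
    putPrice S₀ r ρ (S₀ * Real.exp (r * θ) * Real.exp k) θ = S₀ * unitPut ρ k := by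
  have h1 : ∀ x, max (S₀ * Real.exp (r * θ) * Real.exp k - S₀ * Real.exp (r * θ + x)) 0 =
      S₀ * Real.exp (r * θ) * max (Real.exp k - Real.exp x) 0 := by
    intro x
    rw [mul_max_of_nonneg _ _ (by positivity), Real.exp_add]
    ring_nf
  rw [putPrice]
  simp_rw [h1]
  rw [integral_const_mul, unitPut, ← mul_assoc, mul_left_comm, ← Real.exp_add]
  simp

lemma blackScholesPut_eq {S₀ : ℝ} (hS₀ : 0 < S₀) (r k : ℝ) {θ σ : ℝ} (hθ : 0 < θ) (hσ : 0 < σ) :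
    blackScholesPut S₀ r (S₀ * Real.exp (r * θ) * Real.exp k) θ σ =
      S₀ * unitBlackScholes k (σ * √θ) := by
  have hlog : Real.log (S₀ / (S₀ * Real.exp (r * θ) * Real.exp k)) = -(r * θ) - k := by
    rw [mul_assoc, ← div_div, div_self hS₀.ne', ← Real.exp_add, one_div, ← Real.exp_neg,
      Real.log_exp]
    ring
  have hs : 0 < √θ := Real.sqrt_pos.2 hθ
  have hsq : √θ ^ 2 = θ := Real.sq_sqrt hθ.le
  have e1 : -((-(r * θ) - k + (r - σ ^ 2 / 2) * θ) / (σ * √θ)) =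
      k / (σ * √θ) + σ * √θ / 2 := by
    rw [eq_comm, div_add_div _ _ (by positivity) two_ne_zero, ← neg_div,
      div_eq_div_iff (by positivity) (by positivity)]
    linear_combination σ * √θ * σ ^ 2 * hsq
  have e2 : -((-(r * θ) - k + (r + σ ^ 2 / 2) * θ) / (σ * √θ)) =
      k / (σ * √θ) - σ * √θ / 2 := by
    rw [eq_comm, div_sub_div _ _ (by positivity) two_ne_zero, ← neg_div,
      div_eq_div_iff (by positivity) (by positivity)]
    linear_combination -(σ * √θ * σ ^ 2 * hsq)
  rw [blackScholesPut, hlog, e1, e2, unitBlackScholes]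
  have e3 : Real.exp (r * θ) * Real.exp (-r * θ) = 1 := by
    rw [← Real.exp_add]; simp
  linear_combination (S₀ * Real.exp k * stdNormalCDF (k / (σ * √θ) + σ * √θ / 2)) * e3

lemma isImpliedVol_iff {S₀ : ℝ} (hS₀ : 0 < S₀) (r k : ℝ) (ρ : Measure ℝ) {θ σ : ℝ} (hθ : 0 < θ) :
    IsImpliedVol S₀ r ρ θ k σ ↔ 0 < σ ∧ unitBlackScholes k (σ * √θ) = unitPut ρ k := by
  unfold IsImpliedVol
  refine and_congr_right fun hσ => ?_
  rw [putPrice_eq hS₀, blackScholesPut_eq hS₀ r k hθ hσ]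
  exact mul_right_inj' hS₀.ne'

/-- Implied volatility from a total volatility reproducing the price. -/
lemma impliedVol_eq {S₀ : ℝ} (hS₀ : 0 < S₀) (r k : ℝ) (ρ : Measure ℝ) {θ s : ℝ} (hθ : 0 < θ)
    (hs : 0 < s) (h : unitBlackScholes k s = unitPut ρ k) :
    IsImpliedVol S₀ r ρ θ k (impliedVol S₀ r ρ θ k) ∧ impliedVol S₀ r ρ θ k = s / √θ := by
  have hθ' : 0 < √θ := Real.sqrt_pos.2 hθ
  have hset : {σ : ℝ | IsImpliedVol S₀ r ρ θ k σ} = {s / √θ} := by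
    ext σ
    simp only [mem_ofPred_eq, mem_singleton_iff]
    rw [isImpliedVol_iff hS₀ r k ρ hθ]
    constructor
    · rintro ⟨hσ, h2⟩
      rw [eq_div_iff hθ'.ne']
      exact (strictMonoOn_unitBlackScholes k).injOn (by exact mul_pos hσ hθ') hs (h2.trans h.symm)
    · rintro rfl
      rw [div_mul_cancel₀ _ hθ'.ne']
      exact ⟨by positivity, h⟩
  have h2 : impliedVol S₀ r ρ θ k = s / √θ := by rw [impliedVol, hset, csInf_singleton]
  refine ⟨?_, h2⟩
  have : s / √θ ∈ {σ : ℝ | IsImpliedVol S₀ r ρ θ k σ} := by rw [hset]; rfl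
  rw [h2]
  exact this

/-- The total implied volatility near the money and its derivatives. -/
theorem exists_total_vol {P p₁ p₂ : ℝ → ℝ} (h1 : ∀ k, HasDerivAt P (p₁ k) k)
    (h2 : ∀ k, HasDerivAt p₁ (p₂ k) k) (hc : Continuous p₂) (h0 : 0 < P 0) (h0' : P 0 < 1) :
    ∃ s₀ > 0, unitBlackScholes 0 s₀ = P 0 ∧ ∃ S : ℝ → ℝ, S 0 = s₀ ∧ ContDiffAt ℝ 2 S 0 ∧
      (∀ᶠ k in 𝓝 0, 0 < S k ∧ unitBlackScholes k (S k) = P k) ∧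
      deriv S 0 = (p₁ 0 - stdNormalCDF (s₀ / 2)) / stdNormalPDF (s₀ / 2) ∧
      iteratedDeriv 2 S 0 = (p₂ 0 - p₁ 0) / stdNormalPDF (s₀ / 2) - 1 / s₀ +
        s₀ / 4 * (deriv S 0) ^ 2 := by
  obtain ⟨s₀, hs₀, hsP⟩ := exists_unitBlackScholes_zero_eq h0 h0'
  refine ⟨s₀, hs₀, hsP, ?_⟩
  have hP2 : ContDiff ℝ 2 P := by
    rw [show (2 : WithTop ℕ∞) = 1 + 1 from rfl, contDiff_succ_iff_deriv]
    refine ⟨fun x => (h1 x).differentiableAt, by simp, ?_⟩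
    rw [show deriv P = p₁ from funext fun x => (h1 x).deriv, contDiff_one_iff_deriv]
    refine ⟨fun x => (h2 x).differentiableAt, ?_⟩
    rwa [show deriv p₁ = p₂ from funext fun x => (h2 x).deriv]
  set f : ℝ × ℝ → ℝ := fun q => unitBlackScholes q.1 q.2 - P q.1 with hf
  have cdf : ContDiffAt ℝ 2 f (0, s₀) :=
    (contDiffAt_unitBlackScholes 0 hs₀.ne').sub (hP2.contDiffAt.comp _ contDiffAt_fst)
  have hf0 : f (0, s₀) = 0 := by simp [hf, hsP]
  set c := stdNormalPDF (s₀ / 2) with hcdef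
  have hcpos : 0 < c := stdNormalPDF_pos _
  -- The partial derivative in the volatility is vega, equal to c > 0 at the money, so the implicit
  -- function theorem applies with C² regularity.
  have hinr : (fderiv ℝ f (0, s₀) ∘L .inr ℝ ℝ ℝ).IsInvertible := by
    refine ⟨ContinuousLinearEquiv.unitsEquivAut ℝ (Units.mk0 c hcpos.ne'), ?_⟩
    ext
    have hd : HasFDerivAt f (fderiv ℝ f (0, s₀)) (0, s₀) :=
      (cdf.differentiableAt (by norm_num)).hasFDerivAt
    have hl : HasDerivAt (fun s : ℝ => ((0 : ℝ), s)) (0, 1) s₀ :=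
      (hasDerivAt_const s₀ (0 : ℝ)).prodMk (hasDerivAt_id s₀)
    have h3 := hd.comp_hasDerivAt s₀ hl
    have h4 : HasDerivAt (f ∘ fun s : ℝ => ((0 : ℝ), s)) c s₀ := by
      have := (hasDerivAt_unitBlackScholes_vol 0 hs₀.ne').sub_const (P 0)
      rw [Real.exp_zero, one_mul, zero_div, zero_add] at this
      exact this
    have h5 := h3.unique h4
    simpa using h5.symm
  set S := cdf.implicitFunction two_ne_zero hinr with hS
  have hS0 : S 0 = s₀ := cdf.implicitFunction_apply_self two_ne_zero hinr
  have hSc : ContDiffAt ℝ 2 S 0 := cdf.contDiffAt_implicitFunction two_ne_zero hinr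
  have hSe : ∀ᶠ k in 𝓝 0, 0 < S k ∧ unitBlackScholes k (S k) = P k := by
    have e1 : ∀ᶠ k in 𝓝 (0 : ℝ), f (k, S k) = f (0, s₀) :=
      cdf.eventually_apply_implicitFunction two_ne_zero hinr
    have e2 : ∀ᶠ k in 𝓝 (0 : ℝ), 0 < S k :=
      hSc.continuousAt.eventually_const_lt (by rw [hS0]; exact hs₀)
    filter_upwards [e1, e2] with k hk1 hk2
    rw [hf0] at hk1
    exact ⟨hk2, sub_eq_zero.1 hk1⟩
  have hSd : ∀ᶠ k in 𝓝 0, DifferentiableAt ℝ S k :=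
    (hSc.eventually (by simp)).mono fun k hk => hk.differentiableAt (by norm_num)
  set d : ℝ → ℝ := fun k => k / S k + S k / 2 with hd
  -- The identity BS(k, S(k)) = P(k) differentiated once and solved for S′. It holds on a
  -- neighbourhood of 0, so it can be differentiated again.
  have hderiv : deriv S =ᶠ[𝓝 0] fun k =>
      (Real.exp (-k) * p₁ k - stdNormalCDF (d k)) / stdNormalPDF (d k) := by
    filter_upwards [hSe.eventually_nhds, hSd] with k hk hkd
    have h3 := hasDerivAt_unitBlackScholes_comp (hasDerivAt_id k) hkd.hasDerivAt
      hk.self_of_nhds.1.ne'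
    have h4 : HasDerivAt (fun x => unitBlackScholes (id x) (S x)) (p₁ k) k :=
      (h1 k).congr_of_eventuallyEq (hk.mono fun x hx => hx.2)
    have h5 := h3.unique h4
    have h6 := stdNormalPDF_pos (d k)
    rw [eq_div_iff h6.ne', Real.exp_neg, eq_sub_iff_add_eq, eq_inv_mul_iff_mul_eq₀
      (Real.exp_pos k).ne', ← h5]
    simp only [id_eq, hd]
    ring
  have hd0 : d 0 = s₀ / 2 := by simp [hd, hS0]
  have hS1 : deriv S 0 = (p₁ 0 - stdNormalCDF (s₀ / 2)) / c := by
    rw [hderiv.eq_of_nhds, hd0]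
    simp [hcdef]
  refine ⟨S, hS0, hSc, hSe, hS1, ?_⟩
  rw [iteratedDeriv_succ, iteratedDeriv_one, hderiv.deriv_eq]
  have hSD : HasDerivAt S (deriv S 0) 0 := hSd.self_of_nhds.hasDerivAt
  have hdd : HasDerivAt d (1 / s₀ + deriv S 0 / 2) 0 := by
    have := ((hasDerivAt_id (0 : ℝ)).div hSD (by rw [hS0]; exact hs₀.ne')).add (hSD.div_const 2)
    refine this.congr_deriv ?_
    rw [hS0]
    simp only [id_eq]
    field_simp
    ring
  have hN := (((hasDerivAt_id (0 : ℝ)).neg.exp).mul (h2 0)).sub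
    ((hasDerivAt_stdNormalCDF (d 0)).comp 0 hdd)
  have hD := (hasDerivAt_stdNormalPDF (d 0)).comp 0 hdd
  have hR := hN.div hD (by simp only [Function.comp_apply]; exact (stdNormalPDF_pos _).ne')
  have hR' : HasDerivAt (fun k => (Real.exp (-k) * p₁ k - stdNormalCDF (d k)) /
    stdNormalPDF (d k)) _ 0 := hR
  rw [hR'.deriv]
  simp only [Function.comp_apply, Pi.sub_apply, Pi.mul_apply, Pi.neg_apply, id_eq, neg_zero,
    Real.exp_zero, hd0, ← hcdef]
  have h7 : p₁ 0 - stdNormalCDF (s₀ / 2) = deriv S 0 * c := by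
    rw [hS1, div_mul_cancel₀ _ hcpos.ne']
  simp only [one_mul, h7]
  field_simp
  ring

end impliedVol

/-! ### Pricing functionals on a fixed line and Gaussian line integrals -/

/-- Pricing formulas for the put in terms of the rescaled characteristic function. -/
theorem unitPut_derivatives_scaled {ρ : Measure ℝ} [IsProbabilityMeasure ρ] {v σ : ℝ}
    (hv : 0 < v) (hσ : 0 < σ) {ψ : ℝ → ℂ}
    (hint : Integrable (fun x => Real.exp (-(v / σ) * x)) ρ)
    (hψ : ∀ u : ℝ, complexCharFun ρ ((u + Complex.I * v) / σ) = ψ u) (hψi : Integrable ψ) :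
    ∃ p₁ p₂ : ℝ → ℝ, (∀ k, HasDerivAt (unitPut ρ) (p₁ k) k) ∧ (∀ k, HasDerivAt p₁ (p₂ k) k) ∧
      Continuous p₂ ∧
      (unitPut ρ 0 : ℂ) = (2 * π : ℂ)⁻¹ * ∫ u : ℝ, σ * (((v : ℂ) - Complex.I * u)⁻¹ *
        (((v + σ : ℝ) : ℂ) - Complex.I * u)⁻¹) * ψ u ∧
      p₁ 0 = ((2 * π : ℂ)⁻¹ * ∫ u : ℝ, ((v : ℂ) - Complex.I * u)⁻¹ * ψ u).re ∧
      p₂ 0 - p₁ 0 = σ⁻¹ * ((2 * π : ℂ)⁻¹ * ∫ u : ℝ, ψ u).re := by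
  have hσc : (σ : ℂ) ≠ 0 := by exact_mod_cast hσ.ne'
  -- The damping v/σ for the log return becomes v for the normalized return. The substitution u ↦ σu
  -- moves all integrals to the line Im z = v and accounts for the powers of σ.
  have hφ : ∀ u : ℝ, complexCharFun ρ (u + Complex.I * (v / σ : ℝ)) = ψ (σ * u) := by
    intro u
    rw [← hψ]
    congr 1
    push_cast
    field_simp
  have hi : Integrable fun u : ℝ => complexCharFun ρ (u + Complex.I * (v / σ : ℝ)) := by
    simp_rw [hφ]
    exact hψi.comp_mul_left' hσ.ne'
  have key' : ∀ g : ℝ → ℂ, ∫ u : ℝ, σ * g (σ * u) = ∫ u, g u := by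
    intro g
    rw [integral_const_mul, Measure.integral_comp_mul_left, abs_of_pos (inv_pos.2 hσ),
      Complex.real_smul, Complex.ofReal_inv, mul_inv_cancel_left₀ hσc]
  have key : ∀ g : ℝ → ℂ, ∫ u : ℝ, g (σ * u) = (σ : ℂ)⁻¹ * ∫ u, g u := by
    intro g
    rw [Measure.integral_comp_mul_left, abs_of_pos (inv_pos.2 hσ), Complex.real_smul,
      Complex.ofReal_inv]
  obtain ⟨p₁, p₂, h1, h2, hc, e0, e1, e2⟩ := unitPut_derivatives (div_pos hv hσ) hint hi
  refine ⟨p₁, p₂, h1, h2, hc, ?_, ?_, ?_⟩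
  · rw [e0]
    congr 1
    rw [← key' fun u => σ * (((v : ℂ) - Complex.I * u)⁻¹ *
      (((v + σ : ℝ) : ℂ) - Complex.I * u)⁻¹) * ψ u]
    congr 1
    ext u
    rw [hφ]
    have n1 := sub_I_mul_ne_zero hv (σ * u)
    have n2 := sub_I_mul_ne_zero (by linarith : 0 < v + σ) (σ * u)
    have n3 := sub_I_mul_ne_zero (div_pos hv hσ) u
    have n4 := sub_I_mul_ne_zero (by positivity : 0 < v / σ + 1) u
    have r1 : (v : ℂ) - Complex.I * ((σ * u : ℝ) : ℂ) =
        σ * (((v / σ : ℝ) : ℂ) - Complex.I * u) := by push_cast; field_simp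
    have r2 : ((v + σ : ℝ) : ℂ) - Complex.I * ((σ * u : ℝ) : ℂ) =
        σ * (((v / σ + 1 : ℝ) : ℂ) - Complex.I * u) := by push_cast; field_simp
    rw [r1, r2, mul_inv, mul_inv]
    field_simp
  · rw [e1]
    congr 2
    rw [← key' fun u => ((v : ℂ) - Complex.I * u)⁻¹ * ψ u]
    congr 1
    ext u
    rw [hφ]
    have r1 : (v : ℂ) - Complex.I * ((σ * u : ℝ) : ℂ) =
        σ * (((v / σ : ℝ) : ℂ) - Complex.I * u) := by push_cast; field_simp
    rw [r1, mul_inv]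
    field_simp
  · rw [e2]
    simp_rw [hφ]
    rw [key, mul_left_comm, ← Complex.ofReal_inv, Complex.re_ofReal_mul]

lemma norm_add_I_mul_le {v : ℝ} (hv : 0 < v) (u : ℝ) :
    ‖(u : ℂ) + Complex.I * v‖ ≤ (1 + v) * (1 + |u|) := by
  refine (norm_add_le _ _).trans ?_
  rw [norm_mul, Complex.norm_I, Complex.norm_real, Complex.norm_real, Real.norm_eq_abs,
    Real.norm_eq_abs, abs_of_pos hv]
  nlinarith [mul_nonneg hv.le (abs_nonneg u)]

lemma integrable_one_add_abs_pow_mul_gauss (n : ℕ) :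
    Integrable fun u : ℝ => (1 + |u|) ^ n * Real.exp (-u ^ 2 / 2) := by
  have h0 : Integrable fun u : ℝ => Real.exp (-(1 / 2) * u ^ 2) :=
    integrable_exp_neg_mul_sq (by norm_num)
  have h1 : Integrable fun u : ℝ => |u| ^ n * Real.exp (-(1 / 2) * u ^ 2) := by
    have := (integrable_rpow_mul_exp_neg_mul_sq (b := 1 / 2) (by norm_num) (s := n)
      (by linarith [n.cast_nonneg (α := ℝ)])).norm
    refine this.congr (Eventually.of_forall fun u => ?_)
    simp [Real.rpow_natCast]
  refine Integrable.mono' ((h0.add h1).const_mul (2 ^ n)) (by fun_prop)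
    (Eventually.of_forall fun u => ?_)
  rw [Real.norm_eq_abs, abs_of_nonneg (by positivity), Pi.add_apply,
    show -u ^ 2 / 2 = -(1 / 2) * u ^ 2 by ring, ← one_add_mul, ← mul_assoc]
  refine mul_le_mul_of_nonneg_right ?_ (Real.exp_pos _).le
  rcases le_total |u| 1 with h | h
  · exact (pow_le_pow_left₀ (by positivity) (by linarith : 1 + |u| ≤ 2) n).trans
      (le_mul_of_one_le_right (by positivity) (by simp))
  · refine (pow_le_pow_left₀ (by positivity) (by linarith : 1 + |u| ≤ 2 * |u|) n).trans ?_
    rw [mul_pow]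
    exact mul_le_mul_of_nonneg_left (by simp) (by positivity)

lemma norm_cexp_neg_sq_div_two (v u : ℝ) :
    ‖Complex.exp (-((u : ℂ) + Complex.I * v) ^ 2 / 2)‖ =
      Real.exp (v ^ 2 / 2) * Real.exp (-u ^ 2 / 2) := by
  rw [Complex.norm_exp, ← Real.exp_add]
  congr 1
  simp [sq]
  ring

/-- Integrability and size of a function dominated by a polynomial times a Gaussian. -/
lemma integral_le_of_gauss_bound {g : ℝ → ℂ} (hg : Continuous g) {K : ℝ} {n : ℕ}
    (h : ∀ u, ‖g u‖ ≤ K * ((1 + |u|) ^ n * Real.exp (-u ^ 2 / 2))) :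
    Integrable g ∧ ‖∫ u, g u‖ ≤ K * ∫ u : ℝ, (1 + |u|) ^ n * Real.exp (-u ^ 2 / 2) := by
  have hi := (integrable_one_add_abs_pow_mul_gauss n).const_mul K
  refine ⟨hi.mono' hg.aestronglyMeasurable (Eventually.of_forall h), ?_⟩
  rw [← integral_const_mul]
  exact norm_integral_le_of_norm_le hi (Eventually.of_forall h)

/-- `∫ z ^ n exp (-z ^ 2 / 2)` along the line `Im z = v`. -/
noncomputable def gaussLineMoment (v : ℝ) (n : ℕ) : ℂ :=
  ∫ u : ℝ, ((u : ℂ) + Complex.I * v) ^ n * Complex.exp (-((u : ℂ) + Complex.I * v) ^ 2 / 2)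

lemma norm_pow_mul_cexp_le {v : ℝ} (hv : 0 < v) (n : ℕ) (u : ℝ) :
    ‖((u : ℂ) + Complex.I * v) ^ n * Complex.exp (-((u : ℂ) + Complex.I * v) ^ 2 / 2)‖ ≤
      ((1 + v) ^ n * Real.exp (v ^ 2 / 2)) * ((1 + |u|) ^ n * Real.exp (-u ^ 2 / 2)) := by
  rw [norm_mul, norm_pow, norm_cexp_neg_sq_div_two]
  have := pow_le_pow_left₀ (norm_nonneg _) (norm_add_I_mul_le hv u) n
  rw [mul_pow] at this
  calc _ ≤ (1 + v) ^ n * (1 + |u|) ^ n * (Real.exp (v ^ 2 / 2) * Real.exp (-u ^ 2 / 2)) := by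
        gcongr
    _ = _ := by ring

lemma integrable_pow_mul_cexp {v : ℝ} (hv : 0 < v) (n : ℕ) :
    Integrable fun u : ℝ =>
      ((u : ℂ) + Complex.I * v) ^ n * Complex.exp (-((u : ℂ) + Complex.I * v) ^ 2 / 2) :=
  (integral_le_of_gauss_bound (by fun_prop) (norm_pow_mul_cexp_le hv n)).1

lemma hasDerivAt_cexp_neg_sq (v u : ℝ) :
    HasDerivAt (fun u : ℝ => Complex.exp (-((u : ℂ) + Complex.I * v) ^ 2 / 2))
      (-(((u : ℂ) + Complex.I * v) * Complex.exp (-((u : ℂ) + Complex.I * v) ^ 2 / 2))) u := by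
  have h0 : HasDerivAt (fun u : ℝ => (u : ℂ) + Complex.I * v) 1 u :=
    (Complex.ofRealCLM.hasDerivAt (x := u)).add_const _
  have h1 : HasDerivAt (fun u : ℝ => -((u : ℂ) + Complex.I * v) ^ 2 / 2)
      (-((u : ℂ) + Complex.I * v)) u :=
    (((h0.pow 2).neg).div_const 2).congr_deriv (by norm_num; ring)
  exact h1.cexp.congr_deriv (by ring)

lemma gaussLineMoment_one {v : ℝ} (hv : 0 < v) : gaussLineMoment v 1 = 0 := by
  have := integral_eq_zero_of_hasDerivAt_of_integrable (hasDerivAt_cexp_neg_sq v)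
    (by simpa using (integrable_pow_mul_cexp hv 1).neg)
    (by simpa using integrable_pow_mul_cexp hv 0)
  rw [integral_neg, neg_eq_zero] at this
  simpa [gaussLineMoment] using this

/-- Integrating the derivative of z^{n+1}e^{−z²/2} along the line gives zero, which is the usual
recursion for Gaussian moments; no contour has to be moved. -/
lemma gaussLineMoment_add_two {v : ℝ} (hv : 0 < v) (n : ℕ) :
    gaussLineMoment v (n + 2) = (n + 1) * gaussLineMoment v n := by
  have hd : ∀ u : ℝ, HasDerivAt (fun u : ℝ => ((u : ℂ) + Complex.I * v) ^ (n + 1) *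
      Complex.exp (-((u : ℂ) + Complex.I * v) ^ 2 / 2))
      ((n + 1) * (((u : ℂ) + Complex.I * v) ^ n *
        Complex.exp (-((u : ℂ) + Complex.I * v) ^ 2 / 2)) -
        ((u : ℂ) + Complex.I * v) ^ (n + 2) *
        Complex.exp (-((u : ℂ) + Complex.I * v) ^ 2 / 2)) u := by
    intro u
    have h0 : HasDerivAt (fun u : ℝ => (u : ℂ) + Complex.I * v) 1 u :=
      (Complex.ofRealCLM.hasDerivAt (x := u)).add_const _
    refine ((h0.pow (n + 1)).mul (hasDerivAt_cexp_neg_sq v u)).congr_deriv ?_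
    push_cast
    simp only [Pi.pow_apply]
    ring
  have i1 := (integrable_pow_mul_cexp hv n).const_mul ((n : ℂ) + 1)
  have i2 := integrable_pow_mul_cexp hv (n + 2)
  have := integral_eq_zero_of_hasDerivAt_of_integrable hd (i1.sub i2)
    (integrable_pow_mul_cexp hv (n + 1))
  rw [integral_sub i1 i2, integral_const_mul, sub_eq_zero] at this
  exact this.symm

lemma gaussLineMoment_zero (v : ℝ) :
    (2 * π : ℂ)⁻¹ * gaussLineMoment v 0 = stdNormalPDF 0 := by
  have h := GaussianFourier.integral_cexp_neg_mul_sq_add_real_mul_I (b := 1 / 2) (by norm_num) v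
  have e : gaussLineMoment v 0 = ((π : ℂ) / (1 / 2)) ^ (1 / 2 : ℂ) := by
    rw [← h]
    unfold gaussLineMoment
    congr 1
    ext u
    rw [pow_zero, one_mul]
    congr 1
    ring
  have e2 : ((π : ℂ) / (1 / 2)) ^ (1 / 2 : ℂ) = ((√(2 * π) : ℝ) : ℂ) := by
    rw [Real.sqrt_eq_rpow, Complex.ofReal_cpow (by positivity)]
    push_cast
    congr 1
    ring
  have e3 : √(2 * π) * √(2 * π) = 2 * π := Real.mul_self_sqrt (by positivity)
  have e4 : √(2 * π) ≠ 0 := by positivity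
  rw [e, e2, stdNormalPDF, show (2 * π : ℂ)⁻¹ = (((2 * π)⁻¹ : ℝ) : ℂ) by push_cast; rfl,
    ← Complex.ofReal_mul, ← e3]
  congr 1
  simp
  field_simp

/-- `exp (-i z σ / 2 - z ^ 2 / 2)` at `z = u + i v`. -/
noncomputable def gaussCF (v σ u : ℝ) : ℂ :=
  Complex.exp (-(Complex.I * (u + Complex.I * v) * σ) / 2 - ((u : ℂ) + Complex.I * v) ^ 2 / 2)

lemma continuous_gaussCF (v σ : ℝ) : Continuous (gaussCF v σ) := by
  unfold gaussCF; fun_prop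

lemma gaussCF_eq (v σ u : ℝ) : gaussCF v σ u =
    Complex.exp (-(Complex.I * (u + Complex.I * v) * σ) / 2) *
      Complex.exp (-((u : ℂ) + Complex.I * v) ^ 2 / 2) := by
  rw [gaussCF, ← Complex.exp_add]
  congr 1
  ring

lemma norm_gaussCF_le {v σ : ℝ} (hv : 0 < v) (hσ : σ ≤ 1) (u : ℝ) :
    ‖gaussCF v σ u‖ ≤ Real.exp (v / 2 + v ^ 2 / 2) * Real.exp (-u ^ 2 / 2) := by
  rw [gaussCF_eq, norm_mul, norm_cexp_neg_sq_div_two, Complex.norm_exp, ← mul_assoc,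
    ← Real.exp_add]
  gcongr
  have : (-(Complex.I * (u + Complex.I * v) * σ) / 2).re = v * σ / 2 := by
    simp
  rw [this]
  nlinarith

lemma integrable_gaussCF {v σ : ℝ} (hv : 0 < v) (hσ : σ ≤ 1) : Integrable (gaussCF v σ) :=
  (integral_le_of_gauss_bound (n := 0) (continuous_gaussCF v σ)
    (fun u => by simpa using norm_gaussCF_le hv hσ u)).1

/-- Gaussian values of the three pricing functionals. -/
theorem gaussCF_functionals {v σ : ℝ} (hv : 0 < v) (hσ : 0 < σ) (hσ1 : σ ≤ 1) :
    ((2 * π : ℂ)⁻¹ * ∫ u : ℝ, gaussCF v σ u).re = stdNormalPDF (σ / 2) ∧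
    ((2 * π : ℂ)⁻¹ * ∫ u : ℝ, ((v : ℂ) - Complex.I * u)⁻¹ * gaussCF v σ u).re =
      stdNormalCDF (σ / 2) ∧
    ((2 * π : ℂ)⁻¹ * ∫ u : ℝ, σ * (((v : ℂ) - Complex.I * u)⁻¹ *
        (((v + σ : ℝ) : ℂ) - Complex.I * u)⁻¹) * gaussCF v σ u) =
      ((2 * stdNormalCDF (σ / 2) - 1 : ℝ) : ℂ) := by
  have hσc : (σ : ℂ) ≠ 0 := by exact_mod_cast hσ.ne'
  -- The integrals are not computed. The pricing formulas are applied to the normal law N(−σ²/2,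
  -- σ²), whose normalized transform is `gaussCF`; the price and its derivatives are then known from
  -- the Black–Scholes formula.
  obtain ⟨w, hw⟩ : ∃ w : NNReal, w = ⟨σ ^ 2, sq_nonneg σ⟩ := ⟨_, rfl⟩
  have hwσ : ((w : ℝ) : ℂ) = (σ : ℂ) ^ 2 := by
    rw [hw, ← Complex.ofReal_pow]; rfl
  obtain ⟨ρ, hρ⟩ : ∃ ρ, ρ = gaussianReal (-σ ^ 2 / 2) w := ⟨_, rfl⟩
  have : IsProbabilityMeasure ρ := by rw [hρ]; infer_instance
  have hint : Integrable (fun x => Real.exp (-(v / σ) * x)) ρ :=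
    hρ ▸ integrable_exp_mul_gaussianReal _
  have hψ : ∀ u : ℝ, complexCharFun ρ ((u + Complex.I * v) / σ) = gaussCF v σ u := by
    intro u
    have := complexMGF_id_gaussianReal (μ := -σ ^ 2 / 2) (v := w)
      (Complex.I * ((u + Complex.I * v) / σ))
    rw [complexCharFun, hρ]
    refine Eq.trans ?_ (this.trans ?_)
    · rfl
    · rw [gaussCF]
      congr 1
      rw [hwσ]
      push_cast
      field_simp
      linear_combination ((u : ℂ) + Complex.I * v) ^ 2 * Complex.I_sq
  obtain ⟨p₁, p₂, h1, h2, -, e0, e1, e2⟩ :=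
    unitPut_derivatives_scaled hv hσ hint hψ (integrable_gaussCF hv hσ1)
  have hP : unitPut ρ = fun k => unitBlackScholes k σ :=
    funext fun k => by rw [hρ, hw]; exact unitPut_gaussianReal k hσ
  have d1 : ∀ k, p₁ k = Real.exp k * stdNormalCDF (k / σ + σ / 2) := by
    intro k
    have := hasDerivAt_unitBlackScholes_comp (hasDerivAt_id k) (hasDerivAt_const k σ) hσ.ne'
    have h := h1 k
    rw [hP] at h
    simpa using h.unique this
  have d2 : p₂ 0 = stdNormalCDF (σ / 2) + stdNormalPDF (σ / 2) / σ := by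
    have h : HasDerivAt (fun k => Real.exp k * stdNormalCDF (k / σ + σ / 2)) (p₂ 0) 0 := by
      rw [← funext d1]
      exact h2 0
    have hk : HasDerivAt (fun k : ℝ => k / σ + σ / 2) (1 / σ) 0 :=
      ((hasDerivAt_id 0).div_const σ).add_const _
    have := (Real.hasDerivAt_exp 0).mul ((hasDerivAt_stdNormalCDF (0 / σ + σ / 2)).comp 0 hk)
    rw [h.unique this]
    simp [div_eq_mul_inv]
  refine ⟨?_, ?_, ?_⟩
  · rw [d1, d2] at e2
    have : stdNormalPDF (σ / 2) / σ = σ⁻¹ * ((2 * π : ℂ)⁻¹ * ∫ u : ℝ, gaussCF v σ u).re := by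
      rw [← e2]; simp
    rw [div_eq_inv_mul] at this
    exact (mul_left_cancel₀ (inv_ne_zero hσ.ne') this).symm
  · rw [← e1, d1]; simp
  · rw [← e0, hP, ← unitBlackScholes_zero]

/-- `∫ z ^ n exp (-i z σ / 2 - z ^ 2 / 2)` along the line `Im z = v`. -/
noncomputable def shiftLineMoment (v : ℝ) (n : ℕ) (σ : ℝ) : ℂ :=
  ∫ u : ℝ, ((u : ℂ) + Complex.I * v) ^ n * gaussCF v σ u

lemma norm_pow_mul_gaussCF_le {v σ : ℝ} (hv : 0 < v) (hσ : σ ≤ 1) (n : ℕ) (u : ℝ) :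
    ‖((u : ℂ) + Complex.I * v) ^ n * gaussCF v σ u‖ ≤
      ((1 + v) ^ n * Real.exp (v / 2 + v ^ 2 / 2)) *
        ((1 + |u|) ^ n * Real.exp (-u ^ 2 / 2)) := by
  rw [norm_mul, norm_pow]
  have := pow_le_pow_left₀ (norm_nonneg _) (norm_add_I_mul_le hv u) n
  rw [mul_pow] at this
  calc _ ≤ (1 + v) ^ n * (1 + |u|) ^ n *
      (Real.exp (v / 2 + v ^ 2 / 2) * Real.exp (-u ^ 2 / 2)) := by
        gcongr
        exact norm_gaussCF_le hv hσ u
    _ = _ := by ring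

lemma integrable_pow_mul_gaussCF {v σ : ℝ} (hv : 0 < v) (hσ : σ ≤ 1) (n : ℕ) :
    Integrable fun u : ℝ => ((u : ℂ) + Complex.I * v) ^ n * gaussCF v σ u :=
  (integral_le_of_gauss_bound ((by fun_prop : Continuous fun u : ℝ =>
    ((u : ℂ) + Complex.I * v) ^ n).mul (continuous_gaussCF v σ))
    (norm_pow_mul_gaussCF_le hv hσ n)).1

/-- Expansion of e^{−izσ/2} in σ under the Gaussian integral. The constant and linear terms are the
line moments of orders n and n+1; the Taylor remainder costs two further powers of z. -/
lemma exists_shiftLineMoment_bound {v : ℝ} (hv : 0 < v) (n : ℕ) :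
    ∃ K > 0, ∀ σ ∈ Ioc (0 : ℝ) 1, ‖shiftLineMoment v n σ‖ ≤ K ∧
      ‖shiftLineMoment v n σ - gaussLineMoment v n‖ ≤ K * σ ∧
      ‖shiftLineMoment v n σ - gaussLineMoment v n +
        Complex.I * σ / 2 * gaussLineMoment v (n + 1)‖ ≤ K * σ ^ 2 := by
  set W : ℕ → ℝ := fun n => ∫ u : ℝ, (1 + |u|) ^ n * Real.exp (-u ^ 2 / 2) with hW
  have hW0 : ∀ n, 0 ≤ W n := fun n => integral_nonneg fun u => by positivity
  set K0 : ℝ := (1 + v) ^ n * Real.exp (v / 2 + v ^ 2 / 2) * W n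
  set K2 : ℝ := (1 + v) ^ (n + 2) * (1 + Real.exp (v / 2)) * Real.exp (v ^ 2 / 2) * W (n + 2)
  set K1 : ℝ := ‖gaussLineMoment v (n + 1)‖ + K2
  have h0 : 0 ≤ K0 := by have := hW0 n; positivity
  have h2 : 0 ≤ K2 := by have := hW0 (n + 2); positivity
  refine ⟨1 + K0 + K1, by positivity, fun σ hσ => ?_⟩
  have i1 := integrable_pow_mul_gaussCF hv hσ.2 n
  have i2 := integrable_pow_mul_cexp hv n
  have i3 := (integrable_pow_mul_cexp hv (n + 1)).const_mul (Complex.I * σ / 2)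
  have s2 : ‖shiftLineMoment v n σ - gaussLineMoment v n +
        Complex.I * σ / 2 * gaussLineMoment v (n + 1)‖ ≤ K2 * σ ^ 2 := by
    unfold shiftLineMoment gaussLineMoment
    rw [← integral_sub i1 i2, ← integral_const_mul]
    refine (congrArg norm (integral_add (i1.sub i2) i3)).symm.trans_le ?_
    have c0 := continuous_gaussCF v σ
    refine (integral_le_of_gauss_bound (n := n + 2)
      (K := (1 + v) ^ (n + 2) * (1 + Real.exp (v / 2)) * Real.exp (v ^ 2 / 2) * σ ^ 2)
      ?_ fun u => ?_).2.trans (le_of_eq ?_)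
    · fun_prop
    · set z : ℂ := (u : ℂ) + Complex.I * v with hz
      set w : ℂ := -(Complex.I * z * σ) / 2 with hw
      have e1 : z ^ n * gaussCF v σ u - z ^ n * Complex.exp (-z ^ 2 / 2) +
          Complex.I * σ / 2 * (z ^ (n + 1) * Complex.exp (-z ^ 2 / 2)) =
          z ^ n * (Complex.exp w - ∑ k ∈ Finset.range 2, w ^ k / (k.factorial : ℂ)) *
            Complex.exp (-z ^ 2 / 2) := by
        rw [gaussCF_eq]
        simp [Finset.sum_range_succ]
        ring
      have hwre : w.re = v * σ / 2 := by simp [hw, hz]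
      have hwn : ‖w‖ ≤ ‖z‖ * σ := by
        rw [hw, norm_div, norm_neg, norm_mul, norm_mul, Complex.norm_I, Complex.norm_real,
          Real.norm_eq_abs, abs_of_pos hσ.1, one_mul]
        have : 0 ≤ ‖z‖ * σ := by have := hσ.1; positivity
        simp
        linarith
      have e2 := norm_cexp_sub_sum_le_add 2 w
      have hzb := pow_le_pow_left₀ (norm_nonneg _) (norm_add_I_mul_le hv u) (n + 2)
      change ‖z ^ n * gaussCF v σ u - z ^ n * Complex.exp (-z ^ 2 / 2) +
          Complex.I * σ / 2 * (z ^ (n + 1) * Complex.exp (-z ^ 2 / 2))‖ ≤ _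
      rw [e1, norm_mul, norm_mul, norm_pow, hz, norm_cexp_neg_sq_div_two, ← hz]
      have e3 : 1 + Real.exp w.re ≤ 1 + Real.exp (v / 2) := by
        rw [hwre]
        have : v * σ / 2 ≤ v / 2 := by nlinarith [hσ.2]
        gcongr
      calc _ ≤ ‖z‖ ^ n * ((‖z‖ * σ) ^ 2 * (1 + Real.exp (v / 2))) *
            (Real.exp (v ^ 2 / 2) * Real.exp (-u ^ 2 / 2)) := by
            gcongr
            exact e2.trans (by gcongr)
        _ = ‖z‖ ^ (n + 2) * ((1 + Real.exp (v / 2)) * σ ^ 2 *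
            (Real.exp (v ^ 2 / 2) * Real.exp (-u ^ 2 / 2))) := by ring
        _ ≤ ((1 + v) * (1 + |u|)) ^ (n + 2) * ((1 + Real.exp (v / 2)) * σ ^ 2 *
            (Real.exp (v ^ 2 / 2) * Real.exp (-u ^ 2 / 2))) := by
            gcongr
        _ = _ := by rw [mul_pow]; ring
    · simp only [K2, hW]; ring
  have s0 : ‖shiftLineMoment v n σ‖ ≤ K0 :=
    (integral_le_of_gauss_bound ((by fun_prop : Continuous fun u : ℝ =>
    ((u : ℂ) + Complex.I * v) ^ n).mul (continuous_gaussCF v σ))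
    (norm_pow_mul_gaussCF_le hv hσ.2 n)).2
  have hK1 : 0 ≤ K1 := by positivity
  have hσ0 := hσ.1
  have s1 : ‖shiftLineMoment v n σ - gaussLineMoment v n‖ ≤ K1 * σ := by
    have : shiftLineMoment v n σ - gaussLineMoment v n =
        (shiftLineMoment v n σ - gaussLineMoment v n +
        Complex.I * σ / 2 * gaussLineMoment v (n + 1)) -
        Complex.I * σ / 2 * gaussLineMoment v (n + 1) := by ring
    rw [this]
    refine (norm_sub_le _ _).trans ?_
    have t : ‖Complex.I * σ / 2 * gaussLineMoment v (n + 1)‖ ≤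
        ‖gaussLineMoment v (n + 1)‖ * σ := by
      rw [norm_mul, norm_div, norm_mul, Complex.norm_I, Complex.norm_real, Real.norm_eq_abs,
        abs_of_pos hσ0]
      have : 0 ≤ ‖gaussLineMoment v (n + 1)‖ * σ := by positivity
      simp
      linarith
    have : K2 * σ ^ 2 ≤ K2 * σ := by
      have : σ ^ 2 ≤ σ := by nlinarith [hσ.2]
      gcongr
    simp only [K1]
    linarith
  refine ⟨by linarith, s1.trans ?_, s2.trans ?_⟩
  · gcongr; linarith
  · have : K2 ≤ K1 := by simp only [K1]; linarith [norm_nonneg (gaussLineMoment v (n + 1))]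
    gcongr
    linarith

/-- The second order Edgeworth type approximation of the characteristic function on the line
`Im z = v`. -/
noncomputable def edgeCF (v σ k₃ k₄ u : ℝ) : ℂ :=
  gaussCF v σ u * (1 - Complex.I * k₃ * ((u : ℂ) + Complex.I * v) ^ 3 -
    (k₃ : ℂ) ^ 2 / 2 * ((u : ℂ) + Complex.I * v) ^ 6 + k₄ * ((u : ℂ) + Complex.I * v) ^ 4)

lemma integral_linear_four {f₀ f₁ f₂ f₃ : ℝ → ℂ} (h₀ : Integrable f₀) (h₁ : Integrable f₁)
    (h₂ : Integrable f₂) (h₃ : Integrable f₃) (a b c : ℂ) :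
    Integrable (fun u => f₀ u + a * f₁ u + b * f₂ u + c * f₃ u) ∧
    ∫ u, (f₀ u + a * f₁ u + b * f₂ u + c * f₃ u) =
      (∫ u, f₀ u) + a * (∫ u, f₁ u) + b * (∫ u, f₂ u) + c * ∫ u, f₃ u := by
  have i1 := h₀.add (h₁.const_mul a)
  have i2 := i1.add (h₂.const_mul b)
  refine ⟨i2.add (h₃.const_mul c), ?_⟩
  rw [← integral_const_mul, ← integral_const_mul, ← integral_const_mul]
  refine (integral_add i2 (h₃.const_mul c)).trans ?_
  congr 1
  refine (integral_add i1 (h₂.const_mul b)).trans ?_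
  congr 1
  exact integral_add h₀ (h₁.const_mul a)

lemma integrable_edgeCF {v σ : ℝ} (hv : 0 < v) (hσ : σ ≤ 1) (k₃ k₄ : ℝ) :
    Integrable (edgeCF v σ k₃ k₄) := by
  have h := integrable_pow_mul_gaussCF hv hσ
  refine (integral_linear_four (h 0) (h 3) (h 6) (h 4) (-(Complex.I * k₃)) (-((k₃ : ℂ) ^ 2 / 2))
    k₄).1.congr (Eventually.of_forall fun u => ?_)
  simp only [edgeCF]
  ring

/-- As v − iu = −i(u + iv), this kernel cancels one power of z exactly and leaves a polynomial times
the Gaussian factor. -/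
lemma inv_sub_I_mul_mul {v : ℝ} (hv : 0 < v) (u : ℝ) :
    ((v : ℂ) - Complex.I * u)⁻¹ * ((u : ℂ) + Complex.I * v) = Complex.I := by
  rw [inv_mul_eq_iff_eq_mul₀ (sub_I_mul_ne_zero hv u)]
  linear_combination (u : ℂ) * Complex.I_sq

lemma norm_two_pi_inv_mul_le (z : ℂ) : ‖(2 * π : ℂ)⁻¹ * z‖ ≤ ‖z‖ := by
  rw [norm_mul, norm_inv, norm_mul, Complex.norm_real, Real.norm_eq_abs, abs_of_pos pi_pos]
  refine mul_le_of_le_one_left (norm_nonneg _) (inv_le_one_of_one_le₀ ?_)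
  simp
  linarith [pi_gt_three]

/-- Values of the three pricing functionals at the Edgeworth approximation. -/
theorem exists_edgeCF_functionals {v : ℝ} (hv : 0 < v) :
    ∃ K > 0, ∀ σ ∈ Ioc (0 : ℝ) 1, ∀ k₃ k₄ : ℝ,
      |((2 * π : ℂ)⁻¹ * ∫ u : ℝ, edgeCF v σ k₃ k₄ u).re -
        (stdNormalPDF (σ / 2) + 3 * k₄ * stdNormalPDF 0)| ≤ K * (σ * |k₃| + σ * |k₄| + k₃ ^ 2) ∧
      |((2 * π : ℂ)⁻¹ * ∫ u : ℝ, ((v : ℂ) - Complex.I * u)⁻¹ * edgeCF v σ k₃ k₄ u).re -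
        (stdNormalCDF (σ / 2) + stdNormalPDF 0 * (k₃ + 3 / 2 * σ * k₄))| ≤
        K * (σ ^ 2 * |k₃| + σ ^ 2 * |k₄| + σ * k₃ ^ 2) ∧
      ‖((2 * π : ℂ)⁻¹ * ∫ u : ℝ, σ * (((v : ℂ) - Complex.I * u)⁻¹ *
        (((v + σ : ℝ) : ℂ) - Complex.I * u)⁻¹) * edgeCF v σ k₃ k₄ u) -
        ((2 * stdNormalCDF (σ / 2) - 1 - σ * k₄ * stdNormalPDF 0 : ℝ) : ℂ)‖ ≤
        K * (σ ^ 2 * |k₃| + σ ^ 2 * |k₄| + σ * k₃ ^ 2) := by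
  choose B hB0 hB using fun n => exists_shiftLineMoment_bound hv n
  have q0 := gaussLineMoment_zero v
  have q1 := gaussLineMoment_one hv
  have q2 : gaussLineMoment v 2 = gaussLineMoment v 0 := by
    simpa using gaussLineMoment_add_two hv 0
  have q3 : gaussLineMoment v 3 = 0 := by
    simpa [q1] using gaussLineMoment_add_two hv 1
  have q4 : gaussLineMoment v 4 = 3 * gaussLineMoment v 0 := by
    rw [gaussLineMoment_add_two hv 2, q2]; norm_num
  have q5 : gaussLineMoment v 5 = 0 := by
    simpa [q3] using gaussLineMoment_add_two hv 3
  set J := gaussLineMoment v with hJ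
  set S : ℝ → ℕ → ℂ := fun σ n => shiftLineMoment v n σ with hS
  set T : ℝ → ℕ → ℂ := fun σ n => ∫ u : ℝ, (((v + σ : ℝ) : ℂ) - Complex.I * u)⁻¹ *
    (((u : ℂ) + Complex.I * v) ^ n * gaussCF v σ u) with hT
  set W : ℕ → ℝ := fun n => v⁻¹ * (((1 + v) ^ n * Real.exp (v / 2 + v ^ 2 / 2)) *
    ∫ u : ℝ, (1 + |u|) ^ n * Real.exp (-u ^ 2 / 2)) with hW
  have hW0 : ∀ n, 0 ≤ W n := fun n => mul_nonneg (by positivity)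
    (mul_nonneg (by positivity) (integral_nonneg fun u => by positivity))
  have hTi : ∀ σ ∈ Ioc (0 : ℝ) 1, ∀ n, Integrable fun u : ℝ =>
      (((v + σ : ℝ) : ℂ) - Complex.I * u)⁻¹ * (((u : ℂ) + Complex.I * v) ^ n * gaussCF v σ u) :=
    fun σ hσ n => (integrable_pow_mul_gaussCF hv hσ.2 n).bdd_mul
      (continuous_inv_sub_I_mul (by linarith [hσ.1])).aestronglyMeasurable
      (Eventually.of_forall fun u => norm_inv_sub_I_mul_le (by linarith [hσ.1]) u)
  have hTb : ∀ σ ∈ Ioc (0 : ℝ) 1, ∀ n, ‖T σ n‖ ≤ W n := by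
    intro σ hσ n
    simp only [hW]
    rw [← integral_const_mul, ← integral_const_mul]
    refine norm_integral_le_of_norm_le (((integrable_one_add_abs_pow_mul_gauss n).const_mul
      _).const_mul _) (Eventually.of_forall fun u => ?_)
    rw [norm_mul]
    refine mul_le_mul ((norm_inv_sub_I_mul_le (by linarith [hσ.1]) u).trans ?_)
      (norm_pow_mul_gaussCF_le hv hσ.2 n u) (norm_nonneg _) (by positivity)
    exact inv_anti₀ hv (by linarith [hσ.1])
  set K : ℝ := B 1 + B 2 + B 3 + B 4 + B 5 + B 6 + W 1 + W 2 + W 5 with hK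
  have b1 := hB0 1
  have b2 := hB0 2
  have b3 := hB0 3
  have b4 := hB0 4
  have b5 := hB0 5
  have b6 := hB0 6
  have w1 := hW0 1
  have w2 := hW0 2
  have w5 := hW0 5
  refine ⟨K, by positivity, fun σ hσ k₃ k₄ => ?_⟩
  have hσ0 := hσ.1
  -- The second kernel cancels a power of z only up to a correction of order σ, because its pole is
  -- shifted from v to v + σ.
  have hR : ∀ u : ℝ, (((v + σ : ℝ) : ℂ) - Complex.I * u)⁻¹ * ((u : ℂ) + Complex.I * v) =
      Complex.I - Complex.I * σ * (((v + σ : ℝ) : ℂ) - Complex.I * u)⁻¹ := by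
    intro u
    have hne := sub_I_mul_ne_zero (by linarith : 0 < v + σ) u
    rw [inv_mul_eq_iff_eq_mul₀ hne, mul_sub, mul_comm (((v + σ : ℝ) : ℂ) - Complex.I * u)
      (Complex.I * σ * _), inv_mul_cancel_right₀ hne]
    push_cast
    linear_combination (u : ℂ) * Complex.I_sq
  have hTstep : ∀ n, T σ (n + 1) = Complex.I * S σ n - Complex.I * σ * T σ n := by
    intro n
    simp only [hT, hS, shiftLineMoment]
    rw [← integral_const_mul, ← integral_const_mul, ← integral_sub
      ((integrable_pow_mul_gaussCF hv hσ.2 n).const_mul _) ((hTi σ hσ n).const_mul _)]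
    congr 1
    ext u
    linear_combination (((u : ℂ) + Complex.I * v) ^ n * gaussCF v σ u) * hR u
  have hi := integrable_pow_mul_gaussCF hv hσ.2
  obtain ⟨g1, g2, g3⟩ := gaussCF_functionals hv hσ0 hσ.2
  refine ⟨?_, ?_, ?_⟩
  -- Third line moments vanish, so k₃ enters with a factor σ; the fourth is 3J₀ and gives 3k₄; the
  -- quadratic term in k₃ is only bounded.
  · have e : ∫ u : ℝ, edgeCF v σ k₃ k₄ u = (∫ u, gaussCF v σ u) + -(Complex.I * k₃) * S σ 3 +
        -((k₃ : ℂ) ^ 2 / 2) * S σ 6 + k₄ * S σ 4 := by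
      refine Eq.trans ?_
        (integral_linear_four (integrable_gaussCF hv hσ.2) (hi 3) (hi 6) (hi 4) _ _ _).2
      congr 1
      ext u
      simp only [edgeCF]
      ring
    have e2 : ((2 * π : ℂ)⁻¹ * ∫ u : ℝ, edgeCF v σ k₃ k₄ u).re -
        (stdNormalPDF (σ / 2) + 3 * k₄ * stdNormalPDF 0) =
        ((2 * π : ℂ)⁻¹ * (-(Complex.I * k₃) * (S σ 3 - J 3) +
        -((k₃ : ℂ) ^ 2 / 2) * S σ 6 + k₄ * (S σ 4 - J 4))).re := by
      have : (2 * π : ℂ)⁻¹ * ∫ u : ℝ, edgeCF v σ k₃ k₄ u =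
          (2 * π : ℂ)⁻¹ * (∫ u, gaussCF v σ u) + ((3 * k₄ * stdNormalPDF 0 : ℝ) : ℂ) +
          (2 * π : ℂ)⁻¹ * (-(Complex.I * k₃) * (S σ 3 - J 3) +
        -((k₃ : ℂ) ^ 2 / 2) * S σ 6 + k₄ * (S σ 4 - J 4)) := by
        rw [e, q3, q4]
        push_cast
        rw [← q0]
        ring
      rw [this, Complex.add_re, Complex.add_re, g1, Complex.ofReal_re]
      ring
    rw [e2]
    refine (Complex.abs_re_le_norm _).trans ((norm_two_pi_inv_mul_le _).trans ?_)
    refine (norm_add₃_le).trans ?_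
    have t3 := (hB 3 σ hσ).2.1
    have t6 := (hB 6 σ hσ).1
    have t4 := (hB 4 σ hσ).2.1
    simp only [norm_mul, norm_neg, Complex.norm_I, Complex.norm_real, Real.norm_eq_abs, one_mul,
      norm_div, norm_pow, sq_abs]
    have n2 : ‖(2 : ℂ)‖ = 2 := by simp
    rw [n2]
    calc _ ≤ |k₃| * (B 3 * σ) + k₃ ^ 2 / 2 * B 6 + |k₄| * (B 4 * σ) := by gcongr
      _ ≤ K * (σ * |k₃|) + K * k₃ ^ 2 + K * (σ * |k₄|) := by
        have : |k₃| * (B 3 * σ) = B 3 * (σ * |k₃|) := by ring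
        have : k₃ ^ 2 / 2 * B 6 ≤ B 6 * k₃ ^ 2 := by nlinarith [sq_nonneg k₃]
        have : |k₄| * (B 4 * σ) = B 4 * (σ * |k₄|) := by ring
        have : B 3 * (σ * |k₃|) ≤ K * (σ * |k₃|) := by gcongr; linarith
        have : B 6 * k₃ ^ 2 ≤ K * k₃ ^ 2 := by gcongr; linarith
        have : B 4 * (σ * |k₄|) ≤ K * (σ * |k₄|) := by gcongr; linarith
        linarith
      _ = _ := by ring
  -- After cancelling one power of z, k₃ meets the second moment J₀. The k₄ term meets a vanishing
  -- third moment, so its first order correction in σ, proportional to J₄ = 3J₀, yields 3σk₄/2. The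
  -- k₃² term gains σ since the fifth moment is zero.
  · have e : ∫ u : ℝ, ((v : ℂ) - Complex.I * u)⁻¹ * edgeCF v σ k₃ k₄ u =
        (∫ u : ℝ, ((v : ℂ) - Complex.I * u)⁻¹ * gaussCF v σ u) + k₃ * S σ 2 +
        -((k₃ : ℂ) ^ 2 / 2 * Complex.I) * S σ 5 + k₄ * Complex.I * S σ 3 := by
      have h0 := (integrable_gaussCF hv hσ.2).bdd_mul
        (continuous_inv_sub_I_mul hv).aestronglyMeasurable
        (Eventually.of_forall fun u => norm_inv_sub_I_mul_le hv u)
      refine Eq.trans ?_ (integral_linear_four h0 (hi 2) (hi 5) (hi 3) _ _ _).2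
      congr 1
      ext u
      have hz := inv_sub_I_mul_mul hv u
      simp only [edgeCF]
      linear_combination gaussCF v σ u * (-Complex.I * k₃ * ((u : ℂ) + Complex.I * v) ^ 2 -
        (k₃ : ℂ) ^ 2 / 2 * ((u : ℂ) + Complex.I * v) ^ 5 +
        k₄ * ((u : ℂ) + Complex.I * v) ^ 3) * hz -
        gaussCF v σ u * k₃ * ((u : ℂ) + Complex.I * v) ^ 2 * Complex.I_sq
    have e2 : ((2 * π : ℂ)⁻¹ * ∫ u : ℝ, ((v : ℂ) - Complex.I * u)⁻¹ * edgeCF v σ k₃ k₄ u).re -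
        (stdNormalCDF (σ / 2) + stdNormalPDF 0 * (k₃ + 3 / 2 * σ * k₄)) =
        ((2 * π : ℂ)⁻¹ * (k₃ * (S σ 2 - J 2 + Complex.I * σ / 2 * J 3) +
        -((k₃ : ℂ) ^ 2 / 2 * Complex.I) * (S σ 5 - J 5) +
          k₄ * Complex.I * (S σ 3 - J 3 + Complex.I * σ / 2 * J 4))).re := by
      have : (2 * π : ℂ)⁻¹ * ∫ u : ℝ, ((v : ℂ) - Complex.I * u)⁻¹ * edgeCF v σ k₃ k₄ u =
          (2 * π : ℂ)⁻¹ * (∫ u : ℝ, ((v : ℂ) - Complex.I * u)⁻¹ * gaussCF v σ u) +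
          ((stdNormalPDF 0 * (k₃ + 3 / 2 * σ * k₄) : ℝ) : ℂ) +
          (2 * π : ℂ)⁻¹ * (k₃ * (S σ 2 - J 2 + Complex.I * σ / 2 * J 3) +
        -((k₃ : ℂ) ^ 2 / 2 * Complex.I) * (S σ 5 - J 5) +
          k₄ * Complex.I * (S σ 3 - J 3 + Complex.I * σ / 2 * J 4)) := by
        rw [e, q3, q4, q5, q2]
        push_cast
        rw [← q0]
        linear_combination (-(2 * π : ℂ)⁻¹ * k₄ * σ * 3 / 2 * J 0) * Complex.I_sq
      rw [this, Complex.add_re, Complex.add_re, g2, Complex.ofReal_re]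
      ring
    rw [e2]
    refine (Complex.abs_re_le_norm _).trans ((norm_two_pi_inv_mul_le _).trans ?_)
    refine (norm_add₃_le).trans ?_
    have t2 := (hB 2 σ hσ).2.2
    have t5 := (hB 5 σ hσ).2.1
    have t3 := (hB 3 σ hσ).2.2
    have n2 : ‖(2 : ℂ)‖ = 2 := by simp
    have n1 : ∀ k : ℝ, ‖(k : ℂ)‖ = |k| := fun k => by simp
    rw [norm_mul, norm_mul _ (S σ 5 - J 5), norm_neg, norm_mul, norm_mul _ (S σ 3 - _ + _),
      norm_mul, Complex.norm_I, n1, n1, norm_div, norm_pow, n1, n2, sq_abs]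
    calc _ ≤ |k₃| * (B 2 * σ ^ 2) + k₃ ^ 2 / 2 * 1 * (B 5 * σ) + |k₄| * 1 * (B 3 * σ ^ 2) := by
          gcongr
      _ ≤ K * (σ ^ 2 * |k₃|) + K * (σ * k₃ ^ 2) + K * (σ ^ 2 * |k₄|) := by
        have : |k₃| * (B 2 * σ ^ 2) = B 2 * (σ ^ 2 * |k₃|) := by ring
        have : k₃ ^ 2 / 2 * 1 * (B 5 * σ) ≤ B 5 * (σ * k₃ ^ 2) := by
          have : 0 ≤ B 5 * (σ * k₃ ^ 2) := by positivity
          linarith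
        have : |k₄| * 1 * (B 3 * σ ^ 2) = B 3 * (σ ^ 2 * |k₄|) := by ring
        have : B 2 * (σ ^ 2 * |k₃|) ≤ K * (σ ^ 2 * |k₃|) := by gcongr; linarith
        have : B 5 * (σ * k₃ ^ 2) ≤ K * (σ * k₃ ^ 2) := by gcongr; linarith
        have : B 3 * (σ ^ 2 * |k₄|) ≤ K * (σ ^ 2 * |k₄|) := by gcongr; linarith
        linarith
      _ = _ := by ring
  -- Here both kernels act, with a prefactor σ. The k₄ term reduces to −σk₄J₀; the k₃ term meets a
  -- vanishing first moment and is O(σ²|k₃|).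
  · have e : ∫ u : ℝ, σ * (((v : ℂ) - Complex.I * u)⁻¹ *
        (((v + σ : ℝ) : ℂ) - Complex.I * u)⁻¹) * edgeCF v σ k₃ k₄ u =
        (∫ u : ℝ, σ * (((v : ℂ) - Complex.I * u)⁻¹ *
        (((v + σ : ℝ) : ℂ) - Complex.I * u)⁻¹) * gaussCF v σ u) + σ * k₃ * T σ 2 +
        -(σ * (k₃ : ℂ) ^ 2 / 2 * Complex.I) * T σ 5 + σ * k₄ * Complex.I * T σ 3 := by
      have h0 : Integrable fun u : ℝ => σ * (((v : ℂ) - Complex.I * u)⁻¹ *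
        (((v + σ : ℝ) : ℂ) - Complex.I * u)⁻¹) * gaussCF v σ u := by
        have := ((integrable_gaussCF hv hσ.2).bdd_mul
          (continuous_inv_sub_I_mul (by linarith : 0 < v + σ)).aestronglyMeasurable
          (Eventually.of_forall fun u => norm_inv_sub_I_mul_le (by linarith) u)).bdd_mul
          (continuous_inv_sub_I_mul hv).aestronglyMeasurable
          (Eventually.of_forall fun u => norm_inv_sub_I_mul_le hv u)
        exact (this.const_mul (σ : ℂ)).congr (Eventually.of_forall fun u => by ring)
      rw [hT, ← (integral_linear_four h0 (hTi σ hσ 2) (hTi σ hσ 5) (hTi σ hσ 3) _ _ _).2]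
      congr 1
      ext u
      have hz := inv_sub_I_mul_mul hv u
      simp only [edgeCF]
      generalize (((v + σ : ℝ) : ℂ) - Complex.I * u)⁻¹ = R
      linear_combination σ * R * gaussCF v σ u *
        (-Complex.I * k₃ * ((u : ℂ) + Complex.I * v) ^ 2 -
        (k₃ : ℂ) ^ 2 / 2 * ((u : ℂ) + Complex.I * v) ^ 5 +
        k₄ * ((u : ℂ) + Complex.I * v) ^ 3) * hz -
        σ * R * gaussCF v σ u * k₃ * ((u : ℂ) + Complex.I * v) ^ 2 * Complex.I_sq
    have e2 : ((2 * π : ℂ)⁻¹ * ∫ u : ℝ, σ * (((v : ℂ) - Complex.I * u)⁻¹ *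
        (((v + σ : ℝ) : ℂ) - Complex.I * u)⁻¹) * edgeCF v σ k₃ k₄ u) -
        ((2 * stdNormalCDF (σ / 2) - 1 - σ * k₄ * stdNormalPDF 0 : ℝ) : ℂ) =
        (2 * π : ℂ)⁻¹ * (σ * k₃ * (Complex.I * (S σ 1 - J 1) - Complex.I * σ * T σ 1) +
        -(σ * (k₃ : ℂ) ^ 2 / 2 * Complex.I) * T σ 5 +
        σ * k₄ * (-(S σ 2 - J 2) + σ * T σ 2)) := by
      rw [Complex.ofReal_sub, ← g3, e, hTstep 2, hTstep 1, q1, q2]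
      push_cast
      rw [← q0]
      linear_combination ((2 * π : ℂ)⁻¹ * σ * k₄ * (S σ 2 -
        σ * (Complex.I * S σ 1 - Complex.I * σ * T σ 1))) * Complex.I_sq
    rw [e2]
    refine (norm_two_pi_inv_mul_le _).trans ?_
    refine (norm_add₃_le).trans ?_
    have t1 := (hB 1 σ hσ).2.1
    have t2 := (hB 2 σ hσ).2.1
    have u1 := hTb σ hσ 1
    have u2 := hTb σ hσ 2
    have u5 := hTb σ hσ 5
    have n2 : ‖(2 : ℂ)‖ = 2 := by simp
    have n1 : ∀ k : ℝ, ‖(k : ℂ)‖ = |k| := fun k => by simp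
    have nσ : ‖(σ : ℂ)‖ = σ := by rw [n1, abs_of_pos hσ0]
    have m1 : ‖Complex.I * (S σ 1 - J 1) - Complex.I * σ * T σ 1‖ ≤ (B 1 + W 1) * σ := by
      refine (norm_sub_le _ _).trans ?_
      rw [norm_mul, norm_mul, norm_mul, Complex.norm_I, nσ]
      have := mul_le_mul_of_nonneg_left u1 hσ0.le
      linarith
    have m2 : ‖-(S σ 2 - J 2) + σ * T σ 2‖ ≤ (B 2 + W 2) * σ := by
      refine (norm_add_le _ _).trans ?_
      rw [norm_neg, norm_mul, nσ]
      have := mul_le_mul_of_nonneg_left u2 hσ0.le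
      linarith
    rw [norm_mul, norm_mul _ (T σ 5), norm_neg, norm_mul, norm_mul _ (-(S σ 2 - _) + _),
      norm_mul, Complex.norm_I, n1 k₃, norm_mul (σ : ℂ) (k₄ : ℂ), n1 k₄, norm_div, norm_mul,
      norm_pow, nσ, n1, n2, sq_abs]
    calc _ ≤ σ * |k₃| * ((B 1 + W 1) * σ) + σ * k₃ ^ 2 / 2 * 1 * W 5 +
          σ * |k₄| * ((B 2 + W 2) * σ) := by
          gcongr
      _ ≤ K * (σ ^ 2 * |k₃|) + K * (σ * k₃ ^ 2) + K * (σ ^ 2 * |k₄|) := by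
        have : σ * |k₃| * ((B 1 + W 1) * σ) = (B 1 + W 1) * (σ ^ 2 * |k₃|) := by ring
        have : σ * k₃ ^ 2 / 2 * 1 * W 5 ≤ W 5 * (σ * k₃ ^ 2) := by
          have : 0 ≤ W 5 * (σ * k₃ ^ 2) := by positivity
          linarith
        have : σ * |k₄| * ((B 2 + W 2) * σ) = (B 2 + W 2) * (σ ^ 2 * |k₄|) := by ring
        have : (B 1 + W 1) * (σ ^ 2 * |k₃|) ≤ K * (σ ^ 2 * |k₃|) := by gcongr; linarith
        have : W 5 * (σ * k₃ ^ 2) ≤ K * (σ * k₃ ^ 2) := by gcongr; linarith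
        have : (B 2 + W 2) * (σ ^ 2 * |k₄|) ≤ K * (σ ^ 2 * |k₄|) := by gcongr; linarith
        linarith
      _ = _ := by ring

/-! ### From price expansions to implied volatility expansions -/

lemma mul_sub_le_stdNormalCDF_sub {x y : ℝ} (hx : 0 ≤ x) (hxy : x ≤ y) (hy : y ≤ 1) :
    stdNormalPDF 1 * (y - x) ≤ stdNormalCDF y - stdNormalCDF x := by
  refine (convex_Icc (0 : ℝ) 1).mul_sub_le_image_sub_of_le_deriv
    (fun t _ => (hasDerivAt_stdNormalCDF t).continuousAt.continuousWithinAt)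
    (fun t _ => (hasDerivAt_stdNormalCDF t).differentiableAt.differentiableWithinAt)
    (fun t ht => ?_) x ⟨hx, hxy.trans hy⟩ y ⟨hx.trans hxy, hy⟩ hxy
  rw [interior_Icc] at ht
  rw [(hasDerivAt_stdNormalCDF t).deriv]
  exact stdNormalPDF_anti ht.1.le ht.2.le

lemma abs_stdNormalCDF_sub_le {m x y : ℝ} (hx : x ∈ Icc 0 m) (hy : y ∈ Icc 0 m) :
    |stdNormalCDF y - stdNormalCDF x - stdNormalPDF 0 * (y - x)| ≤
      stdNormalPDF 0 * m ^ 2 * |y - x| := by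
  have h := (convex_Icc (0 : ℝ) m).norm_image_sub_le_of_norm_hasDerivWithin_le
    (f := fun t => stdNormalCDF t - stdNormalPDF 0 * t)
    (f' := fun t => stdNormalPDF t - stdNormalPDF 0) (C := stdNormalPDF 0 * m ^ 2)
    (fun t _ => ((hasDerivAt_stdNormalCDF t).sub (by
      simpa using (hasDerivAt_id t).const_mul (stdNormalPDF 0))).hasDerivWithinAt)
    (fun t ht => by
      refine (stdNormalPDF_zero_sub_le t).trans ?_
      exact mul_le_mul_of_nonneg_left (pow_le_pow_left₀ ht.1 ht.2 2) (stdNormalPDF_pos 0).le)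
    hx hy
  simp only [Real.norm_eq_abs] at h
  convert h using 2
  ring

lemma abs_stdNormalPDF_sub_le {m x y : ℝ} (hx : x ∈ Icc 0 m) (hy : y ∈ Icc 0 m) :
    |stdNormalPDF y - stdNormalPDF x| ≤ m * stdNormalPDF 0 * |y - x| :=
  (convex_Icc (0 : ℝ) m).norm_image_sub_le_of_norm_hasDerivWithin_le
    (fun t _ => (hasDerivAt_stdNormalPDF t).hasDerivWithinAt)
    (fun t ht => by
      rw [norm_neg, Real.norm_eq_abs, abs_mul, abs_of_nonneg ht.1,
        abs_of_pos (stdNormalPDF_pos t)]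
      exact mul_le_mul ht.2 (stdNormalPDF_le t) (stdNormalPDF_pos t).le (ht.1.trans ht.2))
    hx hy

lemma sq_add_three_le (x y z : ℝ) : (x + y + z) ^ 2 ≤ 3 * (x ^ 2 + y ^ 2 + z ^ 2) := by
  nlinarith [sq_nonneg (x - y), sq_nonneg (x - z), sq_nonneg (y - z)]

set_option maxHeartbeats 1000000 in
/-- From expansions of the at-the-money price and its derivatives to expansions of the total
implied volatility and its derivatives. -/
theorem exists_total_vol_expansion (K : ℝ) (hK : 0 < K) :
    ∃ A > 0, ∃ η > 0, ∀ σ ∈ Ioc (0 : ℝ) 1, ∀ k₃ k₄ ε δ e p a f s : ℝ, 0 ≤ ε →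
      δ = σ * |k₃| + σ * |k₄| + k₃ ^ 2 + ε →
      e = σ ^ 2 * |k₃| + σ ^ 2 * |k₄| + σ * k₃ ^ 2 + ε →
      |σ * f - (stdNormalPDF (σ / 2) + 3 * k₄ * stdNormalPDF 0)| ≤ K * δ →
      |a - (stdNormalCDF (σ / 2) + stdNormalPDF 0 * (k₃ + 3 / 2 * σ * k₄))| ≤ K * e →
      |p - (2 * stdNormalCDF (σ / 2) - 1 - σ * k₄ * stdNormalPDF 0)| ≤ K * (σ * δ) →
      0 < s → 2 * stdNormalCDF (s / 2) - 1 = p → |k₄| ≤ η → δ ≤ η →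
      |(a - stdNormalCDF (s / 2)) / stdNormalPDF (s / 2) - (k₃ + 2 * σ * k₄)| ≤ A * e ∧
      |σ * (f / stdNormalPDF (s / 2) - 1 / s +
        s / 4 * ((a - stdNormalCDF (s / 2)) / stdNormalPDF (s / 2)) ^ 2) - 2 * k₄| ≤
          A * (δ + k₄ ^ 2) := by
  set φ := stdNormalPDF 0 with hφ
  set c := stdNormalPDF 1 with hc
  have φ0 : 0 < φ := stdNormalPDF_pos 0
  have c0 : 0 < c := stdNormalPDF_pos 1
  set r := φ / c with hr
  have r0 : 0 < r := by positivity
  set B := r + K / c + K / φ with hB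
  have hB0 : 0 < B := by positivity
  set A₁ := 2 * K / c + 2 * r with hA₁
  have hA₁0 : 0 < A₁ := by positivity
  set A₂ := K / c + r * (1 + B) + 3 * r + 4 * B ^ 2 + B + 4 + 2 * (1 + 4 + A₁ ^ 2) with hA₂
  have hA₂0 : 0 < A₂ := by positivity
  refine ⟨A₁ + A₂, by positivity, min 1 (c / (4 * (φ + K))), by positivity, ?_⟩
  intro σ hσ k₃ k₄ ε δ e p a f s hε hδ he H1 H2 H3 hs hsp hk hδη
  obtain ⟨hσ0, hσ1⟩ := hσ
  have hk1 : |k₄| ≤ 1 := hk.trans (min_le_left _ _)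
  have hδ1 : δ ≤ 1 := hδη.trans (min_le_left _ _)
  have hδ0 : 0 ≤ δ := by rw [hδ]; positivity
  have he0 : 0 ≤ e := by rw [he]; positivity
  -- The threshold c/(4(φ+K)) is chosen for this bound: the price deviation then stays below cσ/4,
  -- too small to move s far from σ.
  have hsmall : |k₄| * φ + K * δ ≤ c / 4 := by
    have h1 := hk.trans (min_le_right _ _)
    have h2 := hδη.trans (min_le_right _ _)
    calc _ ≤ c / (4 * (φ + K)) * φ + K * (c / (4 * (φ + K))) := by gcongr
      _ = c / 4 := by field_simp
  have hσ2 : σ ^ 2 ≤ 1 := pow_le_one₀ hσ0.le hσ1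
  have hσσ : σ ^ 2 ≤ σ := by rw [sq]; exact mul_le_of_le_one_left hσ0.le hσ1
  have a3 := abs_nonneg k₃
  have a4 := abs_nonneg k₄
  have hσδe : σ * δ ≤ e := by
    have h1 : σ * ε ≤ ε := mul_le_of_le_one_left hε hσ1
    have h2 : σ * δ = σ ^ 2 * |k₃| + σ ^ 2 * |k₄| + σ * k₃ ^ 2 + σ * ε := by rw [hδ]; ring
    rw [h2, he]
    linarith
  have heδ : e ≤ δ := by
    rw [hδ, he]
    have h1 : σ ^ 2 * |k₃| ≤ σ * |k₃| := by gcongr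
    have h2 : σ ^ 2 * |k₄| ≤ σ * |k₄| := by gcongr
    have h3 : σ * k₃ ^ 2 ≤ k₃ ^ 2 := mul_le_of_le_one_left (sq_nonneg _) hσ1
    linarith
  set D := p - (2 * stdNormalCDF (σ / 2) - 1) with hD
  have hDe : |D + σ * k₄ * φ| ≤ K * (σ * δ) := by
    rw [show D + σ * k₄ * φ = p - (2 * stdNormalCDF (σ / 2) - 1 - σ * k₄ * φ) by rw [hD]; ring]
    exact H3
  have hDb : |D| ≤ σ * (|k₄| * φ + K * δ) := by
    have h1 : |D| ≤ |D + σ * k₄ * φ| + |σ * k₄ * φ| := by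
      have := abs_sub (D + σ * k₄ * φ) (σ * k₄ * φ)
      rwa [add_sub_cancel_right] at this
    rw [abs_mul, abs_mul, abs_of_pos hσ0, abs_of_pos φ0] at h1
    linarith
  have hDs : D = 2 * (stdNormalCDF (s / 2) - stdNormalCDF (σ / 2)) := by rw [hD, ← hsp]; ring
  -- A priori bound: for s > 2σ monotonicity would force D ≥ cσ. It also places s/2 and σ/2 in [0,
  -- σ], where the density is at least c.
  have hs2 : s ≤ 2 * σ := by
    by_contra! hlt
    have h1 := mul_sub_le_stdNormalCDF_sub (x := σ / 2) (y := σ) (by positivity)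
      (by linarith) hσ1
    have h2 : stdNormalCDF σ ≤ stdNormalCDF (s / 2) := monotone_cdf _ (by linarith)
    have h3 : c * σ ≤ D := by rw [hDs]; linarith
    have h4 := (le_abs_self D).trans (hDb.trans (mul_le_mul_of_nonneg_left hsmall hσ0.le))
    have : 0 < c * σ := by positivity
    linarith
  have hcd : c * |s - σ| ≤ |D| := by
    rcases le_total σ s with h | h
    · have h1 := mul_sub_le_stdNormalCDF_sub (x := σ / 2) (y := s / 2) (by positivity)
        (by linarith) (by linarith)
      rw [abs_of_nonneg (by linarith)]
      refine le_trans ?_ (le_abs_self D)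
      rw [hDs]; linarith
    · have h1 := mul_sub_le_stdNormalCDF_sub (x := s / 2) (y := σ / 2) (by positivity)
        (by linarith) (by linarith)
      rw [abs_of_nonpos (by linarith)]
      refine le_trans ?_ (neg_le_abs D)
      rw [hDs]; linarith
  -- Relative deviation of the total volatility; the target is x = −k₄ + O(δ).
  obtain ⟨x, hx⟩ : ∃ x, s = σ * (1 + x) := ⟨s / σ - 1, by field_simp; ring⟩
  have hsσ : s - σ = σ * x := by rw [hx]; ring
  rw [hsσ, abs_mul, abs_of_pos hσ0] at hcd
  have hxc : c * |x| ≤ |k₄| * φ + K * δ := by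
    have : σ * (c * |x|) ≤ σ * (|k₄| * φ + K * δ) := by linarith
    exact le_of_mul_le_mul_left this hσ0
  have hx2 : |x| ≤ 1 / 2 := by
    by_contra! h
    have : c * (1 / 2) < c * |x| := by gcongr
    linarith
  have hxb : |x| ≤ |k₄| * r + K / c * δ := by
    rw [hr, show |k₄| * (φ / c) + K / c * δ = (|k₄| * φ + K * δ) / c by field_simp,
      le_div_iff₀ c0]
    linarith
  have hmem1 : σ / 2 ∈ Icc 0 σ := ⟨by positivity, by linarith⟩
  have hmem2 : s / 2 ∈ Icc 0 σ := ⟨by positivity, by linarith⟩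
  -- Linearizing the distribution function at 0 gives φσx = D + O(σ³|x|), while D = −σk₄φ + O(σδ);
  -- dividing by φσ leaves O(δ).
  have hxk : |x + k₄| ≤ B * δ := by
    have h1 := abs_stdNormalCDF_sub_le hmem1 hmem2
    have h2 : |φ * (σ * x) - D| ≤ φ * σ ^ 2 * (σ * |x|) := by
      rw [abs_sub_comm, hDs]
      rw [show s / 2 - σ / 2 = σ * x / 2 by rw [← hsσ]; ring, abs_div, abs_mul,
        abs_of_pos hσ0] at h1
      rw [show 2 * (stdNormalCDF (s / 2) - stdNormalCDF (σ / 2)) - φ * (σ * x) =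
        2 * (stdNormalCDF (s / 2) - stdNormalCDF (σ / 2) - φ * (σ * x / 2)) by ring, abs_mul]
      have t2 : |(2 : ℝ)| = 2 := by norm_num
      rw [t2] at h1 ⊢
      linarith
    have h3 : |φ * σ * (x + k₄)| ≤ φ * σ ^ 2 * (σ * |x|) + K * (σ * δ) := by
      rw [show φ * σ * (x + k₄) = (φ * (σ * x) - D) + (D + σ * k₄ * φ) by ring]
      exact (abs_add_le _ _).trans (add_le_add h2 hDe)
    rw [abs_mul, abs_of_pos (by positivity : 0 < φ * σ)] at h3
    have h4 : |x + k₄| ≤ σ ^ 2 * |x| + K / φ * δ := by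
      have : φ * σ * |x + k₄| ≤ φ * σ * (σ ^ 2 * |x| + K / φ * δ) := by
        refine h3.trans (le_of_eq ?_)
        field_simp
      exact le_of_mul_le_mul_left this (by positivity)
    have h5 : σ ^ 2 * |x| ≤ r * δ + K / c * δ := by
      have h6 : σ ^ 2 * |k₄| ≤ δ := by
        rw [hδ]
        have : σ ^ 2 * |k₄| ≤ σ * |k₄| := by gcongr
        have : 0 ≤ σ * |k₃| := by positivity
        linarith [sq_nonneg k₃]
      calc σ ^ 2 * |x| ≤ σ ^ 2 * (|k₄| * r + K / c * δ) := by gcongr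
        _ = r * (σ ^ 2 * |k₄|) + σ ^ 2 * (K / c * δ) := by ring
        _ ≤ r * δ + 1 * (K / c * δ) := by gcongr
        _ = _ := by ring
    rw [hB]
    linarith
  have hxk' : |x| ≤ |k₄| + B * δ := by
    have := abs_sub (x + k₄) k₄
    rw [add_sub_cancel_right] at this
    linarith
  set q := stdNormalPDF (s / 2) with hq
  have q0 : 0 < q := stdNormalPDF_pos _
  have hcq : c ≤ q := stdNormalPDF_anti (by positivity) (by linarith)
  have hφq : |φ / q - 1| ≤ r * σ ^ 2 := by
    have h1 := stdNormalPDF_zero_sub_le (s / 2)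
    rw [div_sub_one q0.ne', abs_div, abs_of_pos q0, div_le_iff₀ q0]
    rw [abs_sub_comm] at h1
    calc |φ - q| ≤ φ * (s / 2) ^ 2 := h1
      _ ≤ φ * σ ^ 2 := by gcongr; linarith
      _ = r * σ ^ 2 * c := by rw [hr]; field_simp
      _ ≤ r * σ ^ 2 * q := by gcongr
  have hσk4 : σ ^ 2 * |k₄| ≤ δ := by
    rw [hδ]
    have : σ ^ 2 * |k₄| ≤ σ * |k₄| := by gcongr
    have : 0 ≤ σ * |k₃| := by positivity
    linarith [sq_nonneg k₃]
  set s' := (a - stdNormalCDF (s / 2)) / q with hs'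
  have main1 : |s' - (k₃ + 2 * σ * k₄)| ≤ A₁ * e := by
    -- The coefficient 2 is 3/2 from the expansion of a plus 1/2 from the shift D/2 of the
    -- distribution function between σ/2 and s/2.
    have h1 : |a - stdNormalCDF (s / 2) - φ * (k₃ + 2 * σ * k₄)| ≤ 2 * K * e := by
      have e1 : a - stdNormalCDF (s / 2) - φ * (k₃ + 2 * σ * k₄) =
          (a - (stdNormalCDF (σ / 2) + φ * (k₃ + 3 / 2 * σ * k₄))) - (D + σ * k₄ * φ) / 2 := by
        rw [hDs]; ring
      rw [e1]
      refine (abs_sub _ _).trans ?_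
      rw [abs_div, abs_of_pos (two_pos : (0 : ℝ) < 2)]
      have := mul_le_mul_of_nonneg_left hσδe hK.le
      have : 0 ≤ K * e := by positivity
      linarith
    have e2 : s' - (k₃ + 2 * σ * k₄) = (a - stdNormalCDF (s / 2) - φ * (k₃ + 2 * σ * k₄)) / q +
        (k₃ + 2 * σ * k₄) * (φ / q - 1) := by
      rw [hs']; field_simp; ring
    rw [e2]
    refine (abs_add_le _ _).trans ?_
    rw [abs_div, abs_of_pos q0, abs_mul]
    have h2 : |k₃ + 2 * σ * k₄| ≤ |k₃| + 2 * σ * |k₄| := by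
      refine (abs_add_le _ _).trans ?_
      rw [abs_mul, abs_of_pos (by positivity : 0 < 2 * σ)]
    have h3 : (|k₃| + 2 * σ * |k₄|) * σ ^ 2 ≤ 2 * e := by
      rw [he]
      have : σ * |k₄| * σ ^ 2 ≤ σ ^ 2 * |k₄| := by
        have : σ * (σ ^ 2 * |k₄|) ≤ 1 * (σ ^ 2 * |k₄|) := by gcongr
        linarith
      have : 0 ≤ σ ^ 2 * |k₃| := by positivity
      have : 0 ≤ σ * k₃ ^ 2 := by positivity
      linarith
    calc _ ≤ 2 * K * e / c + (|k₃| + 2 * σ * |k₄|) * (r * σ ^ 2) := by gcongr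
      _ = 2 * K / c * e + r * ((|k₃| + 2 * σ * |k₄|) * σ ^ 2) := by ring
      _ ≤ 2 * K / c * e + r * (2 * e) := by gcongr
      _ = A₁ * e := by rw [hA₁]; ring
  refine ⟨main1.trans (by gcongr; linarith), ?_⟩
  have hx1 : 0 < 1 + x := by linarith [neg_abs_le x]
  have t1 : |σ * f / q - (1 + 3 * k₄)| ≤ (K / c + r * (1 + B) + 3 * r) * δ := by
    have e1 : σ * f / q - (1 + 3 * k₄) =
        (σ * f - (stdNormalPDF (σ / 2) + 3 * k₄ * φ)) / q + (stdNormalPDF (σ / 2) - q) / q +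
          3 * k₄ * (φ / q - 1) := by field_simp; ring
    rw [e1]
    refine (abs_add_three _ _ _).trans ?_
    rw [abs_div, abs_div, abs_of_pos q0, abs_mul, abs_mul]
    have h1 := abs_stdNormalPDF_sub_le hmem2 hmem1
    rw [show σ / 2 - s / 2 = -(σ * x / 2) by rw [← hsσ]; ring, abs_neg, abs_div, abs_mul,
      abs_of_pos hσ0, abs_of_pos (two_pos : (0 : ℝ) < 2)] at h1
    have h2 : σ ^ 2 * |x| ≤ (1 + B) * δ := by
      calc σ ^ 2 * |x| ≤ σ ^ 2 * (|k₄| + B * δ) := by gcongr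
        _ = σ ^ 2 * |k₄| + σ ^ 2 * (B * δ) := by ring
        _ ≤ δ + 1 * (B * δ) := by gcongr
        _ = _ := by ring
    have h3 : σ * φ * (σ * |x| / 2) ≤ φ * ((1 + B) * δ) := by
      have : φ * (σ ^ 2 * |x|) ≤ φ * ((1 + B) * δ) := by gcongr
      have : 0 ≤ φ * (σ ^ 2 * |x|) := by positivity
      linarith
    have t3 : |(3 : ℝ)| = 3 := by norm_num
    rw [t3]
    calc _ ≤ K * δ / c + φ * ((1 + B) * δ) / c + 3 * |k₄| * (r * σ ^ 2) := by
          gcongr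
          exact h1.trans h3
      _ = K / c * δ + r * (1 + B) * δ + 3 * r * (σ ^ 2 * |k₄|) := by rw [hr]; field_simp
      _ ≤ K / c * δ + r * (1 + B) * δ + 3 * r * δ := by gcongr
      _ = _ := by ring
  -- σ/s = 1/(1+x) = 1 − x + x²/(1+x), with x close to −k₄ and 1+x ≥ 1/2.
  have t2 : |σ / s - (1 + k₄)| ≤ (4 * B ^ 2 + B) * δ + 4 * k₄ ^ 2 := by
    have e1 : σ / s - (1 + k₄) = x ^ 2 / (1 + x) - (x + k₄) := by
      rw [hx]; field_simp; ring
    rw [e1]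
    refine (abs_sub _ _).trans ?_
    have h1 : |x ^ 2 / (1 + x)| ≤ 2 * x ^ 2 := by
      rw [abs_of_nonneg (by positivity), div_le_iff₀ hx1]
      have h2 : 1 / 2 ≤ 1 + x := by linarith [neg_abs_le x]
      have := mul_le_mul_of_nonneg_left h2 (sq_nonneg x)
      linarith
    have h2 : x ^ 2 ≤ 2 * k₄ ^ 2 + 2 * (B ^ 2 * δ) := by
      have h3 : x ^ 2 ≤ (|k₄| + B * δ) ^ 2 := by
        rw [← sq_abs x]; gcongr
      have h4 : (B * δ) ^ 2 ≤ B ^ 2 * δ := by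
        rw [mul_pow]
        have : δ ^ 2 ≤ δ := by rw [sq]; exact mul_le_of_le_one_left hδ0 hδ1
        gcongr
      have h5 : |k₄| ^ 2 = k₄ ^ 2 := sq_abs _
      have h6 := add_sq_le (a := |k₄|) (b := B * δ)
      linarith
    have h3 : 2 * x ^ 2 ≤ 4 * k₄ ^ 2 + 4 * B ^ 2 * δ := by linarith
    linarith
  have t3 : |σ * (s / 4 * s' ^ 2)| ≤ 2 * (1 + 4 + A₁ ^ 2) * (δ + k₄ ^ 2) := by
    rw [abs_of_nonneg (by positivity)]
    have h1 : |s'| ≤ |k₃| + 2 * σ * |k₄| + A₁ * e := by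
      have h2 : |k₃ + 2 * σ * k₄| ≤ |k₃| + 2 * σ * |k₄| := by
        refine (abs_add_le _ _).trans ?_
        rw [abs_mul, abs_of_pos (by positivity : 0 < 2 * σ)]
      have := abs_add_le (s' - (k₃ + 2 * σ * k₄)) (k₃ + 2 * σ * k₄)
      rw [sub_add_cancel] at this
      linarith
    have h2 : s' ^ 2 ≤ 3 * (k₃ ^ 2 + 4 * (σ ^ 2 * k₄ ^ 2) + A₁ ^ 2 * e ^ 2) := by
      rw [← sq_abs s', ← sq_abs k₃, ← sq_abs k₄]
      refine (pow_le_pow_left₀ (abs_nonneg _) h1 2).trans ?_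
      refine (sq_add_three_le _ _ _).trans (le_of_eq ?_)
      ring
    have h3 : k₃ ^ 2 ≤ δ := by
      rw [hδ]
      have : 0 ≤ σ * |k₃| := by positivity
      have : 0 ≤ σ * |k₄| := by positivity
      linarith
    have h4 : e ^ 2 ≤ δ := by
      rw [sq]
      exact (mul_le_of_le_one_left he0 (heδ.trans hδ1)).trans heδ
    have h5 : σ ^ 2 * k₄ ^ 2 ≤ k₄ ^ 2 := mul_le_of_le_one_left (sq_nonneg _) hσ2
    have h6 : s' ^ 2 ≤ 3 * (1 + 4 + A₁ ^ 2) * (δ + k₄ ^ 2) := by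
      refine h2.trans ?_
      have : A₁ ^ 2 * e ^ 2 ≤ A₁ ^ 2 * δ := by gcongr
      have : 0 ≤ A₁ ^ 2 * k₄ ^ 2 := by positivity
      have : 0 ≤ k₄ ^ 2 := sq_nonneg _
      linarith
    have h7 : σ * (s / 4 * s' ^ 2) ≤ 1 / 2 * s' ^ 2 := by
      have h8 : σ * s ≤ 1 * (2 * 1) := by gcongr; linarith
      have : σ * s * s' ^ 2 ≤ 1 * (2 * 1) * s' ^ 2 := by gcongr
      linarith
    have : 0 ≤ (1 + 4 + A₁ ^ 2) * (δ + k₄ ^ 2) := by positivity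
    linarith
  -- The density contributes 1 + 3k₄ and the term σ/s removes 1 + k₄, which leaves 2k₄; the squared
  -- slope is of lower order.
  have e0 : σ * (f / q - 1 / s + s / 4 * s' ^ 2) - 2 * k₄ =
      (σ * f / q - (1 + 3 * k₄)) - (σ / s - (1 + k₄)) + σ * (s / 4 * s' ^ 2) := by ring
  rw [e0]
  refine (abs_add_le _ _).trans ((add_le_add_left (abs_sub _ _) _).trans ?_)
  have z1 : 0 ≤ k₄ ^ 2 := sq_nonneg _
  have z2 : 0 ≤ K / c + r * (1 + B) + 3 * r + 4 * B ^ 2 + B := by positivity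
  have z3 : 0 ≤ A₁ * (δ + k₄ ^ 2) := by positivity
  have z4 : 0 ≤ (K / c + r * (1 + B) + 3 * r + 4 * B ^ 2 + B) * k₄ ^ 2 := by positivity
  rw [hA₂]
  linarith

lemma unitPut_zero_lt_one {ρ : Measure ℝ} [IsProbabilityMeasure ρ] (h : Integrable Real.exp ρ) :
    unitPut ρ 0 < 1 := by
  have hi : Integrable (fun x => max (Real.exp 0 - Real.exp x) 0) ρ :=
    ((integrable_const (Real.exp 0)).sub h).pos_part
  have h1 : 0 < ∫ x, (1 - max (Real.exp 0 - Real.exp x) 0) ∂ρ := by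
    have hpos : ∀ x : ℝ, 0 < 1 - max (Real.exp 0 - Real.exp x) 0 := fun x => by
      rw [Real.exp_zero, sub_pos]
      exact max_lt (by linarith [Real.exp_pos x]) one_pos
    refine (integral_pos_iff_support_of_nonneg (fun x => (hpos x).le)
      ((integrable_const 1).sub hi)).2 ?_
    rw [Function.support_eq_univ fun x => (hpos x).ne', measure_univ]
    exact one_pos
  rw [integral_sub (integrable_const 1) hi] at h1
  simp only [integral_const, probReal_univ, smul_eq_mul, mul_one] at h1
  unfold unitPut
  linarith

/-- Existence and smoothness of the implied volatility near the money, with formulas for its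
derivatives at the money in terms of the rescaled characteristic function `ψ`. -/
theorem impliedVol_at_money {ρ : Measure ℝ} [IsProbabilityMeasure ρ] {v σ θ S₀ : ℝ} (r : ℝ)
    (hv : 0 < v) (hσ : 0 < σ) (hθ : 0 < θ) (hS₀ : 0 < S₀) {ψ : ℝ → ℂ}
    (hint : Integrable (fun x => Real.exp (-(v / σ) * x)) ρ)
    (hψ : ∀ u : ℝ, complexCharFun ρ ((u + Complex.I * v) / σ) = ψ u) (hψi : Integrable ψ)
    (hexp : Integrable Real.exp ρ) (hpos : 0 < unitPut ρ 0) :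
    (∀ᶠ k in 𝓝 (0 : ℝ), IsImpliedVol S₀ r ρ θ k (impliedVol S₀ r ρ θ k)) ∧
    ContDiffAt ℝ 2 (impliedVol S₀ r ρ θ) 0 ∧
    ∃ p a f s : ℝ, 0 < s ∧ 2 * stdNormalCDF (s / 2) - 1 = p ∧
      (p : ℂ) = (2 * π : ℂ)⁻¹ * ∫ u : ℝ, σ * (((v : ℂ) - Complex.I * u)⁻¹ *
        (((v + σ : ℝ) : ℂ) - Complex.I * u)⁻¹) * ψ u ∧
      a = ((2 * π : ℂ)⁻¹ * ∫ u : ℝ, ((v : ℂ) - Complex.I * u)⁻¹ * ψ u).re ∧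
      σ * f = ((2 * π : ℂ)⁻¹ * ∫ u : ℝ, ψ u).re ∧
      √θ * deriv (impliedVol S₀ r ρ θ) 0 =
        (a - stdNormalCDF (s / 2)) / stdNormalPDF (s / 2) ∧
      √θ * iteratedDeriv 2 (impliedVol S₀ r ρ θ) 0 = f / stdNormalPDF (s / 2) - 1 / s +
        s / 4 * ((a - stdNormalCDF (s / 2)) / stdNormalPDF (s / 2)) ^ 2 := by
  obtain ⟨p₁, p₂, h1, h2, hc, e0, e1, e2⟩ := unitPut_derivatives_scaled hv hσ hint hψ hψi
  obtain ⟨s, hs, hsP, S, hS0, hSc, hSe, d1, d2⟩ :=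
    exists_total_vol h1 h2 hc hpos (unitPut_zero_lt_one hexp)
  have hθ' : 0 < √θ := Real.sqrt_pos.2 hθ
  have hev : impliedVol S₀ r ρ θ =ᶠ[𝓝 0] (√θ)⁻¹ • S := by
    filter_upwards [hSe] with k hk
    rw [(impliedVol_eq hS₀ r k ρ hθ hk.1 hk.2).2, Pi.smul_apply, smul_eq_mul, div_eq_inv_mul]
  refine ⟨?_, (hSc.const_smul (√θ)⁻¹).congr_of_eventuallyEq hev, unitPut ρ 0, p₁ 0, p₂ 0 - p₁ 0, s, hs,
    ?_, e0, e1, ?_, ?_, ?_⟩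
  · filter_upwards [hSe] with k hk
    exact (impliedVol_eq hS₀ r k ρ hθ hk.1 hk.2).1
  · rw [← unitBlackScholes_zero, hsP]
  · rw [e2, mul_inv_cancel_left₀ hσ.ne']
  · rw [hev.deriv_eq, deriv_const_smul _ (hSc.differentiableAt two_ne_zero), smul_eq_mul,
      mul_inv_cancel_left₀ hθ'.ne', d1]
  · rw [(hev.iteratedDeriv 2).eq_of_nhds, iteratedDeriv_const_smul hSc, smul_eq_mul,
      mul_inv_cancel_left₀ hθ'.ne', d2, d1]

/-- Quantitative expansion of the at-the-money skew and curvature. -/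
theorem exists_impliedVol_expansion {v : ℝ} (hv : 0 < v) :
    ∃ A > 0, ∃ η > 0, ∀ (ρ : Measure ℝ) [IsProbabilityMeasure ρ] (σ k₃ k₄ ε δ e θ S₀ r : ℝ)
      (ψ : ℝ → ℂ), σ ∈ Ioc (0 : ℝ) 1 → 0 < θ → 0 < S₀ →
      Integrable (fun x => Real.exp (-(v / σ) * x)) ρ →
      (∀ u : ℝ, complexCharFun ρ ((u + Complex.I * v) / σ) = ψ u) → Integrable ψ →
      Integrable Real.exp ρ → 0 < unitPut ρ 0 →
      ε = ∫ u, ‖ψ u - edgeCF v σ k₃ k₄ u‖ →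
      δ = σ * |k₃| + σ * |k₄| + k₃ ^ 2 + ε →
      e = σ ^ 2 * |k₃| + σ ^ 2 * |k₄| + σ * k₃ ^ 2 + ε → |k₄| ≤ η → δ ≤ η →
      |√θ * deriv (impliedVol S₀ r ρ θ) 0 - (k₃ + 2 * σ * k₄)| ≤ A * e ∧
      |σ * (√θ * iteratedDeriv 2 (impliedVol S₀ r ρ θ) 0) - 2 * k₄| ≤ A * (δ + k₄ ^ 2) := by
  obtain ⟨K, hK, hKb⟩ := exists_edgeCF_functionals hv
  -- The three kernels are bounded by 1, v⁻¹ and σv⁻². Replacing ψ by its Edgeworth approximation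
  -- thus costs these multiples of ε, and the enlarged constant absorbs them.
  obtain ⟨A, hA, η, hη, hAb⟩ := exists_total_vol_expansion (K + 1 + v⁻¹ + v⁻¹ ^ 2) (by positivity)
  refine ⟨A, hA, η, hη, ?_⟩
  intro ρ _ σ k₃ k₄ ε δ e θ S₀ r ψ hσ hθ hS₀ hint hψ hψi hexp hpos hε hδ he hk hδη
  have hσ0 := hσ.1
  obtain ⟨-, -, p, a, f, s, hs, hsp, hp, ha, hf, hd, hdd⟩ :=
    impliedVol_at_money r hv hσ0 hθ hS₀ hint hψ hψi hexp hpos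
  obtain ⟨K1, K2, K3⟩ := hKb σ hσ k₃ k₄
  have hE := integrable_edgeCF hv hσ.2 k₃ k₄
  have hε0 : 0 ≤ ε := hε ▸ integral_nonneg fun u => norm_nonneg _
  have hdiff : ∀ (g : ℝ → ℂ) (c : ℝ), Continuous g → (∀ u, ‖g u‖ ≤ c) →
      ‖(2 * π : ℂ)⁻¹ * (∫ u, g u * ψ u) - (2 * π : ℂ)⁻¹ * ∫ u, g u * edgeCF v σ k₃ k₄ u‖ ≤
        c * ε := by
    intro g c hg hgc
    have i1 := hψi.bdd_mul hg.aestronglyMeasurable (Eventually.of_forall hgc)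
    have i2 := hE.bdd_mul hg.aestronglyMeasurable (Eventually.of_forall hgc)
    rw [← mul_sub, ← integral_sub i1 i2]
    refine (norm_two_pi_inv_mul_le _).trans ?_
    rw [hε, ← integral_const_mul]
    refine norm_integral_le_of_norm_le ((hψi.sub hE).norm.const_mul c)
      (Eventually.of_forall fun u => ?_)
    rw [← mul_sub, norm_mul]
    exact mul_le_mul_of_nonneg_right (hgc u) (norm_nonneg _)
  have g1 := hdiff (fun _ => 1) 1 continuous_const (fun u => by simp)
  have g2 := hdiff _ _ (continuous_inv_sub_I_mul hv) (norm_inv_sub_I_mul_le hv)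
  have g3 := hdiff (fun u : ℝ => σ * (((v : ℂ) - Complex.I * u)⁻¹ *
      (((v + σ : ℝ) : ℂ) - Complex.I * u)⁻¹)) (σ * (v⁻¹ * v⁻¹))
    (continuous_const.mul ((continuous_inv_sub_I_mul hv).mul
      (continuous_inv_sub_I_mul (by linarith)))) (fun u => by
        rw [norm_mul, norm_mul, Complex.norm_real, Real.norm_eq_abs, abs_of_pos hσ0]
        gcongr
        · exact norm_inv_sub_I_mul_le hv u
        · refine (norm_inv_sub_I_mul_le (by linarith) u).trans (inv_anti₀ hv (by linarith)))
  simp only [one_mul] at g1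
  rw [← hp] at g3
  have g1' := (Complex.abs_re_le_norm _).trans g1
  have g2' := (Complex.abs_re_le_norm _).trans g2
  rw [Complex.sub_re, ← hf] at g1'
  rw [Complex.sub_re, ← ha] at g2'
  have hv' : 0 < v⁻¹ := inv_pos.2 hv
  have hvi : 0 < v⁻¹ ^ 2 := by positivity
  have q3 : 0 ≤ σ * |k₃| + σ * |k₄| + k₃ ^ 2 := by positivity
  have q4 : 0 ≤ σ ^ 2 * |k₃| + σ ^ 2 * |k₄| + σ * k₃ ^ 2 := by positivity
  rw [hd, hdd]
  refine hAb σ hσ k₃ k₄ ε δ e p a f s hε0 hδ he ?_ ?_ ?_ hs hsp hk hδη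
  · have h := (abs_sub_le _ _ _).trans (add_le_add g1' K1)
    refine h.trans ?_
    rw [hδ]
    generalize σ * |k₃| + σ * |k₄| + k₃ ^ 2 = x at *
    have : 0 ≤ (v⁻¹ + v⁻¹ ^ 2) * (x + ε) := by positivity
    have : 0 ≤ K * ε := by positivity
    linarith
  · have h := (abs_sub_le _ _ _).trans (add_le_add g2' K2)
    refine h.trans ?_
    rw [he]
    generalize σ ^ 2 * |k₃| + σ ^ 2 * |k₄| + σ * k₃ ^ 2 = x at *
    have : 0 ≤ (1 + v⁻¹ ^ 2) * (x + ε) := by positivity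
    have : 0 ≤ K * ε := by positivity
    have : 0 ≤ v⁻¹ * x := by positivity
    linarith
  · have h := (norm_sub_le_norm_sub_add_norm_sub _ _ _).trans (add_le_add g3 K3)
    rw [← Complex.ofReal_sub, Complex.norm_real, Real.norm_eq_abs] at h
    refine h.trans ?_
    rw [hδ, show σ ^ 2 * |k₃| + σ ^ 2 * |k₄| + σ * k₃ ^ 2 =
      σ * (σ * |k₃| + σ * |k₄| + k₃ ^ 2) by ring]
    generalize σ * |k₃| + σ * |k₄| + k₃ ^ 2 = x at *
    have : 0 ≤ (1 + v⁻¹) * (σ * (x + ε)) := by positivity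
    have : 0 ≤ K * (σ * ε) := by positivity
    have : 0 ≤ v⁻¹ ^ 2 * (σ * x) := by positivity
    linarith

/-! ### Expansion and decay of the normalized characteristic function -/

section expansion

variable {b C G M Y : ℝ}

/-- `∫ |x| ^ n e ^ (s x)` against the CGMY Lévy density. -/
noncomputable def cgmyAbsMoment (C G M Y : ℝ) (n : ℕ) (s : ℝ) : ℝ :=
  C * Real.Gamma (n - Y) * ((M - s) ^ (Y - n) + (G + s) ^ (Y - n))

lemma cgmyAbsMoment_nonneg (hC : 0 ≤ C) (hY : Y < 2) {s : ℝ} (hs : s ∈ Ioo (-G) M) {n : ℕ}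
    (hn : 2 ≤ n) : 0 ≤ cgmyAbsMoment C G M Y n s := by
  have hn' : (2 : ℝ) ≤ n := by exact_mod_cast hn
  have h1 : 0 < Real.Gamma (n - Y) := Real.Gamma_pos_of_pos (by linarith)
  have h2 : 0 ≤ M - s := by linarith [hs.2]
  have h3 : 0 ≤ G + s := by linarith [hs.1]
  unfold cgmyAbsMoment
  positivity

/-- Taylor expansion of the Lévy exponent. -/
theorem norm_cgmyExponent_sub_sum_le (hC : 0 ≤ C) (hY : Y < 2) (hG : 0 < G) (hM : 0 < M) {z : ℂ}
    (hz : z.re ∈ Ioo (-G) M) {n : ℕ} (hn : 2 ≤ n) :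
    ‖cgmyExponent C G M Y z -
      ∑ k ∈ Finset.Ico 2 n, (cgmyCumulantIter C G M Y k 0 : ℂ) * (z ^ k / (k.factorial : ℂ))‖ ≤
      ‖z‖ ^ n * (cgmyAbsMoment C G M Y n 0 + cgmyAbsMoment C G M Y n z.re) := by
  have h0 : (0 : ℝ) ∈ Ioo (-G) M := ⟨by linarith, hM⟩
  set l := cgmyLevyDensity C G M Y with hl
  have ik : ∀ k ∈ Finset.Ico 2 n, Integrable fun x : ℝ =>
      (z * x) ^ k / (k.factorial : ℂ) * (l x : ℂ) := by
    intro k hk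
    have : Integrable fun x : ℝ => ((x ^ k * Real.exp (0 * x) * l x : ℝ) : ℂ) :=
      (integrable_pow_mul_cgmy (C := C) hY h0 (Finset.mem_Ico.1 hk).1).ofReal
    refine (this.const_mul (z ^ k / (k.factorial : ℂ))).congr (Eventually.of_forall fun x => ?_)
    simp only [zero_mul, Real.exp_zero, mul_one]
    push_cast
    ring
  have ek : ∀ k ∈ Finset.Ico 2 n, (cgmyCumulantIter C G M Y k 0 : ℂ) * (z ^ k / (k.factorial : ℂ))
      = ∫ x : ℝ, (z * x) ^ k / (k.factorial : ℂ) * (l x : ℂ) := by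
    intro k hk
    have := integral_pow_mul_cgmy (C := C) hY h0 (Finset.mem_Ico.1 hk).1
    simp only [zero_mul, Real.exp_zero, mul_one] at this
    rw [cgmyCumulantIter, ← this, ← integral_complex_ofReal, mul_comm, ← integral_const_mul]
    congr 1
    ext x
    push_cast
    ring
  rw [Finset.sum_congr rfl ek, ← integral_finsetSum _ ik, cgmyExponent,
    ← integral_sub (integrable_cgmyExponent hC hY hG hM hz) (integrable_finsetSum _ ik)]
  have m0 := integrable_abs_pow_mul_cgmy (C := C) hY h0 hn
  have m1 := integrable_abs_pow_mul_cgmy (C := C) hY hz hn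
  rw [cgmyAbsMoment, cgmyAbsMoment, ← integral_abs_pow_mul_cgmy hY h0 hn,
    ← integral_abs_pow_mul_cgmy hY hz hn, ← integral_add m0 m1, ← integral_const_mul]
  refine norm_integral_le_of_norm_le ((m0.add m1).const_mul _) (Eventually.of_forall fun x => ?_)
  have hsum : (Complex.exp (z * x) - 1 - z * x) * (l x : ℂ) -
      ∑ k ∈ Finset.Ico 2 n, (z * x) ^ k / (k.factorial : ℂ) * (l x : ℂ) =
      (Complex.exp (z * x) - ∑ k ∈ Finset.range n, (z * x) ^ k / (k.factorial : ℂ)) *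
        (l x : ℂ) := by
    rw [← Finset.sum_mul, Finset.range_eq_Ico, ← Finset.sum_Ico_consecutive _ (Nat.zero_le 2) hn]
    simp [Finset.sum_Ico_eq_sum_range, Finset.sum_range_succ]
    ring
  rw [← hl, hsum, norm_mul, norm_ofReal_cgmy hC]
  have h1 := norm_cexp_sub_sum_le_add n (z * x)
  rw [norm_mul, Complex.norm_real, Real.norm_eq_abs, Complex.re_mul_ofReal, mul_pow] at h1
  have h2 := mul_le_mul_of_nonneg_right h1 (cgmyLevyDensity_nonneg hC G M Y x)
  refine h2.trans (le_of_eq ?_)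
  simp only [zero_mul, Real.exp_zero, mul_one, hl]
  ring

/-- The bound of order two serves the uniform decay; the one of order four, at t = 1, serves the
martingale drift. -/
lemma abs_cgmyCumulant_sub_le (hC : 0 ≤ C) (hY : Y < 2) (hG : 0 < G) (hM : 0 < M) {t : ℝ}
    (ht : t ∈ Ioo (-G) M) :
    |cgmyCumulant C G M Y t| ≤
      t ^ 2 * (cgmyAbsMoment C G M Y 2 0 + cgmyAbsMoment C G M Y 2 t) ∧
    |cgmyCumulant C G M Y t - (cgmyCumulantIter C G M Y 2 0 * t ^ 2 / 2 +
      cgmyCumulantIter C G M Y 3 0 * t ^ 3 / 6)| ≤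
      t ^ 4 * (cgmyAbsMoment C G M Y 4 0 + cgmyAbsMoment C G M Y 4 t) := by
  have h2 := norm_cgmyExponent_sub_sum_le hC hY hG hM (z := (t : ℂ)) (by simpa using ht)
    (n := 2) le_rfl
  have h4 := norm_cgmyExponent_sub_sum_le hC hY hG hM (z := (t : ℂ)) (by simpa using ht)
    (n := 4) (by norm_num)
  rw [cgmyExponent_ofReal] at h2 h4
  constructor
  · simpa [Complex.norm_real] using h2
  · have e : (cgmyCumulant C G M Y t : ℂ) - ∑ k ∈ Finset.Ico 2 4,
        (cgmyCumulantIter C G M Y k 0 : ℂ) * ((t : ℂ) ^ k / (k.factorial : ℂ)) =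
        ((cgmyCumulant C G M Y t - (cgmyCumulantIter C G M Y 2 0 * t ^ 2 / 2 +
      cgmyCumulantIter C G M Y 3 0 * t ^ 3 / 6) : ℝ) : ℂ) := by
      simp [Finset.sum_Ico_eq_sum_range, Finset.sum_range_succ, Nat.factorial]
      ring
    rw [e, Complex.norm_real, Complex.norm_real, Complex.ofReal_re, Real.norm_eq_abs,
      Real.norm_eq_abs, Even.pow_abs (by decide)] at h4
    exact h4

/-- The characteristic function of the normalized law on a horizontal line. -/
lemma complexCharFun_normalized_line {μ : Measure ℝ} (h : IsCGMY b C G M Y μ) (hC : 0 < C)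
    (hY : Y < 2) (hG : 0 < G) (hM : 0 < M) {v : ℝ} (hv : 0 < v) (hvG : v / sigmaZero μ < G)
    (u : ℝ) :
    complexCharFun (normalizedLaw μ) (u + Complex.I * v) =
      Complex.exp (Complex.I * (u + Complex.I * v) / sigmaZero μ * (b + martingaleDrift μ : ℝ) +
        cgmyExponent C G M Y (Complex.I * (u + Complex.I * v) / sigmaZero μ)) ∧
    (Complex.I * (u + Complex.I * v) / sigmaZero μ).re = -(v / sigmaZero μ) ∧
    (Complex.I * (u + Complex.I * v) / sigmaZero μ).im = u / sigmaZero μ := by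
  have hσ := sigmaZero_pos h hC hY hG hM
  have e1 : (Complex.I * (u + Complex.I * v) / sigmaZero μ).re = -(v / sigmaZero μ) := by
    rw [Complex.div_ofReal_re]
    simp [neg_div]
  have e2 : (Complex.I * (u + Complex.I * v) / sigmaZero μ).im = u / sigmaZero μ := by
    rw [Complex.div_ofReal_im]
    simp
  refine ⟨?_, e1, e2⟩
  have hp : 0 < v / sigmaZero μ := div_pos hv hσ
  have e3 : Complex.I * ((u + Complex.I * v) / sigmaZero μ) =
    Complex.I * (u + Complex.I * v) / sigmaZero μ := by ring
  have hmem : (Complex.I * ((u + Complex.I * v) / sigmaZero μ)).re ∈ Ioo (-G) M := by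
    rw [e3, e1]
    exact ⟨by linarith, by linarith⟩
  rw [complexCharFun_normalizedLaw, complexCharFun_logReturnLaw h hC.le hY hG hM hmem, e3]
  push_cast
  rfl

/-- Decay of the characteristic function of the normalized law. -/
theorem norm_complexCharFun_normalized_le {μ : Measure ℝ} (h : IsCGMY b C G M Y μ) (hC : 0 < C)
    (hY : Y ∈ Ioo (0 : ℝ) 2) (hG : 0 < G) (hM : 0 < M) {v T : ℝ} (hv : 0 < v)
    (hvG : v / sigmaZero μ < G) (hT : 1 ≤ T) (hT' : sigmaZero μ * M + v ≤ T) (u : ℝ) :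
    ‖complexCharFun (normalizedLaw μ) (u + Complex.I * v)‖ ≤
      Real.exp (-(v / sigmaZero μ) * (b + martingaleDrift μ) +
        cgmyCumulant C G M Y (-(v / sigmaZero μ))) *
      Real.exp (-(2 / π ^ 2 * Real.exp (-1) / (2 - Y) * 2 ^ (Y - 2) *
        (C * sigmaZero μ ^ (-Y) * T ^ (Y - 2)) * (|u| ^ Y - 1))) := by
  have hσ := sigmaZero_pos h hC hY.2 hG hM
  obtain ⟨e, e1, e2⟩ := complexCharFun_normalized_line h hC hY.2 hG hM hv hvG u
  set σ := sigmaZero μ with hσdef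
  set ζ : ℂ := Complex.I * (u + Complex.I * v) / σ with hζ
  have hp : 0 < v / σ := div_pos hv hσ
  have hmem : ζ.re ∈ Ioo (-G) M := by rw [e1]; exact ⟨by linarith, by linarith⟩
  rw [e, Complex.norm_exp, ← Real.exp_add, Real.exp_le_exp, Complex.add_re,
    Complex.re_mul_ofReal, (integrable_cos_mul_cgmy hC.le hY.2 hG hM hmem).2]
  have hd := le_integral_cos_mul_cgmy hC.le hY.2 hG hM hmem
  rw [e1] at hd ⊢
  rw [e2] at hd ⊢
  have h2Y : 0 < 2 - Y := by linarith [hY.2]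
  set κ := 2 / π ^ 2 * Real.exp (-1) / (2 - Y) with hκ
  have hκ0 : 0 < κ := by positivity
  suffices hs : κ * 2 ^ (Y - 2) * (C * σ ^ (-Y) * T ^ (Y - 2)) * (|u| ^ Y - 1) ≤
      κ * C * (u / σ) ^ 2 * (|u / σ| + (M - -(v / σ))) ^ (Y - 2) by linarith
  -- The conditions on T allow the base to be bounded by σ⁻¹T(1+|u|); since Y − 2 < 0, an upper
  -- bound on the base is a lower bound on the power.
  have hbase : |u / σ| + (M - -(v / σ)) ≤ σ⁻¹ * (T * (1 + |u|)) := by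
    rw [abs_div, abs_of_pos hσ, show |u| / σ + (M - -(v / σ)) = σ⁻¹ * (|u| + (σ * M + v)) by
      field_simp; ring]
    have : |u| ≤ T * |u| := le_mul_of_one_le_left (abs_nonneg _) hT
    gcongr
    linarith
  have hb0 : 0 < |u / σ| + (M - -(v / σ)) := by linarith [abs_nonneg (u / σ)]
  have h1 : (σ⁻¹ * (T * (1 + |u|))) ^ (Y - 2) ≤ (|u / σ| + (M - -(v / σ))) ^ (Y - 2) :=
    Real.rpow_le_rpow_of_nonpos hb0 hbase (by linarith)
  have hT0 : 0 < T := by linarith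
  have e5 : σ⁻¹ ^ (Y - 2) = σ ^ (-Y) * σ ^ 2 := by
    rw [Real.inv_rpow hσ.le, ← Real.rpow_neg hσ.le, ← Real.rpow_natCast σ 2, ← Real.rpow_add hσ]
    congr 1
    push_cast
    ring
  rw [Real.mul_rpow (by positivity) (by positivity), Real.mul_rpow hT0.le (by positivity), e5]
    at h1
  -- For |u| ≥ 1 this compares 1+|u| with 2|u|. Subtracting 1 makes the left side nonpositive for
  -- |u| ≤ 1, where the power |u|^Y would be too large.
  have h3 : 2 ^ (Y - 2) * (|u| ^ Y - 1) ≤ u ^ 2 * (1 + |u|) ^ (Y - 2) := by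
    rcases le_total |u| 1 with hu | hu
    · have : |u| ^ Y ≤ 1 := Real.rpow_le_one (abs_nonneg _) hu hY.1.le
      have h5 : (0 : ℝ) < 2 ^ (Y - 2) := by positivity
      have h4 : (2 : ℝ) ^ (Y - 2) * (|u| ^ Y - 1) ≤ 0 :=
        mul_nonpos_of_nonneg_of_nonpos h5.le (by linarith)
      exact h4.trans (by positivity)
    · have hu0 : 0 < |u| := by linarith
      have h5 : (2 * |u|) ^ (Y - 2) ≤ (1 + |u|) ^ (Y - 2) :=
        Real.rpow_le_rpow_of_nonpos (by positivity) (by linarith) (by linarith)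
      rw [Real.mul_rpow (by norm_num) hu0.le] at h5
      have h6 : u ^ 2 * |u| ^ (Y - 2) = |u| ^ Y := by
        rw [← sq_abs, ← Real.rpow_natCast |u| 2, ← Real.rpow_add hu0]
        congr 1
        push_cast
        ring
      have h7 : (0 : ℝ) < 2 ^ (Y - 2) := by positivity
      calc (2 : ℝ) ^ (Y - 2) * (|u| ^ Y - 1) ≤ 2 ^ (Y - 2) * |u| ^ Y := by gcongr; linarith
        _ = u ^ 2 * (2 ^ (Y - 2) * |u| ^ (Y - 2)) := by rw [← h6]; ring
        _ ≤ _ := by gcongr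
  calc κ * 2 ^ (Y - 2) * (C * σ ^ (-Y) * T ^ (Y - 2)) * (|u| ^ Y - 1)
      = κ * C * σ ^ (-Y) * T ^ (Y - 2) * (2 ^ (Y - 2) * (|u| ^ Y - 1)) := by ring
    _ ≤ κ * C * σ ^ (-Y) * T ^ (Y - 2) * (u ^ 2 * (1 + |u|) ^ (Y - 2)) := by gcongr
    _ = κ * C * (u / σ) ^ 2 * (σ ^ (-Y) * σ ^ 2 * (T ^ (Y - 2) * (1 + |u|) ^ (Y - 2))) := by
        field_simp
    _ ≤ _ := by gcongr

/-- Expansion of the characteristic function of the normalized law. -/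
theorem complexCharFun_normalized_expansion {μ : Measure ℝ} (h : IsCGMY b C G M Y μ) (hC : 0 < C)
    (hY : Y < 2) (hG : 0 < G) (hM : 1 < M) {v δ : ℝ} (hv : 0 < v)
    (hvG : v / sigmaZero μ < G)
    (hδ : δ = sigmaZero μ ^ 2 * |cgmySkewness C G M Y / 6| +
      (cgmyAbsMoment C G M Y 4 0 + cgmyAbsMoment C G M Y 4 1) / sigmaZero μ +
      |cgmyCumulantIter C G M Y 5 0| / sigmaZero μ ^ 5 +
      (cgmyAbsMoment C G M Y 6 0 + cgmyAbsMoment C G M Y 6 (-(v / sigmaZero μ))) /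
        sigmaZero μ ^ 6) (u : ℝ) :
    ∃ a : ℂ, complexCharFun (normalizedLaw μ) (u + Complex.I * v) =
      gaussCF v (sigmaZero μ) u * Complex.exp a ∧
      ‖a - (-(Complex.I * (cgmySkewness C G M Y / 6 : ℝ) * (u + Complex.I * v) ^ 3) +
        (cgmyKurtosis C G M Y / 24 : ℝ) * (u + Complex.I * v) ^ 4)‖ ≤
        δ * (1 + ‖(u : ℂ) + Complex.I * v‖) ^ 6 := by
  have hM0 : 0 < M := by linarith
  have hσ := sigmaZero_pos h hC hY hG hM0
  obtain ⟨e, e1, e2⟩ := complexCharFun_normalized_line h hC hY hG hM0 hv hvG u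
  have hs2 := sigmaZero_sq h hC hY hG hM0
  have hsk := cgmySkewness_eq h hC hY hG hM0
  have hku := cgmyKurtosis_eq h hC hY hG hM0
  rw [cgmyVariance_eq] at hs2
  rw [add_martingaleDrift_eq h hC.le hY hG hM] at e
  set σ := sigmaZero μ with hσdef
  set z : ℂ := (u : ℂ) + Complex.I * v with hz
  set ζ : ℂ := Complex.I * z / σ with hζ
  have hσc : (σ : ℂ) ≠ 0 := by exact_mod_cast hσ.ne'
  have hp : 0 < v / σ := div_pos hv hσ
  have hmem : ζ.re ∈ Ioo (-G) M := by rw [e1]; exact ⟨by linarith, by linarith⟩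
  have t6 := norm_cgmyExponent_sub_sum_le hC.le hY hG hM0 hmem (n := 6) (by norm_num)
  have t4 := (abs_cgmyCumulant_sub_le hC.le hY hG hM0 (t := 1) ⟨by linarith, hM⟩).2
  set c₂ := cgmyCumulantIter C G M Y 2 0
  set c₃ := cgmyCumulantIter C G M Y 3 0
  set c₄ := cgmyCumulantIter C G M Y 4 0
  set c₅ := cgmyCumulantIter C G M Y 5 0
  set m := cgmyCumulant C G M Y 1
  set k₃ := cgmySkewness C G M Y / 6 with hk3
  set k₄ := cgmyKurtosis C G M Y / 24 with hk4
  have hc3 : c₃ = 6 * k₃ * σ ^ 3 := by rw [hk3, hsk]; field_simp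
  have hc4 : c₄ = 24 * k₄ * σ ^ 4 := by rw [hk4, hku]; field_simp
  set R := cgmyExponent C G M Y ζ - ∑ k ∈ Finset.Ico 2 6,
    (cgmyCumulantIter C G M Y k 0 : ℂ) * (ζ ^ k / (k.factorial : ℂ)) with hR
  -- Remainder of the drift: Ψ(1) = σ²/2 + k₃σ³ + E. The first term yields the exponent −izσ/2; the
  -- second yields −izσ²k₃, which is counted among the errors.
  set E := m - (c₂ * 1 ^ 2 / 2 + c₃ * 1 ^ 3 / 6) with hE
  have hm : m = σ ^ 2 / 2 + k₃ * σ ^ 3 + E := by rw [hE, hc3, ← hs2]; ring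
  have hΨ : cgmyExponent C G M Y ζ = c₂ * (ζ ^ 2 / 2) + c₃ * (ζ ^ 3 / 6) + c₄ * (ζ ^ 4 / 24) +
      c₅ * (ζ ^ 5 / 120) + R := by
    rw [hR]
    simp [Finset.sum_Ico_eq_sum_range, Finset.sum_range_succ, Nat.factorial]
    simp only [c₂, c₃, c₄, c₅]
    ring
  have hζσ : ζ * σ = Complex.I * z := by rw [hζ]; field_simp
  have hI2 := Complex.I_sq
  -- The main cubic and quartic terms, followed by four errors in the order of the four summands of
  -- δ.
  refine ⟨-(Complex.I * (k₃ : ℝ) * z ^ 3) + (k₄ : ℝ) * z ^ 4 +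
    (-(Complex.I * z * (σ ^ 2 * k₃)) - ζ * E + c₅ * (ζ ^ 5 / 120) + R), ?_, ?_⟩
  · rw [e, gaussCF, ← Complex.exp_add, hΨ, hm, hc3, hc4, ← hs2]
    congr 1
    push_cast
    rw [← hz]
    have z2 : (σ : ℂ) ^ 2 * ζ ^ 2 = -z ^ 2 := by
      rw [← mul_pow, mul_comm, hζσ, mul_pow, hI2]; ring
    have z3 : (σ : ℂ) ^ 3 * ζ ^ 3 = -Complex.I * z ^ 3 := by
      rw [← mul_pow, mul_comm, hζσ, mul_pow]
      linear_combination Complex.I * z ^ 3 * hI2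
    have z4 : (σ : ℂ) ^ 4 * ζ ^ 4 = z ^ 4 := by
      rw [← mul_pow, mul_comm, hζσ, mul_pow]
      linear_combination (Complex.I ^ 2 - 1) * z ^ 4 * hI2
    linear_combination (-(σ / 2 : ℂ) - k₃ * σ ^ 2) * hζσ + z2 / 2 + k₃ * z3 + k₄ * z4
  · rw [add_sub_cancel_left]
    have nζ : ‖ζ‖ = ‖z‖ / σ := by
      rw [hζ, norm_div, norm_mul, Complex.norm_I, Complex.norm_real, Real.norm_eq_abs,
        abs_of_pos hσ, one_mul]
    have nr : ∀ x : ℝ, ‖(x : ℂ)‖ = |x| := fun x => by simp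
    rw [e1] at t6
    set q4 := cgmyAbsMoment C G M Y 4 0 + cgmyAbsMoment C G M Y 4 1 with hq4
    set q6 := cgmyAbsMoment C G M Y 6 0 + cgmyAbsMoment C G M Y 6 (-(v / σ)) with hq6
    have hq40 : 0 ≤ q4 := add_nonneg
      (cgmyAbsMoment_nonneg hC.le hY ⟨by linarith, hM0⟩ (by norm_num))
      (cgmyAbsMoment_nonneg hC.le hY ⟨by linarith, hM⟩ (by norm_num))
    have hq60 : 0 ≤ q6 := add_nonneg
      (cgmyAbsMoment_nonneg hC.le hY ⟨by linarith, hM0⟩ (by norm_num))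
      (cgmyAbsMoment_nonneg hC.le hY ⟨by linarith, by linarith⟩ (by norm_num))
    have x0 := norm_nonneg z
    have x1 : ‖z‖ ≤ (1 + ‖z‖) ^ 6 :=
      (le_add_of_nonneg_left zero_le_one).trans (le_self_pow₀ (by linarith) (by norm_num))
    have x5 : ‖z‖ ^ 5 ≤ (1 + ‖z‖) ^ 6 :=
      (pow_le_pow_left₀ x0 (by linarith) 5).trans (pow_le_pow_right₀ (by linarith) (by norm_num))
    have x6 : ‖z‖ ^ 6 ≤ (1 + ‖z‖) ^ 6 := pow_le_pow_left₀ x0 (by linarith) 6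
    have s1 : ‖-(Complex.I * z * (σ ^ 2 * k₃))‖ ≤ σ ^ 2 * |k₃| * (1 + ‖z‖) ^ 6 := by
      rw [norm_neg, norm_mul, norm_mul, Complex.norm_I, norm_mul, norm_pow, nr, nr,
        abs_of_pos hσ, one_mul, mul_comm]
      gcongr
    have s2 : ‖ζ * E‖ ≤ q4 / σ * (1 + ‖z‖) ^ 6 := by
      rw [norm_mul, nζ, nr]
      refine (mul_le_mul (div_le_div_of_nonneg_right x1 hσ.le)
        (by simpa only [one_pow, one_mul] using t4) (abs_nonneg _) (by positivity)).trans
        (le_of_eq (by ring))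
    have s3 : ‖(c₅ : ℂ) * (ζ ^ 5 / 120)‖ ≤ |c₅| / σ ^ 5 * (1 + ‖z‖) ^ 6 := by
      rw [norm_mul, nr, norm_div, norm_pow, nζ]
      have : ‖(120 : ℂ)‖ = 120 := by simp
      rw [this, div_pow]
      calc |c₅| * (‖z‖ ^ 5 / σ ^ 5 / 120) ≤ |c₅| * (‖z‖ ^ 5 / σ ^ 5) :=
            mul_le_mul_of_nonneg_left (div_le_self (by positivity) (by norm_num)) (abs_nonneg _)
        _ = |c₅| / σ ^ 5 * ‖z‖ ^ 5 := by ring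
        _ ≤ _ := by gcongr
    have s4 : ‖R‖ ≤ q6 / σ ^ 6 * (1 + ‖z‖) ^ 6 := by
      refine t6.trans ?_
      rw [nζ, div_pow]
      calc ‖z‖ ^ 6 / σ ^ 6 * q6 = q6 / σ ^ 6 * ‖z‖ ^ 6 := by ring
        _ ≤ _ := by gcongr
    rw [hδ]
    have n1 := norm_add_le (-(Complex.I * z * (σ ^ 2 * k₃)) - ζ * E + c₅ * (ζ ^ 5 / 120)) R
    have n2 := norm_add_le (-(Complex.I * z * (σ ^ 2 * k₃)) - ζ * E) ((c₅ : ℂ) * (ζ ^ 5 / 120))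
    have n3 := norm_sub_le (-(Complex.I * z * (σ ^ 2 * k₃))) (ζ * E)
    rw [add_mul, add_mul, add_mul]
    linarith

end expansion

/-! ### L¹ distance to the Edgeworth approximation -/

lemma integrable_one_add_abs_pow_mul_exp_rpow {c Y : ℝ} (hc : 0 < c) (hY : 0 < Y) (n : ℕ) :
    Integrable fun u : ℝ => (1 + |u|) ^ n * Real.exp (-c * |u| ^ Y) := by
  have hk : ∀ k : ℕ, Integrable fun u : ℝ => |u| ^ k * Real.exp (-c * |u| ^ Y) := by
    intro k
    have h0 := integrableOn_rpow_mul_exp_neg_mul_rpow (p := Y) (s := k) (b := c)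
      (by linarith [k.cast_nonneg (α := ℝ)]) hY hc
    refine (integrable_of_half_lines (h0.congr_fun (fun x hx => ?_) measurableSet_Ioi)
      (h0.congr_fun (fun x hx => ?_) measurableSet_Ioi)).1
    · simp only [Real.rpow_natCast]
      rw [abs_of_pos hx]
    · simp only [Real.rpow_natCast]
      rw [abs_neg, abs_of_pos hx]
  refine Integrable.mono' (((hk 0).add (hk n)).const_mul (2 ^ n)) ?_
    (Eventually.of_forall fun u => ?_)
  · have : Measurable fun u : ℝ => (1 + |u|) ^ n * Real.exp (-c * |u| ^ Y) := by fun_prop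
    exact this.aestronglyMeasurable
  rw [Real.norm_eq_abs, abs_of_nonneg (by positivity), Pi.add_apply, pow_zero, ← add_mul,
    ← mul_assoc]
  refine mul_le_mul_of_nonneg_right ?_ (Real.exp_pos _).le
  rcases le_total |u| 1 with h | h
  · exact (pow_le_pow_left₀ (by positivity) (by linarith : 1 + |u| ≤ 2) n).trans
      (le_mul_of_one_le_right (by positivity) (by simp))
  · refine (pow_le_pow_left₀ (by positivity) (by linarith : 1 + |u| ≤ 2 * |u|) n).trans ?_
    rw [mul_pow]
    exact mul_le_mul_of_nonneg_left (by simp) (by positivity)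

lemma norm_edge_factor_le {k₃ k₄ : ℝ} (h3 : |k₃| ≤ 1) (h4 : |k₄| ≤ 1) (z : ℂ) :
    ‖1 - Complex.I * k₃ * z ^ 3 - (k₃ : ℂ) ^ 2 / 2 * z ^ 6 + k₄ * z ^ 4‖ ≤
      4 * (1 + ‖z‖) ^ 6 := by
  have x0 := norm_nonneg z
  have hx : ∀ n ≤ 6, ‖z‖ ^ n ≤ (1 + ‖z‖) ^ 6 := fun n hn =>
    (pow_le_pow_left₀ x0 (by linarith) n).trans (pow_le_pow_right₀ (by linarith) hn)
  have n1 : ∀ k : ℝ, ‖(k : ℂ)‖ = |k| := fun k => by simp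
  have n2 : ‖(2 : ℂ)‖ = 2 := by simp
  have b3 : ‖Complex.I * k₃ * z ^ 3‖ ≤ (1 + ‖z‖) ^ 6 := by
    rw [norm_mul, norm_mul, Complex.norm_I, n1, norm_pow, one_mul]
    exact (mul_le_of_le_one_left (by positivity) h3).trans (hx 3 (by norm_num))
  have b4 : ‖(k₄ : ℂ) * z ^ 4‖ ≤ (1 + ‖z‖) ^ 6 := by
    rw [norm_mul, n1, norm_pow]
    exact (mul_le_of_le_one_left (by positivity) h4).trans (hx 4 (by norm_num))
  have b6 : ‖(k₃ : ℂ) ^ 2 / 2 * z ^ 6‖ ≤ (1 + ‖z‖) ^ 6 := by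
    rw [norm_mul, norm_div, norm_pow, norm_pow, n1, n2]
    refine (mul_le_of_le_one_left (by positivity) ?_).trans (hx 6 le_rfl)
    have : |k₃| ^ 2 ≤ 1 := pow_le_one₀ (abs_nonneg _) h3
    linarith
  have b1 : ‖(1 : ℂ)‖ ≤ (1 + ‖z‖) ^ 6 := by
    rw [norm_one]; simpa using hx 0 (by norm_num)
  have := norm_add_le (1 - Complex.I * k₃ * z ^ 3 - (k₃ : ℂ) ^ 2 / 2 * z ^ 6) (k₄ * z ^ 4)
  have := norm_sub_le (1 - Complex.I * k₃ * z ^ 3) ((k₃ : ℂ) ^ 2 / 2 * z ^ 6)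
  have := norm_sub_le (1 : ℂ) (Complex.I * k₃ * z ^ 3)
  linarith

lemma add_three_pow_three_le {x y z : ℝ} (hx : 0 ≤ x) (hy : 0 ≤ y) (hz : 0 ≤ z) :
    (x + y + z) ^ 3 ≤ 9 * (x ^ 3 + y ^ 3 + z ^ 3) := by
  have h := pow_sum_div_card_le_sum_pow (s := (Finset.univ : Finset (Fin 3))) (f := ![x, y, z]) (fun i _ => by
    fin_cases i <;> simpa) 2
  simp [Fin.sum_univ_three] at h
  linarith

/-- Write a = b₃ + b₄ + d with b₃ cubic, b₄ quartic and d the error. The approximation keeps 1 + b₃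
+ b₄ + b₃²/2. What is dropped is d, the remaining part (b₄+d)(2b₃+b₄+d)/2 of a²/2, and a cubic
remainder, controlled since `hτ` forces |a| ≤ 1. -/
lemma norm_cexp_sub_edge_factor_le {k₃ k₄ δ : ℝ} {a z : ℂ} (hδ : 0 ≤ δ)
    (ha : ‖a - (-(Complex.I * k₃ * z ^ 3) + k₄ * z ^ 4)‖ ≤ δ * (1 + ‖z‖) ^ 6)
    (hτ : (|k₃| + |k₄| + δ) * (1 + ‖z‖) ^ 6 ≤ 1) :
    ‖Complex.exp a - (1 - Complex.I * k₃ * z ^ 3 - (k₃ : ℂ) ^ 2 / 2 * z ^ 6 + k₄ * z ^ 4)‖ ≤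
      40 * (δ + |k₃| * |k₄| + k₄ ^ 2 + |k₃| ^ 3) * (1 + ‖z‖) ^ 18 := by
  have x0 := norm_nonneg z
  set x := 1 + ‖z‖ with hxdef
  have x1 : 1 ≤ x := by linarith
  set t₁ := |k₃| with ht1
  set t₂ := |k₄| with ht2
  have t10 : 0 ≤ t₁ := abs_nonneg _
  have t20 : 0 ≤ t₂ := abs_nonneg _
  have hxn : ∀ n m : ℕ, n ≤ m → ‖z‖ ^ n ≤ x ^ m := fun n m hn =>
    (pow_le_pow_left₀ x0 (by linarith) n).trans (pow_le_pow_right₀ x1 hn)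
  have hτ1 : t₁ + t₂ + δ ≤ 1 :=
    (le_mul_of_one_le_right (by positivity) (one_le_pow₀ x1)).trans hτ
  have n1 : ∀ k : ℝ, ‖(k : ℂ)‖ = |k| := fun k => by simp
  set b3 : ℂ := -(Complex.I * k₃ * z ^ 3) with hb3
  set b4 : ℂ := k₄ * z ^ 4 with hb4
  have nb3 : ‖b3‖ ≤ t₁ * x ^ 6 := by
    rw [hb3, norm_neg, norm_mul, norm_mul, Complex.norm_I, n1, norm_pow, one_mul]
    exact mul_le_mul_of_nonneg_left (hxn 3 6 (by norm_num)) t10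
  have nb4 : ‖b4‖ ≤ t₂ * x ^ 6 := by
    rw [hb4, norm_mul, n1, norm_pow]
    exact mul_le_mul_of_nonneg_left (hxn 4 6 (by norm_num)) t20
  set d : ℂ := a - (b3 + b4) with hd
  have had : a = b3 + b4 + d := by rw [hd]; ring
  have na : ‖a‖ ≤ (t₁ + t₂ + δ) * x ^ 6 := by
    rw [had]
    refine (norm_add₃_le).trans ?_
    linarith
  have na1 : ‖a‖ ≤ 1 := na.trans hτ
  have e3 : ‖Complex.exp a - (1 + a + a ^ 2 / 2)‖ ≤ 4 * ‖a‖ ^ 3 := by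
    have h := norm_cexp_sub_sum_le_add 3 a
    simp only [Finset.sum_range_succ, Finset.sum_range_zero, pow_zero, Nat.factorial, pow_one,
      Nat.cast_one, div_one, zero_add] at h
    have h2 : Real.exp a.re ≤ 3 := by
      have : a.re ≤ 1 := (Complex.re_le_norm a).trans na1
      exact (Real.exp_le_exp.2 this).trans (by linarith [Real.exp_one_lt_d9])
    have h3 : ‖a‖ ^ 3 * (1 + Real.exp a.re) ≤ ‖a‖ ^ 3 * 4 := by gcongr; linarith
    norm_num at h
    rw [mul_comm 4]
    exact h.trans h3
  have id : Complex.exp a - (1 - Complex.I * k₃ * z ^ 3 - (k₃ : ℂ) ^ 2 / 2 * z ^ 6 + k₄ * z ^ 4)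
      = (Complex.exp a - (1 + a + a ^ 2 / 2)) + d + (b4 + d) * (2 * b3 + b4 + d) / 2 := by
    rw [had, hb3, hb4]
    linear_combination (k₃ : ℂ) ^ 2 * z ^ 6 / 2 * Complex.I_sq
  rw [id]
  have x6 : x ^ 6 ≤ x ^ 18 := pow_le_pow_right₀ x1 (by norm_num)
  have x12 : x ^ 12 ≤ x ^ 18 := pow_le_pow_right₀ x1 (by norm_num)
  have m1 : 4 * ‖a‖ ^ 3 ≤ 36 * (δ + t₁ * t₂ + t₂ ^ 2 + t₁ ^ 3) * x ^ 18 := by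
    have h1 : ‖a‖ ^ 3 ≤ (t₁ + t₂ + δ) ^ 3 * x ^ 18 := by
      refine (pow_le_pow_left₀ (norm_nonneg _) na 3).trans (le_of_eq ?_)
      ring
    have h2 : (t₁ + t₂ + δ) ^ 3 ≤ 9 * (t₁ ^ 3 + t₂ ^ 3 + δ ^ 3) := by
      exact add_three_pow_three_le t10 t20 hδ
    have h3 : t₂ ^ 3 ≤ t₂ ^ 2 := pow_le_pow_of_le_one t20 (by linarith) (by norm_num)
    have h4 : δ ^ 3 ≤ δ := by
      simpa using pow_le_pow_of_le_one hδ (by linarith) (by norm_num : 1 ≤ 3)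
    have h5 : 0 ≤ t₁ * t₂ := by positivity
    have h6 : (t₁ + t₂ + δ) ^ 3 ≤ 9 * (δ + t₁ * t₂ + t₂ ^ 2 + t₁ ^ 3) := by linarith
    have h7 := mul_le_mul_of_nonneg_right h6 (by positivity : 0 ≤ x ^ 18)
    linarith
  have m2 : ‖d‖ ≤ δ * x ^ 18 := ha.trans (by gcongr)
  have m3 : ‖(b4 + d) * (2 * b3 + b4 + d) / 2‖ ≤
      3 * (δ + t₁ * t₂ + t₂ ^ 2) * x ^ 18 := by
    rw [norm_div, norm_mul]
    have n2 : ‖(2 : ℂ)‖ = 2 := by simp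
    rw [n2]
    have p1 : ‖b4 + d‖ ≤ (δ + t₂) * x ^ 6 := (norm_add_le _ _).trans (by linarith)
    have p2 : ‖2 * b3 + b4 + d‖ ≤ (2 * t₁ + t₂ + δ) * x ^ 6 := by
      refine (norm_add₃_le).trans ?_
      rw [norm_mul, n2]
      linarith
    have p3 : (δ + t₂) * (2 * t₁ + t₂ + δ) ≤ 6 * (δ + t₁ * t₂ + t₂ ^ 2) := by
      have : δ * (2 * t₁ + 2 * t₂ + δ) ≤ δ * 3 := by gcongr; linarith
      have : 0 ≤ t₁ * t₂ := by positivity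
      have : 0 ≤ t₂ ^ 2 := by positivity
      linarith
    calc ‖b4 + d‖ * ‖2 * b3 + b4 + d‖ / 2
        ≤ ((δ + t₂) * x ^ 6) * ((2 * t₁ + t₂ + δ) * x ^ 6) / 2 := by gcongr
      _ = (δ + t₂) * (2 * t₁ + t₂ + δ) * x ^ 12 / 2 := by ring
      _ ≤ 6 * (δ + t₁ * t₂ + t₂ ^ 2) * x ^ 18 / 2 := by gcongr
      _ = _ := by ring
  refine (norm_add₃_le).trans ?_
  have p : 0 ≤ t₁ ^ 3 * x ^ 18 := by positivity
  have p' : 0 ≤ (t₁ * t₂ + t₂ ^ 2) * x ^ 18 := by positivity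
  have hk : k₄ ^ 2 = t₂ ^ 2 := (sq_abs _).symm
  rw [hk]
  linarith

/-- `L¹` distance between a characteristic function and its Edgeworth approximation. -/
theorem exists_integral_sub_edgeCF_le {c Y K : ℝ} (hc : 0 < c) (hY : 0 < Y) (hK : 0 ≤ K)
    (N : ℕ) : ∃ A > 0, ∀ (v σ k₃ k₄ δ : ℝ) (φ : ℝ → ℂ), 0 < v → v ≤ 1 → σ ≤ 1 → 0 ≤ δ →
      |k₃| ≤ 1 → |k₄| ≤ 1 →
      (∀ u, ‖φ u‖ ≤ K * Real.exp (-c * |u| ^ Y)) →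
      (∀ u : ℝ, ∃ a : ℂ, φ u = gaussCF v σ u * Complex.exp a ∧
        ‖a - (-(Complex.I * k₃ * (u + Complex.I * v) ^ 3) + k₄ * (u + Complex.I * v) ^ 4)‖ ≤
          δ * (1 + ‖(u : ℂ) + Complex.I * v‖) ^ 6) →
      ∫ u, ‖φ u - edgeCF v σ k₃ k₄ u‖ ≤
        A * (δ + |k₃| * |k₄| + k₄ ^ 2 + |k₃| ^ 3 + (|k₃| + |k₄| + δ) ^ N) := by
  set e₁ := Real.exp 1
  -- The first summand is the majorant for the inner region, where the exponential is expanded. The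
  -- other two dominate the characteristic function and its approximation separately in the outer
  -- region.
  set W : ℝ → ℝ := fun u =>
    (e₁ * 40 * 3 ^ 18) * ((1 + |u|) ^ 18 * Real.exp (-u ^ 2 / 2)) +
    (K * 3 ^ (6 * N)) * ((1 + |u|) ^ (6 * N) * Real.exp (-c * |u| ^ Y)) +
    (4 * e₁ * 3 ^ (6 * N + 6)) * ((1 + |u|) ^ (6 * N + 6) * Real.exp (-u ^ 2 / 2)) with hW
  have hWi : Integrable W :=
    (((integrable_one_add_abs_pow_mul_gauss 18).const_mul _).add
      ((integrable_one_add_abs_pow_mul_exp_rpow hc hY _).const_mul _)).add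
      ((integrable_one_add_abs_pow_mul_gauss _).const_mul _)
  have hW0 : ∀ u, 0 ≤ W u := fun u => by simp only [hW, e₁]; positivity
  have hA : 0 ≤ ∫ u, W u := integral_nonneg hW0
  refine ⟨1 + ∫ u, W u, by positivity, ?_⟩
  intro v σ k₃ k₄ δ φ hv hv1 hσ hδ h3 h4 hdec hexp
  set E := δ + |k₃| * |k₄| + k₄ ^ 2 + |k₃| ^ 3 with hE
  set τ := |k₃| + |k₄| + δ with hτ
  have hE0 : 0 ≤ E := by positivity
  have hτ0 : 0 ≤ τ := by positivity
  have hpt : ∀ u, ‖φ u - edgeCF v σ k₃ k₄ u‖ ≤ W u * (E + τ ^ N) := by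
    intro u
    set z : ℂ := (u : ℂ) + Complex.I * v with hz
    have hxu : 1 + ‖z‖ ≤ 3 * (1 + |u|) := by
      have := norm_add_I_mul_le hv u
      have h2 : (1 + v) * (1 + |u|) ≤ 2 * (1 + |u|) := by gcongr; linarith
      linarith [abs_nonneg u]
    have x0 : 0 ≤ 1 + ‖z‖ := by positivity
    have hg : ‖gaussCF v σ u‖ ≤ e₁ * Real.exp (-u ^ 2 / 2) := by
      refine (norm_gaussCF_le hv hσ u).trans ?_
      have : v / 2 + v ^ 2 / 2 ≤ 1 := by nlinarith
      have := Real.exp_le_exp.2 this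
      gcongr
    have w1 : 0 ≤ (e₁ * 40 * 3 ^ 18) * ((1 + |u|) ^ 18 * Real.exp (-u ^ 2 / 2)) := by
      simp only [e₁]; positivity
    have w2 : 0 ≤ (K * 3 ^ (6 * N)) * ((1 + |u|) ^ (6 * N) * Real.exp (-c * |u| ^ Y)) := by
      positivity
    have w3 : 0 ≤ (4 * e₁ * 3 ^ (6 * N + 6)) *
        ((1 + |u|) ^ (6 * N + 6) * Real.exp (-u ^ 2 / 2)) := by
      simp only [e₁]; positivity
    rcases le_total (τ * (1 + ‖z‖) ^ 6) 1 with hin | hout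
    · obtain ⟨a, ha, hab⟩ := hexp u
      have h := norm_cexp_sub_edge_factor_le hδ hab hin
      rw [ha, edgeCF, ← mul_sub, norm_mul]
      calc _ ≤ (e₁ * Real.exp (-u ^ 2 / 2)) * (40 * E * (1 + ‖z‖) ^ 18) := by gcongr
        _ ≤ (e₁ * Real.exp (-u ^ 2 / 2)) * (40 * E * (3 * (1 + |u|)) ^ 18) := by
            simp only [e₁]; gcongr
        _ = (e₁ * 40 * 3 ^ 18) * ((1 + |u|) ^ 18 * Real.exp (-u ^ 2 / 2)) * E := by
            rw [mul_pow]; ring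
        _ ≤ W u * (E + τ ^ N) := by
            refine mul_le_mul ?_ (le_add_of_nonneg_right (by positivity)) hE0 (hW0 u)
            simp only [hW]; linarith
    -- In the outer region the factor τ(1+|z|)^6 is at least 1, so its N-th power may be inserted:
    -- polynomial growth, harmless against the decay, is traded for τ^N.
    · have h1 : 1 ≤ (τ * (1 + ‖z‖) ^ 6) ^ N := one_le_pow₀ hout
      have hp : 1 ≤ τ ^ N * (3 * (1 + |u|)) ^ (6 * N) := by
        refine h1.trans ?_
        rw [mul_pow, ← pow_mul]
        gcongr
      have hb : ‖φ u - edgeCF v σ k₃ k₄ u‖ ≤ K * Real.exp (-c * |u| ^ Y) +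
          (e₁ * Real.exp (-u ^ 2 / 2)) * (4 * (3 * (1 + |u|)) ^ 6) := by
        refine (norm_sub_le _ _).trans (add_le_add (hdec u) ?_)
        rw [edgeCF, norm_mul]
        have := (norm_edge_factor_le h3 h4 z).trans
          (mul_le_mul_of_nonneg_left (pow_le_pow_left₀ x0 hxu 6) (by norm_num))
        simp only [e₁] at hg ⊢
        gcongr
      have hb0 : 0 ≤ K * Real.exp (-c * |u| ^ Y) +
          (e₁ * Real.exp (-u ^ 2 / 2)) * (4 * (3 * (1 + |u|)) ^ 6) := by
        simp only [e₁]; positivity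
      calc _ ≤ _ := hb
        _ ≤ _ := le_mul_of_one_le_right hb0 hp
        _ = ((K * 3 ^ (6 * N)) * ((1 + |u|) ^ (6 * N) * Real.exp (-c * |u| ^ Y)) +
          (4 * e₁ * 3 ^ (6 * N + 6)) * ((1 + |u|) ^ (6 * N + 6) * Real.exp (-u ^ 2 / 2))) *
            τ ^ N := by
          rw [mul_pow, mul_pow, pow_add, pow_add]; ring
        _ ≤ W u * (E + τ ^ N) := by
            refine mul_le_mul ?_ (le_add_of_nonneg_left hE0) (by positivity) (hW0 u)
            simp only [hW]; linarith
  refine (integral_mono_of_nonneg (Eventually.of_forall fun u => norm_nonneg _)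
    (hWi.mul_const _) (Eventually.of_forall hpt)).trans ?_
  rw [integral_mul_const]
  have : 0 ≤ E + τ ^ N := by positivity
  gcongr
  linarith

/-! ### Orders of magnitude in the maturity -/

lemma isBigO_rpow_rpow {a b : ℝ} (h : b ≤ a) :
    (fun θ : ℝ => θ ^ a) =O[𝓝[>] 0] fun θ : ℝ => θ ^ b := by
  refine IsBigO.of_bound 1 ?_
  filter_upwards [Ioo_mem_nhdsGT (zero_lt_one (α := ℝ))] with θ hθ
  rw [one_mul, Real.norm_of_nonneg (Real.rpow_nonneg hθ.1.le _),
    Real.norm_of_nonneg (Real.rpow_nonneg hθ.1.le _)]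
  exact Real.rpow_le_rpow_of_exponent_ge hθ.1 hθ.2.le h

lemma isLittleO_rpow_rpow {a b : ℝ} (h : b < a) :
    (fun θ : ℝ => θ ^ a) =o[𝓝[>] 0] fun θ : ℝ => θ ^ b := by
  have h0 : ∀ᶠ θ : ℝ in 𝓝[>] 0, 0 < θ := eventually_mem_nhdsWithin
  rw [isLittleO_iff_tendsto' (by
    filter_upwards [h0] with θ hθ h
    exact absurd h (Real.rpow_pos_of_pos hθ _).ne')]
  have ht : Tendsto (fun θ : ℝ => θ ^ (a - b)) (𝓝[>] 0) (𝓝 0) := by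
    have := (Real.continuousAt_rpow_const 0 (a - b) (Or.inr (by linarith))).tendsto
    rw [Real.zero_rpow (by linarith)] at this
    exact this.mono_left nhdsWithin_le_nhds
  refine ht.congr' ?_
  filter_upwards [h0] with θ hθ
  exact Real.rpow_sub hθ a b

lemma isBigO_mul_rpow {f g : ℝ → ℝ} {a b : ℝ} (hf : f =O[𝓝[>] 0] fun θ : ℝ => θ ^ a)
    (hg : g =O[𝓝[>] 0] fun θ : ℝ => θ ^ b) :
    (fun θ => f θ * g θ) =O[𝓝[>] 0] fun θ : ℝ => θ ^ (a + b) := by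
  refine (hf.mul hg).congr' EventuallyEq.rfl ?_
  filter_upwards [eventually_mem_nhdsWithin] with θ hθ
  exact (Real.rpow_add hθ a b).symm

lemma isBigO_pow_rpow {f : ℝ → ℝ} {a : ℝ} (hf : f =O[𝓝[>] 0] fun θ : ℝ => θ ^ a) (n : ℕ) :
    (fun θ => f θ ^ n) =O[𝓝[>] 0] fun θ : ℝ => θ ^ (a * n) := by
  refine (hf.pow n).congr' EventuallyEq.rfl ?_
  filter_upwards [eventually_mem_nhdsWithin] with θ hθ
  rw [← Real.rpow_natCast, ← Real.rpow_mul (le_of_lt hθ)]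

lemma isBigO_inv_rpow {f : ℝ → ℝ} {a : ℝ} (hf : (fun θ : ℝ => θ ^ a) =O[𝓝[>] 0] f) :
    (fun θ => (f θ)⁻¹) =O[𝓝[>] 0] fun θ : ℝ => θ ^ (-a) := by
  have h0 : ∀ᶠ θ : ℝ in 𝓝[>] 0, 0 < θ := eventually_mem_nhdsWithin
  refine (hf.inv_rev ?_).congr' EventuallyEq.rfl ?_
  · filter_upwards [h0] with θ hθ h
    exact absurd h (Real.rpow_pos_of_pos hθ _).ne'
  · filter_upwards [h0] with θ hθ
    exact (Real.rpow_neg hθ.le a).symm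

section

variable {Y αM αG : ℝ} {C G M : ℝ → ℝ}

/-- Both tempering parameters are of the order `θ ^ αM`. -/
lemma exists_tempering_bounds (hαG : αM < αG)
    (hpos : ∀ θ ∈ Ioc (0 : ℝ) 1, 0 < C θ ∧ 0 < G θ ∧ 0 < M θ)
    (hM : M =Θ[𝓝[>] 0] fun θ : ℝ => θ ^ αM)
    (hG : (fun θ => G θ - M θ) =O[𝓝[>] 0] fun θ : ℝ => θ ^ αG) :
    ∃ r > 0, ∃ R > 0, ∀ᶠ θ in 𝓝[>] (0 : ℝ),
      r * θ ^ αM ≤ M θ ∧ r * θ ^ αM ≤ G θ ∧ M θ ≤ R * θ ^ αM := by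
  obtain ⟨R, hR, hMR⟩ := hM.1.exists_pos
  obtain ⟨c, hc, hMc⟩ := hM.2.exists_pos
  have hc' : 0 < (2 * c)⁻¹ := by positivity
  -- Since α_G > α_M, the difference G − M is o(θ^{α_M}), so eventually it is at most half of the
  -- lower bound for M.
  have hGo := (hG.trans_isLittleO (isLittleO_rpow_rpow hαG)).bound hc'
  refine ⟨(2 * c)⁻¹, hc', R, hR, ?_⟩
  filter_upwards [hMR.bound, hMc.bound, hGo, Ioo_mem_nhdsGT (zero_lt_one (α := ℝ))]
    with θ h1 h2 h3 hθ
  have hm := (hpos θ ⟨hθ.1, hθ.2.le⟩).2.2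
  have hx : 0 < θ ^ αM := Real.rpow_pos_of_pos hθ.1 _
  rw [Real.norm_of_nonneg hm.le, Real.norm_of_nonneg hx.le] at h1 h2
  rw [Real.norm_of_nonneg hx.le, Real.norm_eq_abs] at h3
  have h4 : c⁻¹ * θ ^ αM ≤ M θ := by rw [inv_mul_le_iff₀ hc]; exact h2
  have e : (2 * c)⁻¹ * θ ^ αM = c⁻¹ * θ ^ αM / 2 := by rw [mul_inv]; ring
  have h5 : 0 < c⁻¹ * θ ^ αM := by positivity
  rw [e] at h3 ⊢
  exact ⟨by linarith, by linarith [(abs_le.1 h3).1], h1⟩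

lemma cgmyAbsMoment_le {C G M Y r s : ℝ} (hC : 0 ≤ C) (hY : Y < 2) (hr : 0 < r) {n : ℕ}
    (hn : 2 ≤ n) (h1 : r ≤ M - s) (h2 : r ≤ G + s) :
    cgmyAbsMoment C G M Y n s ≤ C * Real.Gamma (n - Y) * (2 * r ^ (Y - n)) := by
  have hn' : (2 : ℝ) ≤ n := by exact_mod_cast hn
  have hg : 0 < Real.Gamma (n - Y) := Real.Gamma_pos_of_pos (by linarith)
  unfold cgmyAbsMoment
  have e1 : (M - s) ^ (Y - n) ≤ r ^ (Y - n) :=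
    Real.rpow_le_rpow_of_nonpos hr h1 (by linarith)
  have e2 : (G + s) ^ (Y - n) ≤ r ^ (Y - n) :=
    Real.rpow_le_rpow_of_nonpos hr h2 (by linarith)
  gcongr
  linarith

/-- C contributes 1 − (Y−2)α_M and the power Y − n of the tempering contributes (Y−n)α_M; Y cancels.
A tilt s is harmless while M − s and G + s stay of order at least θ^{α_M}. -/
lemma isBigO_cgmyAbsMoment (hY : Y < 2)
    (hpos : ∀ θ ∈ Ioc (0 : ℝ) 1, 0 < C θ ∧ 0 < G θ ∧ 0 < M θ)
    (hC : C =O[𝓝[>] 0] fun θ : ℝ => θ ^ (1 - (Y - 2) * αM)) {r : ℝ} (hr : 0 < r)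
    {n : ℕ} (hn : 2 ≤ n) {s : ℝ → ℝ}
    (hs : ∀ᶠ θ in 𝓝[>] (0 : ℝ), r * θ ^ αM ≤ M θ - s θ ∧ r * θ ^ αM ≤ G θ + s θ) :
    (fun θ => cgmyAbsMoment (C θ) (G θ) (M θ) Y n (s θ)) =O[𝓝[>] 0]
      fun θ : ℝ => θ ^ (1 - (n - 2) * αM) := by
  have hn' : (2 : ℝ) ≤ n := by exact_mod_cast hn
  have hg : 0 < Real.Gamma (n - Y) := Real.Gamma_pos_of_pos (by linarith)
  have h1 : (fun θ => C θ * θ ^ (αM * (Y - n))) =O[𝓝[>] 0]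
      fun θ : ℝ => θ ^ (1 - (n - 2) * αM) := by
    have := isBigO_mul_rpow hC (isBigO_refl (fun θ : ℝ => θ ^ (αM * (Y - n))) (𝓝[>] 0))
    rwa [show 1 - (Y - 2) * αM + αM * (Y - n) = 1 - (n - 2) * αM by ring] at this
  refine (IsBigO.of_bound (Real.Gamma (n - Y) * (2 * r ^ (Y - n))) ?_).trans h1
  filter_upwards [hs, Ioo_mem_nhdsGT (zero_lt_one (α := ℝ))] with θ h hθ
  have hc := (hpos θ ⟨hθ.1, hθ.2.le⟩).1
  have hx : 0 < θ ^ αM := Real.rpow_pos_of_pos hθ.1 _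
  have hr' : 0 < r * θ ^ αM := by positivity
  have hb := cgmyAbsMoment_le hc.le hY hr' hn h.1 h.2
  rw [Real.mul_rpow hr.le hx.le, ← Real.rpow_mul hθ.1.le] at hb
  have hnn : 0 ≤ cgmyAbsMoment (C θ) (G θ) (M θ) Y n (s θ) :=
    cgmyAbsMoment_nonneg hc.le hY ⟨by linarith [h.2], by linarith [h.1]⟩ hn
  have hx' : 0 < θ ^ (αM * (Y - n)) := Real.rpow_pos_of_pos hθ.1 _
  rw [Real.norm_of_nonneg hnn, Real.norm_of_nonneg (by positivity)]
  refine hb.trans (le_of_eq ?_)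
  ring

lemma abs_rpow_sub_rpow_le {r x y p : ℝ} (hr : 0 < r) (hx : r ≤ x) (hy : r ≤ y) (hp : p ≤ 0) :
    |x ^ p - y ^ p| ≤ |p| * r ^ (p - 1) * |x - y| := by
  refine (convex_Ici r).norm_image_sub_le_of_norm_hasDerivWithin_le
    (f := fun t : ℝ => t ^ p) (f' := fun t => p * t ^ (p - 1))
    (fun t ht => (Real.hasDerivAt_rpow_const (Or.inl (hr.trans_le ht).ne')).hasDerivWithinAt)
    (fun t ht => ?_) hy hx
  have ht0 : 0 < t := hr.trans_le ht
  rw [norm_mul, Real.norm_eq_abs, Real.norm_of_nonneg (Real.rpow_nonneg ht0.le _)]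
  exact mul_le_mul_of_nonneg_left (Real.rpow_le_rpow_of_nonpos hr ht (by linarith))
    (abs_nonneg _)

/-- The odd cumulants are smaller because of the near symmetry of the Lévy density. -/
lemma isBigO_cgmyCumulantIter_odd (hY : Y < 2)
    (hG : (fun θ => G θ - M θ) =O[𝓝[>] 0] fun θ : ℝ => θ ^ αG)
    (hC : C =O[𝓝[>] 0] fun θ : ℝ => θ ^ (1 - (Y - 2) * αM)) {r : ℝ} (hr : 0 < r)
    (hs : ∀ᶠ θ in 𝓝[>] (0 : ℝ), r * θ ^ αM ≤ M θ ∧ r * θ ^ αM ≤ G θ)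
    {n : ℕ} (hn : 2 ≤ n) (ho : Odd n) :
    (fun θ => cgmyCumulantIter (C θ) (G θ) (M θ) Y n 0) =O[𝓝[>] 0]
      fun θ : ℝ => θ ^ (1 - (n - 1) * αM + αG) := by
  have hn' : (2 : ℝ) ≤ n := by exact_mod_cast hn
  have h1 : (fun θ => C θ * (θ ^ (αM * (Y - n - 1)) * (G θ - M θ))) =O[𝓝[>] 0]
      fun θ : ℝ => θ ^ (1 - (n - 1) * αM + αG) := by
    have := isBigO_mul_rpow hC
      (isBigO_mul_rpow (isBigO_refl (fun θ : ℝ => θ ^ (αM * (Y - n - 1))) (𝓝[>] 0)) hG)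
    rwa [show 1 - (Y - 2) * αM + (αM * (Y - n - 1) + αG) = 1 - (n - 1) * αM + αG by ring] at this
  refine (IsBigO.of_bound (|Real.Gamma (n - Y)| * (|Y - n| * r ^ (Y - n - 1))) ?_).trans h1
  filter_upwards [hs, Ioo_mem_nhdsGT (zero_lt_one (α := ℝ))] with θ h hθ
  have hx : 0 < θ ^ αM := Real.rpow_pos_of_pos hθ.1 _
  have hr' : 0 < r * θ ^ αM := by positivity
  have hb := abs_rpow_sub_rpow_le hr' h.1 h.2 (by linarith : Y - n ≤ 0)
  rw [Real.mul_rpow hr.le hx.le, ← Real.rpow_mul hθ.1.le, abs_sub_comm (M θ)] at hb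
  have hx' : 0 < θ ^ (αM * (Y - n - 1)) := Real.rpow_pos_of_pos hθ.1 _
  rw [cgmyCumulantIter, ho.neg_one_pow, sub_zero, add_zero, neg_one_mul, ← sub_eq_add_neg,
    norm_mul, norm_mul, norm_mul, norm_mul, Real.norm_of_nonneg hx'.le, Real.norm_eq_abs (_ - _),
    Real.norm_eq_abs (Real.Gamma _), Real.norm_eq_abs (_ - _)]
  calc _ ≤ ‖C θ‖ * |Real.Gamma (n - Y)| *
        (|Y - n| * (r ^ (Y - n - 1) * θ ^ (αM * (Y - n - 1))) * |G θ - M θ|) := by gcongr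
    _ = _ := by ring

/-- The standard deviation is of the order `θ ^ (1 / 2)`. -/
lemma isTheta_cgmyVariance (hY : Y < 2)
    (hpos : ∀ θ ∈ Ioc (0 : ℝ) 1, 0 < C θ ∧ 0 < G θ ∧ 0 < M θ)
    (hC : C =Θ[𝓝[>] 0] fun θ : ℝ => θ ^ (1 - (Y - 2) * αM)) {r R : ℝ} (hr : 0 < r) (hR : 0 < R)
    (hs : ∀ᶠ θ in 𝓝[>] (0 : ℝ), r * θ ^ αM ≤ M θ ∧ r * θ ^ αM ≤ G θ ∧ M θ ≤ R * θ ^ αM) :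
    (fun θ => cgmyVariance (C θ) (G θ) (M θ) Y) =Θ[𝓝[>] 0] fun θ : ℝ => θ := by
  have hg : 0 < Real.Gamma (2 - Y) := Real.Gamma_pos_of_pos (by linarith)
  constructor
  · have h := isBigO_cgmyAbsMoment hY hpos hC.1 hr (n := 2) le_rfl (s := fun _ => 0)
      (hs.mono fun θ h => by simpa using ⟨h.1, h.2.1⟩)
    simpa [cgmyAbsMoment, cgmyVariance] using h
  · have h1 : (fun θ : ℝ => θ) =O[𝓝[>] 0] fun θ => C θ * θ ^ (αM * (Y - 2)) := by
      refine (hC.2.mul (isBigO_refl (fun θ : ℝ => θ ^ (αM * (Y - 2))) (𝓝[>] 0))).congr' ?_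
        EventuallyEq.rfl
      filter_upwards [eventually_mem_nhdsWithin] with θ hθ
      rw [← Real.rpow_add hθ]
      ring_nf
      exact Real.rpow_one θ
    refine h1.trans (IsBigO.of_bound (Real.Gamma (2 - Y) * R ^ (Y - 2))⁻¹ ?_)
    filter_upwards [hs, Ioo_mem_nhdsGT (zero_lt_one (α := ℝ))] with θ h hθ
    obtain ⟨hc, hg', hm⟩ := hpos θ ⟨hθ.1, hθ.2.le⟩
    have hx : 0 < θ ^ αM := Real.rpow_pos_of_pos hθ.1 _
    have hb : (R * θ ^ αM) ^ (Y - 2) ≤ M θ ^ (Y - 2) :=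
      Real.rpow_le_rpow_of_nonpos hm h.2.2 (by linarith)
    rw [Real.mul_rpow hR.le hx.le, ← Real.rpow_mul hθ.1.le] at hb
    have hx' : 0 < θ ^ (αM * (Y - 2)) := Real.rpow_pos_of_pos hθ.1 _
    have hRp : 0 < R ^ (Y - 2) := Real.rpow_pos_of_pos hR _
    rw [Real.norm_of_nonneg (by positivity),
      Real.norm_of_nonneg (cgmyVariance_pos hc hY hg' hm).le, le_inv_mul_iff₀ (by positivity),
      cgmyVariance]
    have : 0 ≤ G θ ^ (Y - 2) := by positivity
    calc _ = C θ * Real.Gamma (2 - Y) * (R ^ (Y - 2) * θ ^ (αM * (Y - 2))) := by ring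
      _ ≤ C θ * Real.Gamma (2 - Y) * (M θ ^ (Y - 2) + G θ ^ (Y - 2)) := by gcongr; linarith

end

/-! ### Uniform decay and short maturity asymptotics -/

lemma cgmyAbsMoment_two_le {C G M Y s : ℝ} (hC : 0 ≤ C) (hY : Y < 2) (hG : 0 < G) (hM : 0 < M)
    (h1 : M / 2 ≤ M - s) (h2 : G / 2 ≤ G + s) :
    cgmyAbsMoment C G M Y 2 s ≤ 2 ^ (2 - Y) * cgmyVariance C G M Y := by
  have hg : 0 < Real.Gamma (2 - Y) := Real.Gamma_pos_of_pos (by linarith)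
  have e : ∀ x : ℝ, 0 < x → (x / 2) ^ (Y - 2) = 2 ^ (2 - Y) * x ^ (Y - 2) := by
    intro x hx
    rw [Real.div_rpow hx.le (by norm_num), div_eq_mul_inv, ← Real.rpow_neg (by norm_num), neg_sub,
      mul_comm]
  have e1 : (M - s) ^ (Y - 2) ≤ 2 ^ (2 - Y) * M ^ (Y - 2) :=
    e M hM ▸ Real.rpow_le_rpow_of_nonpos (by positivity) h1 (by linarith)
  have e2 : (G + s) ^ (Y - 2) ≤ 2 ^ (2 - Y) * G ^ (Y - 2) :=
    e G hG ▸ Real.rpow_le_rpow_of_nonpos (by positivity) h2 (by linarith)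
  unfold cgmyAbsMoment cgmyVariance
  push_cast
  calc _ ≤ C * Real.Gamma (2 - Y) * (2 ^ (2 - Y) * M ^ (Y - 2) + 2 ^ (2 - Y) * G ^ (Y - 2)) := by
        gcongr
    _ = _ := by ring

/-- Decay of the characteristic function, uniform in the parameters. -/
theorem exists_uniform_decay {κ Y : ℝ} (hκ : 0 < κ) (hY : Y ∈ Ioo (0 : ℝ) 2) :
    ∃ K > 0, ∃ c > 0, ∀ (b C G M v : ℝ) (μ : Measure ℝ), IsCGMY b C G M Y μ → 0 < C → 0 < G →
      κ * M ≤ G → 2 ≤ M → 2 ≤ sigmaZero μ * G → 1 ≤ sigmaZero μ * M → sigmaZero μ ≤ 1 →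
      0 < v → v ≤ 1 → v / sigmaZero μ ≤ G / 2 ∧ ∀ u : ℝ,
        ‖complexCharFun (normalizedLaw μ) (u + Complex.I * v)‖ ≤
          K * Real.exp (-c * |u| ^ Y) := by
  have hY2 := hY.2
  have h2Y : 0 < 2 - Y := by linarith
  have hg : 0 < Real.Gamma (2 - Y) := Real.Gamma_pos_of_pos h2Y
  set g := Real.Gamma (2 - Y) with hgdef
  set κ₀ : ℝ := 2 / π ^ 2 * Real.exp (-1) / (2 - Y) * 2 ^ (Y - 2) with hκ0
  have hκ0' : 0 < κ₀ := by positivity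
  set a₁ : ℝ := κ₀ * 2 ^ (Y - 2) / g with ha1
  set c : ℝ := κ₀ * 2 ^ (Y - 2) / (g * (1 + κ ^ (Y - 2))) with hc
  set D : ℝ := 1 + 2 ^ (2 - Y) with hD
  have hD0 : 0 < D := by positivity
  refine ⟨Real.exp (2 * D) * Real.exp a₁, by positivity, c, by positivity, ?_⟩
  intro b C G M v μ h hC hG hκG hM hσG hσM hσ1 hv hv1
  have hM0 : 0 < M := by linarith
  have hσ := sigmaZero_pos h hC hY2 hG hM0
  have hs2 := sigmaZero_sq h hC hY2 hG hM0
  have hdrift := add_martingaleDrift_eq h hC.le hY2 hG (by linarith)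
  have hvG : v / sigmaZero μ ≤ G / 2 := by
    rw [div_le_div_iff₀ hσ two_pos]; linarith
  refine ⟨hvG, fun u => ?_⟩
  have hvG' : v / sigmaZero μ < G := by linarith
  -- T = 2σM is admissible because σM ≥ 1 ≥ v. It makes the decay rate proportional to CM^{Y−2}/σ².
  have hdec := norm_complexCharFun_normalized_le h hC hY hG hM0 hv hvG' (T := 2 * (sigmaZero μ * M))
    (by linarith) (by linarith) u
  set σ := sigmaZero μ with hσdef
  have hp : 0 < v / σ := div_pos hv hσ
  rw [hdrift] at hdec
  refine hdec.trans ?_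
  rw [← hκ0, mul_assoc (Real.exp (2 * D))]
  have hA0 : cgmyAbsMoment C G M Y 2 0 = σ ^ 2 := by
    rw [hs2]; simp [cgmyAbsMoment, cgmyVariance]
  -- The prefactor: Ψ(−v/σ) and the drift contribution (v/σ)Ψ(1) are each at most D, since the
  -- second moments under these tilts are comparable to σ².
  have b1 : cgmyCumulant C G M Y 1 ≤ D * σ ^ 2 := by
    have h1 := (abs_cgmyCumulant_sub_le hC.le hY2 hG hM0 (t := 1) ⟨by linarith, by linarith⟩).1
    have h2 := cgmyAbsMoment_two_le (s := 1) hC.le hY2 hG hM0 (by linarith) (by linarith)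
    rw [hA0] at h1
    rw [← hs2] at h2
    have h3 := (le_abs_self _).trans h1
    rw [hD]
    linarith
  have b2 : cgmyCumulant C G M Y (-(v / σ)) ≤ D := by
    have h1 := (abs_cgmyCumulant_sub_le hC.le hY2 hG hM0 (t := -(v / σ))
      ⟨by linarith, by linarith⟩).1
    have h2 := cgmyAbsMoment_two_le (s := -(v / σ)) hC.le hY2 hG hM0 (by linarith) (by linarith)
    rw [hA0] at h1
    rw [← hs2] at h2
    refine (le_abs_self _).trans (h1.trans ?_)
    calc (-(v / σ)) ^ 2 * (σ ^ 2 + cgmyAbsMoment C G M Y 2 (-(v / σ)))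
        ≤ (-(v / σ)) ^ 2 * (σ ^ 2 + 2 ^ (2 - Y) * σ ^ 2) := by gcongr
      _ = v ^ 2 * D := by rw [hD]; field_simp
      _ ≤ 1 * D := by gcongr; exact pow_le_one₀ hv.le hv1
      _ = D := one_mul D
  have b3 : -(v / σ) * -cgmyCumulant C G M Y 1 ≤ D := by
    calc -(v / σ) * -cgmyCumulant C G M Y 1 = v / σ * cgmyCumulant C G M Y 1 := by ring
      _ ≤ v / σ * (D * σ ^ 2) := by gcongr
      _ = v * σ * D := by field_simp
      _ ≤ 1 * D := by gcongr; exact mul_le_one₀ hv1 hσ.le hσ1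
      _ = D := one_mul D
  have hMY : 0 < M ^ (Y - 2) := by positivity
  have hw : C * σ ^ (-Y) * (2 * (σ * M)) ^ (Y - 2) = 2 ^ (Y - 2) * (C * M ^ (Y - 2) / σ ^ 2) := by
    have hσp : σ ^ (-Y) * σ ^ (Y - 2) = (σ ^ 2)⁻¹ := by
      rw [← Real.rpow_add hσ, ← Real.rpow_natCast σ 2, ← Real.rpow_neg hσ.le]
      congr 1
      push_cast
      ring
    rw [Real.mul_rpow (by norm_num) (by positivity), Real.mul_rpow hσ.le hM0.le]
    calc _ = 2 ^ (Y - 2) * (C * M ^ (Y - 2)) * (σ ^ (-Y) * σ ^ (Y - 2)) := by ring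
      _ = _ := by rw [hσp]; ring
  -- As σ² = CΓ(2−Y)(M^{Y−2} + G^{Y−2}) and G ≥ κM, the ratio CM^{Y−2}/σ² lies between constants
  -- depending on Y and κ alone.
  have hwu : C * M ^ (Y - 2) / σ ^ 2 ≤ 1 / g := by
    rw [div_le_div_iff₀ (by positivity) hg, hs2, cgmyVariance]
    have : 0 ≤ C * g * G ^ (Y - 2) := by positivity
    linarith
  have hwl : 1 / (g * (1 + κ ^ (Y - 2))) ≤ C * M ^ (Y - 2) / σ ^ 2 := by
    rw [div_le_div_iff₀ (by positivity) (by positivity), hs2, cgmyVariance]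
    have h1 : G ^ (Y - 2) ≤ κ ^ (Y - 2) * M ^ (Y - 2) := by
      rw [← Real.mul_rpow hκ.le hM0.le]
      exact Real.rpow_le_rpow_of_nonpos (by positivity) hκG (by linarith)
    calc 1 * (C * g * (M ^ (Y - 2) + G ^ (Y - 2)))
        ≤ 1 * (C * g * (M ^ (Y - 2) + κ ^ (Y - 2) * M ^ (Y - 2))) := by gcongr
      _ = _ := by ring
  have hAu : κ₀ * (C * σ ^ (-Y) * (2 * (σ * M)) ^ (Y - 2)) ≤ a₁ := by
    rw [hw, ha1]
    calc κ₀ * (2 ^ (Y - 2) * (C * M ^ (Y - 2) / σ ^ 2)) ≤ κ₀ * (2 ^ (Y - 2) * (1 / g)) := by gcongr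
      _ = _ := by ring
  have hAl : c ≤ κ₀ * (C * σ ^ (-Y) * (2 * (σ * M)) ^ (Y - 2)) := by
    rw [hw, hc]
    calc _ = κ₀ * (2 ^ (Y - 2) * (1 / (g * (1 + κ ^ (Y - 2))))) := by ring
      _ ≤ _ := by gcongr
  rw [← Real.exp_add a₁]
  have hu : 0 ≤ |u| ^ Y := by positivity
  refine mul_le_mul (Real.exp_le_exp.2 (by linarith)) (Real.exp_le_exp.2 ?_) (Real.exp_pos _).le
    (Real.exp_pos _).le
  have := mul_le_mul_of_nonneg_right hAl hu
  linarith

lemma eventually_le_rpow {p : ℝ} (hp : p < 0) (B : ℝ) : ∀ᶠ θ : ℝ in 𝓝[>] 0, B ≤ θ ^ p := by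
  have h := (isLittleO_rpow_rpow (a := 0) hp).bound (by positivity : 0 < (|B| + 1)⁻¹)
  filter_upwards [h, eventually_mem_nhdsWithin] with θ h hθ
  rw [Real.rpow_zero, norm_one, Real.norm_of_nonneg (Real.rpow_nonneg (le_of_lt hθ) _),
    le_inv_mul_iff₀ (by positivity)] at h
  linarith [le_abs_self B]

lemma betaBar_lt {β₁ β₂ ε x : ℝ} (h : β₂ + 1 / 2 < x ∨ 2 * β₁ < x ∨ 2 * β₂ - ε < x ∨
    β₁ + β₂ - ε < x) : betaBar β₁ β₂ ε < x := by
  simpa [betaBar, min_lt_iff] using h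

/-- Behaviour of the normalized laws for short maturities. -/
theorem cgmy_short_maturity {Y αM αG : ℝ} (hY : Y ∈ Ioo (0 : ℝ) 2)
    (hαM : αM ∈ Ioo (-1 : ℝ) (-1 / 2)) (hαG : αM < αG) {b C G M : ℝ → ℝ}
    (hpos : ∀ θ ∈ Ioc (0 : ℝ) 1, 0 < C θ ∧ 0 < G θ ∧ 0 < M θ)
    (hM : M =Θ[𝓝[>] 0] fun θ : ℝ => θ ^ αM)
    (hG : (fun θ => G θ - M θ) =O[𝓝[>] 0] fun θ : ℝ => θ ^ αG)
    (hC : C =Θ[𝓝[>] 0] fun θ : ℝ => θ ^ (1 - (Y - 2) * αM)) {Z : ℝ → Measure ℝ}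
    (hZ : ∀ θ ∈ Ioc (0 : ℝ) 1, IsCGMY (b θ) (C θ) (G θ) (M θ) Y (Z θ)) :
    ((fun θ => sigmaZero (Z θ)) =Θ[𝓝[>] 0] fun θ : ℝ => √θ) ∧
    ((fun θ => cgmySkewness (C θ) (G θ) (M θ) Y / 6) =O[𝓝[>] 0]
      fun θ : ℝ => θ ^ (αG - 2 * αM - 1 / 2)) ∧
    ((fun θ => cgmyKurtosis (C θ) (G θ) (M θ) Y / 24) =O[𝓝[>] 0]
      fun θ : ℝ => θ ^ (-2 * αM - 1)) ∧
    (∃ K c : ℝ, 0 < K ∧ 0 < c ∧ ∀ᶠ θ in 𝓝[>] (0 : ℝ), 2 ≤ M θ ∧ sigmaZero (Z θ) ≤ 1 ∧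
      ∀ v : ℝ, 0 < v → v ≤ 1 → v / sigmaZero (Z θ) ≤ G θ / 2 ∧ ∀ u : ℝ,
        ‖complexCharFun (normalizedLaw (Z θ)) (u + Complex.I * v)‖ ≤
          K * Real.exp (-c * |u| ^ Y)) ∧
    ∀ v : ℝ, 0 < v → v ≤ 1 → ∀ ε : ℝ, 0 < ε →
      (fun θ : ℝ => ∫ u : ℝ, ‖complexCharFun (normalizedLaw (Z θ)) (u + Complex.I * v) -
        edgeCF v (sigmaZero (Z θ)) (cgmySkewness (C θ) (G θ) (M θ) Y / 6)
          (cgmyKurtosis (C θ) (G θ) (M θ) Y / 24) u‖) =o[𝓝[>] 0]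
        fun θ => θ ^ betaBar (αG - 2 * αM - 1 / 2) (-2 * αM - 1) ε := by
  obtain ⟨r, hr, R, hR, hb⟩ := exists_tempering_bounds hαG hpos hM hG
  have hY2 := hY.2
  have h01 : ∀ᶠ θ : ℝ in 𝓝[>] 0, θ ∈ Ioo (0 : ℝ) 1 := Ioo_mem_nhdsGT one_pos
  have hV := isTheta_cgmyVariance hY2 hpos hC hr hR hb
  set σ : ℝ → ℝ := fun θ => sigmaZero (Z θ) with hσdef
  have hσpos : ∀ θ ∈ Ioo (0 : ℝ) 1, 0 < σ θ := fun θ hθ => by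
    obtain ⟨h1, h2, h3⟩ := hpos θ ⟨hθ.1, hθ.2.le⟩
    exact sigmaZero_pos (hZ θ ⟨hθ.1, hθ.2.le⟩) h1 hY2 h2 h3
  have hσV : (fun θ => σ θ ^ 2) =ᶠ[𝓝[>] 0] fun θ => cgmyVariance (C θ) (G θ) (M θ) Y := by
    filter_upwards [h01] with θ hθ
    obtain ⟨h1, h2, h3⟩ := hpos θ ⟨hθ.1, hθ.2.le⟩
    exact sigmaZero_sq (hZ θ ⟨hθ.1, hθ.2.le⟩) h1 hY2 h2 h3
  have hsq : (fun θ : ℝ => √θ ^ 2) =ᶠ[𝓝[>] 0] fun θ : ℝ => θ := by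
    filter_upwards [h01] with θ hθ
    exact Real.sq_sqrt hθ.1.le
  have hσ : σ =Θ[𝓝[>] 0] fun θ : ℝ => √θ :=
    ⟨IsBigO.of_pow two_ne_zero (hV.1.congr' hσV.symm hsq.symm),
      IsBigO.of_pow two_ne_zero (hV.2.congr' hsq.symm hσV.symm)⟩
  have hσr : σ =Θ[𝓝[>] 0] fun θ : ℝ => θ ^ (1 / 2 : ℝ) := by
    simpa only [Real.sqrt_eq_rpow] using hσ
  have hσi := isBigO_inv_rpow hσr.2
  have hσin : ∀ n : ℕ, (fun θ => (σ θ ^ n)⁻¹) =O[𝓝[>] 0] fun θ : ℝ => θ ^ (-(n : ℝ) / 2) := by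
    intro n
    have := isBigO_pow_rpow hσi n
    simp only [inv_pow] at this
    rwa [show -(1 / 2 : ℝ) * n = -(n : ℝ) / 2 by ring] at this
  have hb0 : ∀ᶠ θ in 𝓝[>] (0 : ℝ), r * θ ^ αM ≤ M θ ∧ r * θ ^ αM ≤ G θ :=
    hb.mono fun θ h => ⟨h.1, h.2.1⟩
  have hbz : ∀ᶠ θ in 𝓝[>] (0 : ℝ), r * θ ^ αM ≤ M θ - 0 ∧ r * θ ^ αM ≤ G θ + 0 :=
    hb0.mono fun θ h => by simpa using h
  have hk3 : (fun θ => cgmySkewness (C θ) (G θ) (M θ) Y / 6) =O[𝓝[>] 0]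
      fun θ : ℝ => θ ^ (αG - 2 * αM - 1 / 2) := by
    have h3 := isBigO_mul_rpow (isBigO_cgmyCumulantIter_odd hY2 hG hC.1 hr hb0 (n := 3)
      (by norm_num) (by decide)) (hσin 3)
    have h4 := h3.const_mul_left (1 / 6)
    refine h4.congr' ?_ (Eventually.of_forall fun θ => ?_)
    · filter_upwards [h01] with θ hθ
      obtain ⟨h1, h2, h3⟩ := hpos θ ⟨hθ.1, hθ.2.le⟩
      rw [cgmySkewness_eq (hZ θ ⟨hθ.1, hθ.2.le⟩) h1 hY2 h2 h3]
      ring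
    · simp only
      congr 1
      push_cast
      ring
  have hk4 : (fun θ => cgmyKurtosis (C θ) (G θ) (M θ) Y / 24) =O[𝓝[>] 0]
      fun θ : ℝ => θ ^ (-2 * αM - 1) := by
    have h3 := isBigO_mul_rpow (isBigO_cgmyAbsMoment hY2 hpos hC.1 hr (n := 4)
      (by norm_num) (s := fun _ => 0) hbz) (hσin 4)
    have h4 := h3.const_mul_left (1 / 24)
    refine h4.congr' ?_ (Eventually.of_forall fun θ => ?_)
    · filter_upwards [h01] with θ hθ
      obtain ⟨h1, h2, h3⟩ := hpos θ ⟨hθ.1, hθ.2.le⟩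
      rw [cgmyKurtosis_eq (hZ θ ⟨hθ.1, hθ.2.le⟩) h1 hY2 h2 h3]
      have : cgmyCumulantIter (C θ) (G θ) (M θ) Y 4 0 =
          cgmyAbsMoment (C θ) (G θ) (M θ) Y 4 0 := by
        simp only [cgmyCumulantIter, cgmyAbsMoment]
        norm_num
      rw [this]
      ring
    · simp only
      congr 1
      push_cast
      ring
  obtain ⟨d, hd, hσd⟩ := hσr.2.exists_pos
  have hσ1 : ∀ᶠ θ in 𝓝[>] (0 : ℝ), σ θ ≤ 1 := by
    have := (hσr.1.trans_isLittleO (isLittleO_rpow_rpow (b := 0) (by norm_num))).bound one_pos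
    filter_upwards [this] with θ h
    rw [Real.rpow_zero, norm_one, one_mul] at h
    exact (le_abs_self _).trans h
  have hσl : ∀ᶠ θ in 𝓝[>] (0 : ℝ), ∀ B : ℝ, B ≤ θ ^ (1 / 2 + αM) → B * d⁻¹ ≤ σ θ * θ ^ αM := by
    filter_upwards [hσd.bound, h01] with θ h hθ B hB
    rw [Real.norm_of_nonneg (Real.rpow_nonneg hθ.1.le _),
      Real.norm_of_nonneg (hσpos θ hθ).le] at h
    rw [Real.rpow_add hθ.1] at hB
    have hx := Real.rpow_pos_of_pos hθ.1 αM
    rw [mul_inv_le_iff₀ hd]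
    calc B ≤ _ := hB
      _ ≤ (d * σ θ) * θ ^ αM := by gcongr
      _ = _ := by ring
  -- This is where α_M < −1/2 enters: both θ^{α_M} and σ₀θ^{α_M}, of order θ^{1/2+α_M}, tend to
  -- infinity, so the strip of the normalized law eventually contains any fixed line.
  have hlarge : ∀ᶠ θ in 𝓝[>] (0 : ℝ), 2 ≤ r * θ ^ αM ∧ 2 ≤ σ θ * (r * θ ^ αM) := by
    filter_upwards [hσl, eventually_le_rpow (p := αM) (by linarith [hαM.2]) (2 / r),
      eventually_le_rpow (p := 1 / 2 + αM) (by linarith [hαM.2]) (2 * d / r)] with θ h1 h2 h3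
    rw [div_le_iff₀' hr] at h2
    refine ⟨h2, ?_⟩
    have h4 := mul_le_mul_of_nonneg_left (h1 _ h3) hr.le
    rw [show r * (2 * d / r * d⁻¹) = 2 by field_simp] at h4
    linarith
  have hgood : ∀ᶠ θ in 𝓝[>] (0 : ℝ), θ ∈ Ioo (0 : ℝ) 1 ∧ r / R * M θ ≤ G θ ∧ 2 ≤ M θ ∧
      2 ≤ σ θ * G θ ∧ 1 ≤ σ θ * M θ ∧ σ θ ≤ 1 := by
    filter_upwards [h01, hb, hlarge, hσ1] with θ hθ h1 h2 h3
    have hσθ := hσpos θ hθ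
    refine ⟨hθ, ?_, h2.1.trans h1.1, h2.2.trans (by gcongr; exact h1.2.1), ?_, h3⟩
    · calc r / R * M θ ≤ r / R * (R * θ ^ αM) := by gcongr; exact h1.2.2
        _ = r * θ ^ αM := by field_simp
        _ ≤ G θ := h1.2.1
    · have := h2.2.trans (mul_le_mul_of_nonneg_left h1.1 hσθ.le)
      linarith
  obtain ⟨K, hK, c, hc, hdecay⟩ := exists_uniform_decay (κ := r / R) (by positivity) hY
  have hdec : ∀ᶠ θ in 𝓝[>] (0 : ℝ), 2 ≤ M θ ∧ σ θ ≤ 1 ∧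
      ∀ v : ℝ, 0 < v → v ≤ 1 → v / σ θ ≤ G θ / 2 ∧ ∀ u : ℝ,
        ‖complexCharFun (normalizedLaw (Z θ)) (u + Complex.I * v)‖ ≤
          K * Real.exp (-c * |u| ^ Y) := by
    filter_upwards [hgood] with θ ⟨hθ, g1, g2, g3, g4, g5⟩
    obtain ⟨h1, h2, h3⟩ := hpos θ ⟨hθ.1, hθ.2.le⟩
    exact ⟨g2, g5, fun v hv hv1 => hdecay _ _ _ _ v _ (hZ θ ⟨hθ.1, hθ.2.le⟩) h1 h2 g1 g2 g3 g4 g5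
      hv hv1⟩
  refine ⟨hσ, hk3, hk4, ⟨K, c, hK, hc, hdec⟩, ?_⟩
  intro v hv hv1 ε hε
  set β₁ := αG - 2 * αM - 1 / 2 with hβ₁
  set β₂ := -2 * αM - 1 with hβ₂
  have b1 : 0 < β₁ := by linarith [hαM.2]
  have b2 : 0 < β₂ := by linarith [hαM.2]
  have b21 : β₂ < 1 := by linarith [hαM.1]
  set k₃ : ℝ → ℝ := fun θ => cgmySkewness (C θ) (G θ) (M θ) Y / 6 with hk3def
  set k₄ : ℝ → ℝ := fun θ => cgmyKurtosis (C θ) (G θ) (M θ) Y / 24 with hk4def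
  set δ₁ : ℝ → ℝ := fun θ => σ θ ^ 2 * |k₃ θ| with hδ₁
  set δ₂ : ℝ → ℝ := fun θ => (cgmyAbsMoment (C θ) (G θ) (M θ) Y 4 0 +
    cgmyAbsMoment (C θ) (G θ) (M θ) Y 4 1) / σ θ with hδ₂
  set δ₃ : ℝ → ℝ := fun θ => |cgmyCumulantIter (C θ) (G θ) (M θ) Y 5 0| / σ θ ^ 5 with hδ₃
  set δ₄ : ℝ → ℝ := fun θ => (cgmyAbsMoment (C θ) (G θ) (M θ) Y 6 0 +
    cgmyAbsMoment (C θ) (G θ) (M θ) Y 6 (-(v / σ θ))) / σ θ ^ 6 with hδ₄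
  -- Orders of the four errors: 1 + β₁, 3/2 + β₂, β₁ + β₂ and 2β₂. Only the last two use up the ε in
  -- the claimed exponent.
  have o1 : δ₁ =O[𝓝[>] 0] fun θ : ℝ => θ ^ (1 + β₁) := by
    have := isBigO_mul_rpow (isBigO_pow_rpow hσr.1 2) hk3.abs_left
    simpa using this
  have hr2 : 0 < r / 2 := by positivity
  have o2 : δ₂ =O[𝓝[>] 0] fun θ : ℝ => θ ^ (3 / 2 + β₂) := by
    have m0 := isBigO_cgmyAbsMoment hY2 hpos hC.1 hr (n := 4) (by norm_num) (s := fun _ => 0) hbz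
    have m1 := isBigO_cgmyAbsMoment hY2 hpos hC.1 hr2 (n := 4) (by norm_num) (s := fun _ => 1) (by
      filter_upwards [hb, hlarge] with θ h1 h2
      exact ⟨by linarith [h1.1, h2.1], by linarith [h1.2.1, h2.1]⟩)
    have := isBigO_mul_rpow (m0.add m1) hσi
    rw [show (1 - ((4 : ℕ) - 2) * αM + -(1 / 2) : ℝ) = 3 / 2 + β₂ by
      rw [hβ₂]; push_cast; ring] at this
    simpa only [hδ₂, div_eq_mul_inv] using this
  have o3 : δ₃ =O[𝓝[>] 0] fun θ : ℝ => θ ^ (β₁ + β₂) := by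
    have := isBigO_mul_rpow (isBigO_cgmyCumulantIter_odd hY2 hG hC.1 hr hb0 (n := 5)
      (by norm_num) (by decide)).abs_left (hσin 5)
    rw [show (1 - ((5 : ℕ) - 1) * αM + αG + -((5 : ℕ) : ℝ) / 2 : ℝ) = β₁ + β₂ by
      rw [hβ₁, hβ₂]; push_cast; ring] at this
    simpa only [hδ₃, div_eq_mul_inv] using this
  have o4 : δ₄ =O[𝓝[>] 0] fun θ : ℝ => θ ^ (2 * β₂) := by
    have m0 := isBigO_cgmyAbsMoment hY2 hpos hC.1 hr (n := 6) (by norm_num) (s := fun _ => 0) hbz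
    have m1 := isBigO_cgmyAbsMoment hY2 hpos hC.1 hr2 (n := 6) (by norm_num)
      (s := fun θ => -(v / σ θ)) (by
      filter_upwards [hb, hlarge, h01] with θ h1 h2 hθ
      have hs := hσpos θ hθ
      have hp : 0 < v / σ θ := div_pos hv hs
      have hp2 : v / σ θ ≤ r * θ ^ αM / 2 := by
        rw [div_le_div_iff₀ hs two_pos]; linarith [h2.2]
      have := h2.1
      exact ⟨by linarith [h1.1], by linarith [h1.2.1]⟩)
    have := isBigO_mul_rpow (m0.add m1) (hσin 6)
    rw [show (1 - ((6 : ℕ) - 2) * αM + -((6 : ℕ) : ℝ) / 2 : ℝ) = 2 * β₂ by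
      rw [hβ₂]; push_cast; ring] at this
    simpa only [hδ₄, div_eq_mul_inv] using this
  set δ : ℝ → ℝ := fun θ => δ₁ θ + δ₂ θ + δ₃ θ + δ₄ θ with hδ
  set η := min β₁ β₂ with hη
  have hη0 : 0 < η := lt_min b1 b2
  have hη1 : η ≤ β₁ := min_le_left _ _
  have hη2 : η ≤ β₂ := min_le_right _ _
  have oτ : (fun θ => |k₃ θ| + |k₄ θ| + δ θ) =O[𝓝[>] 0] fun θ : ℝ => θ ^ η :=
    ((hk3.trans (isBigO_rpow_rpow hη1)).abs_left.add
      (hk4.trans (isBigO_rpow_rpow hη2)).abs_left).add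
      ((((o1.trans (isBigO_rpow_rpow (by linarith))).add
        (o2.trans (isBigO_rpow_rpow (by linarith)))).add
        (o3.trans (isBigO_rpow_rpow (by linarith)))).add
        (o4.trans (isBigO_rpow_rpow (by linarith))))
  -- Since τ = O(θ^η), this N pushes the outer contribution τ^N beyond the exponent β₂ + 1/2.
  obtain ⟨N, hN⟩ := exists_nat_gt ((β₂ + 1 / 2) / η)
  rw [div_lt_iff₀' hη0] at hN
  obtain ⟨A, hA, hAb⟩ := exists_integral_sub_edgeCF_le hc hY.1 hK.le N
  have small : ∀ {f : ℝ → ℝ} {a : ℝ}, 0 < a → (f =O[𝓝[>] 0] fun θ : ℝ => θ ^ a) →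
      ∀ᶠ θ in 𝓝[>] (0 : ℝ), |f θ| ≤ 1 := by
    intro f a ha hf
    filter_upwards [(hf.trans_isLittleO (isLittleO_rpow_rpow ha)).bound one_pos] with θ h
    simpa using h
  have hmain : (fun θ : ℝ => ∫ u : ℝ, ‖complexCharFun (normalizedLaw (Z θ)) (u + Complex.I * v) -
        edgeCF v (σ θ) (k₃ θ) (k₄ θ) u‖) =O[𝓝[>] 0] fun θ =>
        δ θ + |k₃ θ| * |k₄ θ| + k₄ θ ^ 2 + |k₃ θ| ^ 3 + (|k₃ θ| + |k₄ θ| + δ θ) ^ N := by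
    refine IsBigO.of_bound A ?_
    filter_upwards [hdec, hgood, small b1 hk3, small b2 hk4] with θ h1 h2 h3 h4
    obtain ⟨hC', hG', hM'⟩ := hpos θ ⟨h2.1.1, h2.1.2.le⟩
    have hσθ := hσpos θ h2.1
    have hvG := (h1.2.2 v hv hv1).1
    have hvp : 0 < v / σ θ := div_pos hv hσθ
    have hM1 : 1 < M θ := by linarith [h1.1]
    have hδ0 : 0 ≤ δ θ := by
      have a1 := cgmyAbsMoment_nonneg (G := G θ) (M := M θ) (s := 0) hC'.le hY2 ⟨by linarith, hM'⟩
        (show 2 ≤ 4 by norm_num)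
      have a2 := cgmyAbsMoment_nonneg (G := G θ) (M := M θ) (s := 1) hC'.le hY2 ⟨by linarith, hM1⟩
        (show 2 ≤ 4 by norm_num)
      have a3 := cgmyAbsMoment_nonneg (G := G θ) (M := M θ) (s := 0) hC'.le hY2 ⟨by linarith, hM'⟩
        (show 2 ≤ 6 by norm_num)
      have a4 := cgmyAbsMoment_nonneg (G := G θ) (M := M θ) (s := -(v / σ θ)) hC'.le hY2 ⟨by linarith, by linarith⟩
        (show 2 ≤ 6 by norm_num)
      simp only [hδ, hδ₁, hδ₂, hδ₃, hδ₄]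
      positivity
    have h := hAb v (σ θ) (k₃ θ) (k₄ θ) (δ θ) _ hv hv1 h1.2.1 hδ0 h3 h4 (h1.2.2 v hv hv1).2
      (complexCharFun_normalized_expansion (hZ θ ⟨h2.1.1, h2.1.2.le⟩) hC' hY2 hG' hM1 hv
        (by linarith) rfl)
    rw [Real.norm_of_nonneg (integral_nonneg fun u => norm_nonneg _),
      Real.norm_of_nonneg (by positivity)]
    exact h
  refine hmain.trans_isLittleO ?_
  -- An order suffices as soon as it strictly exceeds one entry of the minimum. For 1 + β₁ that
  -- entry is β₁ + β₂ − ε, since β₂ < 1.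
  have lo : ∀ {f : ℝ → ℝ} {a : ℝ}, (f =O[𝓝[>] 0] fun θ : ℝ => θ ^ a) →
      (β₂ + 1 / 2 < a ∨ 2 * β₁ < a ∨ 2 * β₂ - ε < a ∨ β₁ + β₂ - ε < a) →
      f =o[𝓝[>] 0] fun θ : ℝ => θ ^ betaBar β₁ β₂ ε :=
    fun hf ha => hf.trans_isLittleO (isLittleO_rpow_rpow (betaBar_lt ha))
  have p1 := lo o1 (Or.inr (Or.inr (Or.inr (by linarith))))
  have p2 := lo o2 (Or.inl (by linarith))
  have p3 := lo o3 (Or.inr (Or.inr (Or.inr (by linarith))))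
  have p4 := lo o4 (Or.inr (Or.inr (Or.inl (by linarith))))
  have p5 := lo (isBigO_mul_rpow hk3.abs_left hk4.abs_left)
    (Or.inr (Or.inr (Or.inr (by linarith))))
  have p6 := lo (isBigO_pow_rpow hk4 2) (Or.inr (Or.inr (Or.inl (by push_cast; linarith))))
  have p7 := lo (isBigO_pow_rpow hk3.abs_left 3) (Or.inr (Or.inl (by push_cast; linarith)))
  have p8 := lo (isBigO_pow_rpow oτ N) (Or.inl hN)
  exact ((((((p1.add p2).add p3).add p4).add p5).add p6).add p7).add p8

/-! ### Bounds that are uniform in the maturity -/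

section uniformBounds

variable {b C G M Y : ℝ}

/-- The third and fourth cumulants are controlled by the fourth moment of the log return. -/
lemma abs_cgmyCumulantIter_le {μ : Measure ℝ} (h : IsCGMY b C G M Y μ) (hC : 0 < C)
    (hY : Y < 2) (hG : 0 < G) (hM : 0 < M) {K : ℝ}
    (hi : Integrable (fun x => x ^ 4) (logReturnLaw μ)) (hK : ∫ x, x ^ 4 ∂(logReturnLaw μ) ≤ K) :
    |cgmyCumulantIter C G M Y 3 0| ≤ 1 + 16 * (K + (1 + K) ^ 4) ∧
    |cgmyCumulantIter C G M Y 4 0| ≤ 1 + 16 * (K + (1 + K) ^ 4) := by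
  have hP := h.1
  obtain ⟨-, m2, m3, m4⟩ := central_moments_of_isCGMY h hC.le hY hG hM
  set w := martingaleDrift μ
  set m := b + w with hm
  have hmean : ∫ x, (x + w) ∂μ = m := mean_of_isCGMY h hC.le hY hG hM
  rw [integrable_logReturnLaw μ (by fun_prop)] at hi
  rw [integral_logReturnLaw μ (by fun_prop)] at hK
  have hK0 : 0 ≤ K := (integral_nonneg fun x => by positivity).trans hK
  have i := integrable_pow_of_isCGMY h hC.le hY hG hM
  have hm1 : |m| ≤ 1 + K := by
    rw [← hmean]
    refine (abs_integral_le_integral_abs).trans ?_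
    have h1 : Integrable (fun x => 1 + (x + w) ^ 4) μ := (integrable_const 1).add hi
    have h2 : ∫ x, |x + w| ∂μ ≤ ∫ x, (1 + (x + w) ^ 4) ∂μ := by
      refine integral_mono_of_nonneg (Eventually.of_forall fun x => abs_nonneg _) h1
        (Eventually.of_forall fun x => ?_)
      have e : (x + w) ^ 4 = (|x + w| ^ 2) ^ 2 := by rw [sq_abs]; ring
      simp only [e]
      nlinarith [sq_nonneg (|x + w| ^ 2 - 1 / 2), sq_nonneg (|x + w| - 1 / 2)]
    rw [integral_add (integrable_const 1) hi] at h2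
    simp only [integral_const, probReal_univ, smul_eq_mul, mul_one] at h2
    linarith
  have hm4 : m ^ 4 ≤ (1 + K) ^ 4 := by
    have := pow_le_pow_left₀ (abs_nonneg m) hm1 4
    rwa [Even.pow_abs (by decide)] at this
  have h4 : ∫ x, (x - b) ^ 4 ∂μ ≤ 8 * (K + (1 + K) ^ 4) := by
    have h1 : Integrable (fun x => 8 * ((x + w) ^ 4 + m ^ 4)) μ :=
      (hi.add (integrable_const _)).const_mul 8
    have h2 : ∫ x, (x - b) ^ 4 ∂μ ≤ ∫ x, 8 * ((x + w) ^ 4 + m ^ 4) ∂μ := by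
      refine integral_mono (i 4) h1 fun x => ?_
      simp only
      have e : x - b = (x + w) - m := by rw [hm]; ring
      rw [e]
      have a1 : ((x + w) - m) ^ 2 ≤ 2 * ((x + w) ^ 2 + m ^ 2) := by
        nlinarith [sq_nonneg ((x + w) + m)]
      have a2 := pow_le_pow_left₀ (sq_nonneg _) a1 2
      nlinarith [sq_nonneg ((x + w) ^ 2 - m ^ 2)]
    rw [integral_const_mul, integral_add hi (integrable_const _)] at h2
    simp only [integral_const, probReal_univ, smul_eq_mul, one_mul] at h2
    linarith
  have h4' : 0 ≤ ∫ x, (x - b) ^ 4 ∂μ := integral_nonneg fun x => by positivity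
  have hI4 : 0 ≤ cgmyCumulantIter C G M Y 4 0 := by
    have : 0 < Real.Gamma (4 - Y) := Real.Gamma_pos_of_pos (by linarith)
    simp only [cgmyCumulantIter, sub_zero, add_zero]
    norm_num
    positivity
  constructor
  · rw [← m3]
    refine (abs_integral_le_integral_abs).trans ?_
    have h1 : Integrable (fun x => 1 + 2 * (x - b) ^ 4) μ :=
      (integrable_const 1).add ((i 4).const_mul 2)
    have h2 : ∫ x, |(x - b) ^ 3| ∂μ ≤ ∫ x, (1 + 2 * (x - b) ^ 4) ∂μ := by
      refine integral_mono_of_nonneg (Eventually.of_forall fun x => abs_nonneg _) h1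
        (Eventually.of_forall fun x => ?_)
      have e : (x - b) ^ 4 = |x - b| ^ 4 := by rw [Even.pow_abs (by decide)]
      simp only [abs_pow, e]
      nlinarith [sq_nonneg (|x - b| ^ 2 - |x - b|), sq_nonneg (|x - b| ^ 2 - 1)]
    rw [integral_add (integrable_const 1) ((i 4).const_mul 2), integral_const_mul] at h2
    simp only [integral_const, probReal_univ, smul_eq_mul, mul_one] at h2
    linarith
  -- The fourth central moment is c₄ + 3c₂², so it dominates the nonnegative c₄.
  · rw [abs_of_nonneg hI4]
    nlinarith [sq_nonneg (cgmyCumulantIter C G M Y 2 0)]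

/-- The real-valued variance of a law with infinite second moment is 0 by convention, which would
contradict σ₀ > 0. -/
lemma memLp_two_logReturnLaw {μ : Measure ℝ} (h : IsCGMY b C G M Y μ) (hC : 0 < C)
    (hY : Y < 2) (hG : 0 < G) (hM : 0 < M) : MemLp id 2 (logReturnLaw μ) := by
  have hP := h.1
  by_contra hn
  have := sigmaZero_pos h hC hY hG hM
  rw [sigmaZero, stdDev, Real.sqrt_pos, variance, evariance_eq_top (by fun_prop) hn] at this
  simp at this

/-- The characteristic function of the normalized law is integrable along horizontal lines. -/
lemma integrable_complexCharFun_normalized {μ : Measure ℝ} (h : IsCGMY b C G M Y μ) (hC : 0 < C)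
    (hY : Y ∈ Ioo (0 : ℝ) 2) (hG : 0 < G) (hM : 0 < M) {v : ℝ} (hv : 0 < v)
    (hvG : v / sigmaZero μ < G) :
    Integrable fun u : ℝ => complexCharFun (normalizedLaw μ) (u + Complex.I * v) := by
  have hσ := sigmaZero_pos h hC hY.2 hG hM
  have hline := complexCharFun_normalized_line h hC hY.2 hG hM hv hvG
  have hcont : Continuous fun u : ℝ => complexCharFun (normalizedLaw μ) (u + Complex.I * v) := by
    have e : (fun u : ℝ => complexCharFun (normalizedLaw μ) (u + Complex.I * v)) =
      fun u : ℝ => Complex.exp (Complex.I * (u + Complex.I * v) / sigmaZero μ *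
        (b + martingaleDrift μ : ℝ) +
        cgmyExponent C G M Y (Complex.I * (u + Complex.I * v) / sigmaZero μ)) :=
      funext fun u => (hline u).1
    rw [e]
    have hc : Continuous fun u : ℝ =>
        cgmyExponent C G M Y (Complex.I * (u + Complex.I * v) / sigmaZero μ) := by
      refine (differentiableOn_cgmyExponent hC.le hY.2 hG hM).continuousOn.comp_continuous
        (by fun_prop) fun u => ?_
      have : 0 < v / sigmaZero μ := div_pos hv hσ
      rw [Set.mem_ofPred_eq, (hline u).2.1]
      exact ⟨by linarith, by linarith⟩
    fun_prop
  set T := max 1 (sigmaZero μ * M + v)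
  have hT0 : 0 < T := lt_of_lt_of_le one_pos (le_max_left _ _)
  have hb := norm_complexCharFun_normalized_le h hC hY hG hM hv hvG (le_max_left 1 _)
    (le_max_right 1 (sigmaZero μ * M + v))
  set A := Real.exp (-(v / sigmaZero μ) * (b + martingaleDrift μ) +
        cgmyCumulant C G M Y (-(v / sigmaZero μ)))
  set c := 2 / π ^ 2 * Real.exp (-1) / (2 - Y) * 2 ^ (Y - 2) * (C * sigmaZero μ ^ (-Y) * T ^ (Y - 2))
    with hc
  have hc0 : 0 < c := by
    have : 0 < 2 - Y := by linarith [hY.2]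
    have := Real.pi_pos
    positivity
  clear_value A c
  have hI := ((integrable_one_add_abs_pow_mul_exp_rpow hc0 hY.1 0).const_mul (A * Real.exp c))
  refine hI.mono' hcont.aestronglyMeasurable (Eventually.of_forall fun u => (hb u).trans_eq ?_)
  rw [pow_zero, one_mul, mul_assoc, ← Real.exp_add]
  congr 2
  ring

/-- Lets the uniform bound on the characteristic function, taken at u = 0, serve as a bound on the
moment of order −v. -/
lemma norm_complexCharFun_I_mul (ρ : Measure ℝ) (v : ℝ) :
    ‖complexCharFun ρ (((0 : ℝ) : ℂ) + Complex.I * v)‖ = ∫ x, Real.exp (-v * x) ∂ρ := by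
  have e : complexCharFun ρ (((0 : ℝ) : ℂ) + Complex.I * v) =
      ((∫ x, Real.exp (-v * x) ∂ρ : ℝ) : ℂ) := by
    rw [complexCharFun, ← integral_complex_ofReal]
    refine integral_congr_ae (Eventually.of_forall fun x => ?_)
    simp only [Complex.ofReal_exp]
    congr 1
    push_cast
    linear_combination (v * x : ℂ) * Complex.I_mul_I
  rw [e, Complex.norm_real, Real.norm_of_nonneg (integral_nonneg fun x => (Real.exp_pos _).le)]

lemma integrable_exp_neg_logReturnLaw {μ : Measure ℝ} (h : IsCGMY b C G M Y μ) (hC : 0 ≤ C)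
    (hY : Y < 2) (hG : 0 < G) (hM : 0 < M) {q : ℝ} (hq : 0 < q) (hqG : q < G) :
    Integrable (fun x => Real.exp (-q * x)) (logReturnLaw μ) := by
  rw [integrable_logReturnLaw μ (by fun_prop)]
  have := (integrable_exp_of_isCGMY h hC hY hG hM (s := -q) ⟨by linarith, by linarith⟩).mul_const
    (Real.exp (-q * martingaleDrift μ))
  refine this.congr (Eventually.of_forall fun x => ?_)
  simp only
  rw [← Real.exp_add]; ring_nf

end uniformBounds

/-- Bounds on a family of CGMY log returns that increases in the convex order. -/
theorem exists_uniform_bounds_of_convexOrder {Y : ℝ} (hY : Y < 2) {b C G M : ℝ → ℝ}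
    (hpos : ∀ θ ∈ Ioc (0 : ℝ) 1, 0 < C θ ∧ 0 < G θ ∧ 0 < M θ) {Z : ℝ → Measure ℝ}
    (hZ : ∀ θ ∈ Ioc (0 : ℝ) 1, IsCGMY (b θ) (C θ) (G θ) (M θ) Y (Z θ))
    (hexp : ∀ θ ∈ Ioc (0 : ℝ) 1, Integrable Real.exp (Z θ))
    (hKellerer : ∀ s t : ℝ, 0 < s → s ≤ t → t ≤ 1 →
      ConvexOrderLE ((logReturnLaw (Z s)).map Real.exp) ((logReturnLaw (Z t)).map Real.exp))
    {δ : ℝ} (hδ : δ ∈ Ioc (0 : ℝ) 1) :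
    ∃ p > 0, ∃ c > 0, ∃ B : ℝ, ∀ θ ∈ Ioc (0 : ℝ) 1, p ≤ G θ ∧
      Integrable (fun x => Real.exp (-p * x)) (logReturnLaw (Z θ)) ∧
      ∫ x, Real.exp (-p * x) ∂(logReturnLaw (Z θ)) ≤ B ∧
      |cgmyCumulantIter (C θ) (G θ) (M θ) Y 3 0| ≤ B ∧
      |cgmyCumulantIter (C θ) (G θ) (M θ) Y 4 0| ≤ B ∧ (δ ≤ θ → c ≤ sigmaZero (Z θ)) := by
  have h1 : (1 : ℝ) ∈ Ioc (0 : ℝ) 1 := ⟨one_pos, le_rfl⟩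
  have hPr : ∀ θ ∈ Ioc (0 : ℝ) 1, IsProbabilityMeasure (Z θ) := fun θ hθ => (hZ θ hθ).1
  have hE : ∀ θ ∈ Ioc (0 : ℝ) 1, Integrable Real.exp (logReturnLaw (Z θ)) ∧
      ∫ x, Real.exp x ∂(logReturnLaw (Z θ)) = 1 := fun θ hθ =>
    have := hPr θ hθ
    integral_exp_logReturnLaw (Z θ) (hexp θ hθ)
  obtain ⟨hC1, hG1, hM1⟩ := hpos 1 h1
  have := hPr 1 h1
  have := hPr δ hδ
  -- Half of the left tempering parameter at maturity 1: strictly inside its strip, so the moment of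
  -- order −p is finite there.
  set p := G 1 / 2 with hp
  have hp0 : 0 < p := by positivity
  have hint := integrable_exp_neg_logReturnLaw (hZ 1 h1) hC1.le hY hG1 hM1 hp0 (by linarith)
  set K := ∫ x, Real.exp (-p * x) ∂(logReturnLaw (Z 1)) with hK
  obtain ⟨hCδ, hGδ, hMδ⟩ := hpos δ hδ
  have hpδ := (integral_max_exp_sub_one_pos (hE δ hδ).1 (hE δ hδ).2
    (sigmaZero_pos (hZ δ hδ) hCδ hY hGδ hMδ)).1
  obtain ⟨c, hc, hcb⟩ := ConvexOrderLE.exists_le_stdDev (hE δ hδ).1 (hE 1 h1).1 hpδ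
  set K4 := 24 * (1 + p⁻¹ ^ 4) * (K + 1)
  refine ⟨p, hp0, c, hc, max K (1 + 16 * (K4 + (1 + K4) ^ 4)), fun θ hθ => ?_⟩
  have := hPr θ hθ
  obtain ⟨hCθ, hGθ, hMθ⟩ := hpos θ hθ
  obtain ⟨i1, i2⟩ := (hKellerer θ 1 hθ.1 hθ.2 le_rfl).integrable_exp_neg_mul hp0 hint
  have i3 : Integrable (fun x => Real.exp (-p * x)) (Z θ) := by
    rw [integrable_logReturnLaw _ (by fun_prop)] at i1
    refine (i1.mul_const (Real.exp (p * martingaleDrift (Z θ)))).congr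
      (Eventually.of_forall fun x => ?_)
    simp only
    rw [← Real.exp_add]; ring_nf
  obtain ⟨j1, j2⟩ := integral_pow_four_le hp0 i1 (hE θ hθ).1
  have j3 : ∫ x, x ^ 4 ∂(logReturnLaw (Z θ)) ≤ K4 := by
    rw [(hE θ hθ).2] at j2
    exact j2.trans (mul_le_mul_of_nonneg_left (by linarith) (by positivity))
  obtain ⟨k3, k4⟩ := abs_cgmyCumulantIter_le (hZ θ hθ) hCθ hY hGθ hMθ j1 j3
  exact ⟨le_of_integrable_exp_neg (hZ θ hθ) hCθ hY hGθ hMθ i3, i1, i2.trans (le_max_left _ _),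
    k3.trans (le_max_right _ _), k4.trans (le_max_right _ _), fun hδθ =>
      hcb _ inferInstance (hE θ hθ).1 (hE θ hθ).2
        (memLp_two_logReturnLaw (hZ θ hθ) hCθ hY hGθ hMθ) (hKellerer δ θ hδ.1 hδθ hθ.2)
        (hKellerer θ 1 hθ.1 hθ.2 le_rfl)⟩

/-- A damping parameter that is admissible for all maturities at once, together with bounds on the
rescaled skewness and kurtosis. -/
theorem exists_uniform_damping {Y αM αG : ℝ} (hY : Y ∈ Ioo (0 : ℝ) 2)
    (hαM : αM ∈ Ioo (-1 : ℝ) (-1 / 2)) (hαG : αM < αG) {b C G M : ℝ → ℝ}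
    (hpos : ∀ θ ∈ Ioc (0 : ℝ) 1, 0 < C θ ∧ 0 < G θ ∧ 0 < M θ)
    (hM : M =Θ[𝓝[>] 0] fun θ : ℝ => θ ^ αM)
    (hG : (fun θ => G θ - M θ) =O[𝓝[>] 0] fun θ : ℝ => θ ^ αG)
    (hC : C =Θ[𝓝[>] 0] fun θ : ℝ => θ ^ (1 - (Y - 2) * αM)) {Z : ℝ → Measure ℝ}
    (hZ : ∀ θ ∈ Ioc (0 : ℝ) 1, IsCGMY (b θ) (C θ) (G θ) (M θ) Y (Z θ))
    (hexp : ∀ θ ∈ Ioc (0 : ℝ) 1, Integrable Real.exp (Z θ))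
    (hKellerer : ∀ s t : ℝ, 0 < s → s ≤ t → t ≤ 1 →
      ConvexOrderLE ((logReturnLaw (Z s)).map Real.exp) ((logReturnLaw (Z t)).map Real.exp)) :
    (∃ v : ℝ, 0 < v ∧ v ≤ 1 ∧ (∀ θ ∈ Ioo (0 : ℝ) 1, v / sigmaZero (Z θ) < G θ) ∧
      ∃ B : ℝ, ∀ θ ∈ Ioo (0 : ℝ) 1, ∫ x, Real.exp (-v * x) ∂(normalizedLaw (Z θ)) ≤ B) ∧
    ∃ B : ℝ, ∀ θ ∈ Ioo (0 : ℝ) 1,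
      |cgmySkewness (C θ) (G θ) (M θ) Y / 6 * θ ^ (-(αG - 2 * αM - 1 / 2))| ≤ B ∧
      |cgmyKurtosis (C θ) (G θ) (M θ) Y / 24 * θ ^ (-(-2 * αM - 1))| ≤ B := by
  obtain ⟨-, hS, hQ, ⟨K, c₁, hK, hc₁, hdecay⟩, -⟩ := cgmy_short_maturity hY hαM hαG hpos hM hG hC hZ
  have hβ1 : 0 < αG - 2 * αM - 1 / 2 := by linarith [hαM.1, hαM.2]
  have hβ2 : 0 < -2 * αM - 1 := by linarith [hαM.1, hαM.2]
  set β₁ := αG - 2 * αM - 1 / 2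
  set β₂ := -2 * αM - 1
  obtain ⟨A₁, hA₁⟩ := hS.bound
  obtain ⟨A₂, hA₂⟩ := hQ.bound
  obtain ⟨δ, hδ0, hδ⟩ := mem_nhdsGT_iff_exists_Ioo_subset.1 (hdecay.and (hA₁.and hA₂))
  have hδ0 : 0 < δ := hδ0
  -- Maturities below δ' are covered by the asymptotics, the others by the convex order.
  set δ' := min (δ / 2) 1
  have hδ' : δ' ∈ Ioc (0 : ℝ) 1 := ⟨lt_min (by positivity) one_pos, min_le_right _ _⟩
  have hlt : ∀ θ ∈ Ioo (0 : ℝ) 1, θ < δ' → θ ∈ Ioo 0 δ := fun θ hθ h =>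
    ⟨hθ.1, by linarith [min_le_left (δ / 2) 1]⟩
  obtain ⟨p, hp, c, hc, B, hB⟩ :=
    exists_uniform_bounds_of_convexOrder hY.2 hpos hZ hexp hKellerer hδ'
  have hIc : ∀ θ ∈ Ioo (0 : ℝ) 1, θ ∈ Ioc (0 : ℝ) 1 := fun θ hθ => ⟨hθ.1, hθ.2.le⟩
  have hσ : ∀ θ ∈ Ioo (0 : ℝ) 1, 0 < sigmaZero (Z θ) := fun θ hθ =>
    have h := hpos θ (hIc θ hθ)
    sigmaZero_pos (hZ θ (hIc θ hθ)) h.1 hY.2 h.2.1 h.2.2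
  constructor
  -- v ≤ 1 suits the short maturities; v ≤ pc/2 gives v/σ₀ ≤ p/2 < G when σ₀ ≥ c and G ≥ p.
  · set v := min 1 (p * c / 2) with hv
    have hv0 : 0 < v := lt_min one_pos (by positivity)
    have hvp : ∀ θ ∈ Ioo (0 : ℝ) 1, δ' ≤ θ → v / sigmaZero (Z θ) ≤ p / 2 := by
      intro θ hθ h
      have h1 := (hB θ (hIc θ hθ)).2.2.2.2.2 h
      rw [div_le_iff₀ (hσ θ hθ)]
      calc v ≤ p / 2 * c := by linarith [min_le_right 1 (p * c / 2)]
        _ ≤ _ := by gcongr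
    refine ⟨v, hv0, min_le_left _ _, fun θ hθ => ?_, max K (1 + B), fun θ hθ => ?_⟩
    · rcases lt_or_ge θ δ' with h | h
      · have h1 := ((hδ (hlt θ hθ h)).1.2.2 v hv0 (min_le_left _ _)).1
        linarith [(hpos θ (hIc θ hθ)).2.1]
      · linarith [hvp θ hθ h, (hB θ (hIc θ hθ)).1]
    · rcases lt_or_ge θ δ' with h | h
      · have h1 := ((hδ (hlt θ hθ h)).1.2.2 v hv0 (min_le_left _ _)).2 0
        rw [norm_complexCharFun_I_mul, abs_zero, Real.zero_rpow hY.1.ne', mul_zero, Real.exp_zero,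
          mul_one] at h1
        exact h1.trans (le_max_left _ _)
      · obtain ⟨-, hi, hI, -⟩ := hB θ (hIc θ hθ)
        have hP : IsProbabilityMeasure (Z θ) := (hZ θ (hIc θ hθ)).1
        have hq := hvp θ hθ h
        have hq0 : 0 < v / sigmaZero (Z θ) := div_pos hv0 (hσ θ hθ)
        rw [integral_normalizedLaw _ (by fun_prop)]
        -- With q = v/σ₀ between 0 and p, e^{−qx} is at most 1 on the right half line and at most
        -- e^{−px} on the left.
        have h1 : ∫ x, Real.exp (-v * (x / sigmaZero (Z θ))) ∂(logReturnLaw (Z θ)) ≤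
            ∫ x, (1 + Real.exp (-p * x)) ∂(logReturnLaw (Z θ)) := by
          refine integral_mono_of_nonneg (Eventually.of_forall fun x => (Real.exp_pos _).le)
            ((integrable_const 1).add hi) (Eventually.of_forall fun x => ?_)
          simp only
          have e : -v * (x / sigmaZero (Z θ)) = -(v / sigmaZero (Z θ)) * x := by ring
          rw [e]
          rcases le_total 0 x with hx | hx
          · have := Real.exp_le_one_iff.2 (by nlinarith : -(v / sigmaZero (Z θ)) * x ≤ 0)
            linarith [Real.exp_pos (-p * x)]
          · have := Real.exp_le_exp.2 (by nlinarith : -(v / sigmaZero (Z θ)) * x ≤ -p * x)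
            linarith
        rw [integral_add (integrable_const 1) hi] at h1
        simp only [integral_const, probReal_univ, smul_eq_mul, mul_one] at h1
        exact (h1.trans (by linarith)).trans (le_max_right _ _)
  · have hneg : ∀ β : ℝ, 0 < β → ∀ θ ∈ Ioo (0 : ℝ) 1, δ' ≤ θ → θ ^ (-β) ≤ δ' ^ (-β) :=
      fun β hβ θ hθ h => Real.rpow_le_rpow_of_nonpos hδ'.1 h (by linarith)
    have hB0 : 0 ≤ B := (abs_nonneg _).trans (hB 1 ⟨one_pos, le_rfl⟩).2.2.2.1
    have hnear : ∀ θ ∈ Ioo (0 : ℝ) 1, ∀ k β A : ℝ, ‖k‖ ≤ A * ‖θ ^ β‖ → |k * θ ^ (-β)| ≤ A := by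
      intro θ hθ k β A h
      have h0 := Real.rpow_pos_of_pos hθ.1 β
      rw [Real.norm_eq_abs, Real.norm_of_nonneg h0.le] at h
      rw [abs_mul, abs_of_pos (Real.rpow_pos_of_pos hθ.1 _), Real.rpow_neg hθ.1.le,
        ← div_eq_mul_inv, div_le_iff₀ h0]
      exact h
    have hfar : ∀ θ ∈ Ioo (0 : ℝ) 1, δ' ≤ θ → ∀ k : ℝ, ∀ n : ℕ, ∀ m β : ℝ, 1 ≤ m → |k| ≤ B → 0 < β →
        |k / sigmaZero (Z θ) ^ n / m * θ ^ (-β)| ≤ B / c ^ n * δ' ^ (-β) := by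
      intro θ hθ h k n m β hm hk hβ
      have h1 := (hB θ (hIc θ hθ)).2.2.2.2.2 h
      have h2 := hσ θ hθ
      rw [abs_mul, abs_of_pos (Real.rpow_pos_of_pos hθ.1 _), abs_div, abs_div,
        abs_of_pos (by linarith : 0 < m), abs_of_pos (pow_pos h2 n)]
      refine mul_le_mul ?_ (hneg β hβ θ hθ h) (Real.rpow_pos_of_pos hθ.1 _).le (by positivity)
      exact (div_le_self (by positivity) hm).trans (by gcongr)
    refine ⟨max (max A₁ A₂) (max (B / c ^ 3 * δ' ^ (-β₁)) (B / c ^ 4 * δ' ^ (-β₂))),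
      fun θ hθ => ?_⟩
    obtain ⟨h1, h2, h3⟩ := hpos θ (hIc θ hθ)
    rcases lt_or_ge θ δ' with h | h
    · have h1 := (hδ (hlt θ hθ h)).2
      exact ⟨(hnear θ hθ _ _ _ h1.1).trans ((le_max_left _ _).trans (le_max_left _ _)),
        (hnear θ hθ _ _ _ h1.2).trans ((le_max_right _ _).trans (le_max_left _ _))⟩
    · obtain ⟨-, -, -, k3, k4, -⟩ := hB θ (hIc θ hθ)
      rw [cgmySkewness_eq (hZ θ (hIc θ hθ)) h1 hY.2 h2 h3,
        cgmyKurtosis_eq (hZ θ (hIc θ hθ)) h1 hY.2 h2 h3]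
      exact ⟨(hfar θ hθ h _ 3 6 β₁ (by norm_num) k3 hβ1).trans
          ((le_max_left _ _).trans (le_max_right _ _)),
        (hfar θ hθ h _ 4 24 β₂ (by norm_num) k4 hβ2).trans
          ((le_max_right _ _).trans (le_max_right _ _))⟩

/-! ### At-the-money skew and curvature -/

/-- The powers θ^{−β} in the rescaled coefficients cancel the explicit powers of θ, so estimates can
be made with k₃ and k₄ themselves. -/
lemma edgeworthCharFun_eq_edgeCF {θ : ℝ} (hθ : 0 < θ) (β₁ β₂ s k₃ k₄ v u : ℝ) :
    edgeworthCharFun 0 0 β₁ β₂ s (k₃ * θ ^ (-β₁)) (k₄ * θ ^ (-β₂)) θ (u + Complex.I * v) =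
      edgeCF v s k₃ k₄ u := by
  have e : ∀ k β : ℝ, ((k * θ ^ (-β) : ℝ) : ℂ) * ((θ ^ β : ℝ) : ℂ) = k := by
    intro k β
    rw [← Complex.ofReal_mul, mul_assoc, ← Real.rpow_add hθ, neg_add_cancel, Real.rpow_zero, mul_one]
  have e2 : ((θ ^ (2 * β₁) : ℝ) : ℂ) = ((θ ^ β₁ : ℝ) : ℂ) ^ 2 := by
    rw [← Complex.ofReal_pow, ← Real.rpow_mul_natCast hθ.le, mul_comm]; norm_num
  have e3 := e k₃ β₁
  have e4 := e k₄ β₂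
  unfold edgeworthCharFun edgeCF gaussCF
  rw [e2, ← e3, ← e4]
  generalize ((k₃ * θ ^ (-β₁) : ℝ) : ℂ) = a
  generalize ((k₄ * θ ^ (-β₂) : ℝ) : ℂ) = d
  push_cast
  ring_nf

/-- From the scaled expansions of the derivatives to the asymptotic skew and curvature. -/
lemma skew_curvature_of_bounds {β₁ β₂ A : ℝ} (hβ₁ : β₂ / 2 < β₁) (hβ₂ : 0 < β₂) (hβ₂' : β₂ < 1)
    {σ k₃ k₄ D D₂ : ℝ → ℝ} {err : ℝ → ℝ}
    (hσ : σ =Θ[𝓝[>] 0] fun θ : ℝ => √θ)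
    (h3 : k₃ =O[𝓝[>] 0] fun θ : ℝ => θ ^ β₁) (h4 : k₄ =O[𝓝[>] 0] fun θ : ℝ => θ ^ β₂)
    (herr : ∀ ε : ℝ, 0 < ε → err =o[𝓝[>] 0] fun θ => θ ^ betaBar β₁ β₂ ε)
    {η : ℝ} (hη : 0 < η)
    (h : ∀ᶠ θ in 𝓝[>] (0 : ℝ), 0 < σ θ ∧ (|k₄ θ| ≤ η →
      σ θ * |k₃ θ| + σ θ * |k₄ θ| + k₃ θ ^ 2 + err θ ≤ η →
      |√θ * D θ - (k₃ θ + 2 * σ θ * k₄ θ)| ≤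
        A * (σ θ ^ 2 * |k₃ θ| + σ θ ^ 2 * |k₄ θ| + σ θ * k₃ θ ^ 2 + err θ) ∧
      |σ θ * (√θ * D₂ θ) - 2 * k₄ θ| ≤
        A * ((σ θ * |k₃ θ| + σ θ * |k₄ θ| + k₃ θ ^ 2 + err θ) + k₄ θ ^ 2))) :
    (∀ ε : ℝ, 0 < ε → (fun θ => D θ - (k₃ θ * θ ^ (-(1 / 2) : ℝ) + 2 * (σ θ / √θ) * k₄ θ))
      =o[𝓝[>] 0] fun θ => θ ^ (betaBar β₁ β₂ ε - 1 / 2)) ∧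
    (fun θ => D₂ θ - 2 * k₄ θ / (σ θ / √θ) * θ⁻¹) =o[𝓝[>] 0] fun θ => θ ^ (β₂ - 1) := by
  have hpos : ∀ᶠ θ in 𝓝[>] (0 : ℝ), 0 < θ := eventually_mem_nhdsWithin
  have hσr : σ =Θ[𝓝[>] 0] fun θ : ℝ => θ ^ (1 / 2 : ℝ) := by
    simpa only [Real.sqrt_eq_rpow] using hσ
  have h3' := h3.norm_left
  have h4' := h4.norm_left
  simp only [Real.norm_eq_abs] at h3' h4'
  have hσ2 := isBigO_pow_rpow hσr.1 2
  have h32 := isBigO_pow_rpow h3 2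
  have h42 := isBigO_pow_rpow h4 2
  have hδ : (fun θ => (σ θ * |k₃ θ| + σ θ * |k₄ θ| + k₃ θ ^ 2 + err θ) + k₄ θ ^ 2)
      =o[𝓝[>] 0] fun θ => θ ^ β₂ := by
    -- The curvature needs only o(θ^{β₂}). With ε₀ below both β₁ and β₂, and 2β₁ > β₂, every entry
    -- of the minimum exceeds β₂.
    set ε₀ := min β₁ β₂ / 2
    have hb1 : 0 < β₁ := by linarith
    have hε₀ : 0 < ε₀ := half_pos (lt_min hb1 hβ₂)
    have e1 : ε₀ ≤ β₁ / 2 := div_le_div_of_nonneg_right (min_le_left _ _) two_pos.le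
    have e2 : ε₀ ≤ β₂ / 2 := div_le_div_of_nonneg_right (min_le_right _ _) two_pos.le
    have hbar : β₂ < betaBar β₁ β₂ ε₀ := by
      simp only [betaBar, lt_min_iff]
      exact ⟨by linarith, by linarith, by linarith, by linarith⟩
    refine (((IsLittleO.add ?_ ?_).add ?_).add ?_).add ?_
    · exact (isBigO_mul_rpow hσr.1 h3').trans_isLittleO (isLittleO_rpow_rpow (by linarith))
    · exact (isBigO_mul_rpow hσr.1 h4').trans_isLittleO (isLittleO_rpow_rpow (by linarith))
    · exact h32.trans_isLittleO (isLittleO_rpow_rpow (by push_cast; linarith))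
    · exact (herr ε₀ hε₀).trans (isLittleO_rpow_rpow hbar)
    · exact h42.trans_isLittleO (isLittleO_rpow_rpow (by push_cast; linarith))
  have hzero : Tendsto (fun θ : ℝ => θ ^ β₂) (𝓝[>] 0) (𝓝 0) := by
    have := (Real.continuousAt_rpow_const 0 β₂ (Or.inr hβ₂.le)).tendsto
    rw [Real.zero_rpow hβ₂.ne'] at this
    exact this.mono_left nhdsWithin_le_nhds
  have hδη := (hδ.isBigO.trans_tendsto hzero).eventually_le_const hη
  have hkη := (h4'.trans_tendsto hzero).eventually_le_const hη
  have hmain : ∀ᶠ θ in 𝓝[>] (0 : ℝ), 0 < θ ∧ 0 < σ θ ∧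
      |√θ * D θ - (k₃ θ + 2 * σ θ * k₄ θ)| ≤
        A * (σ θ ^ 2 * |k₃ θ| + σ θ ^ 2 * |k₄ θ| + σ θ * k₃ θ ^ 2 + err θ) ∧
      |σ θ * (√θ * D₂ θ) - 2 * k₄ θ| ≤
        A * ((σ θ * |k₃ θ| + σ θ * |k₄ θ| + k₃ θ ^ 2 + err θ) + k₄ θ ^ 2) := by
    filter_upwards [h, hδη, hkη, hpos] with θ h h1 h2 h3
    exact ⟨h3, h.1, h.2 h2 (by linarith [sq_nonneg (k₄ θ)])⟩
  have hsi : (fun θ : ℝ => (√θ)⁻¹) =O[𝓝[>] 0] fun θ : ℝ => θ ^ (-(1 / 2) : ℝ) :=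
    isBigO_inv_rpow (f := fun θ => √θ) (by simp only [Real.sqrt_eq_rpow]; exact isBigO_refl _ _)
  have hσi := isBigO_inv_rpow hσr.2
  have hrp : ∀ a c d : ℝ, a + c = d →
      (fun θ : ℝ => θ ^ a * θ ^ c) =ᶠ[𝓝[>] 0] fun θ => θ ^ d := by
    intro a c d had
    filter_upwards [hpos] with θ hθ
    rw [← Real.rpow_add hθ, had]
  refine ⟨fun ε hε => ?_, ?_⟩
  · have he : (fun θ => σ θ ^ 2 * |k₃ θ| + σ θ ^ 2 * |k₄ θ| + σ θ * k₃ θ ^ 2 + err θ)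
        =o[𝓝[>] 0] fun θ => θ ^ betaBar β₁ β₂ ε := by
      refine ((IsLittleO.add ?_ ?_).add ?_).add (herr ε hε)
      · exact (isBigO_mul_rpow hσ2 h3').trans_isLittleO (isLittleO_rpow_rpow (betaBar_lt
          (Or.inr (Or.inr (Or.inr (by push_cast; linarith))))))
      · exact (isBigO_mul_rpow hσ2 h4').trans_isLittleO (isLittleO_rpow_rpow (betaBar_lt
          (Or.inl (by push_cast; linarith))))
      · exact (isBigO_mul_rpow hσr.1 h32).trans_isLittleO (isLittleO_rpow_rpow (betaBar_lt
          (Or.inr (Or.inl (by push_cast; linarith)))))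
    -- Division by √θ turns the bound on the slope of the total volatility into one for the implied
    -- volatility and lowers the exponent by 1/2.
    have h1 := (hsi.mul_isLittleO he).congr' EventuallyEq.rfl (hrp _ _ (betaBar β₁ β₂ ε - 1 / 2) (by ring))
    refine IsBigO.trans_isLittleO (IsBigO.of_bound |A| ?_) h1
    filter_upwards [hmain] with θ ⟨hθ, hσθ, hD, _⟩
    have hs := Real.sqrt_pos.2 hθ
    have e : D θ - (k₃ θ * θ ^ (-(1 / 2) : ℝ) + 2 * (σ θ / √θ) * k₄ θ) =
        (√θ)⁻¹ * (√θ * D θ - (k₃ θ + 2 * σ θ * k₄ θ)) := by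
      rw [Real.rpow_neg hθ.le, ← Real.sqrt_eq_rpow]
      field_simp
    rw [e, Real.norm_eq_abs, Real.norm_eq_abs, abs_mul, abs_mul, mul_left_comm]
    exact mul_le_mul_of_nonneg_left (hD.trans ((le_abs_self _).trans_eq (abs_mul _ _)))
      (abs_nonneg _)
  -- The curvature is divided by both √θ and σ₀ ≍ √θ, hence the loss of a full power of θ.
  · have h1 := ((hsi.mul hσi).mul_isLittleO hδ).congr' EventuallyEq.rfl
      (((hrp _ _ (-1) (by ring)).mul EventuallyEq.rfl).trans (hrp (-1) β₂ (β₂ - 1) (by ring)))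
    refine IsBigO.trans_isLittleO (IsBigO.of_bound |A| ?_) h1
    filter_upwards [hmain] with θ ⟨hθ, hσθ, _, hD⟩
    have hs := Real.sqrt_pos.2 hθ
    have e : D₂ θ - 2 * k₄ θ / (σ θ / √θ) * θ⁻¹ =
        ((√θ)⁻¹ * (σ θ)⁻¹) * (σ θ * (√θ * D₂ θ) - 2 * k₄ θ) := by
      have : θ⁻¹ = (√θ)⁻¹ * (√θ)⁻¹ := by rw [← mul_inv, Real.mul_self_sqrt hθ.le]
      rw [this]
      field_simp
    rw [e, Real.norm_eq_abs, Real.norm_eq_abs, abs_mul ((√θ)⁻¹ * (σ θ)⁻¹),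
      abs_mul ((√θ)⁻¹ * (σ θ)⁻¹), mul_left_comm |A|]
    exact mul_le_mul_of_nonneg_left (hD.trans ((le_abs_self _).trans_eq (abs_mul _ _)))
      (abs_nonneg _)

theorem mainTheorem8
    (Y αM αG S₀ r : ℝ) (hY : Y ∈ Ioo (0 : ℝ) 2)
    (hαM : αM ∈ Ioo (-1 : ℝ) (-1 / 2)) (hαG : αM < αG) (hS₀ : 0 < S₀)
    (b C G M : ℝ → ℝ)
    (hpos : ∀ θ ∈ Ioc (0 : ℝ) 1, 0 < C θ ∧ 0 < G θ ∧ 0 < M θ)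
    (hM : M =Θ[𝓝[>] 0] fun θ : ℝ => θ ^ αM)
    (hG : (fun θ => G θ - M θ) =O[𝓝[>] 0] fun θ : ℝ => θ ^ αG)
    (hC : C =Θ[𝓝[>] 0] fun θ : ℝ => θ ^ (1 - (Y - 2) * αM))
    (Z : ℝ → Measure ℝ)
    (hZ : ∀ θ ∈ Ioc (0 : ℝ) 1, IsCGMY (b θ) (C θ) (G θ) (M θ) Y (Z θ))
    (hexp : ∀ θ ∈ Ioc (0 : ℝ) 1, Integrable Real.exp (Z θ))
    (hKellerer : ∀ s t : ℝ, 0 < s → s ≤ t → t ≤ 1 →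
      ConvexOrderLE ((logReturnLaw (Z s)).map Real.exp) ((logReturnLaw (Z t)).map Real.exp)) :
    -- order of the standard deviation; variance, skewness and excess kurtosis
    ((fun θ => sigmaZero (Z θ)) =Θ[𝓝[>] 0] fun θ : ℝ => √θ) ∧
    (∀ θ ∈ Ioc (0 : ℝ) 1,
      sigmaZero (Z θ) ^ 2 = cgmyVariance (C θ) (G θ) (M θ) Y ∧
      skewnessOf (normalizedLaw (Z θ)) = cgmySkewness (C θ) (G θ) (M θ) Y ∧
      excessKurtosisOf (normalizedLaw (Z θ)) = cgmyKurtosis (C θ) (G θ) (M θ) Y) ∧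
    -- the characteristic function conditions with `(m, n) = (0, 0)`
    CharFunConditions (fun θ => normalizedLaw (Z θ)) (fun θ => sigmaZero (Z θ))
      (fun θ => cgmySkewness (C θ) (G θ) (M θ) Y / 6 * θ ^ (-(αG - 2 * αM - 1 / 2)))
      (fun θ => cgmyKurtosis (C θ) (G θ) (M θ) Y / 24 * θ ^ (-(-2 * αM - 1)))
      0 0 (αG - 2 * αM - 1 / 2) (-2 * αM - 1) ∧
    -- the implied volatility exists near the money and is twice differentiable at the money
    (∀ θ ∈ Ioo (0 : ℝ) 1,
      (∀ᶠ k in 𝓝 (0 : ℝ), IsImpliedVol S₀ r (logReturnLaw (Z θ)) θ k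
        (impliedVol S₀ r (logReturnLaw (Z θ)) θ k)) ∧
      ContDiffAt ℝ 2 (impliedVol S₀ r (logReturnLaw (Z θ)) θ) 0) ∧
    -- at-the-money skew
    (∀ ε : ℝ, 0 < ε →
      (fun θ : ℝ => deriv (impliedVol S₀ r (logReturnLaw (Z θ)) θ) 0 -
          (cgmySkewness (C θ) (G θ) (M θ) Y / 6 * θ ^ (-(1 / 2) : ℝ) +
            1 / 12 * (sigmaZero (Z θ) / √θ) * cgmyKurtosis (C θ) (G θ) (M θ) Y))
        =o[𝓝[>] 0] fun θ => θ ^ (betaBar (αG - 2 * αM - 1 / 2) (-2 * αM - 1) ε - 1 / 2)) ∧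
    -- at-the-money curvature
    ((fun θ : ℝ => iteratedDeriv 2 (impliedVol S₀ r (logReturnLaw (Z θ)) θ) 0 -
          cgmyKurtosis (C θ) (G θ) (M θ) Y / (12 * (sigmaZero (Z θ) / √θ)) * θ⁻¹)
        =o[𝓝[>] 0] fun θ => θ ^ (-2 * αM - 2)) := by
  have hY2 := hY.2
  have hIc : ∀ θ ∈ Ioo (0 : ℝ) 1, θ ∈ Ioc (0 : ℝ) 1 := fun θ hθ => ⟨hθ.1, hθ.2.le⟩
  -- α_G > α_M gives β₁ > −α_M − 1/2 = β₂/2, so k₃² is negligible against θ^{β₂}.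
  have hβ₁ : (-2 * αM - 1) / 2 < αG - 2 * αM - 1 / 2 := by linarith [hαM.1, hαM.2]
  have hβ₂ : 0 < -2 * αM - 1 := by linarith [hαM.1, hαM.2]
  have hβ₂' : -2 * αM - 1 < 1 := by linarith [hαM.1, hαM.2]
  obtain ⟨hΘ, hS, hQ, ⟨K, c, hK, hc, hdecay⟩, herr⟩ :=
    cgmy_short_maturity hY hαM hαG hpos hM hG hC hZ
  obtain ⟨⟨v, hv, hv1, hvG, hvB⟩, hB⟩ :=
    exists_uniform_damping hY hαM hαG hpos hM hG hC hZ hexp hKellerer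
  have hφi : ∀ θ ∈ Ioo (0 : ℝ) 1, Integrable fun u : ℝ =>
      complexCharFun (normalizedLaw (Z θ)) (u + Complex.I * v) := fun θ hθ =>
    have h := hpos θ (hIc θ hθ)
    integrable_complexCharFun_normalized (hZ θ (hIc θ hθ)) h.1 hY h.2.1 h.2.2 hv (hvG θ hθ)
  have hσ : ∀ θ ∈ Ioo (0 : ℝ) 1, 0 < sigmaZero (Z θ) := fun θ hθ =>
    have h := hpos θ (hIc θ hθ)
    sigmaZero_pos (hZ θ (hIc θ hθ)) h.1 hY.2 h.2.1 h.2.2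
  have hint : ∀ θ ∈ Ioo (0 : ℝ) 1, Integrable (fun x => Real.exp (-(v / sigmaZero (Z θ)) * x))
      (logReturnLaw (Z θ)) := fun θ hθ =>
    have h := hpos θ (hIc θ hθ)
    integrable_exp_neg_logReturnLaw (hZ θ (hIc θ hθ)) h.1.le hY.2 h.2.1 h.2.2
      (div_pos hv (hσ θ hθ)) (hvG θ hθ)
  have hPr : ∀ θ ∈ Ioo (0 : ℝ) 1, IsProbabilityMeasure (Z θ) := fun θ hθ => (hZ θ (hIc θ hθ)).1
  have hE : ∀ θ ∈ Ioo (0 : ℝ) 1, Integrable Real.exp (logReturnLaw (Z θ)) ∧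
      ∫ x, Real.exp x ∂(logReturnLaw (Z θ)) = 1 := fun θ hθ =>
    have := hPr θ hθ
    integral_exp_logReturnLaw (Z θ) (hexp θ (hIc θ hθ))
  have hput : ∀ θ ∈ Ioo (0 : ℝ) 1, 0 < unitPut (logReturnLaw (Z θ)) 0 := fun θ hθ => by
    have := hPr θ hθ
    have h := (integral_max_exp_sub_one_pos (hE θ hθ).1 (hE θ hθ).2 (hσ θ hθ)).2
    simpa [unitPut] using h
  have hψ : ∀ θ : ℝ, ∀ u : ℝ, complexCharFun (logReturnLaw (Z θ))
      ((u + Complex.I * v) / sigmaZero (Z θ)) =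
      complexCharFun (normalizedLaw (Z θ)) (u + Complex.I * v) := fun θ u =>
    (complexCharFun_normalizedLaw _ _).symm
  obtain ⟨A, -, η, hη, hexpand⟩ := exists_impliedVol_expansion hv
  have h01 : ∀ᶠ θ : ℝ in 𝓝[>] 0, θ ∈ Ioo (0 : ℝ) 1 := Ioo_mem_nhdsGT one_pos
  -- The L¹ error for the damping v, chosen uniformly in the maturity, plays the role of `err`.
  have hmain := skew_curvature_of_bounds (A := A) hβ₁ hβ₂ hβ₂' hΘ hS hQ (herr v hv hv1) hη
    (D := fun θ => deriv (impliedVol S₀ r (logReturnLaw (Z θ)) θ) 0)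
    (D₂ := fun θ => iteratedDeriv 2 (impliedVol S₀ r (logReturnLaw (Z θ)) θ) 0) (by
      filter_upwards [h01, hdecay] with θ hθ hd
      have := hPr θ hθ
      exact ⟨hσ θ hθ, hexpand _ _ _ _ _ _ _ θ S₀ r _ ⟨hσ θ hθ, hd.2.1⟩ hθ.1 hS₀ (hint θ hθ)
        (hψ θ) (hφi θ hθ) (hE θ hθ).1 (hput θ hθ) rfl rfl rfl⟩)
  refine ⟨hΘ, fun θ hθ => ?_, ⟨by linarith, hβ₂, hB, v, hv, ?_, hφi, fun ε hε => ?_⟩,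
    fun θ hθ => ?_, fun ε hε => ?_, ?_⟩
  · obtain ⟨h1, h2, h3⟩ := hpos θ hθ
    exact ⟨sigmaZero_sq (hZ θ hθ) h1 hY2 h2 h3, skewnessOf_normalizedLaw (hZ θ hθ) h1 hY2 h2 h3,
      excessKurtosisOf_normalizedLaw (hZ θ hθ) h1 hY2 h2 h3⟩
  · obtain ⟨B, hB⟩ := hvB
    refine ⟨B, fun θ hθ => ⟨?_, hB θ hθ⟩⟩
    rw [integrable_normalizedLaw _ (by fun_prop)]
    refine (hint θ hθ).congr (Eventually.of_forall fun x => ?_)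
    simp only
    ring_nf
  · refine (herr v hv hv1 ε hε).congr' ?_ EventuallyEq.rfl
    filter_upwards [h01] with θ hθ
    simp only [edgeworthCharFun_eq_edgeCF hθ.1]
  · have := hPr θ hθ
    obtain ⟨h1, h2, -⟩ := impliedVol_at_money r hv (hσ θ hθ) hθ.1 hS₀ (hint θ hθ) (hψ θ)
      (hφi θ hθ) (hE θ hθ).1 (hput θ hθ)
    exact ⟨h1, h2⟩
  -- With k₄ equal to the excess kurtosis over 24, the coefficient 2k₄ becomes 1/12 of the kurtosis.
  · refine (hmain.1 ε hε).congr_left fun θ => ?_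
    ring
  · have e : -2 * αM - 2 = -2 * αM - 1 - 1 := by ring
    rw [e]
    refine hmain.2.congr_left fun θ => ?_
    rw [mul_comm (12 : ℝ), ← div_div _ _ (12 : ℝ)]
    ring
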